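/- **Setting.** Let $\mathbb K$ be a field of characteristic zero, $(X,\mathcal O)$ a ringed space whose structure sheaf is a sheaf of commutative $\mathbb K$-algebras, $\mathcal L$ a Lie algebroid over $(X,\mathcal O)$ (a sheaf of $\mathcal O$-modules, locally free of constant finite rank, all of whose section spaces are Lie–Rinehart algebras over $\mathbb K$, compatibly with restriction), and $\mathcal E$ a locally free $\mathcal O$-module of constant finite rank $r$. Let $\Omega^\bullet_{\mathcal L}=\bigwedge^\bullet\mathcal L^\vee$ with its Lie algebroid differential $d_{\mathcal L}$ and exterior product. The Lie algebroid cohomology is the hypercohomology ring $H^\bullet_{\rm Lie}(\mathcal L)=\mathbb H^\bullet(X,\Omega_{\mathcal L}^\bullet)$. Let $\mathcal I=\bigoplus_k\mathcal I_k$ be the ring of polynomial functions $P:M_r(\mathbb K)\to\mathbb K$ with $P(gMg^{-1})=P(M)$ for all $g\in GL_r(\mathbb K)$, graded by degree. Let $\mathcal U=(U_i)_{i\in I}$ be an open covering of $X$ with an $\mathcal L$-connection $\nabla_i$ on $\mathcal E|_{U_i}$ for each $i$. For $i_0,\dots,i_n\in I$ put $U_{i_0\dots i_n}=U_{i_0}\cap\dots\cap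 U_{i_n}$. Let $\mathsf R_n=\mathbb K[t_0,\dots,t_n]/(t_0+\dots+t_n=1)$, $\mathsf T_n={\rm Der}_{\mathbb K}(\mathsf R_n)$, and consider on $\mathsf R_n\otimes_{\mathbb K}\mathcal E|_{U_{i_0\dots i_n}}$ the connection $$\nabla^{\rm tot}_n=\mathsf d_n+\sum_{j=0}^n t_j\nabla_{i_j}$$ for the direct sum Lie algebroid $\mathcal L\oplus\mathsf T_n$, with curvature $R(\nabla_n^{\rm tot})$. For $P\in\mathcal I$ put $$P(\mathcal E,\{\nabla_i\})_{i_0\dots i_n}=\int_{\Delta^n}P\bigl(R(\nabla^{\rm tot}_n)\bigr)\in\Omega_{\mathcal L}(U_{i_0\dots i_n}).$$ Here $P(R)$ is computed in local frames of $\mathcal E$ by substituting the matrix of curvature 2-forms in $P$, and $\int_{\Delta^n}$ is $\iota_{\partial_{t_1}}\cdots\iota_{\partial_{t_n}}$ (so that $(\int_{\Delta^n}\omega)(X_1,\dots,X_q)$ is obtained from $\omega(\partial_{t_n},\dots,\partial_{t_1},X_1,\dots,X_q)$) followed by $\int t_1^{a_1}\cdots t_n^{a_n}=\frac{a_1!\cdots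 a_n!}{(n+a_1+\dots+a_n)!}$ on coefficients. The total Čech complex of $\Omega_{\mathcal L}$ on $\mathcal U$ has components $C^{n,q}=\prod_{i_0,\dots,i_n}\Omega^q_{\mathcal L}(U_{i_0\dots i_n})$, differential $D=\delta+(-1)^n d_{\mathcal L}$, and the Alexander–Whitney product $(ab)_{i_0\dots i_{p+p'}}=(-1)^{qp'}a_{i_0\dots i_p}\wedge b_{i_p\dots i_{p+p'}}$ for $a\in C^{p,q}$, $b\in C^{p',q'}$. **Proposition.** (i) For every covering with connections $(\mathcal U,\{\nabla_i\})$ and every $P\in\mathcal I$, the local expressions glue to well-defined forms $P(\mathcal E,\{\nabla_i\})_{n}=(P(\mathcal E,\{\nabla_i\})_{i_0\dots i_n})$, of bounded total degree. If $P\in\mathcal I_k$ then $P(\mathcal E,\{\nabla_i\})_n\in C^{n,2k-n}$, and it vanishes for $n>2k$. They satisfy $$d_{\mathcal L}P(\mathcal E,\{\nabla_i\})_n=\delta P(\mathcal E,\{\nabla_i\})_{n-1}\qquad(n\ge 0,\ \delta P(\mathcal E,\{\nabla_i\})_{-1}:=0),$$ and therefore $c_P(\mathcal U,\{\nabla_i\}):=\bigl((-1)^{n(n-1)/2}P(\mathcal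 E,\{\nabla_i\})_n\bigr)_{n\ge0}$ is a cocycle, $D\,c_P(\mathcal U,\{\nabla_i\})=0$. (ii) For two coverings with connections $(\mathcal U,\{\nabla_i\})$ and $(\mathcal U',\{\nabla'_{i'}\})$, and every common refinement $V_j\subseteq U_{\varphi(j)}\cap U'_{\varphi'(j)}$, the pullbacks $\varphi^*c_P(\mathcal U,\{\nabla_i\})$ and $\varphi'^*c_P(\mathcal U',\{\nabla'_{i'}\})$ are cohomologous in the total Čech complex of $(V_j)$. (iii) There is one and only one ring homomorphism $\Phi:\mathcal I\to H_{\rm Lie}^{\bullet}(\mathcal L)$ with $\Phi(\mathcal I_k)\subseteq H_{\rm Lie}^{2k}(\mathcal L)$ for all $k$ such that, for every covering with connections $(\mathcal U,\{\nabla_i\})$ and every $P\in\mathcal I$, $\Phi(P)$ is the image of the class of $c_P(\mathcal U,\{\nabla_i\})$ under the canonical map from Čech hypercohomology of $\mathcal U$ to hypercohomology. In particular, the class does not depend on the covering and the local connections. -/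

import Mathlib

open CategoryTheory TopologicalSpace Opposite
open scoped TensorProduct

set_option linter.unusedSectionVars false
universe u v
noncomputable section
namespace ChernWeil

/-- Functions of a finite list of arguments; the value on a list of length `q` is the
degree `q` component. Forms are the multilinear alternating ones, see `Cochain.IsForm`. -/
def Cochain (A L : Type*) := List L → A

namespace Cochain

section Ring
variable {A L : Type*} [CommRing A]

instance : AddCommGroup (Cochain A L) := inferInstanceAs (AddCommGroup (List L → A))

/-- Contraction `ι_X`, inserting `X` as the first argument. -/
def ins (X : L) (ω : Cochain A L) : Cochain A L := fun l => ω (X :: l)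

/-- The parity involution, `(-1)^q` in degree `q`. -/
def sgn (ω : Cochain A L) : Cochain A L := fun l => (-1) ^ l.length * ω l

/-- Exterior product as the signed sum over shuffles, written recursively through
`ι_X (a ∧ b) = (ι_X a) ∧ b + (-1)^|a| a ∧ ι_X b`. -/
def wedge : List L → Cochain A L → Cochain A L → A
  | [], a, b => a [] * b []
  | X :: l, a, b => wedge l (ins X a) b + wedge l (sgn a) (ins X b)

instance : Mul (Cochain A L) := ⟨fun a b l => wedge l a b⟩

/-- A function as a form of degree `0`. -/
def const (f : A) : Cochain A L := fun l => if l = [] then f else 0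

instance : One (Cochain A L) := ⟨const 1⟩

theorem ext' {a b : Cochain A L} (h : ∀ l, a l = b l) : a = b := funext h
theorem add_app (a b : Cochain A L) (l : List L) : (a + b) l = a l + b l := rfl
theorem neg_app (a : Cochain A L) (l : List L) : (-a) l = - a l := rfl
theorem sub_app (a b : Cochain A L) (l : List L) : (a - b) l = a l - b l := rfl
theorem one_nil : (1 : Cochain A L) [] = 1 := rfl
theorem zero_app (l : List L) : (0 : Cochain A L) l = 0 := rfl
theorem mul_nil (a b : Cochain A L) : (a * b) [] = a [] * b [] := rfl
theorem mul_cons (a b : Cochain A L) (X : L) (l : List L) :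
    (a * b) (X :: l) = (ins X a * b) l + (sgn a * ins X b) l := rfl
theorem ins_app (X : L) (a : Cochain A L) (l : List L) : ins X a l = a (X :: l) := rfl
theorem sgn_nil (a : Cochain A L) : sgn a [] = a [] := by simp [sgn]
theorem ins_mul (X : L) (a b : Cochain A L) :
    ins X (a * b) = ins X a * b + sgn a * ins X b := rfl
theorem ins_add (X : L) (a b : Cochain A L) : ins X (a + b) = ins X a + ins X b := rfl
theorem ins_zero (X : L) : ins X (0 : Cochain A L) = 0 := rfl
theorem ins_sgn (X : L) (a : Cochain A L) : ins X (sgn a) = - sgn (ins X a) := by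
  refine ext' fun l => ?_
  simp only [ins, sgn, neg_app, List.length_cons, pow_succ]; ring
theorem sgn_add (a b : Cochain A L) : sgn (a + b) = sgn a + sgn b := by
  refine ext' fun l => ?_
  simp only [sgn, add_app]; ring
theorem sgn_zero : sgn (0 : Cochain A L) = 0 := by
  refine ext' fun l => ?_
  simp [sgn, zero_app]
theorem sgn_neg (a : Cochain A L) : sgn (-a) = - sgn a := by
  refine ext' fun l => ?_
  simp [sgn, neg_app]
theorem sgn_sgn (a : Cochain A L) : sgn (sgn a) = a := by
  refine ext' fun l => ?_
  simp only [sgn, ← mul_assoc, ← mul_pow]; simp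

protected theorem add_mul (a b c : Cochain A L) : (a + b) * c = a * c + b * c := by
  refine ext' fun l => ?_
  induction l generalizing a b c with
  | nil => simp only [mul_nil, add_app]; ring
  | cons X l ih => simp only [mul_cons, add_app, ins_add, sgn_add, ih]; ring
protected theorem mul_add (a b c : Cochain A L) : a * (b + c) = a * b + a * c := by
  refine ext' fun l => ?_
  induction l generalizing a b c with
  | nil => simp only [mul_nil, add_app]; ring
  | cons X l ih => simp only [mul_cons, add_app, ins_add, ih]; ring
protected theorem zero_mul (a : Cochain A L) : 0 * a = 0 := by
  have h := Cochain.add_mul (0 : Cochain A L) 0 a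
  simpa using h
protected theorem mul_zero (a : Cochain A L) : a * 0 = 0 := by
  have h := Cochain.mul_add a (0 : Cochain A L) 0
  simpa using h
protected theorem neg_mul (a b : Cochain A L) : (-a) * b = - (a * b) := by
  have h := Cochain.add_mul a (-a) b
  rw [add_neg_cancel, Cochain.zero_mul] at h
  exact (neg_eq_of_add_eq_zero_right h.symm).symm
theorem sgn_mul (a b : Cochain A L) : sgn (a * b) = sgn a * sgn b := by
  refine ext' fun l => ?_
  induction l generalizing a b with
  | nil => simp only [mul_nil, sgn_nil]
  | cons X l ih =>
    have h1 := ih (ins X a) b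
    have h2 := ih (sgn a) (ins X b)
    simp only [sgn] at h1 h2
    rw [mul_cons, ins_sgn, ins_sgn, Cochain.neg_mul, neg_app]
    have h3 : (sgn (sgn a) * - sgn (ins X b)) l = - (sgn (sgn a) * sgn (ins X b)) l := by
      have h := Cochain.mul_add (sgn (sgn a)) (sgn (ins X b)) (-sgn (ins X b))
      rw [add_neg_cancel, Cochain.mul_zero] at h
      have := congrFun h l
      rw [add_app, zero_app] at this
      linear_combination -this
    rw [h3, ← ih, ← ih]
    simp only [sgn, mul_cons, List.length_cons, pow_succ]; ring
protected theorem mul_assoc (a b c : Cochain A L) : a * b * c = a * (b * c) := by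
  refine ext' fun l => ?_
  induction l generalizing a b c with
  | nil => simp only [mul_nil]; ring
  | cons X l ih =>
    simp only [mul_cons, ins_mul, Cochain.add_mul, Cochain.mul_add, add_app, ih, sgn_mul]; ring
theorem ins_const (X : L) (f : A) : ins X (const f) = 0 := by
  refine ext' fun l => ?_
  simp [ins, const, zero_app]
theorem sgn_const (f : A) : sgn (const f : Cochain A L) = const f := by
  refine ext' fun l => ?_
  by_cases h : l = [] <;> simp [sgn, const, h]
theorem const_mul_app (f : A) (a : Cochain A L) (l : List L) :
    (const f * a : Cochain A L) l = f * a l := by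
  induction l generalizing a with
  | nil => simp [mul_nil, const]
  | cons X l ih => simp only [mul_cons, ins_const, Cochain.zero_mul, sgn_const, ih, zero_app,
      zero_add, ins_app]
theorem mul_const_app (f : A) (a : Cochain A L) (l : List L) :
    (a * const f : Cochain A L) l = a l * f := by
  induction l generalizing a with
  | nil => simp [mul_nil, const]
  | cons X l ih => simp only [mul_cons, ins_const, Cochain.mul_zero, ih, zero_app,
      add_zero, ins_app]

instance : Ring (Cochain A L) where
  __ := (inferInstance : AddCommGroup (Cochain A L))
  left_distrib := Cochain.mul_add
  right_distrib := Cochain.add_mul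
  zero_mul := Cochain.zero_mul
  mul_zero := Cochain.mul_zero
  mul_assoc := Cochain.mul_assoc
  one_mul a := ext' fun l => by
    change (const 1 * a : Cochain A L) l = a l
    rw [const_mul_app, one_mul]
  mul_one a := ext' fun l => by
    change (a * const 1 : Cochain A L) l = a l
    rw [mul_const_app, mul_one]
end Ring

section Diff
variable {A L : Type*} [CommRing A] [LieRing L] [LieRingModule L A]

/-- The Lie derivative
`(L_X ω)(Y₁,…,Y_q) = X(ω(Y₁,…,Y_q)) - ∑ ω(Y₁,…,[X,Y_i],…,Y_q)`, recursively. -/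
def lieD (X : L) : List L → Cochain A L → A
  | [], ω => ⁅X, ω []⁆
  | Y :: l, ω => lieD X l (ins Y ω) - ω (⁅X, Y⁆ :: l)

def lieDer (X : L) (ω : Cochain A L) : Cochain A L := fun l => lieD X l ω

/-- The Chevalley-Eilenberg differential, recursively through Cartan's formula
`ι_X d = L_X - d ι_X`; this is the usual formula
`(dω)(X₀,…,X_q) = ∑ (-1)^i X_i(ω(…,X̂_i,…)) + ∑_{i<j} (-1)^(i+j) ω([X_i,X_j],…,X̂_i,…,X̂_j,…)`. -/
def diff : List L → Cochain A L → A
  | [], _ => 0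
  | X :: l, ω => lieDer X ω l - diff l (ins X ω)

def d (ω : Cochain A L) : Cochain A L := fun l => diff l ω

theorem lieDer_nil (X : L) (ω : Cochain A L) : lieDer X ω [] = ⁅X, ω []⁆ := rfl
theorem lieDer_cons (X Y : L) (l : List L) (ω : Cochain A L) :
    lieDer X ω (Y :: l) = lieDer X (ins Y ω) l - ins ⁅X, Y⁆ ω l := rfl
theorem ins_lieDer (X Y : L) (ω : Cochain A L) :
    ins Y (lieDer X ω) = lieDer X (ins Y ω) - ins ⁅X, Y⁆ ω := rfl
theorem d_nil (ω : Cochain A L) : d ω [] = 0 := rfl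
theorem d_cons (X : L) (l : List L) (ω : Cochain A L) :
    d ω (X :: l) = lieDer X ω l - d (ins X ω) l := rfl
theorem ins_d (X : L) (ω : Cochain A L) : ins X (d ω) = lieDer X ω - d (ins X ω) := rfl

theorem lieDer_add (X : L) (a b : Cochain A L) :
    lieDer X (a + b) = lieDer X a + lieDer X b := by
  refine ext' fun l => ?_
  induction l generalizing a b with
  | nil => simp only [lieDer_nil, add_app, lie_add]
  | cons Y l ih => simp only [lieDer_cons, add_app, ins_add, ih]; ring
theorem d_add (a b : Cochain A L) : d (a + b) = d a + d b := by
  refine ext' fun l => ?_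
  induction l generalizing a b with
  | nil => simp only [d_nil, add_app, add_zero]
  | cons Y l ih => simp only [d_cons, add_app, ins_add, ih, lieDer_add]; ring
theorem lieDer_neg (X : L) (a : Cochain A L) : lieDer X (-a) = - lieDer X a := by
  have h := lieDer_add X a (-a)
  have h0 := lieDer_add X (0 : Cochain A L) 0
  rw [add_zero, left_eq_add] at h0
  rw [add_neg_cancel, h0] at h
  exact (neg_eq_of_add_eq_zero_right h.symm).symm
theorem d_neg (a : Cochain A L) : d (-a) = - d a := by
  have h := d_add a (-a)
  have h0 := d_add (0 : Cochain A L) 0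
  rw [add_zero, left_eq_add] at h0
  rw [add_neg_cancel, h0] at h
  exact (neg_eq_of_add_eq_zero_right h.symm).symm
theorem lieDer_zero (X : L) : lieDer X (0 : Cochain A L) = 0 := by
  have h0 := lieDer_add X (0 : Cochain A L) 0
  rwa [add_zero, left_eq_add] at h0
theorem d_zero : d (0 : Cochain A L) = 0 := by
  have h0 := d_add (0 : Cochain A L) 0
  rwa [add_zero, left_eq_add] at h0
theorem lieDer_const (X : L) (f : A) :
    lieDer X (const f : Cochain A L) = const ⁅X, f⁆ := by
  refine ext' fun l => ?_
  cases l with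
  | nil => rfl
  | cons Y l => simp only [lieDer_cons, ins_const, zero_app, sub_zero, lieDer_zero]; rfl
theorem lieDer_sub (X : L) (a b : Cochain A L) :
    lieDer X (a - b) = lieDer X a - lieDer X b := by
  rw [sub_eq_add_neg, lieDer_add, lieDer_neg, ← sub_eq_add_neg]
theorem d_sub (a b : Cochain A L) : d (a - b) = d a - d b := by
  rw [sub_eq_add_neg, d_add, d_neg, ← sub_eq_add_neg]
theorem sgn_sub (a b : Cochain A L) : sgn (a - b) = sgn a - sgn b := by
  rw [sub_eq_add_neg, sgn_add, sgn_neg, ← sub_eq_add_neg]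
theorem ins_sub (X : L) (a b : Cochain A L) : ins X (a - b) = ins X a - ins X b := rfl
theorem ins_neg (X : L) (a : Cochain A L) : ins X (-a) = - ins X a := rfl
theorem sgn_lieDer (X : L) (a : Cochain A L) : sgn (lieDer X a) = lieDer X (sgn a) := by
  refine ext' fun l => ?_
  induction l generalizing a with
  | nil => simp only [sgn_nil, lieDer_nil]
  | cons Y l ih =>
    have h := ih (ins Y a)
    simp only [lieDer_cons, ins_sgn, lieDer_neg, neg_app]
    rw [← h]
    simp only [sgn, lieDer_cons, List.length_cons, pow_succ]; ring
theorem sgn_d (a : Cochain A L) : sgn (d a) = - d (sgn a) := by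
  refine ext' fun l => ?_
  induction l generalizing a with
  | nil => simp only [sgn_nil, d_nil, neg_app, neg_zero]
  | cons Y l ih =>
    have := ih (ins Y a)
    simp only [neg_app, d_cons, ins_sgn, d_neg, ← sgn_lieDer] at this ⊢
    rw [eq_neg_iff_add_eq_zero] at this
    simp only [sgn, d_cons, List.length_cons, pow_succ] at this ⊢
    linear_combination this
end Diff

section Rinehart
variable {A L : Type*} [CommRing A] [LieRing L] [Module A L] [LieRingModule L A]
  [LieRinehartRing A L]

theorem lieDer_mul (X : L) (a b : Cochain A L) :
    lieDer X (a * b) = lieDer X a * b + a * lieDer X b := by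
  refine ext' fun l => ?_
  induction l generalizing a b with
  | nil =>
    simp only [lieDer_nil, add_app, mul_nil, LieRinehartRing.leibniz_mul_right, smul_eq_mul]; ring
  | cons Y l ih =>
    simp only [lieDer_cons, add_app, ins_mul, mul_cons, lieDer_add, ih, ins_lieDer,
      sub_mul, mul_sub, sub_app, sgn_lieDer]; ring
theorem d_mul (a b : Cochain A L) : d (a * b) = d a * b + sgn a * d b := by
  refine ext' fun l => ?_
  induction l generalizing a b with
  | nil => simp only [d_nil, add_app, mul_nil]; ring
  | cons Y l ih =>
    simp only [d_cons, add_app, ins_mul, mul_cons, d_add, lieDer_mul, ih, ins_d, ins_sgn, sgn_d,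
      sub_mul, mul_sub, sub_app, sgn_sgn, neg_mul, neg_app]; ring

/-- `A`-multilinear alternating in each degree. -/
structure IsForm (ω : Cochain A L) : Prop where
  map_add : ∀ (l₁ : List L) (X Y : L) (l₂ : List L),
    ω (l₁ ++ (X + Y) :: l₂) = ω (l₁ ++ X :: l₂) + ω (l₁ ++ Y :: l₂)
  map_smul : ∀ (l₁ : List L) (f : A) (X : L) (l₂ : List L),
    ω (l₁ ++ (f • X) :: l₂) = f * ω (l₁ ++ X :: l₂)
  alternating : ∀ (l₁ : List L) (X : L) (l₂ : List L), ω (l₁ ++ X :: X :: l₂) = 0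

namespace IsForm

theorem ins {ω : Cochain A L} (h : IsForm ω) (X : L) : IsForm (ins X ω) :=
  ⟨fun l₁ => h.map_add (X :: l₁), fun l₁ => h.map_smul (X :: l₁),
    fun l₁ => h.alternating (X :: l₁)⟩

theorem ins_add_left {ω : Cochain A L} (h : IsForm ω) (X Y : L) :
    Cochain.ins (X + Y) ω = Cochain.ins X ω + Cochain.ins Y ω :=
  ext' fun l => h.map_add [] X Y l

theorem ins_smul_left {ω : Cochain A L} (h : IsForm ω) (f : A) (X : L) :
    Cochain.ins (f • X) ω = const f * Cochain.ins X ω :=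
  ext' fun l => (h.map_smul [] f X l).trans (const_mul_app f (Cochain.ins X ω) l).symm

theorem ins_ins {ω : Cochain A L} (h : IsForm ω) (X : L) :
    Cochain.ins X (Cochain.ins X ω) = 0 :=
  ext' fun l => h.alternating [] X l

theorem sgn {ω : Cochain A L} (h : IsForm ω) : IsForm (sgn ω) := by
  refine ⟨fun l₁ X Y l₂ => ?_, fun l₁ f X l₂ => ?_, fun l₁ X l₂ => ?_⟩
  · simp only [Cochain.sgn, h.map_add, List.length_append, List.length_cons]; ring
  · simp only [Cochain.sgn, h.map_smul, List.length_append, List.length_cons]; ring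
  · simp only [Cochain.sgn, h.alternating, mul_zero]

theorem zero : IsForm (0 : Cochain A L) :=
  ⟨fun _ _ _ _ => (add_zero _).symm, fun _ _ _ _ => (mul_zero _).symm, fun _ _ _ => rfl⟩

theorem add {a b : Cochain A L} (ha : IsForm a) (hb : IsForm b) : IsForm (a + b) := by
  refine ⟨fun l₁ X Y l₂ => ?_, fun l₁ f X l₂ => ?_, fun l₁ X l₂ => ?_⟩
  · simp only [add_app, ha.map_add, hb.map_add]; ring
  · simp only [add_app, ha.map_smul, hb.map_smul]; ring
  · simp only [add_app, ha.alternating, hb.alternating, add_zero]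

theorem neg {a : Cochain A L} (ha : IsForm a) : IsForm (-a) := by
  refine ⟨fun l₁ X Y l₂ => ?_, fun l₁ f X l₂ => ?_, fun l₁ X l₂ => ?_⟩
  · simp only [neg_app, ha.map_add]; ring
  · simp only [neg_app, ha.map_smul]; ring
  · simp only [neg_app, ha.alternating, neg_zero]

theorem sub {a b : Cochain A L} (ha : IsForm a) (hb : IsForm b) : IsForm (a - b) := by
  rw [sub_eq_add_neg]; exact ha.add hb.neg

theorem const (f : A) : IsForm (const f : Cochain A L) := by
  refine ⟨fun l₁ X Y l₂ => ?_, fun l₁ f X l₂ => ?_, fun l₁ X l₂ => ?_⟩ <;>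
  simp [Cochain.const]

theorem mul {a b : Cochain A L} (ha : IsForm a) (hb : IsForm b) : IsForm (a * b) := by
  refine ⟨fun l₁ X Y l₂ => ?_, fun l₁ f X l₂ => ?_, fun l₁ X l₂ => ?_⟩
  · induction l₁ generalizing a b with
    | nil =>
      simp only [List.nil_append, mul_cons, ha.ins_add_left, hb.ins_add_left, add_mul, mul_add,
        add_app]; ring
    | cons Z l₁ ih =>
      simp only [List.cons_append, mul_cons, ih (ha.ins Z) hb, ih ha.sgn (hb.ins Z)]; ring
  · induction l₁ generalizing a b with
    | nil =>
      have h : Cochain.sgn a * (Cochain.const f * Cochain.ins X b)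
          = Cochain.const f * (Cochain.sgn a * Cochain.ins X b) := by
        rw [← mul_assoc, ← mul_assoc]
        congr 1
        refine ext' fun l => ?_
        rw [const_mul_app, mul_const_app, mul_comm]
      simp only [List.nil_append, mul_cons, ha.ins_smul_left, hb.ins_smul_left, h, mul_assoc,
        const_mul_app]; ring
    | cons Z l₁ ih =>
      simp only [List.cons_append, mul_cons, ih (ha.ins Z) hb, ih ha.sgn (hb.ins Z)]; ring
  · induction l₁ generalizing a b with
    | nil =>
      simp only [List.nil_append, mul_cons, ins_sgn, ha.ins_ins, hb.ins_ins, mul_zero, zero_mul,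
        zero_app, neg_mul, neg_app]; ring
    | cons Z l₁ ih =>
      simp only [List.cons_append, mul_cons, ih (ha.ins Z) hb, ih ha.sgn (hb.ins Z), add_zero]

theorem lieDer {a : Cochain A L} (ha : IsForm a) (X : L) : IsForm (lieDer X a) := by
  refine ⟨fun l₁ Y Z l₂ => ?_, fun l₁ f Y l₂ => ?_, fun l₁ Y l₂ => ?_⟩
  · induction l₁ generalizing a with
    | nil =>
      simp only [List.nil_append, lieDer_cons, ha.ins_add_left, lie_add, lieDer_add, add_app]; ring
    | cons W l₁ ih =>
      simp only [List.cons_append, lieDer_cons, ih (ha.ins W), (ha.ins _).map_add]; ring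
  · induction l₁ generalizing a with
    | nil =>
      simp only [List.nil_append, lieDer_cons, ha.ins_smul_left, lieDer_mul, lieDer_const,
        LieRinehartRing.leibniz_smul_right, ha.ins_add_left, add_app, const_mul_app]; ring
    | cons W l₁ ih =>
      simp only [List.cons_append, lieDer_cons, ih (ha.ins W), (ha.ins _).map_smul]; ring
  · induction l₁ generalizing a with
    | nil =>
      have h : Cochain.ins ⁅X, Y⁆ (Cochain.ins Y a) = - Cochain.ins Y (Cochain.ins ⁅X, Y⁆ a) := by
        have := ha.ins_ins (⁅X, Y⁆ + Y)
        simp only [ha.ins_add_left, (ha.ins _).ins_add_left, ins_add, ha.ins_ins] at this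
        rw [eq_neg_iff_add_eq_zero]
        simpa [add_comm] using this
      have h0 := lieDer_add X (0 : Cochain A L) 0
      rw [add_zero, left_eq_add] at h0
      have h1 := congrFun h l₂
      simp only [List.nil_append, lieDer_cons, ha.ins_ins, h0, zero_app]
      simp only [ins_app, neg_app] at h1 ⊢
      linear_combination -h1
    | cons W l₁ ih =>
      simp only [List.cons_append, lieDer_cons, ih (ha.ins W), (ha.ins _).alternating, sub_zero]

theorem lieDer_add_left {a : Cochain A L} (ha : IsForm a) (X Y : L) :
    Cochain.lieDer (X + Y) a = Cochain.lieDer X a + Cochain.lieDer Y a := by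
  refine ext' fun l => ?_
  induction l generalizing a with
  | nil => simp only [lieDer_nil, add_app, add_lie]
  | cons Z l ih =>
    simp only [lieDer_cons, add_app, ih (ha.ins Z), add_lie, ha.ins_add_left]; ring

theorem ins_comm {a : Cochain A L} (ha : IsForm a) (X Y : L) :
    Cochain.ins X (Cochain.ins Y a) = - Cochain.ins Y (Cochain.ins X a) := by
  have := ha.ins_ins (X + Y)
  simp only [ha.ins_add_left, (ha.ins _).ins_add_left, ins_add, ha.ins_ins] at this
  rw [eq_neg_iff_add_eq_zero]
  simpa [add_comm] using this

theorem lieDer_smul_left {a : Cochain A L} (ha : IsForm a) (f : A) (X : L) :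
    Cochain.lieDer (f • X) a = Cochain.const f * Cochain.lieDer X a
      + Cochain.d (Cochain.const f) * Cochain.ins X a := by
  refine ext' fun l => ?_
  induction l generalizing a with
  | nil =>
    simp only [lieDer_nil, add_app, LieRinehartRing.lie_smul_eq_mul, mul_nil,
      d_nil, zero_mul, add_zero]
    rfl
  | cons Y l ih =>
    have h1 : ⁅f • X, Y⁆ = f • ⁅X, Y⁆ + (-⁅Y, f⁆) • X := by
      rw [← lie_skew, LieRinehartRing.leibniz_smul_right, ← lie_skew X Y, neg_add, neg_smul,
        smul_neg]
    have h2 : Cochain.ins Y (Cochain.d (Cochain.const f : Cochain A L)) = Cochain.const ⁅Y, f⁆ := by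
      rw [ins_d, ins_const, d_zero, sub_zero, lieDer_const]
    simp only [lieDer_cons, ih (ha.ins Y), add_app, const_mul_app, mul_cons, h1, ha.ins_add_left,
      ha.ins_smul_left, h2, ha.ins_comm Y X, sgn_d, sgn_const, ins_const, zero_mul, zero_app,
      ins_lieDer, sub_app, neg_mul, mul_neg, neg_neg, neg_app]
    ring

theorem d {a : Cochain A L} (ha : IsForm a) : IsForm (d a) := by
  refine ⟨fun l₁ X Y l₂ => ?_, fun l₁ f X l₂ => ?_, fun l₁ X l₂ => ?_⟩
  · induction l₁ generalizing a with
    | nil =>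
      simp only [List.nil_append, d_cons, ha.lieDer_add_left, ha.ins_add_left, d_add, add_app]; ring
    | cons Z l₁ ih =>
      simp only [List.cons_append, d_cons, (ha.lieDer Z).map_add, ih (ha.ins Z)]; ring
  · induction l₁ generalizing a with
    | nil =>
      simp only [List.nil_append, d_cons, ha.lieDer_smul_left, ha.ins_smul_left, d_mul, add_app,
        const_mul_app, sgn_const]; ring
    | cons Z l₁ ih =>
      simp only [List.cons_append, d_cons, (ha.lieDer Z).map_smul, ih (ha.ins Z)]; ring
  · induction l₁ generalizing a with
    | nil =>
      have h : Cochain.ins (0 : L) a = 0 := by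
        simpa using ha.ins_add_left 0 0
      simp only [List.nil_append, d_cons, lieDer_cons, lie_self, h, ha.ins_ins, d_zero, zero_app]
      ring
    | cons Z l₁ ih =>
      simp only [List.cons_append, d_cons, (ha.lieDer Z).alternating, ih (ha.ins Z), sub_zero]
end IsForm
end Rinehart

section Vanish
variable {A L : Type*} [CommRing A]

theorem mul_vanish {a b : Cochain A L} {m₁ m₂ p₁ p₂ : ℕ}
    (ha : ∀ l, m₁ < p₁ + l.length → a l = 0) (hb : ∀ l, m₂ < p₂ + l.length → b l = 0)
    (l : List L) (hl : m₁ + m₂ < p₁ + p₂ + l.length) : (a * b) l = 0 := by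
  induction l generalizing a b p₁ p₂ with
  | nil =>
    rw [mul_nil]
    rcases lt_or_ge m₁ p₁ with h | h
    · rw [ha [] (by simpa using h), zero_mul]
    · rw [hb [] (by simp at hl ⊢; omega), mul_zero]
  | cons Y l ih =>
    simp only [List.length_cons] at hl
    rw [mul_cons, ih (p₁ := p₁ + 1) (p₂ := p₂), ih (p₁ := p₁) (p₂ := p₂ + 1), add_zero]
    · intro l hl; simp only [sgn, ha l hl, mul_zero]
    · intro l hl; exact hb _ (by simp only [List.length_cons]; omega)
    · omega
    · intro l hl; exact ha _ (by simp only [List.length_cons]; omega)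
    · exact hb
    · omega

variable [LieRing L] [LieRingModule L A]

theorem lieDer_vanish {a : Cochain A L} {m p : ℕ} (X : L)
    (ha : ∀ l, m < p + l.length → a l = 0) (l : List L) (hl : m < p + l.length) :
    lieDer X a l = 0 := by
  induction l generalizing a p with
  | nil => rw [lieDer_nil, ha [] hl, lie_zero]
  | cons Y l ih =>
    simp only [List.length_cons] at hl
    rw [lieDer_cons, ih (p := p + 1), ins_app, ha, sub_zero]
    · simp only [List.length_cons]; omega
    · intro l hl; exact ha _ (by simp only [List.length_cons]; omega)
    · omega

theorem d_vanish {a : Cochain A L} {m p : ℕ}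
    (ha : ∀ l, m < p + l.length → a l = 0) (l : List L) (hl : m + 1 < p + l.length) :
    d a l = 0 := by
  induction l generalizing a p with
  | nil => rfl
  | cons Y l ih =>
    simp only [List.length_cons] at hl
    rw [d_cons, ih (p := p + 1), lieDer_vanish Y ha, sub_zero]
    · omega
    · intro l hl; exact ha _ (by simp only [List.length_cons]; omega)
    · omega
end Vanish

section Natural
variable {A L A' L' : Type*} [CommRing A'] [CommRing A]

/-- Compatibility of two cochains with maps of the coefficients and of the arguments. -/
def Compat (φ : A →+* A') (ψ : L → L') (a : Cochain A L) (a' : Cochain A' L') : Prop :=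
  ∀ l : List L, φ (a l) = a' (l.map ψ)

namespace Compat
variable {φ : A →+* A'} {ψ : L → L'} {a b : Cochain A L} {a' b' : Cochain A' L'}

theorem ins (h : Compat φ ψ a a') (X : L) : Compat φ ψ (ins X a) (ins (ψ X) a') :=
  fun l => h (X :: l)
theorem zero : Compat φ ψ (0 : Cochain A L) 0 := fun _ => map_zero φ
theorem one : Compat φ ψ (1 : Cochain A L) 1 := by
  intro l
  cases l with
  | nil => exact map_one φ
  | cons X l => exact map_zero φ
theorem add (h : Compat φ ψ a a') (k : Compat φ ψ b b') : Compat φ ψ (a + b) (a' + b') :=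
  fun l => by rw [add_app, map_add, h, k]; rfl
theorem neg (h : Compat φ ψ a a') : Compat φ ψ (-a) (-a') :=
  fun l => by rw [neg_app, map_neg, h]; rfl
theorem sgn (h : Compat φ ψ a a') : Compat φ ψ (sgn a) (sgn a') :=
  fun l => by simp only [Cochain.sgn, map_mul, map_pow, map_neg, map_one, h l, List.length_map]
theorem mul (h : Compat φ ψ a a') (k : Compat φ ψ b b') : Compat φ ψ (a * b) (a' * b') := by
  intro l
  induction l generalizing a b a' b' with
  | nil => rw [mul_nil, map_mul, h, k]; rfl
  | cons X l ih =>
    rw [mul_cons, map_add, ih (h.ins X) k, ih h.sgn (k.ins X), List.map_cons, mul_cons]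

variable [LieRing L] [LieRingModule L A] [LieRing L'] [LieRingModule L' A']

theorem lieDer (h : Compat φ ψ a a') (hφ : ∀ (X : L) (f : A), φ ⁅X, f⁆ = ⁅ψ X, φ f⁆)
    (hψ : ∀ X Y : L, ψ ⁅X, Y⁆ = ⁅ψ X, ψ Y⁆) (X : L) :
    Compat φ ψ (lieDer X a) (lieDer (ψ X) a') := by
  intro l
  induction l generalizing a a' with
  | nil => rw [lieDer_nil, hφ, h]; rfl
  | cons Y l ih =>
    rw [lieDer_cons, map_sub, ih (h.ins Y), h.ins ⁅X, Y⁆ l, hψ, List.map_cons, lieDer_cons]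

theorem d (h : Compat φ ψ a a') (hφ : ∀ (X : L) (f : A), φ ⁅X, f⁆ = ⁅ψ X, φ f⁆)
    (hψ : ∀ X Y : L, ψ ⁅X, Y⁆ = ⁅ψ X, ψ Y⁆) : Compat φ ψ (d a) (d a') := by
  intro l
  induction l generalizing a a' with
  | nil => exact map_zero φ
  | cons Y l ih =>
    rw [d_cons, map_sub, ih (h.ins Y), h.lieDer hφ hψ Y l, List.map_cons, d_cons]
end Compat
end Natural
end Cochain

/-- A ringed space whose structure sheaf is a sheaf of commutative `K`-algebras. -/
structure RingedSpaceOver (K : Type v) [Field K] where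
  space : AlgebraicGeometry.RingedSpace.{u, u}
  scalars : K →+* space.presheaf.obj (op ⊤)

namespace RingedSpaceOver
variable {K : Type v} [Field K] (S : RingedSpaceOver.{u} K)

/-- Open subsets. -/
abbrev Open : Type u := Opens S.space

/-- The ring of sections of the structure sheaf. -/
def Sec (U : S.Open) : Type u := S.space.presheaf.obj (op U)

instance (U : S.Open) : CommRing (S.Sec U) :=
  inferInstanceAs (CommRing (S.space.presheaf.obj (op U)))

/-- Restriction as a ring homomorphism. -/
def resRing {V U : S.Open} (h : V ≤ U) : S.Sec U →+* S.Sec V :=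
  (S.space.presheaf.map (homOfLE h).op).hom

theorem resRing_refl {U : S.Open} (f : S.Sec U) : S.resRing le_rfl f = f := by
  change (S.space.presheaf.map (𝟙 (op U))).hom f = f
  rw [CategoryTheory.Functor.map_id]; rfl

theorem resRing_trans {W V U : S.Open} (h' : W ≤ V) (h : V ≤ U) (f : S.Sec U) :
    S.resRing h' (S.resRing h f) = S.resRing (h'.trans h) f := by
  have := S.space.presheaf.map_comp (homOfLE h).op (homOfLE h').op
  exact (congrArg (fun g => g.hom f) this).symm

instance (U : S.Open) : Algebra K (S.Sec U) :=
  ((S.resRing le_top).comp S.scalars).toAlgebra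

/-- Restriction as a homomorphism of `K`-algebras. -/
def res {V U : S.Open} (h : V ≤ U) : S.Sec U →ₐ[K] S.Sec V :=
  { S.resRing h with commutes' := fun c => S.resRing_trans h le_top (S.scalars c) }

theorem res_refl {U : S.Open} (f : S.Sec U) : S.res le_rfl f = f := S.resRing_refl f

theorem res_trans {W V U : S.Open} (h' : W ≤ V) (h : V ≤ U) (f : S.Sec U) :
    S.res h' (S.res h f) = S.res (h'.trans h) f := S.resRing_trans _ h f

/-- The structure sheaf as a sheaf of rings. -/
def ringSheaf : TopCat.Sheaf RingCat.{u} S.space :=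
  (sheafCompose (Opens.grothendieckTopology S.space) (forget₂ CommRingCat RingCat)).obj S.space.sheaf

end RingedSpaceOver
variable {K : Type v} [Field K] {S : RingedSpaceOver.{u} K}

/-- Sheaves of modules over the structure sheaf. -/
abbrev OModule (S : RingedSpaceOver.{u} K) := SheafOfModules.{u} S.ringSheaf

namespace OModule
/-- Sections of a sheaf of modules. -/
def Sec (M : OModule S) (U : S.Open) : Type u := M.val.obj (op U)
variable (M : OModule S)
instance (U : S.Open) : AddCommGroup (M.Sec U) := inferInstanceAs (AddCommGroup (M.val.obj (op U)))
instance (U : S.Open) : Module (S.Sec U) (M.Sec U) := (M.val.obj (op U)).isModule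
instance (U : S.Open) : Module K (M.Sec U) := Module.compHom _ (algebraMap K (S.Sec U))
instance (U : S.Open) : IsScalarTower K (S.Sec U) (M.Sec U) :=
  ⟨fun c f m => by rw [Algebra.smul_def, mul_smul]; rfl⟩
/-- Restriction of sections. -/
def res {V U : S.Open} (h : V ≤ U) : M.Sec U →+ M.Sec V := (M.val.presheaf.map (homOfLE h).op).hom
theorem res_smul {V U : S.Open} (h : V ≤ U) (f : S.Sec U) (m : M.Sec U) :
    M.res h (f • m) = S.res h f • M.res h m := M.val.map_smul _ _ _
theorem res_refl {U : S.Open} (m : M.Sec U) : M.res le_rfl m = m := by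
  change (M.val.presheaf.map (𝟙 (op U))).hom m = m
  rw [CategoryTheory.Functor.map_id]; rfl
theorem res_trans {W V U : S.Open} (h' : W ≤ V) (h : V ≤ U) (m : M.Sec U) :
    M.res h' (M.res h m) = M.res (h'.trans h) m := by
  have := M.val.presheaf.map_comp (homOfLE h).op (homOfLE h').op
  exact (congrArg (fun g => g.hom m) this).symm
end OModule

/-- A frame of `M` over `V` of rank `r`: sections over `V` whose restrictions form a basis of
`M(W)` over `𝒪(W)` for every open `W ⊆ V`, i.e. an isomorphism `𝒪|_V ^ r ≅ M|_V`. -/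
structure Frame (M : OModule S) (r : ℕ) (V : S.Open) where
  basis : ∀ W : S.Open, W ≤ V → Module.Basis (Fin r) (S.Sec W) (M.Sec W)
  res_basis : ∀ (W : S.Open) (h : W ≤ V) (i : Fin r),
    M.res h (basis V le_rfl i) = basis W h i

/-- Locally free of constant rank `r`. -/
def IsLocallyFree (M : OModule S) (r : ℕ) : Prop :=
  ∀ x : S.space, ∃ V : S.Open, x ∈ V ∧ Nonempty (Frame M r V)

/-- A Lie algebroid: a sheaf of `𝒪`-modules such that each pair of sections is a
Lie-Rinehart algebra over `K`, compatibly with restriction. -/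
structure LieAlgebroid (S : RingedSpaceOver.{u} K) where
  mod : OModule S
  bracket : ∀ U : S.Open, mod.Sec U →ₗ[K] mod.Sec U →ₗ[K] mod.Sec U
  bracket_self : ∀ (U : S.Open) (X : mod.Sec U), bracket U X X = 0
  jacobi : ∀ (U : S.Open) (X Y Z : mod.Sec U),
    bracket U X (bracket U Y Z) = bracket U (bracket U X Y) Z + bracket U Y (bracket U X Z)
  anchor : ∀ U : S.Open, mod.Sec U →ₗ[S.Sec U] Derivation K (S.Sec U) (S.Sec U)
  anchor_bracket : ∀ (U : S.Open) (X Y : mod.Sec U),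
    anchor U (bracket U X Y) = ⁅anchor U X, anchor U Y⁆
  leibniz : ∀ (U : S.Open) (X Y : mod.Sec U) (f : S.Sec U),
    bracket U X (f • Y) = f • bracket U X Y + anchor U X f • Y
  res_bracket : ∀ (U V : S.Open) (h : V ≤ U) (X Y : mod.Sec U),
    mod.res h (bracket U X Y) = bracket V (mod.res h X) (mod.res h Y)
  res_anchor : ∀ (U V : S.Open) (h : V ≤ U) (X : mod.Sec U) (f : S.Sec U),
    S.res h (anchor U X f) = anchor V (mod.res h X) (S.res h f)

namespace LieAlgebroid
variable (L : LieAlgebroid S)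

/-- Sections of the Lie algebroid. -/
def Sec (U : S.Open) : Type u := L.mod.Sec U

instance (U : S.Open) : AddCommGroup (L.Sec U) := inferInstanceAs (AddCommGroup (L.mod.Sec U))
instance (U : S.Open) : Module (S.Sec U) (L.Sec U) :=
  inferInstanceAs (Module (S.Sec U) (L.mod.Sec U))
instance (U : S.Open) : Module K (L.Sec U) := inferInstanceAs (Module K (L.mod.Sec U))
instance (U : S.Open) : IsScalarTower K (S.Sec U) (L.Sec U) :=
  inferInstanceAs (IsScalarTower K (S.Sec U) (L.mod.Sec U))

instance (U : S.Open) : LieRing (L.Sec U) where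
  bracket X Y := L.bracket U X Y
  add_lie X Y Z := LinearMap.congr_fun ((L.bracket U).map_add X Y) Z
  lie_add X Y Z := map_add (L.bracket U X) Y Z
  lie_self := L.bracket_self U
  leibniz_lie := L.jacobi U

instance (U : S.Open) : LieAlgebra K (L.Sec U) where
  lie_smul c X Y := map_smul (L.bracket U X) c Y

instance (U : S.Open) : LieRingModule (L.Sec U) (S.Sec U) where
  bracket X f := L.anchor U X f
  add_lie X Y f := Derivation.congr_fun ((L.anchor U).map_add X Y) f
  lie_add X f g := map_add (L.anchor U X) f g
  leibniz_lie X Y f := by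
    have h : L.anchor U (L.bracket U X Y) f = _ :=
      congrArg (fun D : Derivation K (S.Sec U) (S.Sec U) => D f) (L.anchor_bracket U X Y)
    rw [Derivation.commutator_apply] at h
    change L.anchor U X (L.anchor U Y f)
      = L.anchor U (L.bracket U X Y) f + L.anchor U Y (L.anchor U X f)
    rw [h]; ring

instance (U : S.Open) : LieRinehartRing (S.Sec U) (L.Sec U) where
  lie_smul_eq_mul' f g X := Derivation.congr_fun ((L.anchor U).map_smul f X) g
  leibniz_mul_right' X f g := by
    change L.anchor U X (f * g) = f • L.anchor U X g + L.anchor U X f * g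
    rw [Derivation.leibniz, smul_eq_mul, smul_eq_mul, mul_comm g]
  leibniz_smul_right' X Y f := L.leibniz U X Y f

instance (U : S.Open) : LieRinehartAlgebra K (S.Sec U) (L.Sec U) where
  smul_lie c X f :=
    (Derivation.congr_fun ((L.anchor U).map_smul (algebraMap K (S.Sec U) c) X) f).trans
      (algebraMap_smul (S.Sec U) c (L.anchor U X f))
  lie_smul c X f := (L.anchor U X).map_smul c f

/-- Restriction of sections. -/
def res {V U : S.Open} (h : V ≤ U) : L.Sec U →+ L.Sec V := L.mod.res h

theorem res_refl {U : S.Open} (X : L.Sec U) : L.res le_rfl X = X := L.mod.res_refl X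
theorem res_trans {W V U : S.Open} (h' : W ≤ V) (h : V ≤ U) (X : L.Sec U) :
    L.res h' (L.res h X) = L.res (h'.trans h) X := L.mod.res_trans h' h X
theorem res_lie {V U : S.Open} (h : V ≤ U) (X Y : L.Sec U) :
    L.res h ⁅X, Y⁆ = ⁅L.res h X, L.res h Y⁆ := L.res_bracket U V h X Y
theorem res_lie_fun {V U : S.Open} (h : V ≤ U) (X : L.Sec U) (f : S.Sec U) :
    S.res h ⁅X, f⁆ = ⁅L.res h X, S.res h f⁆ := L.res_anchor U V h X f

/-- The ring underlying `Form`. -/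
def formRing (U : S.Open) :
    Subring (∀ V : {V : S.Open // V ≤ U}, Cochain (S.Sec V.1) (L.Sec V.1)) where
  carrier := {ω | (∀ V, (ω V).IsForm) ∧
    ∀ (V W : {V : S.Open // V ≤ U}) (h : W.1 ≤ V.1),
      Cochain.Compat (S.res h : S.Sec V.1 →+* S.Sec W.1) (L.res h) (ω V) (ω W)}
  mul_mem' ha hb := ⟨fun V => (ha.1 V).mul (hb.1 V), fun V W h => (ha.2 V W h).mul (hb.2 V W h)⟩
  one_mem' := ⟨fun _ => Cochain.IsForm.const 1, fun _ _ _ => Cochain.Compat.one⟩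
  add_mem' ha hb := ⟨fun V => (ha.1 V).add (hb.1 V), fun V W h => (ha.2 V W h).add (hb.2 V W h)⟩
  zero_mem' := ⟨fun _ => Cochain.IsForm.zero, fun _ _ _ => Cochain.Compat.zero⟩
  neg_mem' ha := ⟨fun V => (ha.1 V).neg, fun V W h => (ha.2 V W h).neg⟩

/-- Differential forms `Ω_L(U)` (all degrees together): `𝒪`-multilinear alternating
functions on `L|_U`, i.e. compatible families of alternating forms on `L(V)` for all open `V ⊆ U`.
For `L` locally free of finite rank this is the space of sections over `U` of the exterior algebra
of the dual of `L`. The product is the exterior product. -/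
abbrev Form (U : S.Open) : Type u := L.formRing U

namespace Form
variable {L}
/-- The value of a form on sections over `V ⊆ U`. -/
def eval {U : S.Open} (ω : L.Form U) (V : S.Open) (h : V ≤ U) (l : List (L.Sec V)) : S.Sec V :=
  ω.1 ⟨V, h⟩ l

theorem ext {U : S.Open} {ω η : L.Form U} (h : ∀ V hV l, ω.eval V hV l = η.eval V hV l) : ω = η :=
  Subtype.ext (funext fun V => funext fun l => h V.1 V.2 l)

/-- Restriction of forms. -/
def res {V U : S.Open} (h : V ≤ U) : L.Form U →+* L.Form V where
  toFun ω := ⟨fun W => ω.1 ⟨W.1, W.2.trans h⟩, fun W => ω.2.1 ⟨W.1, W.2.trans h⟩,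
    fun W W' hW => ω.2.2 ⟨W.1, W.2.trans h⟩ ⟨W'.1, W'.2.trans h⟩ hW⟩
  map_one' := rfl
  map_mul' _ _ := rfl
  map_zero' := rfl
  map_add' _ _ := rfl

/-- The Lie algebroid differential. -/
def d {U : S.Open} : L.Form U →+ L.Form U where
  toFun ω := ⟨fun V => (ω.1 V).d, fun V => (ω.2.1 V).d,
    fun V W h => (ω.2.2 V W h).d (L.res_lie_fun h) (L.res_lie h)⟩
  map_zero' := Subtype.ext (funext fun _ => Cochain.d_zero)
  map_add' _ _ := Subtype.ext (funext fun _ => Cochain.d_add _ _)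

/-- The parity involution, `(-1)^q` on forms of degree `q`. -/
def sgn {U : S.Open} : L.Form U →+* L.Form U where
  toFun ω := ⟨fun V => (ω.1 V).sgn, fun V => (ω.2.1 V).sgn, fun V W h => (ω.2.2 V W h).sgn⟩
  map_zero' := Subtype.ext (funext fun _ => Cochain.sgn_zero)
  map_add' _ _ := Subtype.ext (funext fun _ => Cochain.sgn_add _ _)
  map_one' := Subtype.ext (funext fun _ => Cochain.sgn_const 1)
  map_mul' _ _ := Subtype.ext (funext fun _ => Cochain.sgn_mul _ _)

/-- `(-1)^(n q)` on forms of degree `q`. -/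
def sgnPow (n : ℕ) {U : S.Open} : L.Form U →+* L.Form U := sgn ^ n

theorem eval_add {U : S.Open} (ω η : L.Form U) (V : S.Open) (h : V ≤ U) (l : List (L.Sec V)) :
    (ω + η).eval V h l = ω.eval V h l + η.eval V h l := rfl
theorem eval_sum {ι : Type*} (s : Finset ι) {U : S.Open} (ω : ι → L.Form U) (V : S.Open)
    (h : V ≤ U) (l : List (L.Sec V)) :
    (∑ i ∈ s, ω i).eval V h l = ∑ i ∈ s, (ω i).eval V h l :=
  map_sum (⟨⟨fun η : L.Form U => η.eval V h l, rfl⟩, fun _ _ => rfl⟩ : L.Form U →+ S.Sec V) ω s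
theorem eval_sign_mul (n : ℕ) {U : S.Open} (ω : L.Form U) (V : S.Open) (h : V ≤ U)
    (l : List (L.Sec V)) : ((-1) ^ n * ω).eval V h l = (-1) ^ n * ω.eval V h l := by
  rcases Nat.even_or_odd n with hn | hn
  · rw [hn.neg_one_pow, hn.neg_one_pow, one_mul, one_mul]
  · rw [hn.neg_one_pow, hn.neg_one_pow, neg_one_mul, neg_one_mul]; rfl
theorem sgnPow_zero {U : S.Open} (ω : L.Form U) : sgnPow 0 ω = ω := rfl
theorem sgnPow_succ (n : ℕ) {U : S.Open} (ω : L.Form U) :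
    sgnPow (n + 1) ω = sgn (sgnPow n ω) := by
  rw [sgnPow, pow_succ']; rfl
theorem sgnPow_add (m n : ℕ) {U : S.Open} (ω : L.Form U) :
    sgnPow (m + n) ω = sgnPow m (sgnPow n ω) := by
  rw [sgnPow, pow_add]; rfl
theorem eval_sgnPow (n : ℕ) {U : S.Open} (ω : L.Form U) (V : S.Open) (h : V ≤ U)
    (l : List (L.Sec V)) :
    (sgnPow n ω).eval V h l = (-1) ^ (n * l.length) * ω.eval V h l := by
  induction n with
  | zero => simp [sgnPow_zero]
  | succ n ih =>
    rw [sgnPow_succ]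
    change (-1) ^ l.length * (sgnPow n ω).eval V h l = _
    rw [ih, ← mul_assoc, ← pow_add]; ring
theorem res_sgnPow (n : ℕ) {V U : S.Open} (h : V ≤ U) (ω : L.Form U) :
    res h (sgnPow n ω) = sgnPow n (res h ω) := by
  induction n with
  | zero => rfl
  | succ n ih => rw [sgnPow_succ, sgnPow_succ, ← ih]; rfl

theorem res_refl {U : S.Open} (ω : L.Form U) : res le_rfl ω = ω := rfl
theorem res_trans {W V U : S.Open} (h' : W ≤ V) (h : V ≤ U) (ω : L.Form U) :
    res h' (res h ω) = res (h'.trans h) ω := rfl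
theorem res_d {V U : S.Open} (h : V ≤ U) (ω : L.Form U) : res h (d ω) = d (res h ω) := rfl
theorem res_sgn {V U : S.Open} (h : V ≤ U) (ω : L.Form U) : res h (sgn ω) = sgn (res h ω) := rfl
theorem sgn_sgn {U : S.Open} (ω : L.Form U) : sgn (sgn ω) = ω :=
  Subtype.ext (funext fun _ => Cochain.sgn_sgn _)
theorem sgn_d {U : S.Open} (ω : L.Form U) : sgn (d ω) = - d (sgn ω) :=
  Subtype.ext (funext fun _ => Cochain.sgn_d _)
theorem d_mul {U : S.Open} (ω η : L.Form U) : d (ω * η) = d ω * η + sgn ω * d η :=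
  Subtype.ext (funext fun _ => Cochain.d_mul _ _)
theorem d_sgnPow (n : ℕ) {U : S.Open} (ω : L.Form U) :
    d (sgnPow n ω) = (-1) ^ n * sgnPow n (d ω) := by
  induction n with
  | zero => simp [sgnPow_zero]
  | succ n ih =>
    have h := sgn_d (sgnPow n ω)
    rw [sgnPow_succ, sgnPow_succ, ← neg_eq_iff_eq_neg.mpr h, ih, map_mul, map_pow, map_neg,
      map_one, pow_succ]
    simp
end Form
end LieAlgebroid

/-- A system of open sets `N(i₀,…,i_n)` indexed by the nonempty finite lists in `Idx`
(the value at the empty list is irrelevant) that grows when indices are deleted. The main example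
is the system of intersections `U_{i₀} ∩ ⋯ ∩ U_{i_n}` of a covering, see `cech`. -/
structure OpenSystem (S : RingedSpaceOver.{u} K) where
  Idx : Type u
  opens : List Idx → S.Open
  mono : ∀ {l' l : List Idx}, l'.Sublist l → opens l ≤ opens l'

variable (L : LieAlgebroid S)

/-- The group underlying `Tot`. -/
def totGroup (N : OpenSystem S) : AddSubgroup (∀ l : List N.Idx, L.Form (N.opens l)) where
  carrier := {c | c [] = 0 ∧ ∃ m : ℕ, ∀ (l : List N.Idx) (V : S.Open) (h : V ≤ N.opens l)
    (X : List (L.Sec V)), m < l.length + X.length → (c l).eval V h X = 0}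
  zero_mem' := ⟨rfl, 0, fun _ _ _ _ _ => rfl⟩
  add_mem' := by
    rintro a b ⟨ha, m, hm⟩ ⟨hb, n, hn⟩
    refine ⟨?_, max m n, fun l V h X hX => ?_⟩
    · change a [] + b [] = 0
      rw [ha, hb, add_zero]
    · change (a l).eval V h X + (b l).eval V h X = 0
      rw [hm l V h X (lt_of_le_of_lt (le_max_left _ _) hX),
        hn l V h X (lt_of_le_of_lt (le_max_right _ _) hX), add_zero]
  neg_mem' := by
    rintro a ⟨ha, m, hm⟩
    refine ⟨?_, m, fun l V h X hX => ?_⟩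
    · change -a [] = 0
      rw [ha, neg_zero]
    · change -(a l).eval V h X = 0
      rw [hm l V h X hX, neg_zero]

/-- The total space of the double complex
`C^{n,q} = ∏_{(i₀,…,i_n)} Ω_L^q(N(i₀,…,i_n))`: a family of forms, one for each nonempty list
`(i₀,…,i_n)` (a list of length `n + 1`), whose total degrees `n + q` are bounded. The value at the
empty list is zero by convention. -/
def Tot (N : OpenSystem S) : Type u := totGroup L N

namespace Tot
open LieAlgebroid
variable {L} {N : OpenSystem S}

instance : AddCommGroup (Tot L N) := inferInstanceAs (AddCommGroup (totGroup L N))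

/-- The component at a list, restricted to a smaller open set. -/
def val (c : Tot L N) (l : List N.Idx) {U : S.Open} (h : U ≤ N.opens l) : L.Form U :=
  Form.res h (c.1 l)

theorem ext {a b : Tot L N} (h : ∀ l, a.val l le_rfl = b.val l le_rfl) : a = b :=
  Subtype.ext (funext h)
theorem val_congr (c : Tot L N) {l l' : List N.Idx} (e : l = l') {U : S.Open}
    (h : U ≤ N.opens l) : c.val l h = c.val l' (e ▸ h) := by subst e; rfl
theorem val_nil (c : Tot L N) {U : S.Open} (h : U ≤ N.opens []) : c.val [] h = 0 := by
  rw [val, c.2.1, map_zero]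
theorem val_add (a b : Tot L N) (l : List N.Idx) {U : S.Open} (h : U ≤ N.opens l) :
    (a + b).val l h = a.val l h + b.val l h := rfl
theorem val_zero (l : List N.Idx) {U : S.Open} (h : U ≤ N.opens l) :
    (0 : Tot L N).val l h = 0 := rfl
theorem res_val (c : Tot L N) (l : List N.Idx) {U V : S.Open} (h : U ≤ N.opens l) (h' : V ≤ U) :
    Form.res h' (c.val l h) = c.val l (h'.trans h) := rfl

theorem take_le (l : List N.Idx) (j : ℕ) : N.opens l ≤ N.opens (l.take j) :=
  N.mono (List.take_sublist j l)
theorem drop_le (l : List N.Idx) (j : ℕ) : N.opens l ≤ N.opens (l.drop j) :=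
  N.mono (List.drop_sublist j l)
theorem erase_le (l : List N.Idx) (j : ℕ) : N.opens l ≤ N.opens (l.eraseIdx j) :=
  N.mono (List.eraseIdx_sublist l j)

/-- The Alexander-Whitney product: for `a` and `b` of bidegrees `(p, q)` and `(p', q')`,
`(a b)(i₀,…,i_{p+p'}) = (-1)^(q p') a(i₀,…,i_p) ∧ b(i_p,…,i_{p+p'})`. -/
instance : Mul (Tot L N) where
  mul a b := ⟨fun l => ∑ j ∈ Finset.range l.length,
      Form.sgnPow (l.length - 1 - j) (a.val (l.take (j + 1)) (take_le l _)) *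
        b.val (l.drop j) (drop_le l _), by
    obtain ⟨-, m, hm⟩ := a.2
    obtain ⟨-, n, hn⟩ := b.2
    refine ⟨rfl, m + n, fun l V h X hX => ?_⟩
    rw [Form.eval_sum]
    refine Finset.sum_eq_zero fun j hj => ?_
    rw [Finset.mem_range] at hj
    refine Cochain.mul_vanish (m₁ := m) (m₂ := n) (p₁ := j + 1) (p₂ := l.length - j)
      (fun Y hY => ?_) (fun Y hY => ?_) X (by omega)
    · change (Form.sgnPow _ (a.val _ _)).eval V h Y = 0
      rw [Form.eval_sgnPow]
      refine mul_eq_zero_of_right _ (hm _ V _ Y ?_)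
      rw [List.length_take]; omega
    · refine hn _ V _ Y ?_
      rw [List.length_drop]; omega⟩

instance : One (Tot L N) where
  one := ⟨fun l => if l.length = 1 then 1 else 0, by
    refine ⟨rfl, 1, fun l V h X hX => ?_⟩
    dsimp only
    split_ifs with hl
    · cases X with
      | nil => simp [hl] at hX
      | cons Y X => rfl
    · rfl⟩

/-- The differential of the total complex: `δ + (-1)^n d_L` on `C^{n,q}`, that is
`(D c)(i₀,…,i_n) = ∑_j (-1)^j c(i₀,…,î_j,…,i_n) + (-1)^n d_L (c(i₀,…,i_n))`. -/
def D : Tot L N →+ Tot L N where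
  toFun c := ⟨fun l => ∑ j ∈ Finset.range l.length, (-1) ^ j * c.val (l.eraseIdx j) (erase_le l j)
      + (-1) ^ (l.length - 1) * Form.d (c.val l le_rfl), by
    obtain ⟨h0, m, hm⟩ := c.2
    refine ⟨?_, m + 1, fun l V h X hX => ?_⟩
    · simp [val_nil]
    · rw [Form.eval_add, Form.eval_sum, Form.eval_sign_mul]
      refine (congrArg₂ _ (Finset.sum_eq_zero fun j hj => ?_)
        (mul_eq_zero_of_right _ ?_)).trans (add_zero _)
      · rw [Finset.mem_range] at hj
        rw [Form.eval_sign_mul]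
        refine mul_eq_zero_of_right _ (hm _ V _ X ?_)
        rw [List.length_eraseIdx_of_lt hj]; omega
      · exact Cochain.d_vanish (m := m) (p := l.length) (fun Y hY => hm l V h Y hY) X hX⟩
  map_zero' := by
    refine ext fun l => ?_
    change ∑ j ∈ Finset.range l.length, (-1) ^ j * (0 : L.Form (N.opens l))
      + (-1) ^ (l.length - 1) * Form.d (0 : L.Form (N.opens l)) = 0
    simp
  map_add' a b := by
    refine ext fun l => ?_
    change ∑ j ∈ Finset.range l.length, (-1) ^ j * (a.val (l.eraseIdx j) (erase_le l j) +
       b.val (l.eraseIdx j) (erase_le l j))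
      + (-1) ^ (l.length - 1) * Form.d (a.val l le_rfl + b.val l le_rfl) =
      (∑ j ∈ Finset.range l.length, (-1) ^ j * a.val (l.eraseIdx j) (erase_le l j)
      + (-1) ^ (l.length - 1) * Form.d (a.val l le_rfl)) +
      (∑ j ∈ Finset.range l.length, (-1) ^ j * b.val (l.eraseIdx j) (erase_le l j)
      + (-1) ^ (l.length - 1) * Form.d (b.val l le_rfl))
    simp only [mul_add, map_add, Finset.sum_add_distrib]; abel

theorem val_mul (a b : Tot L N) (l : List N.Idx) {U : S.Open} (h : U ≤ N.opens l) :
    (a * b).val l h = ∑ j ∈ Finset.range l.length,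
      Form.sgnPow (l.length - 1 - j) (a.val (l.take (j + 1)) (h.trans (take_le l _))) *
        b.val (l.drop j) (h.trans (drop_le l _)) := by
  change Form.res h (∑ j ∈ Finset.range l.length,
      Form.sgnPow (l.length - 1 - j) (a.val (l.take (j + 1)) (take_le l _)) *
        b.val (l.drop j) (drop_le l _)) = _
  rw [map_sum]
  refine Finset.sum_congr rfl fun j _ => ?_
  rw [map_mul, Form.res_sgnPow]; rfl
theorem val_one (l : List N.Idx) {U : S.Open} (h : U ≤ N.opens l) :
    (1 : Tot L N).val l h = if l.length = 1 then 1 else 0 := by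
  change Form.res h (if l.length = 1 then 1 else 0) = _
  split_ifs
  · rfl
  · rfl
theorem val_D (c : Tot L N) (l : List N.Idx) {U : S.Open} (h : U ≤ N.opens l) :
    (D c).val l h = ∑ j ∈ Finset.range l.length,
      (-1) ^ j * c.val (l.eraseIdx j) (h.trans (erase_le l j))
      + (-1) ^ (l.length - 1) * Form.d (c.val l h) := by
  change Form.res h (∑ j ∈ Finset.range l.length,
      (-1) ^ j * c.val (l.eraseIdx j) (erase_le l j)
      + (-1) ^ (l.length - 1) * Form.d (c.val l le_rfl)) = _
  rw [map_add, map_sum]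
  simp only [map_mul, map_pow, map_neg, map_one]; rfl

protected theorem mul_assoc (a b c : Tot L N) : a * b * c = a * (b * c) := by
  refine ext fun l => ?_
  rw [val_mul, val_mul]
  have hL : ∀ j ∈ Finset.range l.length,
      Form.sgnPow (l.length - 1 - j) ((a * b).val (l.take (j + 1)) (le_rfl.trans (take_le l _))) *
        c.val (l.drop j) (le_rfl.trans (drop_le l _)) =
      ∑ i ∈ Finset.range (j + 1), Form.sgnPow (l.length - 1 - i) (a.val (l.take (i + 1))
        (take_le l _)) * (Form.sgnPow (l.length - 1 - j)
          (b.val ((l.drop i).take (j + 1 - i)) ((drop_le l i).trans (take_le _ _))) *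
        c.val (l.drop j) (drop_le l j)) := by
    intro j hj
    rw [Finset.mem_range] at hj
    have hlen : (l.take (j + 1)).length = j + 1 := by rw [List.length_take]; omega
    rw [val_mul, hlen, map_sum, Finset.sum_mul]
    refine Finset.sum_congr rfl fun i hi => ?_
    rw [Finset.mem_range] at hi
    rw [map_mul, mul_assoc, ← Form.sgnPow_add,
      val_congr a (List.take_take.trans (by rw [min_eq_left (by omega)])),
      val_congr b (List.drop_take (i := i) (j := j + 1) (l := l)),
      show l.length - 1 - j + (j + 1 - 1 - i) = l.length - 1 - i by omega]
  have hR : ∀ i ∈ Finset.range l.length,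
      Form.sgnPow (l.length - 1 - i) (a.val (l.take (i + 1)) (le_rfl.trans (take_le l _))) *
        (b * c).val (l.drop i) (le_rfl.trans (drop_le l _)) =
      ∑ j ∈ Finset.Ico i l.length, Form.sgnPow (l.length - 1 - i) (a.val (l.take (i + 1))
        (take_le l _)) * (Form.sgnPow (l.length - 1 - j)
          (b.val ((l.drop i).take (j + 1 - i)) ((drop_le l i).trans (take_le _ _))) *
        c.val (l.drop j) (drop_le l j)) := by
    intro i hi
    rw [Finset.mem_range] at hi
    rw [val_mul, Finset.mul_sum, Finset.sum_Ico_eq_sum_range, List.length_drop]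
    refine Finset.sum_congr rfl fun k hk => ?_
    rw [Finset.mem_range] at hk
    rw [val_congr c (List.drop_drop (i := k) (j := i) (l := l)),
      val_congr b (show (l.drop i).take (k + 1) = (l.drop i).take (i + k + 1 - i) by
        congr 1; omega),
      show l.length - i - 1 - k = l.length - 1 - (i + k) by omega]
  rw [Finset.sum_congr rfl hL, Finset.sum_congr rfl hR]
  refine Finset.sum_comm' fun j i => ?_
  simp only [Finset.mem_range, Finset.mem_Ico]
  omega

instance : Ring (Tot L N) where
  __ := (inferInstance : AddCommGroup (Tot L N))
  left_distrib a b c := ext fun l => by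
    simp only [val_mul, val_add, mul_add, Finset.sum_add_distrib]
  right_distrib a b c := ext fun l => by
    simp only [val_mul, val_add, map_add, add_mul, Finset.sum_add_distrib]
  zero_mul a := ext fun l => by simp [val_mul, val_zero]
  mul_zero a := ext fun l => by simp [val_mul, val_zero]
  mul_assoc := Tot.mul_assoc
  one_mul a := ext fun l => by
    rw [val_mul]
    cases l with
    | nil => rw [val_nil]; rfl
    | cons x l =>
      rw [Finset.sum_eq_single_of_mem 0 (by simp)]
      · rw [val_one, if_pos (by simp), map_one, one_mul]; rfl
      · intro j hj h0
        rw [Finset.mem_range] at hj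
        rw [val_one, if_neg (by rw [List.length_take]; omega), map_zero, zero_mul]
  mul_one a := ext fun l => by
    rw [val_mul]
    cases l with
    | nil => rw [val_nil]; rfl
    | cons x l =>
      rw [Finset.sum_eq_single_of_mem l.length (by simp)]
      · rw [val_one, if_pos (by simp), mul_one,
          val_congr a (List.take_of_length_le (l := x :: l) (by simp))]
        simp [Form.sgnPow_zero]
      · intro j hj h0
        rw [Finset.mem_range, List.length_cons] at hj
        rw [val_one, if_neg (by rw [List.length_drop, List.length_cons]; omega), mul_zero]

/-- The parity involution, `(-1)^(n+q)` on `C^{n,q}`. -/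
def par : Tot L N →+ Tot L N where
  toFun c := ⟨fun l => (-1) ^ (l.length - 1) * Form.sgn (c.val l le_rfl), by
    obtain ⟨h0, m, hm⟩ := c.2
    refine ⟨by dsimp only; rw [val_nil]; simp, m, fun l V h X hX => ?_⟩
    rw [Form.eval_sign_mul]
    exact mul_eq_zero_of_right _ (mul_eq_zero_of_right _ (hm l V h X hX))⟩
  map_zero' := ext fun l => by
    change (-1) ^ (l.length - 1) * Form.sgn (0 : L.Form (N.opens l)) = 0
    rw [map_zero, mul_zero]
  map_add' a b := ext fun l => by
    change (-1) ^ (l.length - 1) * Form.sgn (a.val l le_rfl + b.val l le_rfl) =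
      (-1) ^ (l.length - 1) * Form.sgn (a.val l le_rfl) +
      (-1) ^ (l.length - 1) * Form.sgn (b.val l le_rfl)
    rw [map_add, mul_add]

theorem val_par (c : Tot L N) (l : List N.Idx) {U : S.Open} (h : U ≤ N.opens l) :
    (par c).val l h = (-1) ^ (l.length - 1) * Form.sgn (c.val l h) := by
  change Form.res h ((-1) ^ (l.length - 1) * Form.sgn (c.val l le_rfl)) = _
  rw [map_mul, map_pow, map_neg, map_one]; rfl

theorem sum_aux {G : Type*} [AddCommGroup G] (n : ℕ) (T₁ T₂ : ℕ → ℕ → G) (h₁ : T₁ 0 0 = 0)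
    (h₂ : T₂ n 0 = 0) (h : ∀ j < n, T₁ (j + 1) (j + 1) = - T₂ j 0) :
    ∑ k ∈ Finset.range (n + 1), ∑ j ∈ Finset.range n,
      (if k ≤ j then T₁ (j + 1) k else T₂ j (k - j)) =
    ∑ j ∈ Finset.range (n + 1), ∑ k ∈ Finset.range (j + 1), T₁ j k +
    ∑ j ∈ Finset.range (n + 1), ∑ k ∈ Finset.range (n + 1 - j), T₂ j k := by
  rw [Finset.sum_comm, Finset.sum_range_succ' _ n, Finset.sum_range_succ _ n]
  have e : n + 1 - n = 1 := by omega
  simp only [zero_add, e, Finset.sum_range_one, h₁, h₂, add_zero]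
  rw [← Finset.sum_add_distrib]
  refine Finset.sum_congr rfl fun j hj => ?_
  rw [Finset.mem_range] at hj
  rw [Finset.sum_range_succ _ (j + 1), h j hj, show n + 1 - j = (n - j) + 1 by omega,
    Finset.sum_range_succ' _ (n - j), show n + 1 = (j + 1) + (n - j) by omega,
    Finset.sum_range_add]
  rw [Finset.sum_congr rfl fun k hk => if_pos (Nat.lt_succ_iff.mp (Finset.mem_range.mp hk)),
    Finset.sum_congr rfl fun k _ => if_neg (by omega),
    Finset.sum_congr (rfl : Finset.range (n - j) = _) fun k _ =>
      congrArg (T₂ j) (show j + 1 + k - j = k + 1 by omega)]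
  abel

theorem take_eraseIdx {ι : Type*} (l : List ι) {k j : ℕ} (h : k ≤ j) :
    (l.eraseIdx k).take (j + 1) = (l.take (j + 2)).eraseIdx k := by
  refine List.ext_getElem? fun i => ?_
  simp only [List.getElem?_take, List.getElem?_eraseIdx]
  split_ifs <;> first | rfl | omega
theorem take_eraseIdx' {ι : Type*} (l : List ι) {k j : ℕ} (h : j < k) :
    (l.eraseIdx k).take (j + 1) = l.take (j + 1) := by
  refine List.ext_getElem? fun i => ?_
  simp only [List.getElem?_take, List.getElem?_eraseIdx]
  split_ifs <;> first | rfl | omega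
theorem drop_eraseIdx {ι : Type*} (l : List ι) {k j : ℕ} (h : k ≤ j) :
    (l.eraseIdx k).drop j = l.drop (j + 1) := by
  refine List.ext_getElem? fun i => ?_
  simp only [List.getElem?_drop, List.getElem?_eraseIdx]
  rw [if_neg (by omega)]; congr 1; omega
theorem drop_eraseIdx' {ι : Type*} (l : List ι) {k j : ℕ} (h : j < k) :
    (l.eraseIdx k).drop j = (l.drop j).eraseIdx (k - j) := by
  refine List.ext_getElem? fun i => ?_
  simp only [List.getElem?_drop, List.getElem?_eraseIdx]
  split_ifs <;> first | rfl | omega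

theorem sign_mul_comm {U : S.Open} (n : ℕ) (a b : L.Form U) :
    a * ((-1) ^ n * b) = (-1) ^ n * (a * b) := by
  rcases Nat.even_or_odd n with h | h <;> simp [h.neg_one_pow]

theorem sgnPow_sign {U : S.Open} (m n : ℕ) (a : L.Form U) :
    Form.sgnPow m ((-1) ^ n * a) = (-1) ^ n * Form.sgnPow m a := by
  rw [map_mul, map_pow, map_neg, map_one]

theorem d_sign {U : S.Open} (n : ℕ) (a : L.Form U) :
    Form.d ((-1) ^ n * a) = (-1) ^ n * Form.d a := by
  rcases Nat.even_or_odd n with h | h <;> simp [h.neg_one_pow]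

theorem D_mul (a b : Tot L N) : D (a * b) = D a * b + par a * D b := by
  refine ext fun l => ?_
  generalize_proofs hl
  rcases Nat.eq_zero_or_pos l.length with hn | hn
  · obtain rfl := List.length_eq_zero_iff.mp hn
    rw [val_nil, val_nil]
  obtain ⟨n, hn⟩ : ∃ n, l.length = n + 1 := ⟨l.length - 1, by omega⟩
  let T₁ : ℕ → ℕ → L.Form (N.opens l) := fun j k => (-1) ^ k *
    (Form.sgnPow (n - j) (a.val ((l.take (j + 1)).eraseIdx k)
      ((take_le l _).trans (erase_le _ _))) * b.val (l.drop j) (drop_le l j))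
  let T₂ : ℕ → ℕ → L.Form (N.opens l) := fun j k => (-1) ^ (j + k) *
    (Form.sgnPow (n + 1 - j) (a.val (l.take (j + 1)) (take_le l _)) *
      b.val ((l.drop j).eraseIdx k) ((drop_le l j).trans (erase_le _ _)))
  have key := sum_aux n T₁ T₂ ?_ ?_ ?_
  · rw [val_add, val_D, val_mul (D a), val_mul (par a), hn, Nat.add_sub_cancel]
    have e₁ : ∀ k ∈ Finset.range (n + 1), (-1) ^ k * (a * b).val (l.eraseIdx k)
        (hl.trans (erase_le l k)) = ∑ j ∈ Finset.range n,
          (if k ≤ j then T₁ (j + 1) k else T₂ j (k - j)) := by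
      intro k hk
      rw [Finset.mem_range] at hk
      have hlen : (l.eraseIdx k).length = n := by
        rw [List.length_eraseIdx_of_lt (by omega)]; omega
      rw [val_mul, hlen, Finset.mul_sum]
      refine Finset.sum_congr rfl fun j hj => ?_
      rw [Finset.mem_range] at hj
      split_ifs with h
      · simp only [T₁]
        rw [val_congr a (take_eraseIdx l h), val_congr b (drop_eraseIdx l h),
          show n - 1 - j = n - (j + 1) by omega]
      · simp only [T₂]
        rw [val_congr a (take_eraseIdx' l (not_le.mp h)),
          val_congr b (drop_eraseIdx' l (not_le.mp h)), show j + (k - j) = k by omega,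
          show n + 1 - j = (n - 1 - j) + 1 + 1 by omega, Form.sgnPow_succ, Form.sgnPow_succ,
          Form.sgn_sgn]
    have e₂ : ∀ j ∈ Finset.range (n + 1), Form.sgnPow (n - j)
        ((D a).val (l.take (j + 1)) (hl.trans (take_le l _))) *
          b.val (l.drop j) (hl.trans (drop_le l _)) = ∑ k ∈ Finset.range (j + 1), T₁ j k +
        (-1) ^ j * (Form.sgnPow (n - j) (Form.d (a.val (l.take (j + 1)) (take_le l _))) *
          b.val (l.drop j) (drop_le l j)) := by
      intro j hj
      rw [Finset.mem_range] at hj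
      have hlen : (l.take (j + 1)).length = j + 1 := by rw [List.length_take]; omega
      rw [val_D, hlen, map_add, add_mul, map_sum, Finset.sum_mul, Nat.add_sub_cancel,
        sgnPow_sign, mul_assoc]
      refine congrArg₂ _ (Finset.sum_congr rfl fun k _ => ?_) rfl
      rw [sgnPow_sign, mul_assoc]
    have e₃ : ∀ j ∈ Finset.range (n + 1), Form.sgnPow (n - j)
        ((par a).val (l.take (j + 1)) (hl.trans (take_le l _))) *
          (D b).val (l.drop j) (hl.trans (drop_le l _)) =
        ∑ k ∈ Finset.range (n + 1 - j), T₂ j k +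
        (-1) ^ n * (Form.sgnPow (n + 1 - j) (a.val (l.take (j + 1)) (take_le l _)) *
          Form.d (b.val (l.drop j) (drop_le l j))) := by
      intro j hj
      rw [Finset.mem_range] at hj
      have hlen : (l.take (j + 1)).length = j + 1 := by rw [List.length_take]; omega
      have hlen' : (l.drop j).length = n + 1 - j := by rw [List.length_drop]; omega
      have hs : ∀ ω : L.Form (N.opens l),
          Form.sgnPow (n - j) (Form.sgn ω) = Form.sgnPow (n + 1 - j) ω := fun ω => by
        rw [show n + 1 - j = (n - j) + 1 by omega, Form.sgnPow_add]; rfl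
      rw [val_D, val_par, hlen, hlen', Nat.add_sub_cancel, sgnPow_sign, hs, mul_add,
        Finset.mul_sum]
      refine congrArg₂ _ (Finset.sum_congr rfl fun k hk => ?_) ?_
      · rw [sign_mul_comm, mul_assoc, ← mul_assoc, ← pow_add, add_comm k]
      · rw [sign_mul_comm, mul_assoc, ← mul_assoc, ← pow_add,
          show n + 1 - j - 1 + j = n by omega]
    rw [Finset.sum_congr rfl e₁, Finset.sum_congr rfl e₂, Finset.sum_congr rfl e₃, key,
      Finset.sum_add_distrib, Finset.sum_add_distrib, val_mul a b, hn, map_sum, Finset.mul_sum]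
    have e₄ : ∀ j ∈ Finset.range (n + 1), (-1) ^ n * Form.d (Form.sgnPow (n + 1 - 1 - j)
        (a.val (l.take (j + 1)) (hl.trans (take_le l _))) *
          b.val (l.drop j) (hl.trans (drop_le l _))) =
        (-1) ^ j * (Form.sgnPow (n - j) (Form.d (a.val (l.take (j + 1)) (take_le l _))) *
          b.val (l.drop j) (drop_le l j)) +
        (-1) ^ n * (Form.sgnPow (n + 1 - j) (a.val (l.take (j + 1)) (take_le l _)) *
          Form.d (b.val (l.drop j) (drop_le l j))) := by
      intro j hj
      rw [Finset.mem_range] at hj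
      rw [Nat.add_sub_cancel, Form.d_mul, Form.d_sgnPow, ← Form.sgnPow_succ,
        show n - j + 1 = n + 1 - j by omega, mul_add, mul_assoc, ← mul_assoc ((-1) ^ n),
        ← pow_add, show n + (n - j) = j + 2 * (n - j) by omega, pow_add,
        Even.neg_one_pow (n := 2 * (n - j)) ⟨n - j, by ring⟩, mul_one]
    rw [Finset.sum_congr rfl e₄, Finset.sum_add_distrib]
    abel
  · simp only [T₁]
    rw [val_congr a (show (l.take (0 + 1)).eraseIdx 0 = [] by
      cases l <;> rfl), val_nil]
    simp
  · simp only [T₂]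
    rw [val_congr b (show (l.drop n).eraseIdx 0 = [] by
      rw [← List.length_eq_zero_iff, List.length_eraseIdx_of_lt (by rw [List.length_drop]; omega),
        List.length_drop]; omega), val_nil]
    simp
  · intro j hj
    simp only [T₁, T₂]
    rw [val_congr a (show (l.take (j + 1 + 1)).eraseIdx (j + 1) = l.take (j + 1) by
        refine List.ext_getElem? fun i => ?_
        simp only [List.getElem?_take, List.getElem?_eraseIdx]
        split_ifs <;> first | rfl | omega),
      val_congr b (show (l.drop j).eraseIdx 0 = l.drop (j + 1) by
        rw [List.eraseIdx_zero, List.tail_drop]),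
      show n + 1 - j = (n - (j + 1)) + 1 + 1 by omega, Form.sgnPow_succ, Form.sgnPow_succ,
      Form.sgn_sgn, add_zero, pow_succ]
    simp

theorem par_par (a : Tot L N) : par (par a) = a := ext fun l => by
  rw [val_par, val_par, map_mul, map_pow, map_neg, map_one, Form.sgn_sgn, ← mul_assoc, ← pow_add,
    Even.neg_one_pow ⟨_, rfl⟩, one_mul]

theorem D_par (a : Tot L N) : D (par a) = - par (D a) := by
  refine ext fun l => ?_
  generalize_proofs hl
  have hneg : (-par (D a)).val l hl = - (par (D a)).val l hl := rfl
  rw [hneg, val_D (par a), val_par a l, val_par (D a), val_D a]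
  rcases Nat.eq_zero_or_pos l.length with hn | hn
  · obtain rfl := List.length_eq_zero_iff.mp hn
    simp [val_nil]
  obtain ⟨n, hn⟩ : ∃ n, l.length = n + 1 := ⟨l.length - 1, by omega⟩
  rw [hn, Nat.add_sub_cancel, map_add, map_sum,
    map_mul Form.sgn, map_pow Form.sgn, map_neg Form.sgn, map_one Form.sgn, Form.sgn_d,
    d_sign, mul_add, Finset.mul_sum, neg_add, ← Finset.sum_neg_distrib]
  refine congrArg₂ _ (Finset.sum_congr rfl fun k hk => ?_) (by simp)
  rw [Finset.mem_range] at hk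
  have hlen : (l.eraseIdx k).length = n := by
    rw [List.length_eraseIdx_of_lt (by omega)]; omega
  rw [val_par, hlen, map_mul, map_pow, map_neg, map_one]
  cases n with
  | zero =>
    have : l.eraseIdx k = [] := List.length_eq_zero_iff.mp hlen
    rw [val_congr a this, val_nil]; simp
  | succ n =>
    rw [Nat.add_sub_cancel, ← mul_assoc, ← mul_assoc, ← pow_add, ← pow_add,
      show n + 1 + k = (k + n) + 1 by omega, pow_succ]
    simp

theorem D_one : D (1 : Tot L N) = 0 := by
  refine ext fun l => ?_
  generalize_proofs hl
  rw [val_D, val_one, val_zero]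
  have hd : Form.d (if l.length = 1 then (1 : L.Form (N.opens l)) else 0) = 0 := by
    split_ifs
    · have := Form.d_mul (1 : L.Form (N.opens l)) 1
      simpa using this
    · exact map_zero _
  rw [hd, mul_zero, add_zero]
  by_cases h2 : l.length = 2
  · obtain ⟨x, y, rfl⟩ := List.length_eq_two.mp h2
    simp [Finset.sum_range_succ, val_one]
  · refine Finset.sum_eq_zero fun k hk => ?_
    rw [Finset.mem_range] at hk
    rw [val_one, List.length_eraseIdx_of_lt hk, if_neg (by omega), mul_zero]
end Tot

namespace Tot
variable {L : LieAlgebroid S} {N N' N'' : OpenSystem S}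

/-- The ring of cocycles of the total complex. -/
def cocycles (L : LieAlgebroid S) (N : OpenSystem S) : Subring (Tot L N) where
  carrier := {c | D c = 0}
  mul_mem' {a b} ha hb := by
    rw [Set.mem_ofPred_eq] at ha hb ⊢
    rw [D_mul, ha, hb, zero_mul, mul_zero, add_zero]
  one_mem' := D_one
  add_mem' {a b} ha hb := by
    rw [Set.mem_ofPred_eq] at ha hb ⊢
    rw [map_add, ha, hb, add_zero]
  zero_mem' := map_zero D
  neg_mem' {a} ha := by
    rw [Set.mem_ofPred_eq] at ha ⊢
    rw [map_neg, ha, neg_zero]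

/-- The two-sided ideal of coboundaries in the ring of cocycles. -/
def coboundaries (L : LieAlgebroid S) (N : OpenSystem S) : Ideal (cocycles L N) where
  carrier := {z | ∃ x : Tot L N, D x = z}
  add_mem' := by
    rintro a b ⟨x, hx⟩ ⟨y, hy⟩
    exact ⟨x + y, by rw [map_add, hx, hy]; rfl⟩
  zero_mem' := ⟨0, map_zero D⟩
  smul_mem' := by
    rintro ⟨a, ha⟩ b ⟨x, hx⟩
    refine ⟨par a * x, ?_⟩
    have h0 : D a = 0 := ha
    rw [D_mul, D_par, h0, map_zero, neg_zero, zero_mul, zero_add, par_par, hx]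
    rfl

instance : (coboundaries L N).IsTwoSided where
  mul_mem_of_left := by
    rintro a ⟨b, hb⟩ ⟨x, hx⟩
    refine ⟨x * b, ?_⟩
    have h0 : D b = 0 := hb
    rw [D_mul, h0, mul_zero, add_zero, hx]
    rfl

/-- Homogeneous of total degree `m`: only components with `n + q = m`. -/
def IsHomogeneous (c : Tot L N) (m : ℕ) : Prop :=
  ∀ (l : List N.Idx) (V : S.Open) (h : V ≤ N.opens l) (X : List (L.Sec V)),
    l.length + X.length ≠ m + 1 → (c.val l le_rfl).eval V h X = 0

/-- The elements of total degree `m`. -/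
def homogeneous (L : LieAlgebroid S) (N : OpenSystem S) (m : ℕ) : AddSubgroup (Tot L N) where
  carrier := {c | IsHomogeneous c m}
  zero_mem' := fun _ _ _ _ _ => rfl
  add_mem' {a b} ha hb l V h X hX := by
    rw [val_add, LieAlgebroid.Form.eval_add, ha l V h X hX, hb l V h X hX, add_zero]
  neg_mem' {a} ha l V h X hX := (congrArg Neg.neg (ha l V h X hX)).trans neg_zero

/-- Pullback along a refinement. -/
def pullback (φ : N'.Idx → N.Idx) (h : ∀ l, N'.opens l ≤ N.opens (l.map φ)) :
    Tot L N →+* Tot L N' where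
  toFun c := ⟨fun l => c.val (l.map φ) (h l), by
    obtain ⟨-, m, hm⟩ := c.2
    refine ⟨c.val_nil _, m, fun l V hV X hX => ?_⟩
    exact hm (l.map φ) V (hV.trans (h l)) X (by rwa [List.length_map])⟩
  map_zero' := rfl
  map_add' _ _ := rfl
  map_one' := ext fun l => by
    change (1 : Tot L N).val (l.map φ) (h l) = _
    rw [val_one, val_one, List.length_map]
  map_mul' a b := ext fun l => by
    refine (val_mul a b (l.map φ) (h l)).trans (Eq.trans ?_ (val_mul (N := N') _ _ l le_rfl).symm)
    rw [List.length_map]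
    refine Finset.sum_congr rfl fun j _ => ?_
    rw [val_congr a List.map_take.symm, val_congr b List.map_drop.symm]
    rfl

theorem val_pullback (φ : N'.Idx → N.Idx) (h : ∀ l, N'.opens l ≤ N.opens (l.map φ))
    (c : Tot L N) (l : List N'.Idx) {U : S.Open} (hU : U ≤ N'.opens l) :
    (pullback φ h c).val l hU = c.val (l.map φ) (hU.trans (h l)) := rfl

theorem D_pullback (φ : N'.Idx → N.Idx) (h : ∀ l, N'.opens l ≤ N.opens (l.map φ))
    (c : Tot L N) : D (pullback φ h c) = pullback φ h (D c) := ext fun l => by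
  rw [val_pullback, val_D, val_D, val_pullback, List.length_map]
  refine congrArg₂ _ (Finset.sum_congr rfl fun j _ => ?_) rfl
  rw [val_pullback, val_congr c (List.eraseIdx_map (f := φ) (l := l) (n := j)).symm]
end Tot

/-- The cohomology of the total complex, a ring. -/
def Cohomology (L : LieAlgebroid S) (N : OpenSystem S) : Type u :=
  Tot.cocycles L N ⧸ Tot.coboundaries L N

namespace Cohomology
variable {L : LieAlgebroid S} {N N' N'' : OpenSystem S}
open Tot

instance : Ring (Cohomology L N) :=
  inferInstanceAs (Ring (Tot.cocycles L N ⧸ Tot.coboundaries L N))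

/-- The class of a cocycle. -/
def mk : Tot.cocycles L N →+* Cohomology L N := Ideal.Quotient.mk (Tot.coboundaries L N)

theorem mk_eq_mk {a b : Tot.cocycles L N} :
    mk a = mk b ↔ ∃ x : Tot L N, D x = (a : Tot L N) - b :=
  Ideal.Quotient.eq

/-- The cohomology in degree `m`. -/
def degree (L : LieAlgebroid S) (N : OpenSystem S) (m : ℕ) : AddSubgroup (Cohomology L N) :=
  ((Tot.homogeneous L N m).comap (Tot.cocycles L N).subtype.toAddMonoidHom).map
    (mk (L := L) (N := N)).toAddMonoidHom

/-- Pullback of cocycles along a refinement. -/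
def cocycleMap (φ : N'.Idx → N.Idx) (h : ∀ l, N'.opens l ≤ N.opens (l.map φ)) :
    Tot.cocycles L N →+* Tot.cocycles L N' :=
  ((Tot.pullback φ h).comp (Tot.cocycles L N).subtype).codRestrict (Tot.cocycles L N') fun z => by
    have h0 : D z.1 = 0 := z.2
    change D (Tot.pullback φ h z.1) = 0
    rw [D_pullback, h0, map_zero]

/-- Pullback of classes along a refinement. -/
def pullback (φ : N'.Idx → N.Idx) (h : ∀ l, N'.opens l ≤ N.opens (l.map φ)) :
    Cohomology L N →+* Cohomology L N' :=
  Ideal.Quotient.lift (Tot.coboundaries L N) (mk.comp (cocycleMap φ h)) fun z hz => by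
    obtain ⟨x, hx⟩ := hz
    refine Ideal.Quotient.eq_zero_iff_mem.mpr ⟨Tot.pullback φ h x, ?_⟩
    rw [D_pullback, hx]; rfl

theorem pullback_mk (φ : N'.Idx → N.Idx) (h : ∀ l, N'.opens l ≤ N.opens (l.map φ))
    (z : Tot.cocycles L N) : pullback φ h (mk z) = mk (cocycleMap φ h z) := rfl

theorem pullback_id (h : ∀ l, N.opens l ≤ N.opens (l.map id)) (z : Cohomology L N) :
    pullback id h z = z := by
  obtain ⟨z, rfl⟩ := Ideal.Quotient.mk_surjective z
  refine congrArg mk (Subtype.ext (Tot.ext fun l => ?_))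
  exact (Tot.val_congr z.1 (List.map_id l).symm _).symm

theorem pullback_comp (φ : N'.Idx → N.Idx) (h : ∀ l, N'.opens l ≤ N.opens (l.map φ))
    (ψ : N''.Idx → N'.Idx) (h' : ∀ l, N''.opens l ≤ N'.opens (l.map ψ))
    (h'' : ∀ l, N''.opens l ≤ N.opens (l.map (φ ∘ ψ))) (z : Cohomology L N) :
    pullback ψ h' (pullback φ h z) = pullback (φ ∘ ψ) h'' z := by
  obtain ⟨z, rfl⟩ := Ideal.Quotient.mk_surjective z
  refine congrArg mk (Subtype.ext (Tot.ext fun l => ?_))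
  exact Tot.val_congr z.1 List.map_map ((h' l).trans (h _))
end Cohomology

/-- A choice of open neighbourhoods `W(x₀,…,x_p)` of `x_p` for all finite sequences of points,
shrinking when points are inserted among `x₀,…,x_{p-1}`; `nbhd h x` is `W(x₀,…,x_{p-1},x)` where `h`
is the list `[x_{p-1},…,x₀]`. -/
structure NbhdSystem (S : RingedSpaceOver.{u} K) where
  nbhd : List S.space → S.space → S.Open
  mem : ∀ h x, x ∈ nbhd h x
  anti : ∀ {h' h : List S.space}, h'.Sublist h → ∀ x, nbhd h x ≤ nbhd h' x

namespace NbhdSystem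
variable (W : NbhdSystem S)

/-- `region [] [x₀,…,x_p] = W(x₀) ∩ W(x₀,x₁) ∩ ⋯ ∩ W(x₀,…,x_p)`. -/
def region : List S.space → List S.space → S.Open
  | _, [] => ⊤
  | h, x :: l => W.nbhd h x ⊓ region (x :: h) l

/-- `Small [] [x₀,…,x_p]`: each point lies in the neighbourhoods chosen for the earlier ones,
`x_j ∈ W(x₀,…,x_i)` for all `i < j`. -/
def Small : List S.space → List S.space → Prop
  | _, [] => True
  | h, x :: l => (∀ y ∈ l, y ∈ W.nbhd h x) ∧ Small (x :: h) l

theorem small_mono {l' l : List S.space} (hl : l'.Sublist l) {h' h : List S.space}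
    (hh : h'.Sublist h) (hs : W.Small h l) : W.Small h' l' := by
  induction hl generalizing h h' with
  | slnil => trivial
  | cons a _ ih => exact ih (hh.cons a) hs.2
  | cons_cons a hl ih =>
    exact ⟨fun y hy => W.anti hh a (hs.1 y (hl.subset hy)), ih (hh.cons_cons a) hs.2⟩

theorem region_mono {l' l : List S.space} (hl : l'.Sublist l) {h' h : List S.space}
    (hh : h'.Sublist h) : W.region h l ≤ W.region h' l' := by
  induction hl generalizing h h' with
  | slnil => exact le_rfl
  | cons a _ ih => exact inf_le_right.trans (ih (hh.cons a))
  | cons_cons a _ ih => exact inf_le_inf (W.anti hh a) (ih (hh.cons_cons a))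

open Classical in
/-- The system of open sets attached to `W`: the intersection
`W(x₀) ∩ ⋯ ∩ W(x₀,…,x_p)` for small sequences, and the empty set (so that there are only zero forms)
for the others. -/
def system : OpenSystem S where
  Idx := S.space
  opens l := if W.Small [] l then W.region [] l else ⊥
  mono {l' l} hl := by
    split_ifs with h h'
    · exact W.region_mono hl (List.Sublist.refl _)
    · exact absurd (W.small_mono hl (List.Sublist.refl _) h) h'
    · exact bot_le
    · exact bot_le

/-- Ordered by shrinking of the neighbourhoods. -/
instance : Preorder (NbhdSystem S) where
  le W W' := ∀ h x, W'.nbhd h x ≤ W.nbhd h x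
  le_refl _ _ _ := le_rfl
  le_trans _ _ _ h h' l x := (h' l x).trans (h l x)

instance : Nonempty (NbhdSystem S) := ⟨⟨fun _ _ => ⊤, fun _ _ => trivial, fun _ _ => le_rfl⟩⟩

instance : IsDirectedOrder (NbhdSystem S) where
  directed W W' := ⟨⟨fun h x => W.nbhd h x ⊓ W'.nbhd h x, fun h x => ⟨W.mem h x, W'.mem h x⟩,
    fun hh x => inf_le_inf (W.anti hh x) (W'.anti hh x)⟩,
    fun _ _ => inf_le_left, fun _ _ => inf_le_right⟩

variable {W} {W' : NbhdSystem S}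
theorem small_of_le (h : W ≤ W') {k l : List S.space} (hs : W'.Small k l) : W.Small k l := by
  induction l generalizing k with
  | nil => trivial
  | cons x l ih => exact ⟨fun y hy => h k x (hs.1 y hy), ih hs.2⟩

theorem region_of_le (h : W ≤ W') (k l : List S.space) : W'.region k l ≤ W.region k l := by
  induction l generalizing k with
  | nil => exact le_rfl
  | cons x l ih => exact inf_le_inf (h k x) (ih _)

open Classical in
theorem opens_of_le (h : W ≤ W') (l : List S.space) :
    W'.system.opens l ≤ W.system.opens (l.map id) := by
  have e : W.system.opens (l.map id) = W.system.opens l := congrArg W.system.opens (List.map_id l)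
  refine le_of_le_of_eq ?_ e.symm
  change ite _ _ _ ≤ ite _ _ _
  split_ifs with h₁ h₂
  · exact region_of_le h _ _
  · exact absurd (small_of_le h h₁) h₂
  · exact bot_le
  · exact bot_le
end NbhdSystem

namespace Hypercohomology
variable (L : LieAlgebroid S)

/-- Restriction of classes to smaller neighbourhoods. -/
def transition (W W' : NbhdSystem S) (h : W ≤ W') :
    Cohomology L W.system →+* Cohomology L W'.system :=
  Cohomology.pullback (N := W.system) (N' := W'.system) id (NbhdSystem.opens_of_le h)

instance : DirectedSystem (fun W : NbhdSystem S => Cohomology L W.system)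
    (fun _ _ h => transition L _ _ h) where
  map_self W x := Cohomology.pullback_id (N := W.system) _ x
  map_map W W' W'' _ _ x :=
    Cohomology.pullback_comp (N := W''.system) (N' := W'.system) (N'' := W.system) id _ id _ _ x
end Hypercohomology

/-- The hypercohomology ring `ℍ^•(X, Ω_L^•)`, i.e. the Lie algebroid cohomology of `L`, computed
by the Godement resolution. A global section of the `p`-th Godement sheaf of a sheaf `F`, that is of
`∏_{x₀} (∏_{x₁} (⋯ ∏_{x_p} F_{x_p} ⋯)_{x₁})_{x₀}` with nested stalks, is given by a choice of
neighbourhoods `x₀ ∈ W(x₀)`, then for every `x₁ ∈ W(x₀)` of a neighbourhood `W(x₀,x₁)` of `x₁`, and so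
on, and by sections of `F` over `W(x₀) ∩ ⋯ ∩ W(x₀,…,x_p)`, up to shrinking the neighbourhoods. So the
ring of global sections of the total Godement resolution of `Ω_L`, with the differential
`δ + (-1)^p d_L` and the Alexander-Whitney product, is the direct limit over neighbourhood systems `W`
of the total complexes of `W.system`, and its cohomology is the direct limit of the cohomologies. -/
def Hypercohomology (L : LieAlgebroid S) : Type u :=
  DirectLimit (fun W : NbhdSystem S => Cohomology L W.system)
    (Hypercohomology.transition L)

namespace Hypercohomology
variable (L : LieAlgebroid S)
instance : Ring (Hypercohomology L) :=
  inferInstanceAs (Ring (DirectLimit (fun W : NbhdSystem S => Cohomology L W.system)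
    (Hypercohomology.transition L)))

/-- The canonical map to the direct limit. -/
def of (W : NbhdSystem S) : Cohomology L W.system →+* Hypercohomology L where
  toFun x := (⟦⟨W, x⟩⟧ : DirectLimit (fun W : NbhdSystem S => Cohomology L W.system)
    (Hypercohomology.transition L))
  map_one' := (DirectLimit.one_def W).symm
  map_mul' x y := (DirectLimit.mul_def (G := fun W : NbhdSystem S => Cohomology L W.system)
    (f := Hypercohomology.transition L) W x y).symm
  map_zero' := (DirectLimit.zero_def W).symm
  map_add' x y := (DirectLimit.add_def (G := fun W : NbhdSystem S => Cohomology L W.system)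
    (f := Hypercohomology.transition L) W x y).symm

/-- The hypercohomology in degree `m`. -/
def degree (m : ℕ) : AddSubgroup (Hypercohomology L) :=
  ⨆ W : NbhdSystem S, (Cohomology.degree L W.system m).map (of L W).toAddMonoidHom
end Hypercohomology

/-- The intersections `U_{i₀} ∩ ⋯ ∩ U_{i_n}` of a family of open sets; the resulting `Tot` is
the total Čech complex of the complex of sheaves `Ω_L`. -/
def cech {I : Type u} (U : I → S.Open) : OpenSystem S where
  Idx := I
  opens l := l.foldr (fun i V => U i ⊓ V) ⊤
  mono {l' l} hl := by
    induction hl with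
    | slnil => exact le_rfl
    | cons a _ ih => exact inf_le_right.trans ih
    | cons_cons a _ ih => exact inf_le_inf le_rfl ih

theorem cech_le {I J : Type u} {U : I → S.Open} {V : J → S.Open} {φ : J → I}
    (h : ∀ j, V j ≤ U (φ j)) (l : List J) : (cech V).opens l ≤ (cech U).opens (l.map φ) := by
  induction l with
  | nil => exact le_rfl
  | cons j l ih => exact inf_le_inf (h j) ih

theorem cech_le_of_mem {I : Type u} (U : I → S.Open) {l : List I} {i : I} (h : i ∈ l) :
    (cech U).opens l ≤ U i := by
  induction l with
  | nil => simp at h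
  | cons j l ih =>
    rcases List.mem_cons.mp h with rfl | h
    · exact inf_le_left
    · exact inf_le_right.trans (ih h)

/-- The neighbourhood system `W(x₀,…,x_p) = U_{ι(x_p)}` for a choice of indices with
`x ∈ U_{ι(x)}`. -/
def NbhdSystem.ofCover {I : Type u} (U : I → S.Open) (ι : S.space → I)
    (hι : ∀ x, x ∈ U (ι x)) : NbhdSystem S where
  nbhd _ x := U (ι x)
  mem _ x := hι x
  anti _ _ := le_rfl

open Classical in
theorem NbhdSystem.ofCover_le {I : Type u} (U : I → S.Open) (ι : S.space → I)
    (hι : ∀ x, x ∈ U (ι x)) (l : List S.space) :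
    (NbhdSystem.ofCover U ι hι).system.opens l ≤ (cech U).opens (l.map ι) := by
  have key : ∀ h, (NbhdSystem.ofCover U ι hι).region h l ≤ (cech U).opens (l.map ι) := by
    induction l with
    | nil => exact fun _ => le_rfl
    | cons x l ih => exact fun h => inf_le_inf le_rfl (ih _)
  change ite _ _ _ ≤ _
  split_ifs
  · exact key _
  · exact bot_le

/-- The canonical homomorphism from the Čech hypercohomology of a covering to
hypercohomology; `ι` chooses for each point a member of the covering that contains it. -/
def cechToHyper (L : LieAlgebroid S) {I : Type u} (U : I → S.Open) (ι : S.space → I)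
    (hι : ∀ x, x ∈ U (ι x)) : Cohomology L (cech U) →+* Hypercohomology L :=
  (Hypercohomology.of L (NbhdSystem.ofCover U ι hι)).comp
    (Cohomology.pullback (N := cech U) (N' := (NbhdSystem.ofCover U ι hι).system) ι
      (NbhdSystem.ofCover_le U ι hι))

namespace Tot
variable {L : LieAlgebroid S} {N : OpenSystem S}

/-- Multiplication by `(-1)^(n(n-1)/2)` on `C^{n,q}`. -/
def signed : Tot L N →+ Tot L N where
  toFun c := ⟨fun l => (-1) ^ ((l.length - 1) * (l.length - 2) / 2) * c.val l le_rfl, by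
    obtain ⟨-, m, hm⟩ := c.2
    refine ⟨by dsimp only; rw [val_nil, mul_zero], m, fun l V h X hX => ?_⟩
    rw [LieAlgebroid.Form.eval_sign_mul]
    exact mul_eq_zero_of_right _ (hm l V h X hX)⟩
  map_zero' := ext fun l => by
    change (-1) ^ ((l.length - 1) * (l.length - 2) / 2) * (0 : L.Form (N.opens l)) = 0
    rw [mul_zero]
  map_add' a b := ext fun l => by
    change (-1) ^ ((l.length - 1) * (l.length - 2) / 2) * (a.val l le_rfl + b.val l le_rfl) =
      (-1) ^ ((l.length - 1) * (l.length - 2) / 2) * a.val l le_rfl +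
      (-1) ^ ((l.length - 1) * (l.length - 2) / 2) * b.val l le_rfl
    rw [mul_add]

theorem val_signed (c : Tot L N) (l : List N.Idx) {U : S.Open} (h : U ≤ N.opens l) :
    (signed c).val l h = (-1) ^ ((l.length - 1) * (l.length - 2) / 2) * c.val l h := by
  change LieAlgebroid.Form.res h
    ((-1) ^ ((l.length - 1) * (l.length - 2) / 2) * c.val l le_rfl) = _
  rw [map_mul, map_pow, map_neg, map_one]; rfl
end Tot

/-- An `L`-connection on `E|_U`: a morphism of sheaves `X ↦ ∇_X`, `𝒪`-linear in `X` and
satisfying the Leibniz rule `∇_X(f m) = f ∇_X m + X(f) m`. -/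
structure Connection (L : LieAlgebroid S) (E : OModule S) (U : S.Open) where
  nabla : ∀ V : S.Open, V ≤ U → L.Sec V →ₗ[S.Sec V] (E.Sec V →ₗ[K] E.Sec V)
  leibniz : ∀ (V : S.Open) (h : V ≤ U) (X : L.Sec V) (f : S.Sec V) (m : E.Sec V),
    nabla V h X (f • m) = f • nabla V h X m + ⁅X, f⁆ • m
  res_nabla : ∀ (V W : S.Open) (h : V ≤ U) (hW : W ≤ V) (X : L.Sec V) (m : E.Sec V),
    E.res hW (nabla V h X m) = nabla W (hW.trans h) (L.res hW X) (E.res hW m)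

/-- The ring `K[t₀,…,t_n]/(t₀ + ⋯ + t_n = 1)` of polynomial functions on the simplex,
identified with `K[t₁,…,t_n]` by eliminating `t₀`. -/
abbrev SimplexRing (K : Type v) [Field K] (n : ℕ) : Type v := MvPolynomial (Fin n) K

namespace SimplexRing
variable (K)

/-- The barycentric coordinates: `t₀ = 1 - ∑ t_i`, and `t_{i+1}` is the variable `X i`. -/
def t {n : ℕ} (j : Fin (n + 1)) : SimplexRing K n :=
  Fin.cases (1 - ∑ i, MvPolynomial.X i) MvPolynomial.X j

/-- The Lie-Rinehart algebra of derivations of the ring of the simplex. -/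
abbrev Vect (n : ℕ) : Type v := Derivation K (SimplexRing K n) (SimplexRing K n)

/-- Integration over the simplex against `dt₁ ∧ ⋯ ∧ dt_n`:
`∫ t₁^{a₁} ⋯ t_n^{a_n} = a₁! ⋯ a_n! / (n + a₁ + ⋯ + a_n)!`. -/
def integral (n : ℕ) : SimplexRing K n →ₗ[K] K :=
  (MvPolynomial.basisMonomials (Fin n) K).constr K fun s =>
    (∏ i, ((s i).factorial : K)) / ((n + ∑ i, s i).factorial : K)
end SimplexRing

/-- Substitution of a matrix of forms in a polynomial `P` in the entries of an `r × r` matrix,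
with the exterior product as multiplication. It is applied to matrices of 2-forms, which commute, so
that the order of the factors is immaterial. -/
def polyEval {A M : Type*} [CommRing A] [Algebra K A] {r : ℕ}
    (P : MvPolynomial (Fin r × Fin r) K) (R : Fin r → Fin r → Cochain A M) : Cochain A M :=
  ∑ s ∈ P.support, Cochain.const (algebraMap K A (P.coeff s)) *
    ((List.finRange r).map fun a => ((List.finRange r).map fun b => R a b ^ s (a, b)).prod).prod

section Local
variable {L : LieAlgebroid S} {E : OModule S} {V : S.Open} {n : ℕ}

/-- The pairs `(X, D)` of a section of `L` over `V` and a derivation of the ring of the simplex.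
They are sections of the direct sum Lie algebroid over the product of `V` with the simplex, which they
generate; their bracket is taken componentwise. -/
abbrev TotalSec (L : LieAlgebroid S) (V : S.Open) (n : ℕ) : Type _ :=
  L.Sec V × SimplexRing.Vect K n

/-- The total connection `d_n + ∑_j t_j ∇_j` on `E`, pulled back to the product of `V` with the
simplex: the operator of covariant derivative along `(X, D)` is `D ⊗ 1 + ∑_j t_j ⊗ (∇_j)_X`. -/
def nablaTot (A : Fin (n + 1) → L.Sec V →ₗ[S.Sec V] (E.Sec V →ₗ[K] E.Sec V))
    (Y : TotalSec L V n) : Module.End K (SimplexRing K n ⊗[K] E.Sec V) :=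
  LinearMap.rTensor (E.Sec V) (Y.2 : SimplexRing K n →ₗ[K] SimplexRing K n) +
    ∑ j, TensorProduct.map (LinearMap.mulLeft K (SimplexRing.t K j)) (A j Y.1)

/-- The curvature `R(Y, Z) = [∇_Y, ∇_Z] - ∇_{[Y, Z]}` of the total connection. -/
def curvature (A : Fin (n + 1) → L.Sec V →ₗ[S.Sec V] (E.Sec V →ₗ[K] E.Sec V))
    (Y Z : TotalSec L V n) : Module.End K (SimplexRing K n ⊗[K] E.Sec V) :=
  nablaTot A Y * nablaTot A Z - nablaTot A Z * nablaTot A Y - nablaTot A ⁅Y, Z⁆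

/-- The matrix of 2-forms of the curvature in a basis `e`:
`R(Y, Z) e_b = ∑_a R_{ab}(Y, Z) e_a`. -/
def curvatureMatrix {r : ℕ} (A : Fin (n + 1) → L.Sec V →ₗ[S.Sec V] (E.Sec V →ₗ[K] E.Sec V))
    (e : Module.Basis (Fin r) (S.Sec V) (E.Sec V)) (a b : Fin r) :
    Cochain (SimplexRing K n ⊗[K] S.Sec V) (TotalSec L V n)
  | [Y, Z] => LinearMap.lTensor (SimplexRing K n) ((e.coord a).restrictScalars K)
      (curvature A Y Z (1 ⊗ₜ e b))
  | _ => 0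

/-- Integration of functions over the simplex, with coefficients in `𝒪(V)`. -/
def fiberIntegral (V : S.Open) (n : ℕ) : SimplexRing K n ⊗[K] S.Sec V →ₗ[K] S.Sec V :=
  (TensorProduct.lid K (S.Sec V)).toLinearMap ∘ₗ
    LinearMap.rTensor (S.Sec V) (SimplexRing.integral K n)

/-- The fibre integral `∫_{Δⁿ} P(R)` for the connection `d_n + ∑_j t_j A_j`, as a form on `V`, computed
in the basis `e`. The integral of a form `ω` over the fibre is the form
`(X₁,…,X_q) ↦ ∫ ω(∂_n,…,∂_1,X₁,…,X_q) dt₁⋯dt_n`, that is `ι_{∂_1}⋯ι_{∂_n}` followed by integration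
of the coefficients; `∂_j` is the derivative with respect to `t_j`. -/
def chernWeil {r : ℕ} (A : Fin (n + 1) → L.Sec V →ₗ[S.Sec V] (E.Sec V →ₗ[K] E.Sec V))
    (e : Module.Basis (Fin r) (S.Sec V) (E.Sec V)) (P : MvPolynomial (Fin r × Fin r) K)
    (X : List (L.Sec V)) : S.Sec V :=
  fiberIntegral V n (polyEval P (curvatureMatrix A e)
    ((List.ofFn fun j : Fin n => ((0, MvPolynomial.pderiv j) : TotalSec L V n)).reverse ++
      X.map fun Y => ((Y, 0) : TotalSec L V n)))
end Local

/-- The ring of polynomial functions `P` on `r × r` matrices over `K` with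
`P(g M g⁻¹) = P(M)` for all invertible `g`. -/
def invariantPolynomials (K : Type v) [Field K] (r : ℕ) :
    Subalgebra K (MvPolynomial (Fin r × Fin r) K) where
  carrier := {P | ∀ (g : GL (Fin r) K) (M : Matrix (Fin r) (Fin r) K),
    MvPolynomial.eval (fun p => (g.1 * M * (g⁻¹).1) p.1 p.2) P =
      MvPolynomial.eval (fun p => M p.1 p.2) P}
  mul_mem' ha hb g M := by rw [map_mul, map_mul, ha g M, hb g M]
  add_mem' ha hb g M := by rw [map_add, map_add, ha g M, hb g M]
  algebraMap_mem' c g M := by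
    rw [MvPolynomial.algebraMap_eq, MvPolynomial.eval_C, MvPolynomial.eval_C]

/-- An open covering of the space with an `L`-connection on the restriction of `E` to each of
its members. -/
structure ConnectionCover (L : LieAlgebroid S) (E : OModule S) where
  Idx : Type u
  opens : Idx → S.Open
  cover : ∀ x : S.space, ∃ i, x ∈ opens i
  conn : ∀ i, Connection L E (opens i)

namespace ConnectionCover
variable {L : LieAlgebroid S} {E : OModule S} (𝒰 : ConnectionCover L E)

/-- The intersections of the members of the covering. -/
abbrev system : OpenSystem S := cech 𝒰.opens

/-- The connections `∇_{i₀}, …, ∇_{i_n}` on an open subset of `U_{i₀} ∩ ⋯ ∩ U_{i_n}`, where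
`(i₀,…,i_n) = i :: t`. -/
def nabla (i : 𝒰.Idx) (t : List 𝒰.Idx) {V : S.Open} (h : V ≤ 𝒰.system.opens (i :: t))
    (j : Fin (t.length + 1)) : L.Sec V →ₗ[S.Sec V] (E.Sec V →ₗ[K] E.Sec V) :=
  (𝒰.conn ((i :: t).get j)).nabla V (h.trans (cech_le_of_mem 𝒰.opens (List.get_mem (i :: t) j)))

/-- The family of forms `p(i₀,…,i_n)` on `U_{i₀} ∩ ⋯ ∩ U_{i_n}` is the family
`∫_{Δⁿ} P(R(d_n + ∑_j t_j ∇_{i_j}))`: over every open subset `V` with a frame of `E` it is given by the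
local formula `chernWeil`. -/
def IsChernWeil {r : ℕ} (P : MvPolynomial (Fin r × Fin r) K) (p : Tot L 𝒰.system) : Prop :=
  ∀ (i : 𝒰.Idx) (t : List 𝒰.Idx) (V : S.Open) (h : V ≤ 𝒰.system.opens (i :: t))
    (e : Frame E r V) (X : List (L.Sec V)),
    (p.val (i :: t) le_rfl).eval V h X = chernWeil (𝒰.nabla i t h) (e.basis V le_rfl) P X
end ConnectionCover
end ChernWeil
end

open ChernWeil

noncomputable section
namespace ChernWeil

/-! On the product of an open set with a simplex, the total connection has a curvature matrix `R =
dθ + θθ` of even forms. The Bianchi identity `dR = Rθ - θR` says that `R + ε dR` is conjugate to `R`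
to first order in `ε`, so `P(R)` is closed for invariant `P` (`d_polyEval_eq_zero`). A change of
frame conjugates `R`, so `P(R)` does not depend on the frame (`Gauge.curv`, `Gauge.polyEval`), and
the local forms glue by the sheaf property (`IsNatural.exists_form`). Both arguments rest on
`aeval_conj`: invariance under conjugation over the field implies invariance over every commutative
algebra.

The relation between `d` and the Čech differential is Stokes' theorem on the fibre (`d_fiberInt`,
`d_cw`). The interior term vanishes because `P(R)` is closed, and on the face `t_j = 0` the total
connection becomes the total connection of the sequence with its `j`-th member deleted. The sign
`(-1)^(n(n-1)/2)` turns this relation into `D c = 0`.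

Independence of the connections is a prism argument. The primitive is the alternating sum over `k`
of the forms of the mixed sequences `∇_{i_0}, …, ∇_{i_k}, ∇'_{i_k}, …, ∇'_{i_n}`; deleting one of
the two members with index `i_k` cancels against the neighbouring value of `k`, and only the two
pure sequences survive (`prism_formula`, `d_prism_cwL`).

Multiplicativity is proved with the same telescoping sum. For sequences `Θ` and `Ψ` the form
`P(R(Θ)) Q(R(Θ, Ψ))` is integrated over a product of two simplices; in the second factor the inner
simplex has the vertices `∑ t_j Θ_j, Ψ_1, …, Ψ_q`. The face opposite to the first vertex gives the
product of the form of `P` on `Θ` and the form of `Q` on `Ψ`, and with `Ψ` empty the integral is the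
form of `PQ` (`d_hcwL`, `hcwL_nil`). Summing over the splittings of a sequence gives a homotopy
between the Alexander-Whitney product and the form of `PQ`.

Integration only ever evaluates forms at `∂_1, …, ∂_n` and at sections of the Lie algebroid. It is
therefore enough to work with cochains on pairs of a section and a constant vector field (`Prism`).
Such pairs are not a module over the functions on the product, so the cochains there are merely
additive and alternating (`IsAlt`), functions are acted on by derivations (`DerAct`), and linearity
over the structure sheaf is followed separately (`Lin`, `Scal`). Working with connection matrices
instead of covariant derivatives is justified by `curvatureMatrix_comap`.

For the last part, every framed open set carries the flat connection of its frame, so coverings with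
connections exist. One of them defines `Φ` and also forces its values. Any two give the same class
after passing to a common refinement indexed by the points. -/

/-- The Lie ring `M` acts on the algebra `O` by `K`-linear derivations. -/
class DerAct (K O M : Type*) [CommRing K] [CommRing O] [Algebra K O] [LieRing M]
    [LieRingModule M O] : Prop where
  lie_mul' : ∀ (X : M) (f g : O), ⁅X, f * g⁆ = ⁅X, f⁆ * g + f * ⁅X, g⁆
  lie_smul' : ∀ (X : M) (c : K) (f : O), ⁅X, c • f⁆ = c • ⁅X, f⁆

/-! ### Graded commutativity, degrees, and additive alternating cochains. -/

namespace Cochain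

section Ring
variable {A G : Type*} [CommRing A]

/-- Contraction exchanges the two parities, so the even and the odd case have to be proved in one
induction. Only the parity of `a` matters; `b` is arbitrary and the sign acts on it as a whole. -/
theorem commute_aux (l : List G) : ∀ a b : Cochain A G,
    (sgn a = a → (a * b) l = (b * a) l) ∧ (sgn a = -a → (a * b) l = (sgn b * a) l) := by
  induction l with
  | nil =>
    intro a b
    refine ⟨fun _ => mul_comm _ _, fun _ => ?_⟩
    rw [mul_nil, mul_nil, sgn_nil, mul_comm]
  | cons X l ih =>
    intro a b
    constructor
    · intro h
      have h1 : sgn (ins X a) = -ins X a := by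
        rw [← neg_eq_iff_eq_neg, ← ins_sgn, h]
      rw [mul_cons, mul_cons, h, (ih (ins X a) b).2 h1, (ih a (ins X b)).1 h, add_comm]
    · intro h
      have h1 : sgn (ins X a) = ins X a := by
        rw [← neg_inj, ← ins_sgn, h]; rfl
      rw [mul_cons, mul_cons, h, (ih (ins X a) b).1 h1, neg_mul, neg_app, (ih a (ins X b)).2 h,
        ins_sgn, sgn_sgn, neg_mul, neg_app, add_comm]

theorem commute_of_even {a : Cochain A G} (h : sgn a = a) (b : Cochain A G) : a * b = b * a :=
  ext' fun l => (commute_aux l a b).1 h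

/-- Concentrated in degree `p`. -/
def Deg (p : ℕ) (a : Cochain A G) : Prop := ∀ l : List G, l.length ≠ p → a l = 0

theorem Deg.sgn_eq {p : ℕ} {a : Cochain A G} (h : Deg p a) (l : List G) :
    sgn a l = (-1) ^ p * a l := by
  by_cases hl : l.length = p
  · rw [sgn, hl]
  · rw [sgn, h l hl, mul_zero, mul_zero]

theorem Deg.odd {a : Cochain A G} (h : Deg 1 a) : sgn a = -a :=
  ext' fun l => by rw [h.sgn_eq, pow_one, neg_one_mul]; rfl

theorem Deg.even {a : Cochain A G} (h : Deg 2 a) : sgn a = a :=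
  ext' fun l => by rw [h.sgn_eq, neg_one_sq, one_mul]

theorem Deg.zero (p : ℕ) : Deg p (0 : Cochain A G) := fun _ _ => rfl

theorem Deg.add {p : ℕ} {a b : Cochain A G} (ha : Deg p a) (hb : Deg p b) : Deg p (a + b) :=
  fun l hl => by rw [add_app, ha l hl, hb l hl, add_zero]

theorem Deg.sum {ι : Type*} (s : Finset ι) {p : ℕ} {a : ι → Cochain A G}
    (ha : ∀ i ∈ s, Deg p (a i)) : Deg p (∑ i ∈ s, a i) := by
  classical
  induction s using Finset.induction_on with
  | empty => exact Deg.zero p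
  | insert i s hi ih =>
    rw [Finset.sum_insert hi]
    exact (ha i (by simp)).add (ih fun j hj => ha j (by simp [hj]))

theorem Deg.const (f : A) : Deg 0 (const f : Cochain A G) := fun l hl => by
  rw [Cochain.const, if_neg]; rintro rfl; exact hl rfl

/-- The offset `n` counts the arguments that have already been inserted in `a`, whose nominal degree
`p` stays fixed. For `b` the degree itself drops, and in degree zero its contraction vanishes. -/
theorem mul_deg_aux (l : List G) : ∀ (a b : Cochain A G) (n p q : ℕ),
    (∀ l : List G, n + l.length ≠ p → a l = 0) → Deg q b → n + l.length ≠ p + q →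
      (a * b) l = 0 := by
  induction l with
  | nil =>
    intro a b n p q ha hb hl
    rw [mul_nil]
    by_cases h : n = p
    · rw [hb [] (by simp at hl ⊢; omega), mul_zero]
    · rw [ha [] (by simpa using h), zero_mul]
  | cons X l ih =>
    intro a b n p q ha hb hl
    simp only [List.length_cons] at hl
    rw [mul_cons, ih (ins X a) b (n + 1) p q (fun l' h => ha _ (by simp; omega)) hb (by omega),
      zero_add]
    rcases q with _ | q
    · have : ins X b = 0 := ext' fun l => hb _ (by simp)
      rw [this, mul_zero]; rfl
    · refine ih (Cochain.sgn a) (ins X b) n p q (fun l' h => ?_) (fun l' h => hb _ (by simpa using h))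
        (by omega)
      rw [Cochain.sgn, ha l' h, mul_zero]

theorem Deg.mul {p q : ℕ} {a b : Cochain A G} (ha : Deg p a) (hb : Deg q b) :
    Deg (p + q) (a * b) := fun l hl =>
  mul_deg_aux l a b 0 p q (fun l h => ha l (by simpa using h)) hb (by simpa using hl)

theorem Deg.pow {p : ℕ} {a : Cochain A G} (ha : Deg p a) (n : ℕ) : Deg (n * p) (a ^ n) := by
  induction n with
  | zero => rw [pow_zero, zero_mul]; exact Deg.const 1
  | succ n ih => rw [pow_succ, add_mul, one_mul]; exact ih.mul ha

/-- Additive in each argument and alternating. -/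
structure IsAlt [AddCommGroup G] (ω : Cochain A G) : Prop where
  map_add : ∀ (l₁ : List G) (X Y : G) (l₂ : List G),
    ω (l₁ ++ (X + Y) :: l₂) = ω (l₁ ++ X :: l₂) + ω (l₁ ++ Y :: l₂)
  alternating : ∀ (l₁ : List G) (X : G) (l₂ : List G), ω (l₁ ++ X :: X :: l₂) = 0

namespace IsAlt
variable [AddCommGroup G] {a b ω : Cochain A G}

theorem ins (h : IsAlt ω) (X : G) : IsAlt (ins X ω) :=
  ⟨fun l₁ => h.map_add (X :: l₁), fun l₁ => h.alternating (X :: l₁)⟩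

theorem ins_add_left (h : IsAlt ω) (X Y : G) :
    Cochain.ins (X + Y) ω = Cochain.ins X ω + Cochain.ins Y ω :=
  ext' fun l => h.map_add [] X Y l

theorem ins_zero_left (h : IsAlt ω) : Cochain.ins 0 ω = 0 := by
  have := h.ins_add_left 0 0
  rwa [add_zero, left_eq_add] at this

theorem ins_neg_left (h : IsAlt ω) (X : G) : Cochain.ins (-X) ω = -Cochain.ins X ω := by
  rw [eq_neg_iff_add_eq_zero, ← h.ins_add_left, neg_add_cancel, h.ins_zero_left]

theorem ins_sub_left (h : IsAlt ω) (X Y : G) :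
    Cochain.ins (X - Y) ω = Cochain.ins X ω - Cochain.ins Y ω := by
  rw [sub_eq_add_neg, h.ins_add_left, h.ins_neg_left, ← sub_eq_add_neg]

theorem ins_ins (h : IsAlt ω) (X : G) : Cochain.ins X (Cochain.ins X ω) = 0 :=
  ext' fun l => h.alternating [] X l

theorem ins_comm (ha : IsAlt a) (X Y : G) :
    Cochain.ins X (Cochain.ins Y a) = - Cochain.ins Y (Cochain.ins X a) := by
  have := ha.ins_ins (X + Y)
  simp only [ha.ins_add_left, (ha.ins _).ins_add_left, ins_add, ha.ins_ins] at this
  rw [eq_neg_iff_add_eq_zero]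
  simpa [add_comm] using this

theorem sgn (h : IsAlt ω) : IsAlt (sgn ω) := by
  refine ⟨fun l₁ X Y l₂ => ?_, fun l₁ X l₂ => ?_⟩
  · simp only [Cochain.sgn, h.map_add, List.length_append, List.length_cons]; ring
  · simp only [Cochain.sgn, h.alternating, mul_zero]

theorem zero : IsAlt (0 : Cochain A G) :=
  ⟨fun _ _ _ _ => (add_zero _).symm, fun _ _ _ => rfl⟩

theorem add (ha : IsAlt a) (hb : IsAlt b) : IsAlt (a + b) := by
  refine ⟨fun l₁ X Y l₂ => ?_, fun l₁ X l₂ => ?_⟩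
  · simp only [add_app, ha.map_add, hb.map_add]; ring
  · simp only [add_app, ha.alternating, hb.alternating, add_zero]

theorem neg (ha : IsAlt a) : IsAlt (-a) := by
  refine ⟨fun l₁ X Y l₂ => ?_, fun l₁ X l₂ => ?_⟩
  · simp only [neg_app, ha.map_add]; ring
  · simp only [neg_app, ha.alternating, neg_zero]

theorem const (f : A) : IsAlt (const f : Cochain A G) := by
  refine ⟨fun l₁ X Y l₂ => ?_, fun l₁ X l₂ => ?_⟩ <;> simp [Cochain.const]

theorem mul (ha : IsAlt a) (hb : IsAlt b) : IsAlt (a * b) := by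
  refine ⟨fun l₁ X Y l₂ => ?_, fun l₁ X l₂ => ?_⟩
  · induction l₁ generalizing a b with
    | nil =>
      simp only [List.nil_append, mul_cons, ha.ins_add_left, hb.ins_add_left, add_mul, mul_add,
        add_app]; ring
    | cons Z l₁ ih =>
      simp only [List.cons_append, mul_cons, ih (ha.ins Z) hb, ih ha.sgn (hb.ins Z)]; ring
  · induction l₁ generalizing a b with
    | nil =>
      simp only [List.nil_append, mul_cons, ins_sgn, ha.ins_ins, hb.ins_ins, mul_zero, zero_mul,
        zero_app, neg_mul, neg_app]; ring
    | cons Z l₁ ih =>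
      simp only [List.cons_append, mul_cons, ih (ha.ins Z) hb, ih ha.sgn (hb.ins Z), add_zero]

variable (A G) in
/-- The subring of additive alternating cochains. -/
def subring : Subring (Cochain A G) where
  carrier := {a | IsAlt a}
  mul_mem' := mul
  one_mem' := const 1
  add_mem' := add
  zero_mem' := zero
  neg_mem' := neg

theorem sum {ι : Type*} (s : Finset ι) {a : ι → Cochain A G} (ha : ∀ i ∈ s, IsAlt (a i)) :
    IsAlt (∑ i ∈ s, a i) := (subring A G).sum_mem ha

theorem of_deg_one (h : Deg 1 a) (hadd : ∀ X Y : G, a [X + Y] = a [X] + a [Y]) : IsAlt a := by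
  refine ⟨fun l₁ X Y l₂ => ?_, fun l₁ X l₂ => h _ (by simp; omega)⟩
  by_cases hl : l₁ = [] ∧ l₂ = []
  · obtain ⟨rfl, rfl⟩ := hl; exact hadd X Y
  · have : l₁.length + l₂.length ≠ 0 := by
      rw [ne_eq, Nat.add_eq_zero_iff, List.length_eq_zero_iff, List.length_eq_zero_iff]; exact hl
    rw [h, h, h, add_zero] <;> simp <;> omega

theorem append_zero (h : IsAlt ω) (l₁ l₂ : List G) : ω (l₁ ++ 0 :: l₂) = 0 := by
  have := h.map_add l₁ 0 0 l₂
  rwa [add_zero, left_eq_add] at this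

/-- Moving an argument to the right. -/
theorem move_right (h : IsAlt ω) (w : G) (v X : List G) :
    ω (w :: (v ++ X)) = (-1) ^ v.length * ω (v ++ w :: X) := by
  induction v generalizing ω with
  | nil => simp
  | cons u v ih =>
    have h1 := congrFun (h.ins_comm u w) (v ++ X)
    have h2 := ih (h.ins u)
    simp only [ins_app, neg_app] at h1 h2
    simp only [List.cons_append, List.length_cons, pow_succ]
    rw [h1, h2]; ring

theorem apply_eq_zero (h : IsAlt ω) (w : G) (v X : List G) : ω (w :: (v ++ w :: X)) = 0 := by
  rw [h.move_right]
  have := h.alternating v w X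
  rw [this, mul_zero]

/-- Expansion of `ω(v₁ - w, …, v_m - w, …)`. -/
theorem map_sub_right (h : IsAlt ω) (w : G) (v X : List G) :
    ω (v.map (· - w) ++ X) = ω (v ++ X) -
      ∑ k ∈ Finset.range v.length, (-1) ^ (v.length - 1 - k) * ω (v.eraseIdx k ++ w :: X) := by
  induction v generalizing ω with
  | nil => simp
  | cons u v ih =>
    have h1 := congrFun (h.ins_sub_left u w) (v.map (· - w) ++ X)
    have h2 := ih (h.ins u)
    have h3 := ih (h.ins w)
    rw [sub_app, ins_app] at h1
    -- In the expansion that begins with `w`, every correction term contains `w` twice and vanishes.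
    -- The remaining term gets its sign by moving `w` past `v`.
    rw [Finset.sum_eq_zero fun k _ => by rw [ins_app, h.apply_eq_zero, mul_zero], sub_zero,
      ins_app w ω (v ++ X), h.move_right] at h3
    rw [List.map_cons, List.cons_append, List.cons_append, h1, h2, h3,
      List.length_cons, Finset.sum_range_succ']
    simp only [List.eraseIdx_cons_succ, List.eraseIdx_zero, List.tail_cons, List.cons_append,
      ins_app, Nat.add_sub_cancel, Nat.sub_zero]
    rw [Finset.sum_congr rfl fun k _ => congrArg₂ _ (congrArg _
      (show v.length - (k + 1) = v.length - 1 - k by omega)) rfl]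
    ring
end IsAlt

/-- Inserting `Z` anywhere amounts to inserting `X` and multiplying by `f`. -/
def Scal (f : A) (X Z : G) (ω : Cochain A G) : Prop :=
  ∀ l₁ l₂ : List G, ω (l₁ ++ Z :: l₂) = f * ω (l₁ ++ X :: l₂)

namespace Scal
variable {f : A} {X Z : G} {a b : Cochain A G}

theorem ins (h : Scal f X Z a) (Y : G) : Scal f X Z (ins Y a) := fun l₁ l₂ => h (Y :: l₁) l₂
theorem ins_eq (h : Scal f X Z a) : Cochain.ins Z a = Cochain.const f * Cochain.ins X a :=
  ext' fun l => (h [] l).trans (const_mul_app f (Cochain.ins X a) l).symm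
theorem sgn (h : Scal f X Z a) : Scal f X Z (sgn a) := fun l₁ l₂ => by
  simp only [Cochain.sgn, h l₁ l₂, List.length_append, List.length_cons]; ring
theorem zero : Scal f X Z (0 : Cochain A G) := fun _ _ => (mul_zero f).symm
theorem add (ha : Scal f X Z a) (hb : Scal f X Z b) : Scal f X Z (a + b) := fun l₁ l₂ => by
  simp only [add_app, ha l₁ l₂, hb l₁ l₂]; ring
theorem neg (ha : Scal f X Z a) : Scal f X Z (-a) := fun l₁ l₂ => by
  simp only [neg_app, ha l₁ l₂]; ring
theorem const (g : A) : Scal f X Z (const g) := fun l₁ l₂ => by simp [Cochain.const]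
theorem mul (ha : Scal f X Z a) (hb : Scal f X Z b) : Scal f X Z (a * b) := by
  intro l₁ l₂
  induction l₁ generalizing a b with
  | nil =>
    have h : Cochain.sgn a * (Cochain.const f * Cochain.ins X b)
        = Cochain.const f * (Cochain.sgn a * Cochain.ins X b) := by
      rw [← mul_assoc, ← mul_assoc, commute_of_even (sgn_const f)]
    simp only [List.nil_append, mul_cons, ha.ins_eq, hb.ins_eq, h, mul_assoc, const_mul_app]; ring
  | cons Y l₁ ih =>
    simp only [List.cons_append, mul_cons, ih (ha.ins Y) hb, ih ha.sgn (hb.ins Y)]; ring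

variable (f X Z) in
/-- The cochains satisfying `Scal f X Z` form a ring. -/
def subring : Subring (Cochain A G) where
  carrier := {a | Scal f X Z a}
  mul_mem' := mul
  one_mem' := const 1
  add_mem' := add
  zero_mem' := zero
  neg_mem' := neg

theorem of_deg_one (h : Deg 1 a) (hf : a [Z] = f * a [X]) : Scal f X Z a := by
  intro l₁ l₂
  by_cases hl : l₁ = [] ∧ l₂ = []
  · obtain ⟨rfl, rfl⟩ := hl; exact hf
  · have : l₁.length + l₂.length ≠ 0 := by
      rw [ne_eq, Nat.add_eq_zero_iff, List.length_eq_zero_iff, List.length_eq_zero_iff]; exact hl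
    rw [h, h, mul_zero] <;> simp <;> omega
end Scal
end Ring

/-! ### Cartan calculus for additive alternating cochains. -/

section Diff
variable {A G : Type*} [CommRing A] [LieRing G] [LieRingModule G A]

theorem Deg.lieDer {p : ℕ} {a : Cochain A G} (ha : Deg p a) (X : G) : Deg p (lieDer X a) := by
  intro l hl
  induction l generalizing a p with
  | nil => rw [lieDer_nil, ha [] hl, lie_zero]
  | cons Y l ih =>
    rw [lieDer_cons, ins_app, ha _ (by simpa using hl), sub_zero]
    rcases p with _ | p
    · have : Cochain.ins Y a = 0 := ext' fun l => ha _ (by simp)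
      rw [this, lieDer_zero]; rfl
    · exact ih (p := p) (fun l' h => ha _ (by simpa using h)) (by simpa using hl)

theorem Deg.d {p : ℕ} {a : Cochain A G} (ha : Deg p a) : Deg (p + 1) (d a) := by
  intro l hl
  induction l generalizing a p with
  | nil => rfl
  | cons Y l ih =>
    simp only [List.length_cons, ne_eq, Nat.add_right_cancel_iff] at hl
    rw [d_cons, ha.lieDer Y l hl]
    rcases p with _ | p
    · have : Cochain.ins Y a = 0 := ext' fun l => ha _ (by simp)
      rw [this, d_zero]; simp [zero_app]
    · rw [ih (a := Cochain.ins Y a) (p := p) (fun l' h => ha (Y :: l') (by simpa using h)) (by simpa using hl), sub_zero]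

namespace IsAlt
variable {a : Cochain A G}

theorem lieDer (ha : IsAlt a) (X : G) : IsAlt (lieDer X a) := by
  refine ⟨fun l₁ Y Z l₂ => ?_, fun l₁ Y l₂ => ?_⟩
  · induction l₁ generalizing a with
    | nil =>
      simp only [List.nil_append, lieDer_cons, ha.ins_add_left, lie_add, lieDer_add, add_app]; ring
    | cons W l₁ ih =>
      simp only [List.cons_append, lieDer_cons, ih (ha.ins W), (ha.ins _).map_add]; ring
  · induction l₁ generalizing a with
    | nil =>
      have h1 := congrFun (ha.ins_comm ⁅X, Y⁆ Y) l₂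
      simp only [List.nil_append, lieDer_cons, ha.ins_ins, lieDer_zero, zero_app]
      simp only [ins_app, neg_app] at h1 ⊢
      linear_combination -h1
    | cons W l₁ ih =>
      simp only [List.cons_append, lieDer_cons, ih (ha.ins W), (ha.ins _).alternating, sub_zero]

theorem lieDer_add_left (ha : IsAlt a) (X Y : G) :
    Cochain.lieDer (X + Y) a = Cochain.lieDer X a + Cochain.lieDer Y a := by
  refine ext' fun l => ?_
  induction l generalizing a with
  | nil => simp only [lieDer_nil, add_app, add_lie]
  | cons Z l ih =>
    simp only [lieDer_cons, add_app, ih (ha.ins Z), add_lie, ha.ins_add_left]; ring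

theorem d (ha : IsAlt a) : IsAlt (d a) := by
  refine ⟨fun l₁ X Y l₂ => ?_, fun l₁ X l₂ => ?_⟩
  · induction l₁ generalizing a with
    | nil =>
      simp only [List.nil_append, d_cons, ha.lieDer_add_left, ha.ins_add_left, d_add, add_app]; ring
    | cons Z l₁ ih =>
      simp only [List.cons_append, d_cons, (ha.lieDer Z).map_add, ih (ha.ins Z)]; ring
  · induction l₁ generalizing a with
    | nil =>
      simp only [List.nil_append, d_cons, lieDer_cons, lie_self, ha.ins_zero_left, ha.ins_ins,
        d_zero, zero_app]
      ring
    | cons Z l₁ ih =>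
      simp only [List.cons_append, d_cons, (ha.lieDer Z).alternating, ih (ha.ins Z), sub_zero]

/-- Inserting an argument `Z` costs a term with `⁅⁅X, Y⁆, Z⁆`, which the Jacobi identity distributes
over the two iterated derivatives. -/
theorem lieDer_lie (ha : IsAlt a) (X Y : G) :
    Cochain.lieDer ⁅X, Y⁆ a = Cochain.lieDer X (Cochain.lieDer Y a) -
      Cochain.lieDer Y (Cochain.lieDer X a) := by
  refine ext' fun l => ?_
  induction l generalizing a with
  | nil => simp only [lieDer_nil, sub_app, lie_lie]
  | cons Z l ih =>
    rw [lieDer_cons, ih (ha.ins Z), lie_lie X Y Z, ha.ins_sub_left]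
    simp only [lieDer_cons, sub_app, ins_lieDer, lieDer_sub]
    ring

theorem lieDer_d (ha : IsAlt a) (X : G) :
    Cochain.lieDer X (Cochain.d a) = Cochain.d (Cochain.lieDer X a) := by
  refine ext' fun l => ?_
  induction l generalizing a with
  | nil => rw [lieDer_nil, d_nil, lie_zero]; rfl
  | cons Y l ih =>
    rw [lieDer_cons, d_cons, ins_d, ins_d, ins_lieDer, lieDer_sub, d_sub, ha.lieDer_lie]
    simp only [sub_app, ih (ha.ins Y)]
    ring

/-- Cartan's formula gives `ι_X d d = [L_X, d] + d d ι_X`; the commutator vanishes by `lieDer_d` and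
the other term by induction on the number of arguments. -/
theorem d_d (ha : IsAlt a) : Cochain.d (Cochain.d a) = 0 := by
  refine ext' fun l => ?_
  induction l generalizing a with
  | nil => rfl
  | cons X l ih =>
    rw [d_cons, ins_d, d_sub, sub_app, ih (ha.ins X), ha.lieDer_d]; simp [zero_app]

/-- Cartan's formula for several commuting arguments. -/
theorem d_append (ha : IsAlt a) (v X : List G)
    (hvX : ∀ u ∈ v, ∀ w ∈ v ++ X, ⁅u, w⁆ = 0) :
    Cochain.d a (v ++ X) = ∑ k : Fin v.length,
        (-1) ^ (k : ℕ) * ⁅v[k], a (v.eraseIdx k ++ X)⁆ +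
      (-1) ^ v.length * Cochain.d (fun l => a (v ++ l) : Cochain A G) X := by
  -- If `u` commutes with all arguments, every bracket term of the Lie derivative has a zero
  -- argument, and only the derivative of the value remains.
  have hL : ∀ (u : G) (l : List G) (a : Cochain A G), IsAlt a → (∀ w ∈ l, ⁅u, w⁆ = 0) →
      Cochain.lieDer u a l = ⁅u, a l⁆ := by
    intro u l
    induction l with
    | nil => intro a _ _; rfl
    | cons w l ih =>
      intro a ha h
      rw [lieDer_cons, h w (by simp), ha.ins_zero_left, zero_app, sub_zero,
        ih _ (ha.ins w) fun x hx => h x (by simp [hx])]; rfl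
  induction v generalizing a with
  | nil => simp
  | cons u v ih =>
    have e : ∑ k : Fin (u :: v).length, (-1) ^ (k : ℕ) * ⁅(u :: v)[k], a ((u :: v).eraseIdx k ++ X)⁆ =
        ⁅u, a (v ++ X)⁆ - ∑ k : Fin v.length, (-1) ^ (k : ℕ) *
          ⁅v[k], a (u :: (v.eraseIdx k ++ X))⁆ := by
      refine (Fin.sum_univ_succ (n := v.length) _).trans ?_
      rw [sub_eq_add_neg, ← Finset.sum_neg_distrib]
      refine congrArg₂ _ (by simp) (Finset.sum_congr rfl fun k _ => ?_)
      simp [pow_succ]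
    rw [e, List.cons_append, d_cons,
      hL u _ a ha fun w hw => hvX u (by simp) w (by simp at hw ⊢; tauto),
      ih (ha.ins u) fun x hx w hw => hvX x (by simp [hx]) w (by simp at hw ⊢; tauto),
      List.length_cons, pow_succ]
    change _ - (_ + (-1) ^ v.length * Cochain.d (fun l => a (u :: (v ++ l))) X) = 
      _ + (-1) ^ v.length * -1 * Cochain.d (fun l => a (u :: (v ++ l))) X
    simp only [ins_app]
    ring
end IsAlt
end Diff

/-! ### The Leibniz rule for an action by derivations. -/

section DerAct
variable {K A G : Type*} [CommRing K] [CommRing A] [Algebra K A] [LieRing G] [LieRingModule G A]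

theorem _root_.ChernWeil.lie_mul_of_derAct (K : Type*) {A G : Type*} [CommRing K] [CommRing A]
    [Algebra K A] [LieRing G] [LieRingModule G A] [h : DerAct K A G] (X : G) (f g : A) :
    ⁅X, f * g⁆ = ⁅X, f⁆ * g + f * ⁅X, g⁆ := h.lie_mul' X f g

theorem _root_.ChernWeil.lie_one_of_derAct (K : Type*) {A G : Type*} [CommRing K] [CommRing A]
    [Algebra K A] [LieRing G] [LieRingModule G A] [DerAct K A G] (X : G) :
    ⁅X, (1 : A)⁆ = 0 := by
  have := lie_mul_of_derAct K X (1 : A) 1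
  rwa [mul_one, mul_one, one_mul, left_eq_add] at this

theorem _root_.ChernWeil.lie_algebraMap [h : DerAct K A G] (X : G) (c : K) :
    ⁅X, algebraMap K A c⁆ = 0 := by
  rw [Algebra.algebraMap_eq_smul_one, h.lie_smul', lie_one_of_derAct K, smul_zero]

theorem lieDer_mul_of_derAct (K : Type*) {A G : Type*} [CommRing K] [CommRing A]
    [Algebra K A] [LieRing G] [LieRingModule G A] [DerAct K A G] (X : G) (a b : Cochain A G) :
    lieDer X (a * b) = lieDer X a * b + a * lieDer X b := by
  refine ext' fun l => ?_
  induction l generalizing a b with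
  | nil => simp only [lieDer_nil, add_app, mul_nil, lie_mul_of_derAct K]
  | cons Y l ih =>
    simp only [lieDer_cons, add_app, ins_mul, mul_cons, lieDer_add, ih, ins_lieDer,
      sub_mul, mul_sub, sub_app, sgn_lieDer]; ring

/-- Only the derivation property of the action enters, with no module structure of `G` over `A`; the
rule therefore also holds on the product with a simplex, where the arguments are constant vector
fields. -/
theorem d_mul_of_derAct (K : Type*) {A G : Type*} [CommRing K] [CommRing A]
    [Algebra K A] [LieRing G] [LieRingModule G A] [DerAct K A G] (a b : Cochain A G) :
    d (a * b) = d a * b + sgn a * d b := by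
  refine ext' fun l => ?_
  induction l generalizing a b with
  | nil => simp only [d_nil, add_app, mul_nil]; ring
  | cons Y l ih =>
    simp only [d_cons, add_app, ins_mul, mul_cons, d_add, lieDer_mul_of_derAct K, ih, ins_d,
      ins_sgn, sgn_d, sub_mul, mul_sub, sub_app, sgn_sgn, neg_mul, neg_app]; ring

theorem d_const_algebraMap [DerAct K A G] (c : K) :
    d (const (algebraMap K A c) : Cochain A G) = 0 := by
  refine ext' fun l => ?_
  cases l with
  | nil => rfl
  | cons X l =>
    rw [d_cons, ins_const, d_zero, lieDer_const, lie_algebraMap]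
    by_cases h : l = [] <;> simp [const, h, zero_app]

theorem d_one [DerAct K A G] : d (1 : Cochain A G) = 0 := by
  have := d_const_algebraMap (A := A) (G := G) (1 : K)
  rwa [map_one] at this
end DerAct

/-- The constants as a subring: `const` is a ring homomorphism. -/
def constHom (A G : Type*) [CommRing A] : A →+* Cochain A G where
  toFun := const
  map_one' := rfl
  map_zero' := ext' fun l => by simp [const, zero_app]
  map_add' f g := ext' fun l => by by_cases h : l = [] <;> simp [const, add_app, h]
  map_mul' f g := ext' fun l => by
    rw [const_mul_app]; by_cases h : l = [] <;> simp [const, h]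

theorem constHom_apply {A G : Type*} [CommRing A] (f : A) : constHom A G f = const f := rfl
end Cochain

/-! ### Invariant polynomials over arbitrary commutative algebras. -/

section Invariance
variable {K : Type*} [Field K] [CharZero K] {r : ℕ}

/-- An invariant polynomial is invariant under conjugation over every commutative algebra. -/
theorem aeval_conj {P : MvPolynomial (Fin r × Fin r) K} (hP : P ∈ invariantPolynomials K r)
    {B : Type*} [CommRing B] [Algebra K B] (g h M : Matrix (Fin r) (Fin r) B) (hgh : g * h = 1) :
    MvPolynomial.aeval (fun p => (g * M * h) p.1 p.2) P =
      MvPolynomial.aeval (fun p => M p.1 p.2) P := by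
  -- A generic pair of matrices: the left summand holds the entries of `g`, the right one those of
  -- `M`. One polynomial identity for this pair specializes to every algebra, with the adjugate in
  -- place of the inverse.
  let σ := (Fin r × Fin r) ⊕ (Fin r × Fin r)
  let G₀ : Matrix (Fin r) (Fin r) (MvPolynomial σ K) := fun a b => MvPolynomial.X (.inl (a, b))
  let M₀ : Matrix (Fin r) (Fin r) (MvPolynomial σ K) := fun a b => MvPolynomial.X (.inr (a, b))
  -- The factor `det` makes the identity trivial at singular points. At the other points `g M adj(g)
  -- = g (det(g) M) g⁻¹`, so invariance over the field applies, and a polynomial over an infinite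
  -- field is determined by its values.
  have key : G₀.det * (MvPolynomial.aeval (fun p => (G₀ * M₀ * G₀.adjugate) p.1 p.2) P -
      MvPolynomial.aeval (fun p => (G₀.det • M₀) p.1 p.2) P) = 0 := by
    refine MvPolynomial.funext fun x => ?_
    let φ : MvPolynomial σ K →ₐ[K] K := MvPolynomial.aeval x
    let g' : Matrix (Fin r) (Fin r) K := φ.mapMatrix G₀
    let M' : Matrix (Fin r) (Fin r) K := φ.mapMatrix M₀
    have hφ : ∀ N : Matrix (Fin r) (Fin r) (MvPolynomial σ K),
        φ (MvPolynomial.aeval (fun p => N p.1 p.2) P) =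
          MvPolynomial.eval (fun p => (φ.mapMatrix N) p.1 p.2) P := by
      intro N
      rw [← AlgHom.comp_apply, MvPolynomial.comp_aeval]; rfl
    have hdet : φ G₀.det = g'.det := AlgHom.map_det φ G₀
    have hadj : φ.mapMatrix G₀.adjugate = g'.adjugate := AlgHom.map_adjugate φ G₀
    rw [map_zero]
    change φ _ = 0
    rw [map_mul, map_sub, hφ, hφ, hdet]
    by_cases h0 : g'.det = 0
    · rw [h0, zero_mul]
    refine mul_eq_zero_of_right _ (sub_eq_zero.mpr ?_)
    have hsm : φ.mapMatrix (G₀.det • M₀) = g'.det • M' := by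
      ext a b
      simp only [AlgHom.mapMatrix_apply, Matrix.map_apply, Matrix.smul_apply, smul_eq_mul, map_mul,
        hdet]
      rfl
    rw [map_mul, map_mul, hadj, hsm]
    let γ := Matrix.GeneralLinearGroup.mkOfDetNeZero g' h0
    have hγ : g' * M' * g'.adjugate = γ.1 * (g'.det • M') * (γ⁻¹).1 := by
      rw [Matrix.coe_units_inv]
      change g' * M' * g'.adjugate = g' * (g'.det • M') * g'⁻¹
      rw [Matrix.inv_def, Matrix.mul_smul, Matrix.mul_smul, Matrix.smul_mul, smul_smul,
        Ring.inverse_eq_inv', inv_mul_cancel₀ h0, one_smul]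
    change MvPolynomial.eval (fun p => (g' * M' * g'.adjugate) p.1 p.2) P = _
    rw [hγ]
    exact hP γ (g'.det • M')
  have hhg : h * g = 1 := mul_eq_one_comm.mp hgh
  have hd : g.det * h.det = 1 := by rw [← Matrix.det_mul, hgh, Matrix.det_one]
  have hadj : g.adjugate = g.det • h := by
    have := congrArg (h * ·) (Matrix.mul_adjugate g)
    simp only [← mul_assoc, hhg, one_mul, Matrix.mul_smul, mul_one] at this
    exact this
  -- The generic identity has `det(g) M` on its right side. Since `det h` is inverse to `det g`,
  -- rescaling `M` beforehand removes that factor.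
  let N : Matrix (Fin r) (Fin r) B := h.det • M
  let ψ : MvPolynomial σ K →ₐ[K] B :=
    MvPolynomial.aeval (Sum.elim (fun p => g p.1 p.2) (fun p => N p.1 p.2))
  have hψ : ∀ Q : Matrix (Fin r) (Fin r) (MvPolynomial σ K),
      ψ (MvPolynomial.aeval (fun p => Q p.1 p.2) P) =
        MvPolynomial.aeval (fun p => (ψ.mapMatrix Q) p.1 p.2) P := by
    intro Q
    rw [← AlgHom.comp_apply, MvPolynomial.comp_aeval]; rfl
  have hG : ψ.mapMatrix G₀ = g := by ext a b; exact MvPolynomial.aeval_X _ _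
  have hM : ψ.mapMatrix M₀ = N := by ext a b; exact MvPolynomial.aeval_X _ _
  have hdet : ψ G₀.det = g.det := (AlgHom.map_det ψ G₀).trans (by rw [hG])
  have hk := congrArg ψ key
  rw [map_mul, map_zero, map_sub, hψ, hψ, hdet] at hk
  have hk' := congrArg (h.det * ·) hk
  rw [← mul_assoc, mul_comm h.det, hd, one_mul, mul_zero, sub_eq_zero] at hk'
  have hsm : ψ.mapMatrix (G₀.det • M₀) = M := by
    ext a b
    have : ψ (M₀ a b) = N a b := congrFun (congrFun hM a) b
    simp only [AlgHom.mapMatrix_apply, Matrix.map_apply, Matrix.smul_apply, smul_eq_mul, map_mul,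
      hdet, this, N, ← mul_assoc, hd, one_mul]
  have hadj' : ψ.mapMatrix G₀.adjugate = g.adjugate := (AlgHom.map_adjugate ψ G₀).trans (by rw [hG])
  rw [map_mul, map_mul, hadj', hG, hM, hsm, hadj] at hk'
  rw [← hk']
  have e : g * N * g.det • h = g * M * h := by
    simp only [N, Matrix.mul_smul, Matrix.smul_mul, smul_smul, hd, one_smul]
  rw [e]
end Invariance

/-! ### Substitution of even forms in polynomials. -/

namespace Cochain

section Even
variable (A G : Type*) [CommRing A]

/-- The even cochains form a commutative ring. -/
def even : Subring (Cochain A G) where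
  carrier := {a | sgn a = a}
  mul_mem' {a b} ha hb := by
    rw [Set.mem_ofPred_eq] at ha hb ⊢
    rw [sgn_mul, ha, hb]
  one_mem' := sgn_const 1
  add_mem' {a b} ha hb := by
    rw [Set.mem_ofPred_eq] at ha hb ⊢
    rw [sgn_add, ha, hb]
  zero_mem' := sgn_zero
  neg_mem' {a} ha := by
    rw [Set.mem_ofPred_eq] at ha ⊢
    rw [sgn_neg, ha]

variable {A G}
theorem mem_even {a : Cochain A G} : a ∈ even A G ↔ sgn a = a := Iff.rfl

instance : CommRing (even A G) where
  __ := (inferInstance : Ring (even A G))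
  mul_comm a b := Subtype.ext (commute_of_even a.2 b.1)

instance {K : Type*} [CommRing K] [Algebra K A] : Algebra K (even A G) :=
  (((constHom A G).comp (algebraMap K A)).codRestrict (even A G)
    fun c => sgn_const (algebraMap K A c)).toAlgebra

variable {K : Type*} [Field K] [Algebra K A] {r : ℕ}

/-- A property of cochains that defines a subring containing the functions passes from the entries
of `R` to `P(R)`. This is applied to alternation and to linearity over functions. -/
theorem polyEval_mem (T : Subring (Cochain A G)) (P : MvPolynomial (Fin r × Fin r) K)
    {R : Fin r → Fin r → Cochain A G} (hR : ∀ a b, R a b ∈ T) (hc : ∀ f : A, const f ∈ T) :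
    polyEval P R ∈ T := by
  refine T.sum_mem fun s _ => T.mul_mem (hc _) (T.list_prod_mem fun x hx => ?_)
  obtain ⟨a, -, rfl⟩ := List.mem_map.mp hx
  refine T.list_prod_mem fun x hx => ?_
  obtain ⟨b, -, rfl⟩ := List.mem_map.mp hx
  exact T.pow_mem (hR a b) _

/-- Even cochains commute, so the ordered products in `polyEval` are an honest evaluation in a
commutative ring. This makes `P ↦ P(R)` a ring homomorphism and puts `aeval_conj` within reach. -/
theorem polyEval_eq_aeval (P : MvPolynomial (Fin r × Fin r) K) (R : Fin r → Fin r → even A G) :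
    polyEval P (fun a b => (R a b : Cochain A G)) =
      (MvPolynomial.aeval (fun p => R p.1 p.2) P : even A G) := by
  rw [MvPolynomial.aeval_def, MvPolynomial.eval₂_eq']
  change _ = (even A G).subtype _
  rw [map_sum]
  refine Finset.sum_congr rfl fun s _ => ?_
  rw [map_mul, Fintype.prod_prod_type, Fin.prod_univ_def, map_list_prod, List.map_map]
  refine congrArg₂ _ rfl (congrArg List.prod (List.map_congr_left fun a _ => ?_))
  rw [Function.comp_apply, Fin.prod_univ_def, map_list_prod, List.map_map]
  rfl

theorem polyEval_congr (P : MvPolynomial (Fin r × Fin r) K)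
    {R : Fin r → Fin r → Cochain A G} (hR : ∀ a b, sgn (R a b) = R a b) :
    polyEval P R = (MvPolynomial.aeval
      (fun p => (⟨R p.1 p.2, mem_even.mpr (hR p.1 p.2)⟩ : even A G)) P : even A G) :=
  polyEval_eq_aeval P (fun a b => (⟨R a b, mem_even.mpr (hR a b)⟩ : even A G))

theorem polyEval_add (P Q : MvPolynomial (Fin r × Fin r) K)
    {R : Fin r → Fin r → Cochain A G} (hR : ∀ a b, sgn (R a b) = R a b) :
    polyEval (P + Q) R = polyEval P R + polyEval Q R := by
  rw [polyEval_congr _ hR, polyEval_congr _ hR, polyEval_congr _ hR, map_add]; rfl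

theorem polyEval_mul (P Q : MvPolynomial (Fin r × Fin r) K)
    {R : Fin r → Fin r → Cochain A G} (hR : ∀ a b, sgn (R a b) = R a b) :
    polyEval (P * Q) R = polyEval P R * polyEval Q R := by
  rw [polyEval_congr _ hR, polyEval_congr _ hR, polyEval_congr _ hR, map_mul]; rfl

theorem polyEval_one {R : Fin r → Fin r → Cochain A G} (hR : ∀ a b, sgn (R a b) = R a b) :
    polyEval (1 : MvPolynomial (Fin r × Fin r) K) R = 1 := by
  rw [polyEval_congr _ hR, map_one]; rfl

theorem polyEval_even (P : MvPolynomial (Fin r × Fin r) K)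
    {R : Fin r → Fin r → Cochain A G} (hR : ∀ a b, sgn (R a b) = R a b) :
    sgn (polyEval P R) = polyEval P R := by
  rw [polyEval_congr _ hR]; exact mem_even.mp (Subtype.prop _)

/-- Functions are even, so the conjugating matrix has entries in the ring of even cochains and
`aeval_conj` applies over that ring. The hypothesis is the intertwining relation `g R' = R g`, the
form in which a change of frame produces it. -/
theorem polyEval_conj [CharZero K] {P : MvPolynomial (Fin r × Fin r) K}
    (hP : P ∈ invariantPolynomials K r) {R R' : Matrix (Fin r) (Fin r) (Cochain A G)}
    (hR : ∀ a b, sgn (R a b) = R a b) (hR' : ∀ a b, sgn (R' a b) = R' a b)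
    {g h : Matrix (Fin r) (Fin r) A} (hgh : g * h = 1)
    (e : (constHom A G).mapMatrix g * R' = R * (constHom A G).mapMatrix g) :
    polyEval P R' = polyEval P R := by
  let κ : A →+* even A G := (constHom A G).codRestrict (even A G) fun f => sgn_const f
  let R₁ : Matrix (Fin r) (Fin r) (even A G) := fun a b => ⟨R a b, mem_even.mpr (hR a b)⟩
  let R₂ : Matrix (Fin r) (Fin r) (even A G) := fun a b => ⟨R' a b, mem_even.mpr (hR' a b)⟩
  have hg : κ.mapMatrix g * κ.mapMatrix h = 1 := by rw [← map_mul, hgh, map_one]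
  have hinj : Function.Injective (even A G).subtype := Subtype.val_injective
  have e' : κ.mapMatrix g * R₂ = R₁ * κ.mapMatrix g := by
    refine Matrix.map_injective hinj ?_
    have h1 := (Matrix.map_mul (f := (even A G).subtype) (L := κ.mapMatrix g) (M := R₂))
    have h2 := (Matrix.map_mul (f := (even A G).subtype) (L := R₁) (M := κ.mapMatrix g))
    exact h1.trans (Eq.trans e h2.symm)
  have e'' : κ.mapMatrix g * R₂ * κ.mapMatrix h = R₁ := by rw [e', mul_assoc, hg, mul_one]
  rw [polyEval_congr _ hR, polyEval_congr _ hR']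
  have := aeval_conj hP (κ.mapMatrix g) (κ.mapMatrix h) R₂ hg
  rw [e''] at this
  exact congrArg Subtype.val this.symm

/-- A monomial of degree `m` in 2-forms is concentrated in degree `2m`. The condition runs over the
monomials of the support, so it serves homogeneous polynomials as well as bounds by the total
degree. -/
theorem polyEval_vanish (P : MvPolynomial (Fin r × Fin r) K)
    {R : Fin r → Fin r → Cochain A G} (hR : ∀ a b, Deg 2 (R a b)) (l : List G)
    (hl : ∀ s ∈ P.support, 2 * s.degree ≠ l.length) : polyEval P R l = 0 := by
  have e : ∀ a b, sgn (R a b) = R a b := fun a b => (hR a b).even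
  have hprod : ∀ (m : List (Fin r)) (f : Fin r → Cochain A G) (n : Fin r → ℕ),
      (∀ a, Deg (n a) (f a)) → Deg (m.map n).sum (m.map f).prod := by
    intro m f n h
    induction m with
    | nil => exact Deg.const 1
    | cons a m ih => simp only [List.map_cons, List.sum_cons, List.prod_cons]; exact (h a).mul ih
  have hs : ∀ s ∈ P.support, (const (algebraMap K A (P.coeff s)) * ((List.finRange r).map
      fun a => ((List.finRange r).map fun b => R a b ^ s (a, b)).prod).prod : Cochain A G) l = 0 := by
    intro s hs
    have h1 := hprod (List.finRange r) _ _ fun a => hprod (List.finRange r)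
      (fun b => R a b ^ s (a, b)) _ fun b => (hR a b).pow (s (a, b))
    refine ((Deg.const (algebraMap K A (P.coeff s))).mul h1) l ?_
    have h2 : (List.map (fun a => (List.map (fun b => s (a, b) * 2) (List.finRange r)).sum)
        (List.finRange r)).sum = 2 * s.degree := by
      rw [← Fin.sum_univ_def]
      simp only [← Fin.sum_univ_def]
      rw [← Fintype.sum_prod_type' (f := fun a b => s (a, b) * 2), ← Finset.sum_mul, mul_comm,
        Finsupp.degree_eq_sum]
    rw [h2, zero_add]
    exact (hl s hs).symm
  let ev : Cochain A G →+ A := ⟨⟨fun ω => ω l, rfl⟩, fun _ _ => rfl⟩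
  change ev (polyEval P R) = 0
  rw [polyEval, map_sum]
  exact Finset.sum_eq_zero hs
end Even

/-! ### Closedness of invariant polynomials of the curvature, and gauge invariance. -/

section Closed
variable {A G : Type*} [CommRing A] [LieRing G] [LieRingModule G A]
  {K : Type*} [Field K] [Algebra K A] {r : ℕ}

variable (A G) in
/-- The cochains as a module over the even ones. -/
def EvenModule := Cochain A G
instance : AddCommGroup (EvenModule A G) := inferInstanceAs (AddCommGroup (Cochain A G))
instance : Module (even A G) (EvenModule A G) :=
  inferInstanceAs (Module (even A G) (Cochain A G))
instance : Module (even A G)ᵐᵒᵖ (EvenModule A G) :=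
  Module.compHom _ ((RingHom.id (even A G)).fromOpposite fun _ _ => mul_comm _ _)
instance : IsCentralScalar (even A G) (EvenModule A G) := ⟨fun _ _ => rfl⟩

variable (A G) in
/-- The trivial square zero extension of the ring of even cochains by all cochains. -/
abbrev EvenTriv := TrivSqZeroExt (even A G) (EvenModule A G)

instance evenTrivAlgebra : Algebra K (EvenTriv A G) :=
  ((TrivSqZeroExt.inlHom (even A G) (EvenModule A G)).comp (algebraMap K (even A G))).toAlgebra

variable (K A G) in
/-- `a ↦ a + ε da` as a homomorphism to the trivial square zero extension. -/
def evenToTriv [DerAct K A G] : even A G →+* EvenTriv A G where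
  toFun a := (a, d a.1)
  map_one' := Prod.ext rfl (d_one (K := K))
  map_zero' := Prod.ext rfl d_zero
  map_add' a b := Prod.ext rfl (d_add _ _)
  map_mul' a b := Prod.ext rfl <| by
    refine (d_mul_of_derAct K a.1 b.1).trans ?_
    have ha : sgn a.1 = a.1 := a.2
    rw [ha, ← commute_of_even b.2, add_comm]
    rfl

/-- With `ε² = 0`, conjugating `R` by `1 - εθ` gives `R + ε(Rθ - θR) = R + ε dR`. Since `a ↦ a + ε
da` is a ring homomorphism on even cochains, invariance yields `P(R) + ε dP(R) = P(R)`. The matrix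
`θ` need not be even, so the `ε`-part is the module of all cochains and not only the even ones. -/
theorem d_polyEval_eq_zero [CharZero K] [DerAct K A G] {P : MvPolynomial (Fin r × Fin r) K}
    (hP : P ∈ invariantPolynomials K r) {R θ : Matrix (Fin r) (Fin r) (Cochain A G)}
    (hR : ∀ a b, sgn (R a b) = R a b)
    (hd : R.map d = R * θ - θ * R) : d (polyEval P R) = 0 := by
  let R₁ : Matrix (Fin r) (Fin r) (even A G) := fun a b => ⟨R a b, mem_even.mpr (hR a b)⟩
  let D : even A G →ₐ[K] EvenTriv A G :=
    { evenToTriv A G K with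
      commutes' := fun c => Prod.ext rfl (d_const_algebraMap (A := A) (G := G) c) }
  let I : even A G →ₐ[K] EvenTriv A G :=
    { TrivSqZeroExt.inlHom (even A G) (EvenModule A G) with commutes' := fun c => rfl }
  let t : Fin r → Fin r → EvenModule A G := fun a b => θ a b
  let T : Matrix (Fin r) (Fin r) (EvenTriv A G) := fun a b => TrivSqZeroExt.inr (t a b)
  have hT : ∀ a b, (T a b).fst = 0 := fun _ _ => rfl
  have hT' : ∀ a b, (T a b).snd = t a b := fun _ _ => rfl
  have hTT : ∀ N : Matrix (Fin r) (Fin r) (EvenTriv A G), T * N * T = 0 := by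
    intro N
    ext a b
    · simp only [Matrix.mul_apply, TrivSqZeroExt.fst_sum, TrivSqZeroExt.fst_mul, hT,
        mul_zero, Finset.sum_const_zero]; rfl
    · simp only [Matrix.mul_apply, TrivSqZeroExt.snd_sum, TrivSqZeroExt.snd_mul, hT,
        TrivSqZeroExt.fst_sum, TrivSqZeroExt.fst_mul, zero_mul,
        Finset.sum_const_zero, zero_smul, MulOpposite.op_zero, add_zero]; rfl
  have hgh : (1 - T) * (1 + T) = 1 := by
    have := hTT 1
    rw [mul_one] at this
    rw [sub_mul, one_mul, mul_add, mul_one, this]; abel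
  have hconj : (1 - T) * I.mapMatrix R₁ * (1 + T) = D.mapMatrix R₁ := by
    have h3 := hTT (I.mapMatrix R₁)
    have h4 : (1 - T) * I.mapMatrix R₁ * (1 + T) = I.mapMatrix R₁ + I.mapMatrix R₁ * T
        - T * I.mapMatrix R₁ - T * I.mapMatrix R₁ * T := by noncomm_ring
    rw [h4, h3, sub_zero]
    have hdab : ∀ a b, d (R a b) = ∑ c, R a c * θ c b - ∑ c, θ a c * R c b := fun a b =>
      congrFun (congrFun hd a) b
    ext a b
    · simp only [Matrix.mul_apply, Matrix.add_apply, Matrix.sub_apply, TrivSqZeroExt.fst_sum,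
        TrivSqZeroExt.fst_mul, TrivSqZeroExt.fst_add, TrivSqZeroExt.fst_sub, hT,
        mul_zero, zero_mul, Finset.sum_const_zero, add_zero, sub_zero]
      rfl
    · simp only [Matrix.mul_apply, Matrix.add_apply, Matrix.sub_apply, TrivSqZeroExt.snd_sum,
        TrivSqZeroExt.snd_mul, TrivSqZeroExt.snd_add, TrivSqZeroExt.snd_sub, hT, hT',
        zero_smul, MulOpposite.op_zero, add_zero,
        zero_add]
      -- The entries of `R` are even, so the right action of the extension agrees with exterior
      -- multiplication on the right.
      have h5 : ∀ c, MulOpposite.op ((I.mapMatrix R₁ c b).fst) • t a c = (θ a c * R c b : Cochain A G) := fun c => commute_of_even (hR c b) (θ a c)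
      have h6 : ∀ c, (I.mapMatrix R₁ a c).fst • t c b = (R a c * θ c b : Cochain A G) := fun c => rfl
      simp only [h5, h6]
      refine Eq.trans ?_ (hdab a b).symm
      rw [show (I.mapMatrix R₁ a b).snd = (0 : Cochain A G) from rfl]
      exact congrArg (· - _) (zero_add _)
  have h := aeval_conj hP (1 - T) (1 + T) (I.mapMatrix R₁) hgh
  rw [hconj] at h
  have hD : D (MvPolynomial.aeval (fun p => R₁ p.1 p.2) P) =
      MvPolynomial.aeval (fun p => (D.mapMatrix R₁) p.1 p.2) P := by
    rw [← AlgHom.comp_apply, MvPolynomial.comp_aeval]; rfl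
  have hI : I (MvPolynomial.aeval (fun p => R₁ p.1 p.2) P) =
      MvPolynomial.aeval (fun p => (I.mapMatrix R₁) p.1 p.2) P := by
    rw [← AlgHom.comp_apply, MvPolynomial.comp_aeval]; rfl
  rw [← hD, ← hI] at h
  rw [polyEval_congr _ hR]
  exact congrArg TrivSqZeroExt.snd h

/-- The curvature matrix `dθ + θ ∧ θ` of a matrix of 1-forms. -/
def curv (θ : Matrix (Fin r) (Fin r) (Cochain A G)) : Matrix (Fin r) (Fin r) (Cochain A G) :=
  θ.map d + θ * θ

/-- Matrices of additive cochains of degree one. -/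
def IsConn (θ : Matrix (Fin r) (Fin r) (Cochain A G)) : Prop :=
  ∀ a b, Deg 1 (θ a b) ∧ IsAlt (θ a b)

theorem map_d_mul (K : Type*) [Field K] [Algebra K A] [DerAct K A G]
    (M N : Matrix (Fin r) (Fin r) (Cochain A G)) :
    (M * N).map d = M.map d * N + M.map sgn * N.map d := by
  let dHom : Cochain A G →+ Cochain A G := ⟨⟨d, d_zero⟩, d_add⟩
  ext a b : 1
  change dHom ((M * N) a b) = _
  simp only [Matrix.mul_apply, Matrix.add_apply, map_sum, Matrix.map_apply,
    ← Finset.sum_add_distrib]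
  exact Finset.sum_congr rfl fun c _ => d_mul_of_derAct K _ _

theorem map_d_add (M N : Matrix (Fin r) (Fin r) (Cochain A G)) :
    (M + N).map d = M.map d + N.map d := by
  ext a b : 1
  exact d_add _ _

namespace IsConn
variable {θ θ' : Matrix (Fin r) (Fin r) (Cochain A G)}

theorem map_sgn (h : IsConn θ) : θ.map sgn = -θ := by
  ext a b : 1
  exact (h a b).1.odd

theorem curv_deg (h : IsConn θ) (a b : Fin r) : Deg 2 (curv θ a b) := by
  refine (h a b).1.d.add ?_
  rw [Matrix.mul_apply]
  exact Deg.sum _ fun c _ => (h a c).1.mul (h c b).1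

theorem curv_even (h : IsConn θ) (a b : Fin r) : sgn (curv θ a b) = curv θ a b :=
  (h.curv_deg a b).even

theorem curv_isAlt (h : IsConn θ) (a b : Fin r) : IsAlt (curv θ a b) := by
  refine (h a b).2.d.add ?_
  rw [Matrix.mul_apply]
  exact IsAlt.sum _ fun c _ => (h a c).2.mul (h c b).2

theorem polyEval_isAlt (h : IsConn θ) (P : MvPolynomial (Fin r × Fin r) K) :
    IsAlt (polyEval P (curv θ)) :=
  polyEval_mem (IsAlt.subring A G) P h.curv_isAlt IsAlt.const

/-- Since `θ` is odd and `ddθ = 0`, applying `d` to `dθ + θθ` leaves `dθ θ - θ dθ`; the cubic terms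
of `Rθ - θR` cancel. -/
theorem bianchi (K : Type*) [Field K] [Algebra K A] [DerAct K A G] (h : IsConn θ) :
    (curv θ).map d = curv θ * θ - θ * curv θ := by
  have hdd : (θ.map d).map d = 0 := by
    ext a b : 1
    exact (h a b).2.d_d
  rw [curv, map_d_add, hdd, map_d_mul K, h.map_sgn]
  noncomm_ring

theorem d_polyEval [CharZero K] [DerAct K A G] (h : IsConn θ) {P : MvPolynomial (Fin r × Fin r) K}
    (hP : P ∈ invariantPolynomials K r) : d (polyEval P (curv θ)) = 0 :=
  d_polyEval_eq_zero hP h.curv_even (h.bianchi K)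
end IsConn

/-- `θ'` is the transform of `θ` under the change of frame `g`. -/
def Gauge (g : Matrix (Fin r) (Fin r) A) (θ θ' : Matrix (Fin r) (Fin r) (Cochain A G)) : Prop :=
  (constHom A G).mapMatrix g * θ' =
    θ * (constHom A G).mapMatrix g + ((constHom A G).mapMatrix g).map d

/-- Differentiating `g θ' = θ g + dg` gives `g dθ' = dθ g - θ dg - dg θ'`. Substituting the relation
twice in `g θ' θ'` cancels all terms with `dg`. In this multiplied form no inverse of `g` is needed.
-/
theorem Gauge.curv (K : Type*) [Field K] [Algebra K A] [DerAct K A G]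
    {g : Matrix (Fin r) (Fin r) A} {θ θ' : Matrix (Fin r) (Fin r) (Cochain A G)}
    (h : Gauge g θ θ') (hθ : IsConn θ) :
    (constHom A G).mapMatrix g * curv θ' = Cochain.curv θ * (constHom A G).mapMatrix g := by
  unfold Gauge at h
  have hs : ((constHom A G).mapMatrix g).map sgn = (constHom A G).mapMatrix g := by
    ext a b : 1
    exact sgn_const _
  have hdd : (((constHom A G).mapMatrix g).map d).map d = 0 := by
    ext a b : 1
    exact (IsAlt.const (g a b)).d_d
  have h1 := congrArg (fun M => Matrix.map M d) h
  simp only [map_d_add, map_d_mul K, hs, hθ.map_sgn, hdd, add_zero] at h1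
  rw [Cochain.curv, Cochain.curv, mul_add, ← mul_assoc, h, add_mul, add_mul, mul_assoc θ, h]
  rw [← eq_sub_iff_add_eq'] at h1
  rw [h1]
  noncomm_ring

theorem Gauge.polyEval [CharZero K] [DerAct K A G]
    {g h : Matrix (Fin r) (Fin r) A} (hgh : g * h = 1)
    {θ θ' : Matrix (Fin r) (Fin r) (Cochain A G)}
    (hg : Gauge g θ θ') (hθ : IsConn θ) (hθ' : IsConn θ') {P : MvPolynomial (Fin r × Fin r) K}
    (hP : P ∈ invariantPolynomials K r) :
    polyEval P (Cochain.curv θ') = polyEval P (Cochain.curv θ) :=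
  polyEval_conj hP hθ.curv_even hθ'.curv_even hgh (hg.curv K hθ)
end Closed
end Cochain

/-! ### Naturality of cochains along correspondences of the arguments. -/

namespace Cochain

/-- `a'` is the image of `a` under `φ` along a correspondence `(α, β)` of the arguments. -/
def Rel {A A' G G' Λ : Type*} (φ : A → A') (α : Λ → G) (β : Λ → G') (a : Cochain A G)
    (a' : Cochain A' G') : Prop := ∀ l : List Λ, φ (a (l.map α)) = a' (l.map β)

/-- The cochain `φ(a(α, …, α))`. -/
def pull {A A' G Λ : Type*} (φ : A → A') (α : Λ → G) (a : Cochain A G) : Cochain A' Λ :=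
  fun l => φ (a (l.map α))

theorem Rel.ins {A A' G G' Λ : Type*} [CommRing A] [CommRing A'] {φ : A → A'} {α : Λ → G}
    {β : Λ → G'} {a : Cochain A G} {a' : Cochain A' G'} (h : Rel φ α β a a') (X : Λ) :
    Rel φ α β (ins (α X) a) (ins (β X) a') := fun l => h (X :: l)

section Add
variable {A A' G G' Λ : Type*} [CommRing A] [CommRing A'] {φ : A →+ A'} {α : Λ → G} {β : Λ → G'}
  {a b : Cochain A G} {a' b' : Cochain A' G'}

theorem Rel.lieDer [LieRing G] [LieRing G'] [LieRing Λ] [LieRingModule G A] [LieRingModule G' A']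
    (h : Rel φ α β a a') (hα : ∀ X Y, α ⁅X, Y⁆ = ⁅α X, α Y⁆) (hβ : ∀ X Y, β ⁅X, Y⁆ = ⁅β X, β Y⁆)
    (hφ : ∀ X f, φ ⁅α X, f⁆ = ⁅β X, φ f⁆) (X : Λ) :
    Rel φ α β (lieDer (α X) a) (lieDer (β X) a') := by
  intro l
  induction l generalizing a a' with
  | nil => exact (hφ X _).trans (congrArg _ (h []))
  | cons Y l ih =>
    simp only [List.map_cons, lieDer_cons, map_sub]
    rw [ih (h.ins Y), ← hα, ← hβ]
    exact congrArg _ (h (⁅X, Y⁆ :: l))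

/-- The differential is built from brackets and the action on values alone, so an additive `φ`
suffices. This generality is needed for integration over the simplex, which is not multiplicative.
-/
theorem Rel.d_of_add [LieRing G] [LieRing G'] [LieRing Λ] [LieRingModule G A]
    [LieRingModule G' A'] (h : Rel φ α β a a') (hα : ∀ X Y, α ⁅X, Y⁆ = ⁅α X, α Y⁆)
    (hβ : ∀ X Y, β ⁅X, Y⁆ = ⁅β X, β Y⁆) (hφ : ∀ X f, φ ⁅α X, f⁆ = ⁅β X, φ f⁆) :
    Rel φ α β (d a) (d a') := by
  intro l
  induction l generalizing a a' with
  | nil => exact map_zero φ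
  | cons X l ih =>
    simp only [List.map_cons, d_cons, map_sub]
    rw [ih (h.ins X)]
    exact congrArg (· - _) (h.lieDer hα hβ hφ X l)
end Add
end Cochain

/-- A homomorphism of algebras compatible with a correspondence of Lie rings acting on them. -/
structure Morph (K A G A' G' Λ : Type*) [CommRing K] [CommRing A] [Algebra K A] [CommRing A']
    [Algebra K A'] [LieRing G] [LieRing G'] [LieRing Λ] [LieRingModule G A]
    [LieRingModule G' A'] where
  φ : A →ₐ[K] A'
  α : Λ → G
  β : Λ → G'
  α_lie : ∀ X Y, α ⁅X, Y⁆ = ⁅α X, α Y⁆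
  β_lie : ∀ X Y, β ⁅X, Y⁆ = ⁅β X, β Y⁆
  φ_lie : ∀ X f, φ ⁅α X, f⁆ = ⁅β X, φ f⁆

namespace Morph
open Cochain
variable {K A G A' G' Λ : Type*} [CommRing A] [CommRing A'] [LieRing G]
  [LieRing G'] [LieRing Λ] [LieRingModule G A] [LieRingModule G' A']

section
variable [CommRing K] [Algebra K A] [Algebra K A']
variable (m : Morph K A G A' G' Λ)

/-- Cochains related by the morphism. -/
def Rel (a : Cochain A G) (a' : Cochain A' G') : Prop := Cochain.Rel m.φ m.α m.β a a'

variable {m} {a b : Cochain A G} {a' b' : Cochain A' G'}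

/-- Indexing both sides by a third Lie ring `Λ` treats restriction to open sets (where `α` is the
identity) and pullback to faces and products (where `β` is the identity) by the same closure rules.
-/
theorem Rel.d (h : m.Rel a a') : m.Rel (d a) (d a') :=
  Cochain.Rel.d_of_add (φ := (m.φ : A →+ A')) h m.α_lie m.β_lie m.φ_lie
theorem Rel.add (ha : m.Rel a a') (hb : m.Rel b b') : m.Rel (a + b) (a' + b') :=
  fun l => (map_add m.φ _ _).trans (congrArg₂ _ (ha l) (hb l))
theorem Rel.zero : m.Rel 0 0 := fun _ => map_zero m.φ
theorem Rel.ins (h : m.Rel a a') (X : Λ) : m.Rel (ins (m.α X) a) (ins (m.β X) a') :=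
  fun l => h (X :: l)
theorem Rel.sgn (h : m.Rel a a') : m.Rel (sgn a) (sgn a') := fun l => by
  simp only [Cochain.sgn, map_mul, map_pow, map_neg, map_one, h l, List.length_map]
theorem Rel.mul (h : m.Rel a a') (k : m.Rel b b') : m.Rel (a * b) (a' * b') := by
  intro l
  induction l generalizing a b a' b' with
  | nil => exact (map_mul m.φ _ _).trans (congrArg₂ _ (h []) (k []))
  | cons X l ih =>
    simp only [List.map_cons, mul_cons, map_add]
    rw [ih (h.ins X) k, ih h.sgn (k.ins X)]
theorem Rel.const {f : A} {f' : A'} (h : m.φ f = f') : m.Rel (const f) (const f') := by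
  intro l
  cases l with
  | nil => exact h
  | cons X l => exact map_zero m.φ
theorem Rel.one : m.Rel 1 1 := Rel.const (map_one m.φ)
theorem Rel.pow (h : m.Rel a a') (n : ℕ) : m.Rel (a ^ n) (a' ^ n) := by
  induction n with
  | zero => simpa using Rel.one
  | succ n ih => rw [pow_succ, pow_succ]; exact ih.mul h
theorem Rel.sum {ι : Type*} (s : Finset ι) {a : ι → Cochain A G} {a' : ι → Cochain A' G'}
    (h : ∀ i ∈ s, m.Rel (a i) (a' i)) : m.Rel (∑ i ∈ s, a i) (∑ i ∈ s, a' i) := by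
  classical
  induction s using Finset.induction_on with
  | empty => exact Rel.zero
  | insert i s hi ih =>
    rw [Finset.sum_insert hi, Finset.sum_insert hi]
    exact (h i (by simp)).add (ih fun j hj => h j (by simp [hj]))
theorem Rel.listProd {ι : Type*} (s : List ι) {a : ι → Cochain A G} {a' : ι → Cochain A' G'}
    (h : ∀ i ∈ s, m.Rel (a i) (a' i)) : m.Rel (s.map a).prod (s.map a').prod := by
  induction s with
  | nil => exact Rel.one
  | cons i s ih =>
    simp only [List.map_cons, List.prod_cons]
    exact (h i (by simp)).mul (ih fun j hj => h j (by simp [hj]))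
theorem Rel.curv {r : ℕ} {θ : Matrix (Fin r) (Fin r) (Cochain A G)}
    {θ' : Matrix (Fin r) (Fin r) (Cochain A' G')} (h : ∀ a b, m.Rel (θ a b) (θ' a b))
    (a b : Fin r) : m.Rel (Cochain.curv θ a b) (Cochain.curv θ' a b) := by
  refine (h a b).d.add ?_
  rw [Matrix.mul_apply, Matrix.mul_apply]
  exact Rel.sum _ fun c _ => (h a c).mul (h c b)
end

theorem Rel.polyEval [Field K] [Algebra K A] [Algebra K A'] {m : Morph K A G A' G' Λ}
    {r : ℕ} {R : Fin r → Fin r → Cochain A G}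
    {R' : Fin r → Fin r → Cochain A' G'} (h : ∀ a b, m.Rel (R a b) (R' a b))
    (P : MvPolynomial (Fin r × Fin r) K) : m.Rel (polyEval P R) (polyEval P R') :=
  Rel.sum _ fun _ _ => (Rel.const (AlgHom.commutes m.φ _)).mul <|
    Rel.listProd _ fun a _ => Rel.listProd _ fun b _ => (h a b).pow _
end Morph

/-! ### Products with a simplex and their constant vector fields. -/

/-- The sum of `M` and the Lie ring of constant vector fields on the `n`-simplex. -/
def Prism (K M : Type*) (n : ℕ) := M × (Fin n → K)

namespace Prism
variable {K M : Type*} {n : ℕ} [Field K] [LieRing M]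

instance : AddCommGroup (Prism K M n) := inferInstanceAs (AddCommGroup (M × (Fin n → K)))

/-- The pair `(X, c)`. -/
def mk (X : M) (c : Fin n → K) : Prism K M n := (X, c)
theorem mk_fst (X : M) (c : Fin n → K) : (mk X c).1 = X := rfl
theorem mk_snd (X : M) (c : Fin n → K) : (mk X c).2 = c := rfl

theorem ext {x y : Prism K M n} (h : x.1 = y.1) (h' : x.2 = y.2) : x = y := Prod.ext h h'
theorem add_fst (x y : Prism K M n) : (x + y).1 = x.1 + y.1 := rfl
theorem add_snd (x y : Prism K M n) : (x + y).2 = x.2 + y.2 := rfl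

instance : LieRing (Prism K M n) where
  bracket x y := mk ⁅x.1, y.1⁆ 0
  add_lie x y z := ext (add_lie x.1 y.1 z.1) (add_zero _).symm
  lie_add x y z := ext (lie_add x.1 y.1 z.1) (add_zero _).symm
  lie_self x := ext (lie_self x.1) rfl
  leibniz_lie x y z := ext (leibniz_lie x.1 y.1 z.1) (add_zero _).symm

theorem lie_fst (x y : Prism K M n) : ⁅x, y⁆.1 = ⁅x.1, y.1⁆ := rfl
theorem lie_snd (x y : Prism K M n) : ⁅x, y⁆.2 = 0 := rfl

variable (K M n) in
/-- The coordinate vector fields `∂_n, …, ∂_1`. -/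
def frame : List (Prism K M n) := (List.ofFn fun j => mk 0 (Pi.single j 1)).reverse

variable (K n) in
/-- The inclusion of `M`. -/
def incl (X : M) : Prism K M n := mk X 0

theorem length_frame : (frame K M n).length = n :=
  (List.length_reverse).trans (List.length_ofFn)
end Prism

section Action
variable (K : Type*) {O M : Type*} [Field K] [CommRing O] [Algebra K O] [LieRing M]
  [LieRingModule M O]

/-- The constant vector field with components `c`. -/
def coordDer {n : ℕ} (c : Fin n → K) : Derivation K (SimplexRing K n) (SimplexRing K n) :=
  MvPolynomial.mkDerivation K fun i => MvPolynomial.C (c i)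

theorem coordDer_X {n : ℕ} (c : Fin n → K) (i : Fin n) :
    coordDer K c (MvPolynomial.X i) = MvPolynomial.C (c i) := MvPolynomial.mkDerivation_X _ _ _

theorem coordDer_add {n : ℕ} (c c' : Fin n → K) :
    coordDer K (c + c') = coordDer K c + coordDer K c' :=
  MvPolynomial.derivation_ext fun i => by simp [coordDer_X]

theorem coordDer_zero {n : ℕ} : coordDer K (0 : Fin n → K) = 0 :=
  MvPolynomial.derivation_ext fun i => by simp [coordDer_X]

theorem coordDer_single {n : ℕ} (i : Fin n) : coordDer K (Pi.single i 1) = MvPolynomial.pderiv i :=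
  MvPolynomial.derivation_ext fun j => by
    rw [coordDer_X, MvPolynomial.pderiv_X]
    by_cases h : j = i
    · subst h; simp
    · simp [h]

theorem coordDer_lie {n : ℕ} (c c' : Fin n → K) : ⁅coordDer K c, coordDer K c'⁆ = 0 :=
  MvPolynomial.derivation_ext fun i => by
    simp [Derivation.commutator_apply, coordDer_X, ← MvPolynomial.algebraMap_eq]

theorem coordDer_comm {n : ℕ} (c c' : Fin n → K) (f : SimplexRing K n) :
    coordDer K c (coordDer K c' f) = coordDer K c' (coordDer K c f) := by
  have := Derivation.congr_fun (coordDer_lie K c c') f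
  rwa [Derivation.commutator_apply, Derivation.zero_apply, sub_eq_zero] at this

/-- The action of an element as a linear map. -/
def actLin [DerAct K O M] (X : M) : O →ₗ[K] O where
  toFun f := ⁅X, f⁆
  map_add' := lie_add X
  map_smul' c f := DerAct.lie_smul' X c f

/-- The action of a pair `(X, c)` on functions. -/
def prismAct [DerAct K O M] {n : ℕ} (Y : Prism K M n) :
    SimplexRing K n ⊗[K] O →ₗ[K] SimplexRing K n ⊗[K] O :=
  LinearMap.rTensor O (coordDer K Y.2 : SimplexRing K n →ₗ[K] SimplexRing K n) +
    LinearMap.lTensor (SimplexRing K n) (actLin K Y.1)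

variable {K}
theorem prismAct_tmul [DerAct K O M] {n : ℕ} (Y : Prism K M n) (f : SimplexRing K n) (g : O) :
    prismAct K Y (f ⊗ₜ[K] g) = coordDer K Y.2 f ⊗ₜ g + f ⊗ₜ ⁅Y.1, g⁆ := rfl

instance [DerAct K O M] {n : ℕ} : LieRingModule (Prism K M n) (SimplexRing K n ⊗[K] O) where
  bracket Y F := prismAct K Y F
  add_lie x y F := by
    induction F with
    | zero => simp
    | add F G hF hG => simp only [map_add, hF, hG]; abel
    | tmul f g =>
      simp only [prismAct_tmul, Prism.add_fst, Prism.add_snd, coordDer_add, Derivation.add_apply,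
        add_lie, TensorProduct.add_tmul, TensorProduct.tmul_add]; abel
  lie_add x F G := map_add _ F G
  leibniz_lie x y F := by
    induction F with
    | zero => simp
    | add F G hF hG => simp only [map_add, hF, hG]; abel
    | tmul f g =>
      simp only [prismAct_tmul, map_add, Prism.lie_fst, Prism.lie_snd, coordDer_zero,
        Derivation.zero_apply, TensorProduct.zero_tmul, lie_lie, TensorProduct.tmul_sub,
        coordDer_comm K x.2 y.2]
      abel

theorem prism_lie_tmul [DerAct K O M] {n : ℕ} (Y : Prism K M n) (f : SimplexRing K n) (g : O) :
    ⁅Y, f ⊗ₜ[K] g⁆ = coordDer K Y.2 f ⊗ₜ g + f ⊗ₜ ⁅Y.1, g⁆ := rfl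

theorem prism_lie_def [DerAct K O M] {n : ℕ} (Y : Prism K M n) (F : SimplexRing K n ⊗[K] O) :
    ⁅Y, F⁆ = prismAct K Y F := rfl

instance [DerAct K O M] {n : ℕ} : DerAct K (SimplexRing K n ⊗[K] O) (Prism K M n) where
  lie_mul' Y F G := by
    simp only [prism_lie_def]
    induction F with
    | zero => simp
    | add F F' hF hF' => simp only [map_add, add_mul, hF, hF']; abel
    | tmul f g =>
      induction G with
      | zero => simp
      | add G G' hG hG' => simp only [map_add, mul_add, hG, hG']; abel
      | tmul f' g' =>
        simp only [Algebra.TensorProduct.tmul_mul_tmul, prismAct_tmul, Derivation.leibniz,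
          lie_mul_of_derAct K, add_mul, mul_add, TensorProduct.add_tmul, TensorProduct.tmul_add,
          smul_eq_mul, mul_comm f']
        abel
  lie_smul' Y c F := map_smul (prismAct K Y) c F
end Action

namespace Morph
open Cochain
variable {K A G A' G' Λ : Type*} [Field K] [CommRing A] [CommRing A'] [Algebra K A] [Algebra K A']
  [LieRing G] [LieRing G'] [LieRing Λ] [LieRingModule G A] [LieRingModule G' A']
  [DerAct K A G] [DerAct K A' G']

/-- The product of a morphism with a simplex. -/
def prism (m : Morph K A G A' G' Λ) (n : ℕ) : Morph K (SimplexRing K n ⊗[K] A) (Prism K G n)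
    (SimplexRing K n ⊗[K] A') (Prism K G' n) (Prism K Λ n) where
  φ := Algebra.TensorProduct.map (AlgHom.id K _) m.φ
  α x := Prism.mk (m.α x.1) x.2
  β x := Prism.mk (m.β x.1) x.2
  α_lie x y := Prism.ext (m.α_lie x.1 y.1) rfl
  β_lie x y := Prism.ext (m.β_lie x.1 y.1) rfl
  φ_lie x F := by
    induction F with
    | zero => simp
    | add F G hF hG => simp only [lie_add, map_add, hF, hG]
    | tmul f g => simp [prism_lie_tmul, m.φ_lie, Prism.mk_fst, Prism.mk_snd]

theorem prism_φ_tmul (m : Morph K A G A' G' Λ) (n : ℕ) (f : SimplexRing K n) (g : A) :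
    (m.prism n).φ (f ⊗ₜ g) = f ⊗ₜ m.φ g := rfl

variable (K A G) in
/-- The projection of a prism to its base. -/
def base (n : ℕ) : Morph K A G (SimplexRing K n ⊗[K] A) (Prism K G n) (Prism K G n) where
  φ := Algebra.TensorProduct.includeRight
  α x := x.1
  β x := x
  α_lie _ _ := rfl
  β_lie _ _ := rfl
  φ_lie x f := by
    simp [prism_lie_tmul]

end Morph

/-! ### Faces of the simplex. -/

namespace SimplexRing
variable (K : Type*) [Field K] {n : ℕ}

/-- The barycentric components of a constant vector field. -/
def bary (c : Fin n → K) : Fin (n + 1) → K := Fin.cons (-∑ i, c i) c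

theorem t_zero : t K (0 : Fin (n + 1)) = 1 - ∑ i, MvPolynomial.X i := rfl
theorem t_succ (i : Fin n) : t K i.succ = MvPolynomial.X i := rfl

theorem sum_t : ∑ j, t K (n := n) j = 1 := by
  rw [Fin.sum_univ_succ, t_zero]
  simp only [t_succ]; ring

theorem coordDer_t (c : Fin n → K) (j : Fin (n + 1)) :
    coordDer K c (t K j) = MvPolynomial.C (bary K c j) := by
  refine Fin.cases ?_ (fun i => ?_) j
  · simp [t_zero, bary, coordDer_X]
  · simp [t_succ, bary, coordDer_X]

/-- Restriction of functions to the face `t_j = 0`. -/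
def face (j : Fin (n + 2)) : SimplexRing K (n + 1) →ₐ[K] SimplexRing K n :=
  MvPolynomial.aeval fun i => j.insertNth (α := fun _ => SimplexRing K n) 0 (t K) i.succ

/-- The map is prescribed on `t_1, t_2, …` only. For `t_0` the value follows because the barycentric
coordinates add up to `1` on the simplex and on its face. -/
theorem face_t (j i : Fin (n + 2)) :
    face K j (t K i) = j.insertNth (α := fun _ => SimplexRing K n) 0 (t K) i := by
  have hX : ∀ i, face K j (MvPolynomial.X i) =
      j.insertNth (α := fun _ => SimplexRing K n) 0 (t K) i.succ := fun i =>
    MvPolynomial.aeval_X _ _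
  refine Fin.cases ?_ (fun i => hX i) i
  rw [t_zero, map_sub, map_one, map_sum]
  simp only [hX]
  rw [sub_eq_iff_eq_add, ← Fin.sum_univ_succ
    (f := j.insertNth (α := fun _ => SimplexRing K n) 0 (t K)), Fin.sum_univ_succAbove _ j]
  simp [sum_t]

theorem face_t_self (j : Fin (n + 2)) : face K j (t K j) = 0 := by
  rw [face_t, Fin.insertNth_apply_same]

theorem face_t_succAbove (j : Fin (n + 2)) (i : Fin (n + 1)) :
    face K j (t K (j.succAbove i)) = t K i := by
  rw [face_t, Fin.insertNth_apply_succAbove]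

/-- The image of a constant vector field under the inclusion of the face `t_j = 0`. -/
def faceTan (j : Fin (n + 2)) (c : Fin n → K) : Fin (n + 1) → K := fun i =>
  j.insertNth (α := fun _ => K) 0 (bary K c) i.succ

theorem faceTan_zero (j : Fin (n + 2)) : faceTan K j (0 : Fin n → K) = 0 := by
  have h : ∀ m, j.insertNth (α := fun _ => K) 0 (bary K (0 : Fin n → K)) m = 0 := by
    intro m
    refine j.succAboveCases ?_ (fun k => ?_) m
    · rw [Fin.insertNth_apply_same]
    · rw [Fin.insertNth_apply_succAbove, bary]
      refine Fin.cases (by simp) (fun _ => by simp) k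
  exact funext fun i => h _

/-- Both sides satisfy the Leibniz rule along the restriction to the face, so the variables decide.
There both are constants, namely the components of the vector field in the ambient simplex. -/
theorem face_coordDer (j : Fin (n + 2)) (c : Fin n → K) (f : SimplexRing K (n + 1)) :
    face K j (coordDer K (faceTan K j c) f) = coordDer K c (face K j f) := by
  have h : ∀ m, coordDer K c (j.insertNth (α := fun _ => SimplexRing K n) 0 (t K) m) =
      MvPolynomial.C (j.insertNth (α := fun _ => K) 0 (bary K c) m) := by
    intro m
    refine j.succAboveCases ?_ (fun k => ?_) m
    · rw [Fin.insertNth_apply_same, Fin.insertNth_apply_same, map_zero, map_zero]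
    · rw [Fin.insertNth_apply_succAbove, Fin.insertNth_apply_succAbove, coordDer_t]
  induction f using MvPolynomial.induction_on with
  | C a => simp [← MvPolynomial.algebraMap_eq]
  | add f g hf hg => simp only [map_add, hf, hg]
  | mul_X f i hf =>
    have hX : face K j (MvPolynomial.X i) =
      j.insertNth (α := fun _ => SimplexRing K n) 0 (t K) i.succ := MvPolynomial.aeval_X _ _
    have hC : face K j (MvPolynomial.C (faceTan K j c i)) = MvPolynomial.C (faceTan K j c i) :=
      AlgHom.commutes _ _
    simp only [Derivation.leibniz, coordDer_X, smul_eq_mul, map_add, map_mul, hf, hX, hC, h]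
    rfl
end SimplexRing

/-! ### Integrals of polynomials and the boundary formula on the simplex. -/

namespace SimplexRing
variable (K : Type*) [Field K] [CharZero K] {n : ℕ}

theorem integral_monomial (s : Fin n →₀ ℕ) : integral K n (MvPolynomial.monomial s 1) =
    (∏ i, ((s i).factorial : K)) / ((n + ∑ i, s i).factorial : K) := by
  rw [integral]
  have := Module.Basis.constr_basis (MvPolynomial.basisMonomials (Fin n) K) K
    (fun s : Fin n →₀ ℕ => (∏ i, ((s i).factorial : K)) / ((n + ∑ i, s i).factorial : K)) s
  rwa [MvPolynomial.coe_basisMonomials] at this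

theorem prod_factorial_add_single (s : Fin n →₀ ℕ) (i : Fin n) :
    ∏ k, (((s + Finsupp.single i 1 : Fin n →₀ ℕ) k).factorial : K) =
      (s i + 1 : K) * ∏ k, ((s k).factorial : K) := by
  rw [← Finset.mul_prod_erase _ _ (Finset.mem_univ i),
    ← Finset.mul_prod_erase Finset.univ (fun k => ((s k).factorial : K)) (Finset.mem_univ i),
    ← mul_assoc]
  refine congrArg₂ _ ?_ (Finset.prod_congr rfl fun k hk => ?_)
  · simp [Nat.factorial_succ]
  · simp [(Finset.ne_of_mem_erase hk).symm]

theorem sum_add_single (s : Fin n →₀ ℕ) (i : Fin n) :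
    ∑ k, (s + Finsupp.single i 1 : Fin n →₀ ℕ) k = ∑ k, s k + 1 := by
  simp [Finset.sum_add_distrib]

/-- This shows that the integral is symmetric in all barycentric coordinates, `t_0` included. The
induction uses `t_0^(a+1) = t_0^a (1 - ∑ t_i)`; with `N = n + a + ∑ s_i` the coefficients combine
through `N + 1 - ∑ (s_i + 1) = a + 1`. -/
theorem integral_t_zero_pow (a : ℕ) (s : Fin n →₀ ℕ) :
    integral K n (t K 0 ^ a * MvPolynomial.monomial s 1) =
      (a.factorial * ∏ i, ((s i).factorial : K)) / ((n + a + ∑ i, s i).factorial : K) := by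
  induction a generalizing s with
  | zero => simp [integral_monomial]
  | succ a ih =>
    have e : t K 0 ^ (a + 1) * MvPolynomial.monomial s 1 = t K 0 ^ a * MvPolynomial.monomial s 1 -
        ∑ i, t K 0 ^ a * MvPolynomial.monomial (s + Finsupp.single i 1) (1 : K) := by
      have h : ∀ i : Fin n, MvPolynomial.monomial (s + Finsupp.single i 1) (1 : K) =
          MvPolynomial.X i * MvPolynomial.monomial s 1 := fun i => by
        rw [MvPolynomial.X, MvPolynomial.monomial_mul, one_mul, add_comm]
      simp only [h]
      rw [← Finset.mul_sum, ← Finset.sum_mul, pow_succ]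
      nth_rewrite 2 [t_zero]
      ring
    rw [e, map_sub, map_sum, ih]
    have h2 : ∀ i : Fin n, integral K n
        (t K 0 ^ a * MvPolynomial.monomial (s + Finsupp.single i 1) (1 : K)) =
        (s i + 1 : K) * ((a.factorial * ∏ i, ((s i).factorial : K)) /
          ((n + a + ∑ i, s i + 1).factorial : K)) := fun i => by
      rw [ih, prod_factorial_add_single, sum_add_single, ← add_assoc]; ring
    simp only [h2]
    rw [← Finset.sum_mul, Finset.sum_add_distrib,
      show n + (a + 1) + ∑ i, s i = n + a + ∑ i, s i + 1 by ring]
    have h3 : ((n + a + ∑ i, s i).factorial : K) ≠ 0 := Nat.cast_ne_zero.mpr (Nat.factorial_ne_zero _)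
    have h4 : ((n + a + ∑ i, s i + 1 : ℕ) : K) ≠ 0 := Nat.cast_ne_zero.mpr (Nat.succ_ne_zero _)
    rw [Nat.factorial_succ (n + a + ∑ i, s i), Nat.factorial_succ a]
    push_cast at h4 ⊢
    simp only [Finset.sum_const, Finset.card_univ, Fintype.card_fin, nsmul_eq_mul, mul_one]
    field_simp
    ring

/-- Along the direction of `t_{i+1}`, with the other variables fixed, the simplex extends from the
face `t_{i+1} = 0` to the face `t_0 = 0`. For a monomial without that variable the derivative is
zero and both face integrals agree; otherwise the face `t_{i+1} = 0` contributes nothing. -/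
theorem integral_coordDer (i : Fin (n + 1)) (f : SimplexRing K (n + 1)) :
    integral K (n + 1) (coordDer K (Pi.single i 1) f) =
      integral K n (face K 0 f) - integral K n (face K i.succ f) := by
  induction f using MvPolynomial.induction_on' with
  | add f g hf hg => simp only [map_add, hf, hg]; ring
  | monomial s c =>
    have hc : MvPolynomial.monomial s c = c • MvPolynomial.monomial s (1 : K) := by
      rw [MvPolynomial.smul_monomial, smul_eq_mul, mul_one]
    rw [hc]
    simp only [map_smul, Derivation.map_smul]
    rw [← smul_sub]
    congr 1
    have hmon : MvPolynomial.monomial s (1 : K) = ∏ k, MvPolynomial.X k ^ s k := by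
      rw [MvPolynomial.monomial_eq, Finsupp.prod_fintype _ _ fun _ => pow_zero _]; simp
    have hmon' : ∀ u : Fin n →₀ ℕ, MvPolynomial.monomial u (1 : K) = ∏ k, MvPolynomial.X k ^ u k :=
      fun u => by
        rw [MvPolynomial.monomial_eq, Finsupp.prod_fintype _ _ fun _ => pow_zero _]; simp
    have h0 : integral K n (face K 0 (MvPolynomial.monomial s 1)) =
        (∏ k, ((s k).factorial : K)) / ((n + ∑ k, s k).factorial : K) := by
      let u : Fin n →₀ ℕ := Finsupp.equivFunOnFinite.symm fun k => s k.succ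
      -- On the face `t_0 = 0` the first variable becomes the eliminated coordinate `t_0` of the
      -- face, hence the need for the integral with powers of `t_0`.
      have e : face K 0 (MvPolynomial.monomial s (1 : K)) =
          t K 0 ^ s 0 * MvPolynomial.monomial u 1 := by
        rw [hmon, map_prod, hmon', Fin.prod_univ_succ]
        refine congrArg₂ _ ?_ (Finset.prod_congr rfl fun k _ => ?_)
        · rw [map_pow, ← t_succ]
          exact congrArg (· ^ _) (face_t_succAbove K 0 0)
        · rw [map_pow, ← t_succ]
          exact congrArg (· ^ _) (face_t_succAbove K 0 k.succ)
      rw [e, integral_t_zero_pow, Fin.prod_univ_succ, Fin.sum_univ_succ, add_assoc]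
      rfl
    rw [h0, coordDer_single, MvPolynomial.pderiv_monomial]
    by_cases hs : s i = 0
    · let u : Fin n →₀ ℕ := Finsupp.equivFunOnFinite.symm fun k => s (i.succAbove k)
      have e : face K i.succ (MvPolynomial.monomial s (1 : K)) = MvPolynomial.monomial u 1 := by
        rw [hmon, map_prod, hmon', Fin.prod_univ_succAbove _ i, hs, pow_zero, map_one, one_mul]
        refine Finset.prod_congr rfl fun k _ => ?_
        rw [map_pow, ← t_succ, ← Fin.succ_succAbove_succ, face_t_succAbove, t_succ]
        rfl
      rw [e, integral_monomial, Fin.prod_univ_succAbove _ i, Fin.sum_univ_succAbove _ i, hs]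
      simp [u]
    · have e : face K i.succ (MvPolynomial.monomial s (1 : K)) = 0 := by
        rw [hmon, map_prod]
        refine Finset.prod_eq_zero (Finset.mem_univ i) ?_
        rw [map_pow, ← t_succ, face_t_self, zero_pow hs]
      rw [e, map_zero, sub_zero]
      obtain ⟨u, hu⟩ : ∃ u, s = u + Finsupp.single i 1 := by
        refine ⟨s - Finsupp.single i 1, (tsub_add_cancel_of_le ?_).symm⟩
        rw [Finsupp.single_le_iff]; omega
      have hmul : MvPolynomial.monomial (s - Finsupp.single i 1) (1 * (s i : K)) =
          (u i + 1 : K) • MvPolynomial.monomial u (1 : K) := by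
        rw [hu, add_tsub_cancel_right, MvPolynomial.smul_monomial]; simp
      rw [hmul, map_smul, integral_monomial, hu, prod_factorial_add_single, sum_add_single,
        smul_eq_mul, mul_div_assoc, show n + 1 + ∑ k, u k = n + (∑ k, u k + 1) by ring]
end SimplexRing

theorem map_neg_one_pow_mul {A B : Type*} [Ring A] [Ring B] (f : A →+ B) (k : ℕ) (x : A) :
    f ((-1) ^ k * x) = (-1) ^ k * f x := by
  rcases Nat.even_or_odd k with hk | hk
  · simp only [hk.neg_one_pow, one_mul]
  · simp only [hk.neg_one_pow, neg_one_mul, map_neg]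

/-! ### Fibre integration and Stokes' theorem. -/

section Integral
open Cochain SimplexRing
variable {K : Type*} {O M : Type*} [Field K] [CommRing O] [Algebra K O] [LieRing M]
  [LieRingModule M O]

variable (K O) in
/-- Integration over the simplex with coefficients in `O`. -/
def simplexIntegral (n : ℕ) : SimplexRing K n ⊗[K] O →ₗ[K] O :=
  (TensorProduct.lid K O).toLinearMap ∘ₗ LinearMap.rTensor O (SimplexRing.integral K n)

theorem simplexIntegral_tmul {n : ℕ} (f : SimplexRing K n) (g : O) :
    simplexIntegral K O n (f ⊗ₜ g) = integral K n f • g := rfl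

theorem simplexIntegral_lie [DerAct K O M] {n : ℕ} (X : M) (F : SimplexRing K n ⊗[K] O) :
    simplexIntegral K O n ⁅Prism.incl K n X, F⁆ = ⁅X, simplexIntegral K O n F⁆ := by
  induction F with
  | zero => simp
  | add F G hF hG => simp only [lie_add, map_add, hF, hG]
  | tmul f g =>
    simp only [prism_lie_tmul, Prism.incl, Prism.mk_fst, Prism.mk_snd, coordDer_zero,
      Derivation.zero_apply, TensorProduct.zero_tmul, zero_add, simplexIntegral_tmul]
    exact (DerAct.lie_smul' X _ g).symm

theorem simplexIntegral_mul {n : ℕ} (g : O) (F : SimplexRing K n ⊗[K] O) :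
    simplexIntegral K O n (F * (1 ⊗ₜ g)) = simplexIntegral K O n F * g := by
  induction F with
  | zero => simp
  | add F G hF hG => simp only [add_mul, map_add, hF, hG]
  | tmul f h =>
    rw [Algebra.TensorProduct.tmul_mul_tmul, simplexIntegral_tmul, simplexIntegral_tmul, mul_one,
      smul_mul_assoc]

theorem simplexIntegral_lie_single [CharZero K] [DerAct K O M] {n : ℕ} (i : Fin (n + 1))
    (F : SimplexRing K (n + 1) ⊗[K] O) :
    simplexIntegral K O (n + 1) ⁅Prism.mk (0 : M) (Pi.single i (1 : K)), F⁆ =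
      simplexIntegral K O n (Algebra.TensorProduct.map (face K 0) (AlgHom.id K O) F) -
      simplexIntegral K O n (Algebra.TensorProduct.map (face K i.succ) (AlgHom.id K O) F) := by
  induction F with
  | zero => simp
  | add F G hF hG => simp only [lie_add, map_add, hF, hG]; ring
  | tmul f g =>
    rw [prism_lie_tmul, Prism.mk_fst, Prism.mk_snd, zero_lie, TensorProduct.tmul_zero, add_zero,
      simplexIntegral_tmul, integral_coordDer, sub_smul]
    rfl

/-- Integration of forms over the simplex. -/
def fiberInt (n : ℕ) (ω : Cochain (SimplexRing K n ⊗[K] O) (Prism K M n)) : Cochain O M :=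
  fun X => simplexIntegral K O n (ω (Prism.frame K M n ++ X.map (Prism.incl K n)))

variable (K O M) in
/-- The inclusion of the face `t_j = 0`. -/
def faceMorph [DerAct K O M] {n : ℕ} (j : Fin (n + 2)) :
    Morph K (SimplexRing K (n + 1) ⊗[K] O) (Prism K M (n + 1)) (SimplexRing K n ⊗[K] O)
      (Prism K M n) (Prism K M n) where
  φ := Algebra.TensorProduct.map (face K j) (AlgHom.id K O)
  α x := Prism.mk x.1 (faceTan K j x.2)
  β x := x
  α_lie x y := Prism.ext rfl (faceTan_zero K j)
  β_lie _ _ := rfl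
  φ_lie x F := by
    induction F with
    | zero => simp
    | add F G hF hG => simp only [lie_add, map_add, hF, hG]
    | tmul f g => simp [prism_lie_tmul, Prism.mk_fst, Prism.mk_snd, face_coordDer]

theorem eraseIdx_ofFn {α : Type*} {n : ℕ} (f : Fin (n + 1) → α) (j : Fin (n + 1)) :
    (List.ofFn f).eraseIdx j = List.ofFn (f ∘ j.succAbove) := by
  induction n with
  | zero => obtain rfl := Fin.fin_one_eq_zero j; simp
  | succ n ih =>
    refine Fin.cases ?_ (fun j => ?_) j
    · rw [List.ofFn_succ]; simp
    · rw [List.ofFn_succ, Fin.val_succ, List.eraseIdx_cons_succ, ih, List.ofFn_succ (n := n)]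
      congr 1
      congr 1
      funext k
      simp

theorem reverse_ofFn {α : Type*} {n : ℕ} (f : Fin n → α) :
    (List.ofFn f).reverse = List.ofFn (f ∘ Fin.rev) := by
  refine List.ext_getElem (by simp) fun i h₁ h₂ => ?_
  simp only [List.getElem_reverse, List.getElem_ofFn, List.length_ofFn, Function.comp_apply]
  congr 1
  ext
  simp [Fin.rev]
  omega

theorem getElem_reverse_ofFn {α : Type*} {n : ℕ} (f : Fin (n + 1) → α) {k : ℕ}
    (h : k < (List.ofFn f).reverse.length) {i : Fin (n + 1)} (hi : (i : ℕ) = n - k) :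
    (List.ofFn f).reverse[k] = f i := by
  rw [List.getElem_reverse, List.getElem_ofFn]
  refine congrArg f (Fin.ext ?_)
  simp [hi]

theorem eraseIdx_reverse_ofFn {α : Type*} {n : ℕ} (f : Fin (n + 1) → α) (k : Fin (n + 1)) :
    (List.ofFn f).reverse.eraseIdx k = (List.ofFn (f ∘ k.rev.succAbove)).reverse := by
  rw [reverse_ofFn, eraseIdx_ofFn, reverse_ofFn]
  congr 1
  funext i
  simp [Fin.rev_succAbove]

variable [CharZero K]

theorem faceTan_succ_single {n : ℕ} (j : Fin (n + 1)) (i : Fin n) :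
    faceTan K j.succ (Pi.single i 1) = Pi.single (j.succAbove i) 1 := by
  funext m
  refine j.succAboveCases ?_ (fun k => ?_) m
  · rw [faceTan, Fin.insertNth_apply_same, Pi.single_eq_of_ne (Fin.succAbove_ne j i).symm]
  · rw [faceTan, ← Fin.succ_succAbove_succ, Fin.insertNth_apply_succAbove, bary, Fin.cons_succ]
    by_cases h : k = i
    · subst h; simp
    · rw [Pi.single_eq_of_ne h, Pi.single_eq_of_ne]
      exact fun h' => h (Fin.succAbove_right_injective h')

theorem faceTan_zero_single {n : ℕ} (i : Fin n) :
    faceTan K 0 (Pi.single i 1) = Pi.single i.succ 1 - Pi.single 0 1 := by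
  funext m
  have : faceTan K 0 (Pi.single i 1) m = bary K (Pi.single i 1) m :=
    Fin.insertNth_apply_succAbove (α := fun _ => K) 0 0 (bary K (Pi.single i 1)) m
  rw [this, bary]
  refine Fin.cases ?_ (fun k => ?_) m
  · simp [Fin.succ_ne_zero]
  · by_cases h : k = i
    · subst h; simp [Fin.succ_ne_zero]
    · simp [h, Fin.succ_ne_zero]

variable (K M) in
/-- The coordinate vector fields without `∂_{j+1}`. -/
def eraseFrame {n : ℕ} (j : Fin (n + 1)) : List (Prism K M (n + 1)) :=
  (List.ofFn ((fun i => Prism.mk (0 : M) (Pi.single i (1 : K))) ∘ j.succAbove)).reverse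

theorem map_frame_succ [DerAct K O M] {n : ℕ} (j : Fin (n + 1)) :
    (Prism.frame K M n).map (faceMorph K O M j.succ).α = eraseFrame K M j := by
  rw [Prism.frame, eraseFrame, List.map_reverse, List.map_ofFn]
  congr 2
  funext i
  exact congrArg (Prism.mk (0 : M)) (faceTan_succ_single j i)

/-- On the face `t_0 = 0` the remaining coordinates have sum `1`, so the coordinate fields of the
face are the differences `∂_j - ∂_1` with `j ≥ 2`. -/
theorem map_frame_zero [DerAct K O M] {n : ℕ} :
    (Prism.frame K M n).map (faceMorph K O M 0).α =
      (eraseFrame K M (0 : Fin (n + 1))).map (· - Prism.mk (0 : M) (Pi.single 0 (1 : K))) := by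
  rw [Prism.frame, eraseFrame, List.map_reverse, List.map_reverse, List.map_ofFn, List.map_ofFn]
  congr 2
  funext i
  exact Prism.ext (sub_zero (0 : M)).symm (faceTan_zero_single i)

/-- Frames are listed as `∂_n, …, ∂_1`, so the field `∂_1` belongs at the end, and positions counted
from the left correspond to reversed indices. -/
theorem eraseFrame_zero_erase {n : ℕ} (k : Fin (n + 1)) :
    (eraseFrame K M (0 : Fin (n + 2))).eraseIdx k ++ [Prism.mk (0 : M) (Pi.single 0 (1 : K))] =
      eraseFrame K M k.rev.succ := by
  rw [eraseFrame, eraseIdx_reverse_ofFn, eraseFrame, List.ofFn_succ (n := n), List.reverse_cons]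
  congr 2
  · congr 2
    funext i
    simp

/-- When `ω` is expanded on the differences `∂_j - ∂_1`, terms with `∂_1` twice vanish and the
others are coordinate frames with one field missing. The face `t_0 = 0` is thereby spread over all
directions, as the boundary formula for each `∂_j` requires. -/
theorem alt_faces [DerAct K O M] {n : ℕ}
    {ω : Cochain (SimplexRing K (n + 1) ⊗[K] O) (Prism K M (n + 1))} (hω : IsAlt ω)
    (X : List (Prism K M (n + 1))) :
    ω ((Prism.frame K M n).map (faceMorph K O M 0).α ++ X) =
      ∑ j : Fin (n + 1), (-1) ^ (j : ℕ) * ω (eraseFrame K M j ++ X) := by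
  rw [map_frame_zero, hω.map_sub_right, Fin.sum_univ_succ]
  have hlen : (eraseFrame K M (0 : Fin (n + 1))).length = n :=
    (List.length_reverse).trans (List.length_ofFn)
  rw [hlen, Fin.val_zero, pow_zero, one_mul, sub_eq_add_neg, ← Finset.sum_neg_distrib]
  congr 1
  rcases n with _ | n
  · simp
  rw [Finset.sum_range, ← Equiv.sum_comp Fin.revPerm]
  refine Finset.sum_congr rfl fun k _ => ?_
  have h := eraseFrame_zero_erase (K := K) (M := M) (Fin.rev k)
  rw [Fin.rev_rev] at h
  rw [Fin.revPerm_apply, ← h, List.append_assoc, Fin.val_succ, pow_succ,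
    show n + 1 - 1 - (Fin.rev k : ℕ) = k by rw [Fin.val_rev]; omega]
  simp only [List.cons_append, List.nil_append]
  ring

/-- Stokes' theorem for the integration over the fibre. -/
theorem d_fiberInt [DerAct K O M] {n : ℕ}
    {ω : Cochain (SimplexRing K (n + 1) ⊗[K] O) (Prism K M (n + 1))} (hω : IsAlt ω) :
    d (fiberInt (n + 1) ω) = (-1) ^ (n + 1) * fiberInt (n + 1) (d ω) +
      ∑ j : Fin (n + 2), (-1) ^ (j : ℕ) *
        fiberInt n (pull (faceMorph K O M j).φ (faceMorph K O M j).α ω) := by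
  refine ext' fun X => ?_
  let ev : Cochain O M →+ O := ⟨⟨fun η => η X, rfl⟩, fun _ _ => rfl⟩
  have hsign : ∀ (k : ℕ) (η : Cochain O M), ev ((-1) ^ k * η) = (-1) ^ k * ev η :=
    map_neg_one_pow_mul ev
  have hsign' : ∀ (k : ℕ) (F : SimplexRing K (n + 1) ⊗[K] O),
      simplexIntegral K O (n + 1) ((-1) ^ k * F) = (-1) ^ k * simplexIntegral K O (n + 1) F :=
    fun k F => map_neg_one_pow_mul (simplexIntegral K O (n + 1)).toAddMonoidHom k F
  have hsign'' : ∀ (k : ℕ) (F : SimplexRing K (n + 1) ⊗[K] O),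
      simplexIntegral K O n ((faceMorph K O M 0).φ ((-1) ^ k * F)) =
        (-1) ^ k * simplexIntegral K O n ((faceMorph K O M 0).φ F) :=
    fun k F => map_neg_one_pow_mul ((simplexIntegral K O n).toAddMonoidHom.comp
      (faceMorph K O M 0).φ.toRingHom.toAddMonoidHom) k F
  change ev (d (fiberInt (n + 1) ω)) = ev ((-1) ^ (n + 1) * fiberInt (n + 1) (d ω) +
      ∑ j : Fin (n + 2), (-1) ^ (j : ℕ) *
        fiberInt n (pull (faceMorph K O M j).φ (faceMorph K O M j).α ω))
  rw [map_add, map_sum, hsign]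
  simp only [hsign]
  let X' := X.map (Prism.incl K (n + 1))
  have hface : ∀ j, ev (fiberInt n (pull (faceMorph K O M j).φ (faceMorph K O M j).α ω)) =
      simplexIntegral K O n ((faceMorph K O M j).φ
        (ω ((Prism.frame K M n).map (faceMorph K O M j).α ++ X'))) := by
    intro j
    change simplexIntegral K O n ((faceMorph K O M j).φ (ω (List.map _ (_ ++ _)))) = _
    rw [List.map_append, List.map_map]
    refine congrArg (fun l => simplexIntegral K O n ((faceMorph K O M j).φ (ω (_ ++ l)))) ?_
    refine List.map_congr_left fun Y _ => ?_
    exact congrArg (Prism.mk Y) (faceTan_zero K j)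
  -- The coordinate fields commute with everything in the list, so `dω` on the frame splits into
  -- derivatives along the `∂_j` and the differential in the base directions.
  have hcartan := hω.d_append (Prism.frame K M (n + 1)) X' ?_
  swap
  · intro u hu w _
    rw [Prism.frame, List.mem_reverse, List.mem_ofFn] at hu
    obtain ⟨i, rfl⟩ := hu
    exact Prism.ext (zero_lie w.1) rfl
  -- Contraction with the frame followed by integration is additive and commutes with the action of
  -- the base, so it commutes with `d` there.
  have hrel : Cochain.Rel (simplexIntegral K O (n + 1)).toAddMonoidHom (Prism.incl K (n + 1)) id
      (fun l => ω (Prism.frame K M (n + 1) ++ l)) (fiberInt (n + 1) ω) := fun l => by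
    rw [List.map_id]; rfl
  have hd := hrel.d_of_add (fun _ _ => rfl) (fun _ _ => rfl) (fun Y F => simplexIntegral_lie Y F) X
  rw [List.map_id] at hd
  have hlen : (Prism.frame K M (n + 1)).length = n + 1 := Prism.length_frame
  -- The frame is in descending order, so position `k` carries the index `n - k`; this is the origin
  -- of the exponent `n - j`.
  have hsum : ∑ k : Fin (Prism.frame K M (n + 1)).length, (-1) ^ (k : ℕ) *
      ⁅(Prism.frame K M (n + 1))[k], ω ((Prism.frame K M (n + 1)).eraseIdx k ++ X')⁆ =
      ∑ j : Fin (n + 1), (-1) ^ (n - j : ℕ) *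
        ⁅Prism.mk (0 : M) (Pi.single j (1 : K)), ω (eraseFrame K M j ++ X')⁆ := by
    refine Fintype.sum_equiv ((finCongr hlen).trans Fin.revPerm) _ _ fun k => ?_
    have h1 : ((((finCongr hlen).trans Fin.revPerm) k : Fin (n + 1)) : ℕ) = n - k := by
      simp only [Equiv.trans_apply, Fin.revPerm_apply, Fin.val_rev, finCongr_apply, Fin.val_cast]
      omega
    have h2 : (k : ℕ) < n + 1 := by have := k.2; omega
    have h3 : (Prism.frame K M (n + 1)).eraseIdx k =
        eraseFrame K M (((finCongr hlen).trans Fin.revPerm) k) :=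
      eraseIdx_reverse_ofFn _ (⟨k, h2⟩ : Fin (n + 1))
    have h4 : (Prism.frame K M (n + 1))[k] = Prism.mk (0 : M)
        (Pi.single (((finCongr hlen).trans Fin.revPerm) k) (1 : K)) :=
      getElem_reverse_ofFn (fun j => Prism.mk (0 : M) (Pi.single j (1 : K))) k.2 h1
    rw [h1, h3, h4, show n - (n - (k : ℕ)) = k by omega]
  rw [hsum, hlen] at hcartan
  have hI := congrArg (simplexIntegral K O (n + 1)) hcartan
  rw [map_add, map_sum, hsign'] at hI
  simp only [hsign', simplexIntegral_lie_single] at hI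
  have hd' : ev (d (fiberInt (n + 1) ω)) = simplexIntegral K O (n + 1)
      (Cochain.d (fun l => ω (Prism.frame K M (n + 1) ++ l) : Cochain _ _) X') := hd.symm
  have hI' : ev (fiberInt (n + 1) (d ω)) = simplexIntegral K O (n + 1)
      (d ω (Prism.frame K M (n + 1) ++ X')) := rfl
  rw [Fin.sum_univ_succ]
  simp only [hface, map_frame_succ, alt_faces hω, map_sum, hsign'']
  rw [← hd', ← hI'] at hI
  rw [hI]
  have hs : ∀ j : Fin (n + 1), (-1 : O) ^ (n + 1) * (-1) ^ (n - j : ℕ) = (-1) ^ ((j : ℕ) + 1) := by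
    intro j
    rw [← pow_add, show n + 1 + (n - j : ℕ) = (j + 1) + 2 * (n - j) by omega, pow_add _ _ (2 * _),
      pow_mul, neg_one_sq, one_pow, mul_one]
  have hs2 : (-1 : O) ^ (n + 1) * (-1) ^ (n + 1) = 1 := by
    rw [← mul_pow, neg_one_mul, neg_neg, one_pow]
  rw [mul_add, ← mul_assoc, hs2, one_mul, Finset.mul_sum]
  simp only [← mul_assoc, hs, Fin.val_succ, Fin.val_zero, pow_zero, one_mul]
  -- For each `j` the two boundary values of the derivative cancel separately: one against the
  -- `j`-th term of the expanded face `t_0 = 0`, the other against the face `t_{j+1} = 0`.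
  rw [add_right_comm, ← Finset.sum_add_distrib, ← Finset.sum_add_distrib,
    Finset.sum_eq_zero, zero_add]
  intro j _
  change _ * (simplexIntegral K O n ((faceMorph K O M 0).φ _) -
    simplexIntegral K O n ((faceMorph K O M j.succ).φ _)) + (_ + _) = 0
  rw [pow_succ]
  ring

theorem d_fiberInt_zero [DerAct K O M] (ω : Cochain (SimplexRing K 0 ⊗[K] O) (Prism K M 0)) :
    d (fiberInt 0 ω) = fiberInt 0 (d ω) := by
  refine ext' fun X => ?_
  have hrel : Cochain.Rel (simplexIntegral K O 0).toAddMonoidHom (Prism.incl K 0) id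
      ω (fiberInt 0 ω) := fun l => by rw [List.map_id]; rfl
  have hd := hrel.d_of_add (fun _ _ => rfl) (fun _ _ => rfl) (fun Y F => simplexIntegral_lie Y F) X
  rw [List.map_id] at hd
  exact hd.symm
end Integral

namespace Morph
open Cochain
variable {K A G A' G' Λ : Type*} [Field K] [CommRing A] [CommRing A'] [Algebra K A] [Algebra K A']
  [LieRing G] [LieRing G'] [LieRing Λ] [LieRingModule G A] [LieRingModule G' A']

theorem Rel.pull_eq {m : Morph K A G A' G' G'} (hm : ∀ x, m.β x = x) {a : Cochain A G}
    {a' : Cochain A' G'} (h : m.Rel a a') : pull m.φ m.α a = a' := funext fun l => by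
  have := h l
  rwa [List.map_congr_left fun x _ => hm x, List.map_id'] at this

theorem rel_pull {m : Morph K A G A' G' G'} (hm : ∀ x, m.β x = x) (a : Cochain A G) :
    m.Rel a (pull m.φ m.α a) := fun l => by
  rw [List.map_congr_left fun x _ => hm x, List.map_id']; rfl
end Morph

namespace Cochain

theorem IsAlt.pull {A A' G Λ : Type*} [CommRing A] [CommRing A'] [AddCommGroup G] [AddCommGroup Λ]
    (φ : A →+ A') {α : Λ → G} (hα : ∀ X Y, α (X + Y) = α X + α Y) {a : Cochain A G}
    (ha : IsAlt a) : IsAlt (pull φ α a) := by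
  refine ⟨fun l₁ X Y l₂ => ?_, fun l₁ X l₂ => ?_⟩
  · simp only [Cochain.pull, List.map_append, List.map_cons, hα, ha.map_add, _root_.map_add]
  · simp only [Cochain.pull, List.map_append, List.map_cons, ha.alternating, map_zero]

theorem Deg.pull {A A' G Λ : Type*} [CommRing A] [CommRing A'] (φ : A →+ A') {α : Λ → G} {p : ℕ}
    {a : Cochain A G} (ha : Deg p a) : Deg p (pull φ α a) := fun l hl => by
  rw [Cochain.pull, ha _ (by rwa [List.length_map]), map_zero]

/-! ### Pullback to the product with a simplex, total connections and characteristic forms. -/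

section Lift
variable {K O M : Type*} [Field K] [CommRing O] [Algebra K O] [LieRing M] [LieRingModule M O]
  [DerAct K O M]

variable (K) in
/-- The pullback to the product with a simplex. -/
def lift (n : ℕ) (a : Cochain O M) : Cochain (SimplexRing K n ⊗[K] O) (Prism K M n) :=
  pull (Morph.base K O M n).φ (Morph.base K O M n).α a

theorem lift_rel (n : ℕ) (a : Cochain O M) : (Morph.base K O M n).Rel a (lift K n a) :=
  Morph.rel_pull (fun _ => rfl) a

/-- The projection is the identity on the index side, so a related cochain is determined. Each
compatibility of `lift` thereby becomes a closure property of `Rel`. -/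
theorem lift_eq {n : ℕ} {a : Cochain O M} {a' : Cochain (SimplexRing K n ⊗[K] O) (Prism K M n)}
    (h : (Morph.base K O M n).Rel a a') : lift K n a = a' := h.pull_eq fun _ => rfl

theorem lift_add (n : ℕ) (a b : Cochain O M) : lift K n (a + b) = lift K n a + lift K n b :=
  lift_eq ((lift_rel n a).add (lift_rel n b))
theorem lift_mul (n : ℕ) (a b : Cochain O M) : lift K n (a * b) = lift K n a * lift K n b :=
  lift_eq ((lift_rel n a).mul (lift_rel n b))
theorem lift_sgn (n : ℕ) (a : Cochain O M) : lift K n (sgn a) = sgn (lift K n a) :=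
  lift_eq (lift_rel n a).sgn
theorem lift_d (n : ℕ) (a : Cochain O M) : lift K n (d a) = d (lift K n a) :=
  lift_eq (lift_rel n a).d
theorem lift_const (n : ℕ) (f : O) :
    lift K n (const f : Cochain O M) = const (1 ⊗ₜ f) := lift_eq (Morph.Rel.const rfl)
theorem lift_sum {ι : Type*} (n : ℕ) (s : Finset ι) (a : ι → Cochain O M) :
    lift K n (∑ i ∈ s, a i) = ∑ i ∈ s, lift K n (a i) :=
  lift_eq (Morph.Rel.sum s fun i _ => lift_rel n (a i))
theorem lift_isAlt {n : ℕ} {a : Cochain O M} (h : IsAlt a) : IsAlt (lift K n a) :=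
  h.pull ((Morph.base K O M n).φ : O →+ SimplexRing K n ⊗[K] O) fun _ _ => rfl
theorem lift_deg {n p : ℕ} {a : Cochain O M} (h : Deg p a) : Deg p (lift K n a) :=
  h.pull ((Morph.base K O M n).φ : O →+ SimplexRing K n ⊗[K] O)
theorem lift_even {n : ℕ} {a : Cochain O M} (h : sgn a = a) : sgn (lift K n a) = lift K n a := by
  rw [← lift_sgn, h]

theorem lift_polyEval {n r : ℕ} (R : Fin r → Fin r → Cochain O M)
    (P : MvPolynomial (Fin r × Fin r) K) :
    lift K n (polyEval P R) = polyEval P fun a b => lift K n (R a b) :=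
  lift_eq (Morph.Rel.polyEval (fun a b => lift_rel n (R a b)) P)

theorem lift_curv {n r : ℕ} (θ : Matrix (Fin r) (Fin r) (Cochain O M)) (a b : Fin r) :
    lift K n (curv θ a b) = curv (θ.map (lift K n)) a b :=
  lift_eq (Morph.Rel.curv (θ' := θ.map (lift K n)) (fun a b => lift_rel n (θ a b)) a b)

theorem IsConn.lift {n r : ℕ} {θ : Matrix (Fin r) (Fin r) (Cochain O M)} (h : IsConn θ) :
    IsConn (θ.map (lift K n)) := fun a b => ⟨lift_deg (h a b).1, lift_isAlt (h a b).2⟩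

theorem lift_prism_rel {A' G' Λ : Type*} [CommRing A'] [Algebra K A'] [LieRing G'] [LieRing Λ]
    [LieRingModule G' A'] [DerAct K A' G'] {m : Morph K O M A' G' Λ} (n : ℕ) {a : Cochain O M}
    {a' : Cochain A' G'} (h : m.Rel a a') : (m.prism n).Rel (lift K n a) (lift K n a') := by
  intro l
  have h' := h (l.map fun x => x.1)
  have e₁ : (l.map (m.prism n).α).map (Morph.base K O M n).α = (l.map fun x => x.1).map m.α := by
    rw [List.map_map, List.map_map]; rfl
  have e₂ : (l.map (m.prism n).β).map (Morph.base K A' G' n).α = (l.map fun x => x.1).map m.β := by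
    rw [List.map_map, List.map_map]; rfl
  simp only [lift, pull, e₁, e₂, ← h']
  exact Morph.prism_φ_tmul m n 1 _

theorem lift_face_rel {n : ℕ} (j : Fin (n + 2)) (a : Cochain O M) :
    (faceMorph K O M j).Rel (lift K (n + 1) a) (lift K n a) := by
  intro l
  simp only [lift, pull, List.map_map]
  change (SimplexRing.face K j 1) ⊗ₜ _ = _
  rw [map_one]
  rfl

variable {n r : ℕ}

variable (K) in
/-- The connection matrix `∑ t_j Θ_j`. -/
def tot (Θ : Fin (n + 1) → Matrix (Fin r) (Fin r) (Cochain O M)) :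
    Matrix (Fin r) (Fin r) (Cochain (SimplexRing K n ⊗[K] O) (Prism K M n)) :=
  fun a b => ∑ j, const (SimplexRing.t K j ⊗ₜ 1) * lift K n (Θ j a b)

variable (K) in
theorem IsConn.tot {Θ : Fin (n + 1) → Matrix (Fin r) (Fin r) (Cochain O M)}
    (h : ∀ j, IsConn (Θ j)) : IsConn (tot K Θ) := fun a b => by
  constructor
  · refine Deg.sum _ fun j _ => ?_
    have := (Deg.const (SimplexRing.t K j ⊗ₜ 1)).mul (lift_deg (K := K) (n := n) (h j a b).1)
    rwa [zero_add] at this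
  · exact IsAlt.sum _ fun j _ => (IsAlt.const _).mul (lift_isAlt (h j a b).2)

theorem tot_prism_rel {A' G' Λ : Type*} [CommRing A'] [Algebra K A'] [LieRing G'] [LieRing Λ]
    [LieRingModule G' A'] [DerAct K A' G'] {m : Morph K O M A' G' Λ}
    {Θ : Fin (n + 1) → Matrix (Fin r) (Fin r) (Cochain O M)}
    {Θ' : Fin (n + 1) → Matrix (Fin r) (Fin r) (Cochain A' G')}
    (h : ∀ j a b, m.Rel (Θ j a b) (Θ' j a b)) (a b : Fin r) :
    (m.prism n).Rel (tot K Θ a b) (tot K Θ' a b) :=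
  Morph.Rel.sum _ fun j _ => (Morph.Rel.const (by rw [Morph.prism_φ_tmul, map_one])).mul
    (lift_prism_rel n (h j a b))

/-- On the face, `t_j` is zero and the other coordinates are those of the face renumbered, so
exactly the summand `Θ_j` disappears. -/
theorem tot_face_rel (j : Fin (n + 2)) (Θ : Fin (n + 2) → Matrix (Fin r) (Fin r) (Cochain O M))
    (a b : Fin r) :
    (faceMorph K O M j).Rel (tot K Θ a b) (tot K (fun i => Θ (j.succAbove i)) a b) := by
  have h : (faceMorph K O M j).Rel (tot K Θ a b) (∑ i, const
      (SimplexRing.face K j (SimplexRing.t K i) ⊗ₜ[K] (1 : O)) * lift K n (Θ i a b)) :=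
    Morph.Rel.sum _ fun i _ => (Morph.Rel.const rfl).mul (lift_face_rel j (Θ i a b))
  rw [Fin.sum_univ_succAbove _ j, SimplexRing.face_t_self, TensorProduct.zero_tmul] at h
  have h0 : (const 0 : Cochain (SimplexRing K n ⊗[K] O) (Prism K M n)) = 0 :=
    (constHom _ _).map_zero
  simp only [h0, zero_mul, zero_add, SimplexRing.face_t_succAbove] at h
  exact h

theorem const_mul_comm {A G : Type*} [CommRing A] (f : A) (a : Cochain A G) :
    const f * a = a * const f := commute_of_even (sgn_const f) a

theorem Gauge.apply {A G : Type*} [CommRing A] [LieRing G] [LieRingModule G A]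
    {g : Matrix (Fin r) (Fin r) A} {θ θ' : Matrix (Fin r) (Fin r) (Cochain A G)} :
    Gauge g θ θ' ↔ ∀ a b, ∑ c, const (g a c) * θ' c b =
      ∑ c, θ a c * const (g c b) + d (const (g a b)) := by
  constructor
  · intro h a b
    have := congrFun (congrFun h a) b
    simpa [Matrix.mul_apply, constHom_apply] using this
  · intro h
    ext a b : 1
    have := h a b
    simpa [Matrix.mul_apply, constHom_apply] using this

theorem Gauge.lift {g : Matrix (Fin r) (Fin r) O} {θ θ' : Matrix (Fin r) (Fin r) (Cochain O M)}
    (h : Gauge g θ θ') : Gauge (g.map fun f => (1 : SimplexRing K n) ⊗ₜ[K] f)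
      (θ.map (lift K n)) (θ'.map (lift K n)) := by
  rw [Gauge.apply] at h ⊢
  intro a b
  have := congrArg (Cochain.lift K n) (h a b)
  simp only [lift_add, lift_sum, lift_mul, lift_d, lift_const] at this
  exact this

/-- The gauge relation is affine in the connection matrix, and the weights `t_j` add up to `1`; the
inhomogeneous term `dg` therefore keeps coefficient one. -/
theorem Gauge.tot {g : Matrix (Fin r) (Fin r) O}
    {Θ Θ' : Fin (n + 1) → Matrix (Fin r) (Fin r) (Cochain O M)}
    (h : ∀ j, Gauge g (Θ j) (Θ' j)) : Gauge (g.map fun f => (1 : SimplexRing K n) ⊗ₜ[K] f)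
      (tot K Θ) (tot K Θ') := by
  rw [Gauge.apply]
  intro a b
  have hj := fun j => Gauge.apply.mp ((h j).lift (K := K) (n := n)) a b
  have h1 : ∀ c, const ((1 : SimplexRing K n) ⊗ₜ[K] g a c) * Cochain.tot K Θ' c b =
      ∑ j, const (SimplexRing.t K j ⊗ₜ 1) *
        (const ((1 : SimplexRing K n) ⊗ₜ[K] g a c) * Cochain.lift K n (Θ' j c b)) := fun c => by
    rw [Cochain.tot, Finset.mul_sum]
    refine Finset.sum_congr rfl fun j _ => ?_
    rw [← mul_assoc, const_mul_comm, mul_assoc]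
  have h2 : ∀ c, Cochain.tot K Θ a c * const ((1 : SimplexRing K n) ⊗ₜ[K] g c b) =
      ∑ j, const (SimplexRing.t K j ⊗ₜ 1) *
        (Cochain.lift K n (Θ j a c) * const ((1 : SimplexRing K n) ⊗ₜ[K] g c b)) := fun c => by
    rw [Cochain.tot, Finset.sum_mul]
    exact Finset.sum_congr rfl fun j _ => mul_assoc _ _ _
  have h3 : (∑ j, const (SimplexRing.t K (n := n) j ⊗ₜ[K] (1 : O)) :
      Cochain _ (Prism K M n)) = 1 := by
    have : ∑ j, constHom _ (Prism K M n) (SimplexRing.t K (n := n) j ⊗ₜ[K] (1 : O)) = 1 := by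
      rw [← map_sum, ← TensorProduct.sum_tmul, SimplexRing.sum_t]
      exact (constHom _ _).map_one
    exact this
  simp only [Matrix.map_apply] at hj ⊢
  simp only [h1, h2]
  rw [Finset.sum_comm, Finset.sum_comm (f := fun c j => const (SimplexRing.t K j ⊗ₜ 1) *
        (Cochain.lift K n (Θ j a c) * const ((1 : SimplexRing K n) ⊗ₜ[K] g c b)))]
  simp only [← Finset.mul_sum]
  simp only [hj, mul_add, Finset.sum_add_distrib, ← Finset.sum_mul]
  rw [h3, one_mul]

/-! Integration over the fibre. -/

theorem fiberInt_add (ω η : Cochain (SimplexRing K n ⊗[K] O) (Prism K M n)) :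
    fiberInt n (ω + η) = fiberInt n ω + fiberInt n η := ext' fun _ => map_add _ _ _

variable (K O M n) in
/-- Integration over the fibre as an additive map. -/
def fiberIntHom : Cochain (SimplexRing K n ⊗[K] O) (Prism K M n) →+ Cochain O M where
  toFun := fiberInt n
  map_zero' := ext' fun _ => map_zero _
  map_add' := fiberInt_add

/-- The coordinate fields are the pairs with base component zero. That `α` and `β` preserve zero is
what sends the frame of one product to the frame of the other. -/
theorem fiberInt_rel {A' G' Λ : Type*} [CommRing A'] [Algebra K A'] [LieRing G'] [LieRing Λ]
    [LieRingModule G' A'] [DerAct K A' G'] {m : Morph K O M A' G' Λ} (hα : m.α 0 = 0)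
    (hβ : m.β 0 = 0) {ω : Cochain (SimplexRing K n ⊗[K] O) (Prism K M n)}
    {ω' : Cochain (SimplexRing K n ⊗[K] A') (Prism K G' n)} (h : (m.prism n).Rel ω ω') :
    m.Rel (fiberInt n ω) (fiberInt n ω') := by
  intro l
  have h' := h (Prism.frame K Λ n ++ l.map (Prism.incl K n))
  have e₁ : (Prism.frame K Λ n ++ l.map (Prism.incl K n)).map (m.prism n).α =
      Prism.frame K M n ++ (l.map m.α).map (Prism.incl K n) := by
    rw [List.map_append, List.map_map, List.map_map, Prism.frame, Prism.frame, List.map_reverse,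
      List.map_ofFn]
    refine congrArg (fun f => (List.ofFn f).reverse ++ _) ?_
    exact funext fun i => congrArg (Prism.mk · _) hα
  have e₂ : (Prism.frame K Λ n ++ l.map (Prism.incl K n)).map (m.prism n).β =
      Prism.frame K G' n ++ (l.map m.β).map (Prism.incl K n) := by
    rw [List.map_append, List.map_map, List.map_map, Prism.frame, Prism.frame, List.map_reverse,
      List.map_ofFn]
    refine congrArg (fun f => (List.ofFn f).reverse ++ _) ?_
    exact funext fun i => congrArg (Prism.mk · _) hβ
  rw [e₁, e₂] at h'
  have hI : ∀ F : SimplexRing K n ⊗[K] O, m.φ (simplexIntegral K O n F) =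
      simplexIntegral K A' n ((m.prism n).φ F) := by
    intro F
    induction F with
    | zero => simp
    | add F G hF hG => simp only [map_add, hF, hG]
    | tmul f g =>
      rw [simplexIntegral_tmul, Morph.prism_φ_tmul, simplexIntegral_tmul, map_smul]
  exact (hI _).trans (congrArg _ h')

theorem fiberInt_isAlt {ω : Cochain (SimplexRing K n ⊗[K] O) (Prism K M n)} (h : IsAlt ω) :
    IsAlt (fiberInt n ω) := by
  refine ⟨fun l₁ X Y l₂ => ?_, fun l₁ X l₂ => ?_⟩
  · have e : Prism.incl K n (X + Y) = Prism.incl K n X + Prism.incl K n Y :=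
      Prism.ext rfl (add_zero _).symm
    simp only [fiberInt, List.map_append, List.map_cons, ← List.append_assoc, e, h.map_add, map_add]
  · simp only [fiberInt, List.map_append, List.map_cons, ← List.append_assoc, h.alternating,
      map_zero]

theorem simplexIntegral_mul_left (g : O) (F : SimplexRing K n ⊗[K] O) :
    simplexIntegral K O n ((1 ⊗ₜ g) * F) = g * simplexIntegral K O n F := by
  rw [mul_comm, simplexIntegral_mul, mul_comm]

theorem fiberInt_scal {f : O} {X Z : M} {ω : Cochain (SimplexRing K n ⊗[K] O) (Prism K M n)}
    (h : Scal (1 ⊗ₜ f) (Prism.incl K n X) (Prism.incl K n Z) ω) : Scal f X Z (fiberInt n ω) := by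
  intro l₁ l₂
  simp only [fiberInt, List.map_append, List.map_cons, ← List.append_assoc]
  rw [h, simplexIntegral_mul_left]

theorem neg_one_pow_cancel {R : Type*} [CommRing R] (n k : ℕ) (x : R) :
    (-1) ^ k * ((-1) ^ (n + k) * x) = (-1) ^ n * x := by
  rw [← mul_assoc, ← pow_add, show k + (n + k) = n + 2 * k by ring, pow_add, pow_mul, neg_one_sq,
    one_pow, mul_one]

/-- The frame occupies `n` of the arguments of an even form, and the parity of the remaining degree
is that of `n`. -/
theorem fiberInt_sgn {ω : Cochain (SimplexRing K n ⊗[K] O) (Prism K M n)} (h : sgn ω = ω) :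
    sgn (fiberInt n ω) = (-1) ^ n * fiberInt n ω := ext' fun X => by
  have h1 := congrFun h (Prism.frame K M n ++ X.map (Prism.incl K n))
  have h2 : (-1) ^ n * fiberInt n ω = fiberInt n ((-1) ^ n * ω) :=
    (map_neg_one_pow_mul (fiberIntHom K O M n) n ω).symm
  have h3 : ∀ (m : ℕ) (η : Cochain (SimplexRing K n ⊗[K] O) (Prism K M n)) Y,
      ((-1) ^ m * η) Y = (-1) ^ m * η Y := fun m η Y =>
    map_neg_one_pow_mul (⟨⟨fun η => η Y, rfl⟩, fun _ _ => rfl⟩ :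
      Cochain (SimplexRing K n ⊗[K] O) (Prism K M n) →+ _) m η
  rw [h2]
  simp only [sgn, List.length_append, Prism.length_frame, List.length_map] at h1
  simp only [sgn, fiberInt, h3]
  refine (map_neg_one_pow_mul (simplexIntegral K O n).toAddMonoidHom _ _).symm.trans
    (congrArg (simplexIntegral K O n) ?_)
  refine (congrArg _ h1.symm).trans (neg_one_pow_cancel n X.length _)

/-- Insertion of a list of arguments in front. -/
def insList {A G : Type*} (v : List G) (a : Cochain A G) : Cochain A G := fun l => a (v ++ l)

variable (n) in
/-- Integration over the fibre of the components along the base. -/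
def baseInt (y : Cochain (SimplexRing K n ⊗[K] O) (Prism K M n)) : Cochain O M :=
  fun l => simplexIntegral K O n (y (l.map (Prism.incl K n)))

/-- Contraction obeys a graded Leibniz rule; a factor killed by every element of `v` leaves all of
`v` to the left factor. With the killed factor on the right no signs arise. -/
theorem mul_append {A G : Type*} [CommRing A] {b : Cochain A G} (v X : List G)
    (hb : ∀ u ∈ v, ins u b = 0) (a : Cochain A G) :
    (a * b) (v ++ X) = (insList v a * b) X := by
  induction v generalizing a with
  | nil => rfl
  | cons u v ih =>
    rw [List.cons_append, mul_cons, hb u (by simp), mul_zero, zero_app, add_zero,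
      ih fun w hw => hb w (by simp [hw])]
    rfl

theorem simplexIntegral_mul_lift (x : Cochain O M) (X : List M)
    (y : Cochain (SimplexRing K n ⊗[K] O) (Prism K M n)) :
    simplexIntegral K O n ((y * lift K n x) (X.map (Prism.incl K n))) =
      (baseInt n y * x) X := by
  induction X generalizing x y with
  | nil => exact simplexIntegral_mul _ _
  | cons Y X ih =>
    rw [List.map_cons, mul_cons, mul_cons, map_add, ih]
    refine congrArg₂ _ rfl ((ih (ins Y x) (sgn y)).trans ?_)
    refine congrArg (fun a : Cochain O M => (a * ins Y x) X) (ext' fun l => ?_)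
    simp only [sgn, baseInt, List.length_map]
    exact map_neg_one_pow_mul (simplexIntegral K O n).toAddMonoidHom _ _

/-- The projection formula: a pulled back form is killed by the coordinate fields, because an
alternating additive form vanishes at a zero argument, and its values are constant along the
simplex. -/
theorem fiberInt_mul_lift {x : Cochain O M} (hx : IsAlt x)
    (y : Cochain (SimplexRing K n ⊗[K] O) (Prism K M n)) :
    fiberInt n (y * lift K n x) = fiberInt n y * x := ext' fun X => by
  rw [fiberInt, mul_append, simplexIntegral_mul_lift]
  · rfl
  · intro u hu
    rw [Prism.frame, List.mem_reverse, List.mem_ofFn] at hu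
    obtain ⟨i, rfl⟩ := hu
    refine ext' fun l => ?_
    have : x (0 :: l.map fun w => w.1) = 0 := hx.append_zero [] _
    exact (congrArg (Morph.base K O M n).φ this).trans (map_zero _)

theorem fiberInt_lift_mul {x : Cochain O M} (hx : IsAlt x) (he : sgn x = x)
    (y : Cochain (SimplexRing K n ⊗[K] O) (Prism K M n)) :
    fiberInt n (lift K n x * y) = x * fiberInt n y := by
  rw [commute_of_even (lift_even he) y, fiberInt_mul_lift hx, commute_of_even he]

theorem fiberInt_zero_lift [CharZero K] (x : Cochain O M) : fiberInt 0 (lift K 0 x) = x := ext' fun X => by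
  change simplexIntegral K O 0 (1 ⊗ₜ x ((X.map (Prism.incl K 0)).map fun w => w.1)) = _
  rw [simplexIntegral_tmul, List.map_map]
  have : SimplexRing.integral K 0 1 = 1 := by
    have := SimplexRing.integral_monomial K (0 : Fin 0 →₀ ℕ)
    simpa using this
  rw [this, one_smul]
  exact congrArg x (List.map_id X)

theorem tot_zero (Θ : Fin 1 → Matrix (Fin r) (Fin r) (Cochain O M)) :
    tot K Θ = (Θ 0).map (lift K 0) := by
  ext a b : 1
  rw [tot, Fin.sum_univ_one, SimplexRing.t_zero, Finset.univ_eq_empty, Finset.sum_empty, sub_zero]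
  exact one_mul _

/-! The characteristic forms. -/

/-- The fibre integral of `P` of the curvature of `∑ t_j Θ_j`. -/
def cw (P : MvPolynomial (Fin r × Fin r) K)
    (Θ : Fin (n + 1) → Matrix (Fin r) (Fin r) (Cochain O M)) : Cochain O M :=
  fiberInt n (polyEval P (curv (tot K Θ)))

theorem cw_isAlt (P : MvPolynomial (Fin r × Fin r) K)
    {Θ : Fin (n + 1) → Matrix (Fin r) (Fin r) (Cochain O M)} (h : ∀ j, IsConn (Θ j)) :
    IsAlt (cw P Θ) := fiberInt_isAlt ((IsConn.tot K h).polyEval_isAlt P)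

theorem cw_sgn (P : MvPolynomial (Fin r × Fin r) K)
    {Θ : Fin (n + 1) → Matrix (Fin r) (Fin r) (Cochain O M)} (h : ∀ j, IsConn (Θ j)) :
    sgn (cw P Θ) = (-1) ^ n * cw P Θ :=
  fiberInt_sgn (polyEval_even P (IsConn.tot K h).curv_even)

theorem cw_rel {A' G' Λ : Type*} [CommRing A'] [Algebra K A'] [LieRing G'] [LieRing Λ]
    [LieRingModule G' A'] [DerAct K A' G'] {m : Morph K O M A' G' Λ} (hα : m.α 0 = 0)
    (hβ : m.β 0 = 0) (P : MvPolynomial (Fin r × Fin r) K)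
    {Θ : Fin (n + 1) → Matrix (Fin r) (Fin r) (Cochain O M)}
    {Θ' : Fin (n + 1) → Matrix (Fin r) (Fin r) (Cochain A' G')}
    (h : ∀ j a b, m.Rel (Θ j a b) (Θ' j a b)) : m.Rel (cw P Θ) (cw P Θ') :=
  fiberInt_rel hα hβ (Morph.Rel.polyEval (Morph.Rel.curv (tot_prism_rel h)) P)

theorem polyEval_tot_face (P : MvPolynomial (Fin r × Fin r) K) (j : Fin (n + 2))
    (Θ : Fin (n + 2) → Matrix (Fin r) (Fin r) (Cochain O M)) :
    (faceMorph K O M j).Rel (polyEval P (curv (tot K Θ)))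
      (polyEval P (curv (tot K fun i => Θ (j.succAbove i)))) :=
  Morph.Rel.polyEval (Morph.Rel.curv (tot_face_rel (K := K) j Θ)) P

variable [CharZero K] {P : MvPolynomial (Fin r × Fin r) K}

/-- Stokes' theorem for the closed form `P(R)`: the interior term is zero, and the face `t_j = 0`
carries the total connection without `Θ_j`. -/
theorem d_cw (hP : P ∈ invariantPolynomials K r)
    {Θ : Fin (n + 2) → Matrix (Fin r) (Fin r) (Cochain O M)} (h : ∀ j, IsConn (Θ j)) :
    d (cw P Θ) = ∑ j : Fin (n + 2), (-1) ^ (j : ℕ) * cw P fun i => Θ (j.succAbove i) := by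
  have hc := IsConn.tot K h
  have hz : fiberInt (K := K) (n + 1) (0 : Cochain (SimplexRing K (n + 1) ⊗[K] O) (Prism K M (n + 1))) = 0 :=
    map_zero (fiberIntHom K O M (n + 1))
  rw [cw, d_fiberInt (hc.polyEval_isAlt P), hc.d_polyEval hP, hz, mul_zero, zero_add]
  refine Finset.sum_congr rfl fun j _ => ?_
  rw [(polyEval_tot_face P j Θ).pull_eq fun _ => rfl]
  rfl

theorem d_cw_zero (hP : P ∈ invariantPolynomials K r)
    {Θ : Fin 1 → Matrix (Fin r) (Fin r) (Cochain O M)} (h : ∀ j, IsConn (Θ j)) :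
    d (cw P Θ) = 0 := by
  rw [cw, d_fiberInt_zero, (IsConn.tot K h).d_polyEval hP]
  exact map_zero (fiberIntHom K O M 0)

theorem polyEval_tot_gauge (hP : P ∈ invariantPolynomials K r)
    {g g' : Matrix (Fin r) (Fin r) O} (hg : g * g' = 1)
    {Θ Θ' : Fin (n + 1) → Matrix (Fin r) (Fin r) (Cochain O M)} (h : ∀ j, IsConn (Θ j))
    (h' : ∀ j, IsConn (Θ' j)) (hG : ∀ j, Gauge g (Θ j) (Θ' j)) :
    polyEval P (curv (tot K Θ)) = polyEval P (curv (tot K Θ')) := by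
  have hg' : g.map (fun f => (1 : SimplexRing K n) ⊗ₜ[K] f) *
      g'.map (fun f => (1 : SimplexRing K n) ⊗ₜ[K] f) = 1 := by
    have e : ∀ M : Matrix (Fin r) (Fin r) O, M.map (fun f => (1 : SimplexRing K n) ⊗ₜ[K] f) =
        (Algebra.TensorProduct.includeRight : O →ₐ[K] SimplexRing K n ⊗[K] O).toRingHom.mapMatrix M :=
      fun _ => rfl
    rw [e, e, ← map_mul, hg, map_one]
  exact (Gauge.polyEval hg' (Gauge.tot hG) (IsConn.tot K h) (IsConn.tot K h') hP).symm

end Lift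
end Cochain

/-! ### The homotopy between products of forms and forms of products. -/

namespace Cochain
theorem d_mul_eq_zero (K : Type*) {A G : Type*} [CommRing K] [CommRing A] [Algebra K A]
    [LieRing G] [LieRingModule G A] [DerAct K A G] {a b : Cochain A G} (ha : d a = 0)
    (hb : d b = 0) : d (a * b) = 0 := by
  rw [d_mul_of_derAct K, ha, hb, zero_mul, mul_zero, add_zero]

section Homotopy
variable {K O M : Type*} [Field K] [CommRing O] [Algebra K O] [LieRing M] [LieRingModule M O]
  [DerAct K O M] {p q r : ℕ} (P Q : MvPolynomial (Fin r × Fin r) K)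

variable (K) in
/-- The connection matrices `∑ t_j Θ_j, Ψ_1, …, Ψ_q` over the product with a simplex. -/
def joinConn (Θ : Fin (p + 1) → Matrix (Fin r) (Fin r) (Cochain O M))
    (Ψ : Fin q → Matrix (Fin r) (Fin r) (Cochain O M)) :
    Fin (q + 1) → Matrix (Fin r) (Fin r) (Cochain (SimplexRing K p ⊗[K] O) (Prism K M p)) :=
  Fin.cons (tot K Θ) fun j => (Ψ j).map (lift K p)

variable (K) in
theorem joinConn_isConn {Θ : Fin (p + 1) → Matrix (Fin r) (Fin r) (Cochain O M)}
    {Ψ : Fin q → Matrix (Fin r) (Fin r) (Cochain O M)} (hΘ : ∀ j, IsConn (Θ j))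
    (hΨ : ∀ j, IsConn (Ψ j)) (j : Fin (q + 1)) : IsConn (joinConn K Θ Ψ j) := by
  refine Fin.cases ?_ (fun j => ?_) j
  · exact IsConn.tot K hΘ
  · exact (hΨ j).lift

theorem joinConn_rel {A' G' A G Λ : Type*} [CommRing A] [CommRing A'] [Algebra K A] [Algebra K A']
    [LieRing G] [LieRing G'] [LieRing Λ] [LieRingModule G A] [LieRingModule G' A']
    [DerAct K A G] [DerAct K A' G'] {p' : ℕ}
    {m : Morph K (SimplexRing K p ⊗[K] A) (Prism K G p) (SimplexRing K p' ⊗[K] A') (Prism K G' p') Λ}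
    {Θ : Fin (p + 1) → Matrix (Fin r) (Fin r) (Cochain A G)}
    {Ψ : Fin q → Matrix (Fin r) (Fin r) (Cochain A G)}
    {Θ' : Fin (p' + 1) → Matrix (Fin r) (Fin r) (Cochain A' G')}
    {Ψ' : Fin q → Matrix (Fin r) (Fin r) (Cochain A' G')}
    (hΘ : ∀ a b, m.Rel (tot K Θ a b) (tot K Θ' a b))
    (hΨ : ∀ j a b, m.Rel (lift K p (Ψ j a b)) (lift K p' (Ψ' j a b))) (j : Fin (q + 1))
    (a b : Fin r) : m.Rel (joinConn K Θ Ψ j a b) (joinConn K Θ' Ψ' j a b) := by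
  refine Fin.cases ?_ (fun j => ?_) j
  · exact hΘ a b
  · exact hΨ j a b

/-- The form `P(R(Θ)) Q(R(Θ, Ψ))`. -/
def homForm (Θ : Fin (p + 1) → Matrix (Fin r) (Fin r) (Cochain O M))
    (Ψ : Fin q → Matrix (Fin r) (Fin r) (Cochain O M)) :
    Cochain (SimplexRing K q ⊗[K] (SimplexRing K p ⊗[K] O)) (Prism K (Prism K M p) q) :=
  lift K q (polyEval P (curv (tot K Θ))) * polyEval Q (curv (tot K (joinConn K Θ Ψ)))

/-- The homotopy between products of characteristic forms and characteristic forms of products. -/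
def hcw (Θ : Fin (p + 1) → Matrix (Fin r) (Fin r) (Cochain O M))
    (Ψ : Fin q → Matrix (Fin r) (Fin r) (Cochain O M)) : Cochain O M :=
  fiberInt p (fiberInt q (homForm P Q Θ Ψ))

theorem homForm_isAlt {Θ : Fin (p + 1) → Matrix (Fin r) (Fin r) (Cochain O M)}
    {Ψ : Fin q → Matrix (Fin r) (Fin r) (Cochain O M)} (hΘ : ∀ j, IsConn (Θ j))
    (hΨ : ∀ j, IsConn (Ψ j)) : IsAlt (homForm P Q Θ Ψ) :=
  (lift_isAlt ((IsConn.tot K hΘ).polyEval_isAlt P)).mul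
    ((IsConn.tot K (joinConn_isConn K hΘ hΨ)).polyEval_isAlt Q)

theorem hcw_isAlt {Θ : Fin (p + 1) → Matrix (Fin r) (Fin r) (Cochain O M)}
    {Ψ : Fin q → Matrix (Fin r) (Fin r) (Cochain O M)} (hΘ : ∀ j, IsConn (Θ j))
    (hΨ : ∀ j, IsConn (Ψ j)) : IsAlt (hcw P Q Θ Ψ) :=
  fiberInt_isAlt (fiberInt_isAlt (homForm_isAlt P Q hΘ hΨ))

theorem homForm_rel {A' G' A G Λ : Type*} [CommRing A] [CommRing A'] [Algebra K A] [Algebra K A']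
    [LieRing G] [LieRing G'] [LieRing Λ] [LieRingModule G A] [LieRingModule G' A']
    [DerAct K A G] [DerAct K A' G'] {p' : ℕ}
    {m : Morph K (SimplexRing K p ⊗[K] A) (Prism K G p) (SimplexRing K p' ⊗[K] A') (Prism K G' p') Λ}
    {Θ : Fin (p + 1) → Matrix (Fin r) (Fin r) (Cochain A G)}
    {Ψ : Fin q → Matrix (Fin r) (Fin r) (Cochain A G)}
    {Θ' : Fin (p' + 1) → Matrix (Fin r) (Fin r) (Cochain A' G')}
    {Ψ' : Fin q → Matrix (Fin r) (Fin r) (Cochain A' G')}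
    (hΘ : ∀ a b, m.Rel (tot K Θ a b) (tot K Θ' a b))
    (hΨ : ∀ j a b, m.Rel (lift K p (Ψ j a b)) (lift K p' (Ψ' j a b))) :
    (m.prism q).Rel (homForm P Q Θ Ψ) (homForm P Q Θ' Ψ') :=
  (lift_prism_rel q (Morph.Rel.polyEval (Morph.Rel.curv hΘ) P)).mul
    (Morph.Rel.polyEval (Morph.Rel.curv (tot_prism_rel (joinConn_rel hΘ hΨ))) Q)

theorem hcw_rel {A' G' Λ : Type*} [CommRing A'] [Algebra K A'] [LieRing G'] [LieRing Λ]
    [LieRingModule G' A'] [DerAct K A' G'] {m : Morph K O M A' G' Λ} (hα : m.α 0 = 0)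
    (hβ : m.β 0 = 0) {Θ : Fin (p + 1) → Matrix (Fin r) (Fin r) (Cochain O M)}
    {Ψ : Fin q → Matrix (Fin r) (Fin r) (Cochain O M)}
    {Θ' : Fin (p + 1) → Matrix (Fin r) (Fin r) (Cochain A' G')}
    {Ψ' : Fin q → Matrix (Fin r) (Fin r) (Cochain A' G')}
    (hΘ : ∀ j a b, m.Rel (Θ j a b) (Θ' j a b)) (hΨ : ∀ j a b, m.Rel (Ψ j a b) (Ψ' j a b)) :
    m.Rel (hcw P Q Θ Ψ) (hcw P Q Θ' Ψ') :=
  fiberInt_rel hα hβ <| fiberInt_rel (Prism.ext hα rfl) (Prism.ext hβ rfl) <|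
    homForm_rel P Q (tot_prism_rel hΘ) fun j a b => lift_prism_rel p (hΨ j a b)

theorem joinConn_face_succ (Θ : Fin (p + 1) → Matrix (Fin r) (Fin r) (Cochain O M))
    (Ψ : Fin (q + 1) → Matrix (Fin r) (Fin r) (Cochain O M)) (j : Fin (q + 1)) :
    (fun i => joinConn K Θ Ψ (j.succ.succAbove i)) =
      joinConn K Θ fun i => Ψ (j.succAbove i) := by
  funext i
  refine Fin.cases ?_ (fun i => ?_) i
  · rw [Fin.succ_succAbove_zero]; rfl
  · rw [Fin.succ_succAbove_succ]; rfl

/-- On the face opposite to the vertex `∑ t_j Θ_j` the second factor only sees the matrices `Ψ`,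
which come from the base; the two factors separate there. -/
theorem homForm_face_zero (Θ : Fin (p + 1) → Matrix (Fin r) (Fin r) (Cochain O M))
    (Ψ : Fin (q + 1) → Matrix (Fin r) (Fin r) (Cochain O M)) :
    (faceMorph K (SimplexRing K p ⊗[K] O) (Prism K M p) 0).Rel (homForm P Q Θ Ψ)
      (lift K q (polyEval P (curv (tot K Θ))) *
        polyEval Q (curv (tot K fun j => (Ψ j).map (lift K p)))) :=
  (lift_face_rel 0 _).mul (polyEval_tot_face Q 0 (joinConn K Θ Ψ))

theorem homForm_face_succ (Θ : Fin (p + 1) → Matrix (Fin r) (Fin r) (Cochain O M))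
    (Ψ : Fin (q + 1) → Matrix (Fin r) (Fin r) (Cochain O M)) (j : Fin (q + 1)) :
    (faceMorph K (SimplexRing K p ⊗[K] O) (Prism K M p) j.succ).Rel (homForm P Q Θ Ψ)
      (homForm P Q Θ fun i => Ψ (j.succAbove i)) := by
  have := (lift_face_rel (K := K) (n := q) j.succ (polyEval P (curv (tot K Θ)))).mul
    (polyEval_tot_face Q j.succ (joinConn K Θ Ψ))
  rwa [joinConn_face_succ] at this

variable [CharZero K] {P Q}

theorem d_homForm (hP : P ∈ invariantPolynomials K r) (hQ : Q ∈ invariantPolynomials K r)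
    {Θ : Fin (p + 1) → Matrix (Fin r) (Fin r) (Cochain O M)}
    {Ψ : Fin q → Matrix (Fin r) (Fin r) (Cochain O M)} (hΘ : ∀ j, IsConn (Θ j))
    (hΨ : ∀ j, IsConn (Ψ j)) : d (homForm P Q Θ Ψ) = 0 := by
  have h1 : d (lift K q (polyEval P (curv (tot K Θ)))) = 0 := by
    rw [← lift_d, (IsConn.tot K hΘ).d_polyEval hP]
    exact lift_eq Morph.Rel.zero
  exact d_mul_eq_zero K h1 ((IsConn.tot K (joinConn_isConn K hΘ hΨ)).d_polyEval hQ)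

theorem cw_lift (Ψ : Fin (q + 1) → Matrix (Fin r) (Fin r) (Cochain O M)) :
    cw Q (fun j => (Ψ j).map (lift K p)) = lift K p (cw Q Ψ) :=
  (lift_eq (cw_rel (m := Morph.base K O M p) rfl rfl Q fun j a b => lift_rel p (Ψ j a b))).symm

/-- Stokes' theorem on the inner simplex for a closed form. The first face gives the product of
characteristic forms after two uses of the projection formula, and the others delete one `Ψ_j`; the
sign of these comes from their number `j + 1`. -/
theorem d_fiberInt_homForm (hP : P ∈ invariantPolynomials K r) (hQ : Q ∈ invariantPolynomials K r)
    {Θ : Fin (p + 1) → Matrix (Fin r) (Fin r) (Cochain O M)}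
    {Ψ : Fin (q + 1) → Matrix (Fin r) (Fin r) (Cochain O M)} (hΘ : ∀ j, IsConn (Θ j))
    (hΨ : ∀ j, IsConn (Ψ j)) :
    fiberInt p (d (fiberInt (q + 1) (homForm P Q Θ Ψ))) = cw P Θ * cw Q Ψ -
      ∑ j : Fin (q + 1), (-1) ^ (j : ℕ) * hcw P Q Θ fun i => Ψ (j.succAbove i) := by
  have hc := IsConn.tot K hΘ
  rw [d_fiberInt (homForm_isAlt P Q hΘ hΨ), d_homForm hP hQ hΘ hΨ,
    show fiberInt (K := K) (q + 1) (0 : Cochain _ (Prism K (Prism K M p) (q + 1))) = 0 from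
      map_zero (fiberIntHom K _ _ (q + 1)), mul_zero, zero_add, Fin.sum_univ_succ,
    Fin.val_zero, pow_zero, one_mul, (homForm_face_zero P Q Θ Ψ).pull_eq fun _ => rfl,
    fiberInt_lift_mul (hc.polyEval_isAlt P) (polyEval_even P hc.curv_even), fiberInt_add]
  have h1 : fiberInt q (polyEval Q (curv (tot K fun j => (Ψ j).map (lift K p)))) =
      lift K p (cw Q Ψ) := cw_lift Ψ
  rw [h1, fiberInt_mul_lift (cw_isAlt Q hΨ), sub_eq_add_neg]
  refine congrArg₂ _ rfl ?_
  refine (map_sum (fiberIntHom K O M p) _ _).trans ?_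
  rw [← Finset.sum_neg_distrib]
  refine Finset.sum_congr rfl fun j _ => ?_
  rw [map_neg_one_pow_mul, (homForm_face_succ P Q Θ Ψ j).pull_eq fun _ => rfl, Fin.val_succ,
    pow_succ, mul_neg_one, neg_mul]
  rfl

theorem d_hcw_zero (hP : P ∈ invariantPolynomials K r) (hQ : Q ∈ invariantPolynomials K r)
    {Θ : Fin 1 → Matrix (Fin r) (Fin r) (Cochain O M)}
    {Ψ : Fin (q + 1) → Matrix (Fin r) (Fin r) (Cochain O M)} (hΘ : ∀ j, IsConn (Θ j))
    (hΨ : ∀ j, IsConn (Ψ j)) :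
    d (hcw P Q Θ Ψ) = cw P Θ * cw Q Ψ -
      ∑ j : Fin (q + 1), (-1) ^ (j : ℕ) * hcw P Q Θ fun i => Ψ (j.succAbove i) := by
  rw [hcw, d_fiberInt_zero, d_fiberInt_homForm hP hQ hΘ hΨ]

/-- A second application of Stokes' theorem, now on the outer simplex. Its faces delete a `Θ_i` in
both factors at once, since the first vertex of the inner simplex is the total connection of `Θ`. -/
theorem d_hcw_succ (hP : P ∈ invariantPolynomials K r) (hQ : Q ∈ invariantPolynomials K r)
    {Θ : Fin (p + 2) → Matrix (Fin r) (Fin r) (Cochain O M)}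
    {Ψ : Fin (q + 1) → Matrix (Fin r) (Fin r) (Cochain O M)} (hΘ : ∀ j, IsConn (Θ j))
    (hΨ : ∀ j, IsConn (Ψ j)) :
    d (hcw P Q Θ Ψ) = (-1) ^ (p + 1) * (cw P Θ * cw Q Ψ -
      ∑ j : Fin (q + 1), (-1) ^ (j : ℕ) * hcw P Q Θ fun i => Ψ (j.succAbove i)) +
      ∑ i : Fin (p + 2), (-1) ^ (i : ℕ) * hcw P Q (fun k => Θ (i.succAbove k)) Ψ := by
  rw [hcw, d_fiberInt (fiberInt_isAlt (homForm_isAlt P Q hΘ hΨ)),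
    d_fiberInt_homForm hP hQ hΘ hΨ]
  refine congrArg₂ _ rfl (Finset.sum_congr rfl fun i _ => ?_)
  have h := fiberInt_rel (m := faceMorph K O M i) (Prism.ext rfl (SimplexRing.faceTan_zero K i)) rfl
    (homForm_rel P Q (tot_face_rel i Θ) fun j a b => lift_face_rel i (Ψ j a b))
  rw [h.pull_eq fun _ => rfl]
  rfl

/-- With `Ψ` empty the inner simplex is a point and its only connection is the total connection of
`Θ`, so the integrand is `P(R) Q(R) = (PQ)(R)`. -/
theorem hcw_nil {Θ : Fin (p + 1) → Matrix (Fin r) (Fin r) (Cochain O M)}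
    (Ψ : Fin 0 → Matrix (Fin r) (Fin r) (Cochain O M)) (hΘ : ∀ j, IsConn (Θ j)) :
    hcw P Q Θ Ψ = cw (P * Q) Θ := by
  have hc := IsConn.tot K hΘ
  rw [hcw, homForm, tot_zero]
  have e : curv ((joinConn K Θ Ψ 0).map (lift K 0)) = fun a b => lift K 0 (curv (tot K Θ) a b) := by
    ext a b : 2
    exact (lift_curv (tot K Θ) a b).symm
  have h : polyEval Q (curv ((joinConn K Θ Ψ 0).map (lift K 0))) =
      lift K 0 (polyEval Q (curv (tot K Θ))) := by
    rw [e]; exact (lift_polyEval _ Q).symm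
  rw [h, ← lift_mul, fiberInt_zero_lift, ← polyEval_mul P Q hc.curv_even]
  rfl

theorem hcw_gauge (hP : P ∈ invariantPolynomials K r) (hQ : Q ∈ invariantPolynomials K r)
    {g g' : Matrix (Fin r) (Fin r) O} (hg : g * g' = 1)
    {Θ Θ' : Fin (p + 1) → Matrix (Fin r) (Fin r) (Cochain O M)}
    {Ψ Ψ' : Fin q → Matrix (Fin r) (Fin r) (Cochain O M)} (hΘ : ∀ j, IsConn (Θ j))
    (hΘ' : ∀ j, IsConn (Θ' j)) (hΨ : ∀ j, IsConn (Ψ j)) (hΨ' : ∀ j, IsConn (Ψ' j))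
    (hG : ∀ j, Gauge g (Θ j) (Θ' j)) (hG' : ∀ j, Gauge g (Ψ j) (Ψ' j)) :
    hcw P Q Θ Ψ = hcw P Q Θ' Ψ' := by
  have hg' : g.map (fun f => (1 : SimplexRing K p) ⊗ₜ[K] f) *
      g'.map (fun f => (1 : SimplexRing K p) ⊗ₜ[K] f) = 1 := by
    have e : ∀ M : Matrix (Fin r) (Fin r) O, M.map (fun f => (1 : SimplexRing K p) ⊗ₜ[K] f) =
        (Algebra.TensorProduct.includeRight : O →ₐ[K] SimplexRing K p ⊗[K] O).toRingHom.mapMatrix M :=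
      fun _ => rfl
    rw [e, e, ← map_mul, hg, map_one]
  rw [hcw, hcw, homForm, homForm, polyEval_tot_gauge hP hg hΘ hΘ' hG,
    polyEval_tot_gauge hQ hg' (joinConn_isConn K hΘ hΨ) (joinConn_isConn K hΘ' hΨ') fun j => ?_]
  refine Fin.cases ?_ (fun j => ?_) j
  · exact Gauge.tot hG
  · exact (hG' j).lift

theorem cw_gauge (hP : P ∈ invariantPolynomials K r) {g g' : Matrix (Fin r) (Fin r) O}
    (hg : g * g' = 1) {Θ Θ' : Fin (p + 1) → Matrix (Fin r) (Fin r) (Cochain O M)}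
    (hΘ : ∀ j, IsConn (Θ j)) (hΘ' : ∀ j, IsConn (Θ' j)) (hG : ∀ j, Gauge g (Θ j) (Θ' j)) :
    cw P Θ = cw P Θ' := by
  rw [cw, cw, polyEval_tot_gauge hP hg hΘ hΘ' hG]

end Homotopy

/-! ### Degree bounds. -/

section Vanishing
variable {K O M : Type*} [Field K] [CommRing O] [Algebra K O] [LieRing M] [LieRingModule M O]
  [DerAct K O M] {p q r : ℕ} (P Q : MvPolynomial (Fin r × Fin r) K)

theorem cw_vanish {Θ : Fin (p + 1) → Matrix (Fin r) (Fin r) (Cochain O M)}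
    (h : ∀ j, IsConn (Θ j)) (X : List M) (hX : ∀ s ∈ P.support, 2 * s.degree ≠ p + X.length) :
    cw P Θ X = 0 := by
  rw [cw, fiberInt, polyEval_vanish P (IsConn.tot K h).curv_deg, map_zero]
  intro s hs
  rw [List.length_append, Prism.length_frame, List.length_map]
  exact hX s hs

theorem polyEval_curv_vanish {A G : Type*} [CommRing A] [Algebra K A] [LieRing G]
    [LieRingModule G A] {θ : Matrix (Fin r) (Fin r) (Cochain A G)} (h : IsConn θ) (l : List G)
    (hl : 2 * P.totalDegree < l.length) : polyEval P (curv θ) l = 0 :=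
  polyEval_vanish P h.curv_deg l fun s hs => by
    have := MvPolynomial.le_totalDegree hs
    have e : s.degree = s.sum fun _ e => e := rfl
    omega

theorem cw_vanish_of_lt {Θ : Fin (p + 1) → Matrix (Fin r) (Fin r) (Cochain O M)}
    (h : ∀ j, IsConn (Θ j)) (X : List M) (hX : 2 * P.totalDegree < p + X.length) :
    cw P Θ X = 0 := by
  rw [cw, fiberInt, polyEval_curv_vanish P (IsConn.tot K h), map_zero]
  rwa [List.length_append, Prism.length_frame, List.length_map]

theorem hcw_vanish {Θ : Fin (p + 1) → Matrix (Fin r) (Fin r) (Cochain O M)}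
    {Ψ : Fin q → Matrix (Fin r) (Fin r) (Cochain O M)} (hΘ : ∀ j, IsConn (Θ j))
    (hΨ : ∀ j, IsConn (Ψ j)) (X : List M)
    (hX : 2 * P.totalDegree + 2 * Q.totalDegree < q + p + X.length) : hcw P Q Θ Ψ X = 0 := by
  rw [hcw, fiberInt, fiberInt, homForm, mul_vanish (m₁ := 2 * P.totalDegree)
    (m₂ := 2 * Q.totalDegree) (p₁ := 0) (p₂ := 0), map_zero, map_zero]
  · intro l hl
    rw [lift, pull, polyEval_curv_vanish P (IsConn.tot K hΘ), map_zero]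
    rw [List.length_map]; omega
  · intro l hl
    exact polyEval_curv_vanish Q (IsConn.tot K (joinConn_isConn K hΘ hΨ)) l (by omega)
  · simp only [List.length_append, Prism.length_frame, List.length_map]; omega
end Vanishing

/-! ### Linearity over functions. -/

section Scalars
variable {K O M : Type*} [Field K] [CommRing O] [Algebra K O] [LieRing M] [LieRingModule M O]
  {n p q r : ℕ}

/-- `θ` behaves as if `Z` were `f X`. -/
def Lin (f : O) (X Z : M) (θ : Cochain O M) : Prop :=
  θ [Z] = f * θ [X] ∧ ∀ Y : M, θ [⁅Y, Z⁆] = f * θ [⁅Y, X⁆] + ⁅Y, f⁆ * θ [X]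

/-- In `dθ(Y, Z) = Y θ(Z) - θ(⁅Y, Z⁆) - Z θ(Y)` the derivative of `f` produced by the first term
cancels the one in the second. `Lin` records exactly the two facts used, and it makes sense where an
argument cannot be multiplied by a function. -/
theorem Lin.d_scal [DerAct K O M] {f : O} {X Z : M} (hZ : ∀ g : O, ⁅Z, g⁆ = f * ⁅X, g⁆)
    {θ : Cochain O M} (h : Lin f X Z θ) (hd : Deg 1 θ) (ha : IsAlt θ) : Scal f X Z (d θ) := by
  have h2 : ∀ Y W, d θ [Y, W] = ⁅Y, θ [W]⁆ - θ [⁅Y, W⁆] - ⁅W, θ [Y]⁆ := by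
    intro Y W
    simp only [d_cons, lieDer_cons, lieDer_nil, d_nil, ins_app, sub_zero]
  have hr : ∀ Y, d θ [Y, Z] = f * d θ [Y, X] := fun Y => by
    rw [h2, h2, h.1, h.2, lie_mul_of_derAct K, hZ]; ring
  have hs : ∀ Y W, d θ [Y, W] = - d θ [W, Y] := fun Y W => congrFun (ha.d.ins_comm W Y) []
  intro l₁ l₂
  by_cases hl : l₁.length + l₂.length = 1
  · rcases l₁ with _ | ⟨Y, l₁⟩
    · obtain ⟨Y, rfl⟩ := List.length_eq_one_iff.mp (by simpa using hl)
      simp only [List.nil_append]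
      rw [hs, hr, hs Y]; ring
    · simp only [List.length_cons] at hl
      obtain rfl := List.length_eq_zero_iff.mp (show l₁.length = 0 by omega)
      obtain rfl := List.length_eq_zero_iff.mp (show l₂.length = 0 by omega)
      exact hr Y
  · rw [hd.d _ (by simp; omega), hd.d _ (by simp; omega), mul_zero]

theorem IsConn.curv_scal [DerAct K O M] {f : O} {X Z : M} (hZ : ∀ g : O, ⁅Z, g⁆ = f * ⁅X, g⁆)
    {θ : Matrix (Fin r) (Fin r) (Cochain O M)} (hθ : IsConn θ) (h : ∀ a b, Lin f X Z (θ a b))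
    (a b : Fin r) : Scal f X Z (curv θ a b) := by
  refine ((h a b).d_scal (K := K) hZ (hθ a b).1 (hθ a b).2).add ?_
  rw [Matrix.mul_apply]
  exact (Scal.subring f X Z).sum_mem fun c _ =>
    (Scal.of_deg_one (hθ a c).1 (h a c).1).mul (Scal.of_deg_one (hθ c b).1 (h c b).1)

theorem IsConn.polyEval_scal [DerAct K O M] {f : O} {X Z : M} (hZ : ∀ g : O, ⁅Z, g⁆ = f * ⁅X, g⁆)
    {θ : Matrix (Fin r) (Fin r) (Cochain O M)} (hθ : IsConn θ) (h : ∀ a b, Lin f X Z (θ a b))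
    (P : MvPolynomial (Fin r × Fin r) K) : Scal f X Z (polyEval P (curv θ)) :=
  polyEval_mem (Scal.subring f X Z) P (hθ.curv_scal (K := K) hZ h) Scal.const

variable [DerAct K O M]

theorem incl_lie_eq {f : O} {X Z : M} (hZ : ∀ g : O, ⁅Z, g⁆ = f * ⁅X, g⁆)
    (F : SimplexRing K n ⊗[K] O) : ⁅Prism.incl K n Z, F⁆ = (1 ⊗ₜ f) * ⁅Prism.incl K n X, F⁆ := by
  induction F with
  | zero => simp
  | add F G hF hG => simp only [lie_add, mul_add, hF, hG]
  | tmul g h =>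
    simp only [prism_lie_tmul, Prism.incl, Prism.mk_fst, Prism.mk_snd, coordDer_zero,
      Derivation.zero_apply, TensorProduct.zero_tmul, zero_add, hZ,
      Algebra.TensorProduct.tmul_mul_tmul, one_mul]

theorem Lin.lift {f : O} {X Z : M} {θ : Cochain O M} (h : Lin f X Z θ) :
    Lin (1 ⊗ₜ[K] f) (Prism.incl K n X) (Prism.incl K n Z) (lift K n θ) := by
  constructor
  · change (1 : SimplexRing K n) ⊗ₜ[K] θ [Z] = (1 ⊗ₜ[K] f) * (1 ⊗ₜ[K] θ [X])
    rw [h.1, Algebra.TensorProduct.tmul_mul_tmul, one_mul]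
  · intro Y
    change (1 : SimplexRing K n) ⊗ₜ[K] θ [⁅Y.1, Z⁆] = (1 ⊗ₜ[K] f) * (1 ⊗ₜ[K] θ [⁅Y.1, X⁆]) +
      ⁅Y, (1 : SimplexRing K n) ⊗ₜ[K] f⁆ * (1 ⊗ₜ[K] θ [X])
    rw [h.2, prism_lie_tmul, Derivation.map_one_eq_zero]
    simp [TensorProduct.tmul_add]

theorem Lin.const_mul {f : O} {X Z : M} {θ : Cochain O M} (h : Lin f X Z θ) (g : O) :
    Lin f X Z (const g * θ) := by
  refine ⟨?_, fun Y => ?_⟩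
  · rw [const_mul_app, const_mul_app, h.1]; ring
  · rw [const_mul_app, const_mul_app, const_mul_app, h.2]; ring

theorem Lin.add {f : O} {X Z : M} {θ η : Cochain O M} (h : Lin f X Z θ) (k : Lin f X Z η) :
    Lin f X Z (θ + η) := by
  refine ⟨?_, fun Y => ?_⟩
  · rw [add_app, add_app, h.1, k.1]; ring
  · rw [add_app, add_app, add_app, h.2, k.2]; ring

theorem Lin.sum {ι : Type*} (s : Finset ι) {f : O} {X Z : M} {θ : ι → Cochain O M}
    (h : ∀ i ∈ s, Lin f X Z (θ i)) : Lin f X Z (∑ i ∈ s, θ i) := by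
  classical
  induction s using Finset.induction_on with
  | empty => exact ⟨(mul_zero f).symm, fun Y => by simp [zero_app]⟩
  | insert i s hi ih =>
    rw [Finset.sum_insert hi]
    exact (h i (by simp)).add (ih fun j hj => h j (by simp [hj]))

theorem Lin.tot {f : O} {X Z : M} {Θ : Fin (n + 1) → Matrix (Fin r) (Fin r) (Cochain O M)}
    (h : ∀ j a b, Lin f X Z (Θ j a b)) (a b : Fin r) :
    Lin (1 ⊗ₜ[K] f) (Prism.incl K n X) (Prism.incl K n Z) (tot K Θ a b) :=
  Lin.sum _ fun j _ => (h j a b).lift.const_mul _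

/-- Each construction that leads to the characteristic form preserves the relation between `X` and
`Z`: `Lin` passes to the product and to the sum `∑ t_j Θ_j`, yields `Scal` for the curvature and its
polynomials, and survives integration. -/
theorem cw_scal {f : O} {X Z : M} (hZ : ∀ g : O, ⁅Z, g⁆ = f * ⁅X, g⁆)
    (P : MvPolynomial (Fin r × Fin r) K)
    {Θ : Fin (n + 1) → Matrix (Fin r) (Fin r) (Cochain O M)} (hΘ : ∀ j, IsConn (Θ j))
    (h : ∀ j a b, Lin f X Z (Θ j a b)) : Scal f X Z (cw P Θ) :=
  fiberInt_scal ((IsConn.tot K hΘ).polyEval_scal (incl_lie_eq hZ) (Lin.tot h) P)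

theorem hcw_scal {f : O} {X Z : M} (hZ : ∀ g : O, ⁅Z, g⁆ = f * ⁅X, g⁆)
    (P Q : MvPolynomial (Fin r × Fin r) K)
    {Θ : Fin (p + 1) → Matrix (Fin r) (Fin r) (Cochain O M)}
    {Ψ : Fin q → Matrix (Fin r) (Fin r) (Cochain O M)} (hΘ : ∀ j, IsConn (Θ j))
    (hΨ : ∀ j, IsConn (Ψ j)) (h : ∀ j a b, Lin f X Z (Θ j a b))
    (k : ∀ j a b, Lin f X Z (Ψ j a b)) : Scal f X Z (hcw P Q Θ Ψ) := by
  refine fiberInt_scal (fiberInt_scal (Scal.mul ?_ ?_))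
  · have hs := (IsConn.tot K hΘ).polyEval_scal (incl_lie_eq (K := K) hZ) (Lin.tot h) P
    intro l₁ l₂
    simp only [Cochain.lift, pull, List.map_append, List.map_cons]
    exact (congrArg (Morph.base K _ (Prism K M p) q).φ (hs _ _)).trans (map_mul _ _ _)
  · refine (IsConn.tot K (joinConn_isConn K hΘ hΨ)).polyEval_scal (incl_lie_eq (incl_lie_eq hZ))
      (Lin.tot fun j a b => ?_) Q
    refine Fin.cases ?_ (fun j => ?_) j
    · exact Lin.tot h a b
    · exact (k j a b).lift
end Scalars
end Cochain

/-! ### Prism operators and forms indexed by lists. -/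

namespace Cochain

/-- This extends `Tot.sum_aux` to families that need not vanish at the two extreme positions: those
two entries are set to zero and then accounted for separately. -/
theorem sum_erase_aux {G : Type*} [AddCommGroup G] (n : ℕ) (T₁ T₂ : ℕ → ℕ → G)
    (h : ∀ j < n, T₁ (j + 1) (j + 1) = - T₂ j 0) :
    ∑ k ∈ Finset.range (n + 1), ∑ j ∈ Finset.range n,
      (if k ≤ j then T₁ (j + 1) k else T₂ j (k - j)) =
    ∑ j ∈ Finset.range (n + 1), ∑ k ∈ Finset.range (j + 1), T₁ j k +
    ∑ j ∈ Finset.range (n + 1), ∑ k ∈ Finset.range (n + 1 - j), T₂ j k - T₁ 0 0 - T₂ n 0 := by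
  have := Tot.sum_aux n (fun j k => if j = 0 then 0 else T₁ j k)
    (fun j k => if j = n ∧ k = 0 then 0 else T₂ j k) (if_pos rfl) (if_pos ⟨rfl, rfl⟩)
    (fun j hj => by simpa [hj.ne] using h j hj)
  have e₁ : ∀ k ∈ Finset.range (n + 1), ∑ j ∈ Finset.range n,
      (if k ≤ j then T₁ (j + 1) k else T₂ j (k - j)) = ∑ j ∈ Finset.range n,
      (if k ≤ j then (if j + 1 = 0 then 0 else T₁ (j + 1) k)
        else (if j = n ∧ k - j = 0 then 0 else T₂ j (k - j))) := fun k _ =>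
    Finset.sum_congr rfl fun j hj => by
      rw [Finset.mem_range] at hj
      rw [if_neg (Nat.succ_ne_zero j), if_neg (c := j = n ∧ _) (by omega)]
  rw [Finset.sum_congr rfl e₁, this, Finset.sum_range_succ' _ n, Finset.sum_range_succ _ n,
    Finset.sum_range_succ' (fun j => ∑ k ∈ Finset.range (j + 1), T₁ j k) n,
    Finset.sum_range_succ (fun j => ∑ k ∈ Finset.range (n + 1 - j), T₂ j k) n]
  have e : n + 1 - n = 1 := by omega
  have e₂ : ∀ j ∈ Finset.range n, ∑ k ∈ Finset.range (n + 1 - j),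
      (if j = n ∧ k = 0 then 0 else T₂ j k) = ∑ k ∈ Finset.range (n + 1 - j), T₂ j k := fun j hj =>
    Finset.sum_congr rfl fun k _ => by
      rw [Finset.mem_range] at hj
      rw [if_neg (by omega)]
  rw [Finset.sum_congr rfl e₂]
  simp only [e, zero_add, Finset.sum_range_one, if_true, and_self, Nat.succ_ne_zero, if_false]
  abel

/-- The prism operator along the splittings of a list, for the differential of a family indexed
by two lists. -/
theorem prism_formula {R α : Type*} [Ring R] (D : R →+ R) (H B : List α → List α → R) (l : List α)
    (hH : ∀ k < l.length, D (H (l.take (k + 1)) (l.drop k)) = (-1) ^ k *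
        (B (l.take (k + 1)) (l.drop k) - ∑ j ∈ Finset.range (l.drop k).length,
          (-1) ^ j * H (l.take (k + 1)) ((l.drop k).eraseIdx j)) +
        ∑ i ∈ Finset.range (l.take (k + 1)).length,
          (-1) ^ i * H ((l.take (k + 1)).eraseIdx i) (l.drop k)) :
    D (∑ k ∈ Finset.range l.length, (-1) ^ k * H (l.take (k + 1)) (l.drop k)) +
      ∑ m ∈ Finset.range l.length, (-1) ^ m *
        ∑ k ∈ Finset.range (l.eraseIdx m).length,
          (-1) ^ k * H ((l.eraseIdx m).take (k + 1)) ((l.eraseIdx m).drop k) =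
    ∑ k ∈ Finset.range l.length, B (l.take (k + 1)) (l.drop k) + H [] l - H l [] := by
  rcases Nat.eq_zero_or_pos l.length with hn | hn
  · obtain rfl := List.length_eq_zero_iff.mp hn
    simp
  obtain ⟨n, hn⟩ : ∃ n, l.length = n + 1 := ⟨l.length - 1, by omega⟩
  have hsq : ∀ k : ℕ, (-1 : R) ^ k * (-1) ^ k = 1 := fun k => by
    rw [← pow_add, Even.neg_one_pow ⟨k, rfl⟩]
  -- `T₁` collects deletions in the left block and `T₂` those in the right block. The blocks share
  -- one entry: deleting the last entry of the left block in one splitting gives the same pair as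
  -- deleting the first entry of the right block in the previous splitting, with opposite sign.
  let T₁ : ℕ → ℕ → R := fun j k => -((-1) ^ j * ((-1) ^ k * H ((l.take (j + 1)).eraseIdx k) (l.drop j)))
  let T₂ : ℕ → ℕ → R := fun j k => (-1) ^ k * H (l.take (j + 1)) ((l.drop j).eraseIdx k)
  have hzero : ∀ j, j < n + 1 → (l.drop j).eraseIdx 0 = l.drop (j + 1) := fun j _ => by
    rw [List.eraseIdx_zero, List.tail_drop]
  have hlast : ∀ j, j < n + 1 → (l.take (j + 1)).eraseIdx j = l.take j := fun j _ => by
    refine List.ext_getElem? fun i => ?_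
    simp only [List.getElem?_take, List.getElem?_eraseIdx]
    split_ifs <;> first | rfl | omega
  have key := sum_erase_aux n T₁ T₂ fun j hj => by
    simp only [T₁, T₂]
    rw [hlast (j + 1) (by omega), hzero j (by omega), ← mul_assoc, hsq, one_mul, pow_zero, one_mul]
  have e₁ : ∀ m ∈ Finset.range (n + 1), (-1) ^ m * ∑ k ∈ Finset.range (l.eraseIdx m).length,
      (-1) ^ k * H ((l.eraseIdx m).take (k + 1)) ((l.eraseIdx m).drop k) =
      ∑ j ∈ Finset.range n, (if m ≤ j then T₁ (j + 1) m else T₂ j (m - j)) := fun m hm => by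
    rw [Finset.mem_range] at hm
    rw [List.length_eraseIdx_of_lt (by omega), hn, Nat.add_sub_cancel, Finset.mul_sum]
    refine Finset.sum_congr rfl fun j hj => ?_
    rw [Finset.mem_range] at hj
    split_ifs with h
    · simp only [T₁]
      rw [Tot.take_eraseIdx l h, Tot.drop_eraseIdx l h, ← mul_assoc, ← mul_assoc, ← neg_mul,
        ← pow_add, ← pow_add, ← neg_one_mul ((-1 : R) ^ _), ← pow_succ',
        show j + 1 + m + 1 = m + j + 2 by ring, pow_add _ _ 2, neg_one_sq, mul_one]
    · simp only [T₂]
      rw [Tot.take_eraseIdx' l (not_le.mp h), Tot.drop_eraseIdx' l (not_le.mp h), ← mul_assoc,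
        ← pow_add, show m + j = m - j + 2 * j by omega, pow_add _ _ (2 * j), pow_mul, neg_one_sq,
        one_pow, mul_one]
  have e₂ : ∀ k ∈ Finset.range (n + 1), (-1) ^ k * D (H (l.take (k + 1)) (l.drop k)) =
      B (l.take (k + 1)) (l.drop k) - ∑ j ∈ Finset.range (n + 1 - k), T₂ k j -
        ∑ i ∈ Finset.range (k + 1), T₁ k i := fun k hk => by
    rw [Finset.mem_range] at hk
    rw [hH k (by omega), mul_add, ← mul_assoc, hsq, one_mul, List.length_drop, List.length_take,
      min_eq_left (by omega), hn, Finset.mul_sum]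
    simp only [T₁, T₂, Finset.sum_neg_distrib, sub_neg_eq_add]
  rw [hn, map_sum, Finset.sum_congr rfl e₁, key]
  simp only [map_neg_one_pow_mul]
  rw [Finset.sum_congr rfl e₂, Finset.sum_sub_distrib, Finset.sum_sub_distrib]
  -- The two deletions without a partner are those that empty the left or the right block; they are
  -- the ends of the homotopy.
  have h1 : T₁ 0 0 = - H [] l := by
    simp only [T₁]
    rw [hlast 0 (by omega), pow_zero, one_mul, one_mul]
    rfl
  have h2 : T₂ n 0 = H l [] := by
    simp only [T₂]
    rw [hzero n (by omega), pow_zero, one_mul, List.take_of_length_le (by omega),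
      List.drop_eq_nil_of_le (by omega)]
  rw [h1, h2]
  abel

section Lists
variable {K O M : Type*} [Field K] [CommRing O] [Algebra K O] [LieRing M] [LieRingModule M O]
  [DerAct K O M] {r : ℕ}

/-- The characteristic form of a list of connection matrices. -/
def cwL (P : MvPolynomial (Fin r × Fin r) K) :
    List (Matrix (Fin r) (Fin r) (Cochain O M)) → Cochain O M
  | [] => 0
  | θ :: t => cw (n := t.length) P (θ :: t).get

/-- The homotopy for two lists of connection matrices. -/
def hcwL (P Q : MvPolynomial (Fin r × Fin r) K) :
    List (Matrix (Fin r) (Fin r) (Cochain O M)) → List (Matrix (Fin r) (Fin r) (Cochain O M)) →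
      Cochain O M
  | [], _ => 0
  | θ :: t, b => hcw (p := t.length) P Q (θ :: t).get b.get

theorem exists_ofFn {α : Type*} {l : List α} (h : l ≠ []) :
    ∃ (n : ℕ) (f : Fin (n + 1) → α), l = List.ofFn f := by
  cases l with
  | nil => exact absurd rfl h
  | cons a t => exact ⟨t.length, (a :: t).get, (List.ofFn_get (a :: t)).symm⟩

theorem cwL_ofFn (P : MvPolynomial (Fin r × Fin r) K) {n : ℕ}
    (Θ : Fin (n + 1) → Matrix (Fin r) (Fin r) (Cochain O M)) : cwL P (List.ofFn Θ) = cw P Θ := by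
  have key : ∀ (l : List (Matrix (Fin r) (Fin r) (Cochain O M))), l = List.ofFn Θ →
      cwL P l = cw P Θ := by
    intro l h
    cases l with
    | nil => simp [List.ofFn_succ] at h
    | cons θ t =>
      obtain rfl : t.length = n := by
        have := congrArg List.length h
        simpa using this
      obtain rfl : (θ :: t).get = Θ := List.ofFn_injective ((List.ofFn_get (θ :: t)).trans h)
      rfl
  exact key _ rfl

theorem hcwL_ofFn (P Q : MvPolynomial (Fin r × Fin r) K) {n q : ℕ}
    (Θ : Fin (n + 1) → Matrix (Fin r) (Fin r) (Cochain O M))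
    (Ψ : Fin q → Matrix (Fin r) (Fin r) (Cochain O M)) :
    hcwL P Q (List.ofFn Θ) (List.ofFn Ψ) = hcw P Q Θ Ψ := by
  have key : ∀ (l b : List (Matrix (Fin r) (Fin r) (Cochain O M))), l = List.ofFn Θ →
      b = List.ofFn Ψ → hcwL P Q l b = hcw P Q Θ Ψ := by
    intro l b h hb
    cases l with
    | nil => simp [List.ofFn_succ] at h
    | cons θ t =>
      obtain rfl : t.length = n := by
        have := congrArg List.length h
        simpa using this
      obtain rfl : b.length = q := by
        have := congrArg List.length hb
        simpa using this
      obtain rfl : (θ :: t).get = Θ := List.ofFn_injective ((List.ofFn_get (θ :: t)).trans h)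
      obtain rfl : b.get = Ψ := List.ofFn_injective ((List.ofFn_get b).trans hb)
      rfl
  exact key _ _ rfl rfl

variable (P Q : MvPolynomial (Fin r × Fin r) K)
  {l b : List (Matrix (Fin r) (Fin r) (Cochain O M))}

theorem cwL_isAlt (h : ∀ θ ∈ l, IsConn θ) : IsAlt (cwL P l) := by
  cases l with
  | nil => exact IsAlt.zero
  | cons θ t => exact cw_isAlt P fun j => h _ (List.get_mem (θ :: t) j)

theorem hcwL_isAlt (h : ∀ θ ∈ l, IsConn θ) (hb : ∀ θ ∈ b, IsConn θ) : IsAlt (hcwL P Q l b) := by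
  cases l with
  | nil => exact IsAlt.zero
  | cons θ t =>
    exact hcw_isAlt P Q (fun j => h _ (List.get_mem (θ :: t) j)) fun j => hb _ (List.get_mem b j)

theorem cwL_sgn (h : ∀ θ ∈ l, IsConn θ) : sgn (cwL P l) = (-1) ^ (l.length - 1) * cwL P l := by
  cases l with
  | nil => rw [cwL, sgn_zero, mul_zero]
  | cons θ t => exact cw_sgn P fun j => h _ (List.get_mem (θ :: t) j)

theorem cwL_vanish (h : ∀ θ ∈ l, IsConn θ) (X : List M)
    (hX : ∀ s ∈ P.support, l.length + X.length ≠ 2 * s.degree + 1) : cwL P l X = 0 := by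
  cases l with
  | nil => rfl
  | cons θ t =>
    refine cw_vanish P (fun j => h _ (List.get_mem (θ :: t) j)) X fun s hs e => hX s hs ?_
    rw [List.length_cons]; omega

theorem cwL_vanish_of_lt (h : ∀ θ ∈ l, IsConn θ) (X : List M)
    (hX : 2 * P.totalDegree + 1 < l.length + X.length) : cwL P l X = 0 := by
  cases l with
  | nil => rfl
  | cons θ t =>
    refine cw_vanish_of_lt P (fun j => h _ (List.get_mem (θ :: t) j)) X ?_
    rw [List.length_cons] at hX; omega

theorem hcwL_vanish (h : ∀ θ ∈ l, IsConn θ) (hb : ∀ θ ∈ b, IsConn θ) (X : List M)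
    (hX : 2 * P.totalDegree + 2 * Q.totalDegree + 1 < l.length + b.length + X.length) :
    hcwL P Q l b X = 0 := by
  cases l with
  | nil => rfl
  | cons θ t =>
    refine hcw_vanish P Q (fun j => h _ (List.get_mem (θ :: t) j)) (fun j => hb _ (List.get_mem b j)) X ?_
    rw [List.length_cons] at hX; omega

theorem cwL_scal {f : O} {X Z : M} (hZ : ∀ g : O, ⁅Z, g⁆ = f * ⁅X, g⁆)
    (h : ∀ θ ∈ l, IsConn θ) (hl : ∀ θ ∈ l, ∀ a b, Lin f X Z (θ a b)) : Scal f X Z (cwL P l) := by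
  cases l with
  | nil => exact Scal.zero
  | cons θ t =>
    exact cw_scal hZ P (fun j => h _ (List.get_mem (θ :: t) j)) fun j => hl _ (List.get_mem (θ :: t) j)

theorem hcwL_scal {f : O} {X Z : M} (hZ : ∀ g : O, ⁅Z, g⁆ = f * ⁅X, g⁆)
    (h : ∀ θ ∈ l, IsConn θ) (hl : ∀ θ ∈ l, ∀ a b, Lin f X Z (θ a b)) (hb : ∀ θ ∈ b, IsConn θ)
    (hlb : ∀ θ ∈ b, ∀ a b, Lin f X Z (θ a b)) : Scal f X Z (hcwL P Q l b) := by
  cases l with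
  | nil => exact Scal.zero
  | cons θ t =>
    exact hcw_scal hZ P Q (fun j => h _ (List.get_mem (θ :: t) j)) (fun j => hb _ (List.get_mem b j))
      (fun j => hl _ (List.get_mem (θ :: t) j)) fun j => hlb _ (List.get_mem b j)

section Maps
variable {ι : Type*}

theorem map_eq_ofFn {α : Type*} (l : List ι) (f : ι → α) :
    l.map f = List.ofFn fun j => f (l.get j) := by
  conv_lhs => rw [← List.ofFn_get l]
  rw [List.map_ofFn]; rfl

theorem cwL_map_cons (i : ι) (t : List ι) (f : ι → Matrix (Fin r) (Fin r) (Cochain O M)) :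
    cwL P ((i :: t).map f) = cw (n := t.length) P fun j => f ((i :: t).get j) := by
  rw [map_eq_ofFn]
  exact cwL_ofFn P (n := t.length) fun j => f ((i :: t).get j)

theorem hcwL_map_cons (i : ι) (t s : List ι) (f : ι → Matrix (Fin r) (Fin r) (Cochain O M)) :
    hcwL P Q ((i :: t).map f) (s.map f) =
      hcw (p := t.length) P Q (fun j => f ((i :: t).get j)) fun j => f (s.get j) := by
  rw [map_eq_ofFn, map_eq_ofFn]
  exact hcwL_ofFn P Q (n := t.length) (fun j => f ((i :: t).get j)) fun j => f (s.get j)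

theorem cwL_rel {A' G' Λ : Type*} [CommRing A'] [Algebra K A'] [LieRing G'] [LieRing Λ]
    [LieRingModule G' A'] [DerAct K A' G'] {m : Morph K O M A' G' Λ} (hα : m.α 0 = 0)
    (hβ : m.β 0 = 0) {l : List ι} {f : ι → Matrix (Fin r) (Fin r) (Cochain O M)}
    {f' : ι → Matrix (Fin r) (Fin r) (Cochain A' G')}
    (h : ∀ i ∈ l, ∀ a b, m.Rel (f i a b) (f' i a b)) :
    m.Rel (cwL P (l.map f)) (cwL P (l.map f')) := by
  cases l with
  | nil => exact Morph.Rel.zero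
  | cons i t =>
    rw [cwL_map_cons, cwL_map_cons]
    exact cw_rel hα hβ P fun j => h _ (List.get_mem (i :: t) j)

theorem hcwL_rel {A' G' Λ : Type*} [CommRing A'] [Algebra K A'] [LieRing G'] [LieRing Λ]
    [LieRingModule G' A'] [DerAct K A' G'] {m : Morph K O M A' G' Λ} (hα : m.α 0 = 0)
    (hβ : m.β 0 = 0) {l s : List ι} {f : ι → Matrix (Fin r) (Fin r) (Cochain O M)}
    {f' : ι → Matrix (Fin r) (Fin r) (Cochain A' G')}
    (h : ∀ i ∈ l, ∀ a b, m.Rel (f i a b) (f' i a b))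
    (hs : ∀ i ∈ s, ∀ a b, m.Rel (f i a b) (f' i a b)) :
    m.Rel (hcwL P Q (l.map f) (s.map f)) (hcwL P Q (l.map f') (s.map f')) := by
  cases l with
  | nil => exact Morph.Rel.zero
  | cons i t =>
    rw [hcwL_map_cons, hcwL_map_cons]
    exact hcw_rel P Q hα hβ (fun j => h _ (List.get_mem (i :: t) j)) fun j => hs _ (List.get_mem s j)

end Maps

variable [CharZero K] {P Q}

theorem cwL_gauge {ι : Type*} (hP : P ∈ invariantPolynomials K r)
    {g g' : Matrix (Fin r) (Fin r) O} (hg : g * g' = 1) {l : List ι}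
    {f f' : ι → Matrix (Fin r) (Fin r) (Cochain O M)} (h : ∀ i ∈ l, IsConn (f i))
    (h' : ∀ i ∈ l, IsConn (f' i)) (hG : ∀ i ∈ l, Gauge g (f i) (f' i)) :
    cwL P (l.map f) = cwL P (l.map f') := by
  cases l with
  | nil => rfl
  | cons i t =>
    rw [cwL_map_cons, cwL_map_cons]
    exact cw_gauge hP hg (fun j => h _ (List.get_mem (i :: t) j)) (fun j => h' _ (List.get_mem (i :: t) j))
      fun j => hG _ (List.get_mem (i :: t) j)

theorem hcwL_gauge {ι : Type*} (hP : P ∈ invariantPolynomials K r)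
    (hQ : Q ∈ invariantPolynomials K r)
    {g g' : Matrix (Fin r) (Fin r) O} (hg : g * g' = 1) {l s : List ι}
    {f f' : ι → Matrix (Fin r) (Fin r) (Cochain O M)} (h : ∀ i ∈ l, IsConn (f i))
    (h' : ∀ i ∈ l, IsConn (f' i)) (hG : ∀ i ∈ l, Gauge g (f i) (f' i)) (k : ∀ i ∈ s, IsConn (f i))
    (k' : ∀ i ∈ s, IsConn (f' i)) (kG : ∀ i ∈ s, Gauge g (f i) (f' i)) :
    hcwL P Q (l.map f) (s.map f) = hcwL P Q (l.map f') (s.map f') := by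
  cases l with
  | nil => rfl
  | cons i t =>
    rw [hcwL_map_cons, hcwL_map_cons]
    exact hcw_gauge hP hQ hg (fun j => h _ (List.get_mem (i :: t) j)) (fun j => h' _ (List.get_mem (i :: t) j))
      (fun j => k _ (List.get_mem s j)) (fun j => k' _ (List.get_mem s j))
      (fun j => hG _ (List.get_mem (i :: t) j)) fun j => kG _ (List.get_mem s j)

theorem d_cwL (hP : P ∈ invariantPolynomials K r) (h : ∀ θ ∈ l, IsConn θ) :
    d (cwL P l) = ∑ j ∈ Finset.range l.length, (-1) ^ j * cwL P (l.eraseIdx j) := by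
  rcases eq_or_ne l [] with rfl | hl
  · exact d_zero
  obtain ⟨n, Θ, rfl⟩ := exists_ofFn hl
  have hΘ : ∀ j, IsConn (Θ j) := fun j => h _ (List.mem_ofFn.mpr ⟨j, rfl⟩)
  rw [cwL_ofFn, List.length_ofFn, Finset.sum_range]
  simp only [eraseIdx_ofFn]
  cases n with
  | zero =>
    -- Deleting the only entry leaves the empty list, whose form is zero by convention, so the
    -- formula also covers a single connection.
    rw [d_cw_zero hP hΘ, Fin.sum_univ_one]
    exact (mul_zero _).symm
  | succ n =>
    rw [d_cw hP hΘ]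
    exact Finset.sum_congr rfl fun j _ => congrArg _ (cwL_ofFn P _).symm

theorem hcwL_nil (h : ∀ θ ∈ l, IsConn θ) : hcwL P Q l [] = cwL (P * Q) l := by
  cases l with
  | nil => rfl
  | cons θ t => exact hcw_nil _ fun j => h _ (List.get_mem (θ :: t) j)

theorem d_hcwL (hP : P ∈ invariantPolynomials K r) (hQ : Q ∈ invariantPolynomials K r)
    (h : ∀ θ ∈ l, IsConn θ) (hb : ∀ θ ∈ b, IsConn θ) (hl0 : l ≠ []) (hb0 : b ≠ []) :
    d (hcwL P Q l b) = (-1) ^ (l.length - 1) * (cwL P l * cwL Q b -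
        ∑ j ∈ Finset.range b.length, (-1) ^ j * hcwL P Q l (b.eraseIdx j)) +
      ∑ i ∈ Finset.range l.length, (-1) ^ i * hcwL P Q (l.eraseIdx i) b := by
  obtain ⟨p, Θ, rfl⟩ := exists_ofFn hl0
  obtain ⟨q, Ψ, rfl⟩ := exists_ofFn hb0
  have hΘ : ∀ j, IsConn (Θ j) := fun j => h _ (List.mem_ofFn.mpr ⟨j, rfl⟩)
  have hΨ : ∀ j, IsConn (Ψ j) := fun j => hb _ (List.mem_ofFn.mpr ⟨j, rfl⟩)
  rw [hcwL_ofFn, List.length_ofFn, List.length_ofFn, Finset.sum_range, Finset.sum_range, cwL_ofFn,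
    cwL_ofFn]
  simp only [eraseIdx_ofFn, hcwL_ofFn, Nat.add_sub_cancel]
  cases p with
  | zero =>
    rw [d_hcw_zero hP hQ hΘ hΨ, Fin.sum_univ_one, pow_zero, one_mul]
    exact (add_zero _).symm.trans (congrArg _ (mul_zero _).symm)
  | succ p =>
    rw [d_hcw_succ hP hQ hΘ hΨ]
    exact congrArg _ (Finset.sum_congr rfl fun i _ => congrArg _ (hcwL_ofFn P Q _ _).symm)

/-- The homotopy for products. -/
theorem d_prism_hcwL {ι : Type*} (hP : P ∈ invariantPolynomials K r)
    (hQ : Q ∈ invariantPolynomials K r) (l : List ι)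
    (f : ι → Matrix (Fin r) (Fin r) (Cochain O M)) (h : ∀ i ∈ l, IsConn (f i)) :
    d (∑ k ∈ Finset.range l.length,
        (-1) ^ k * hcwL P Q ((l.take (k + 1)).map f) ((l.drop k).map f)) +
      ∑ m ∈ Finset.range l.length, (-1) ^ m * ∑ k ∈ Finset.range (l.eraseIdx m).length,
        (-1) ^ k * hcwL P Q (((l.eraseIdx m).take (k + 1)).map f) (((l.eraseIdx m).drop k).map f) =
    ∑ k ∈ Finset.range l.length, cwL P ((l.take (k + 1)).map f) * cwL Q ((l.drop k).map f) -
      cwL (P * Q) (l.map f) := by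
  -- The boundary term is the product of the forms of the two blocks. Of the ends, the one with
  -- empty left block is zero by convention, and the one with empty right block is the form of `PQ`.
  have key := prism_formula (⟨⟨d, d_zero⟩, d_add⟩ : Cochain O M →+ Cochain O M)
    (fun a b => hcwL P Q (a.map f) (b.map f)) (fun a b => cwL P (a.map f) * cwL Q (b.map f)) l ?_
  · refine key.trans ?_
    rw [List.map_nil, hcwL_nil]
    · exact congrArg (· - _) (add_zero _)
    · intro θ hθ
      obtain ⟨i, hi, rfl⟩ := List.mem_map.mp hθ
      exact h i hi
  · intro k hk
    have h1 := d_hcwL hP hQ (l := (l.take (k + 1)).map f) (b := (l.drop k).map f) ?_ ?_ ?_ ?_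
    · refine h1.trans ?_
      simp only [List.length_map, List.eraseIdx_map, List.length_take]
      rw [show min (k + 1) l.length - 1 = k by omega]
    · intro θ hθ
      obtain ⟨i, hi, rfl⟩ := List.mem_map.mp hθ
      exact h i (List.mem_of_mem_take hi)
    · intro θ hθ
      obtain ⟨i, hi, rfl⟩ := List.mem_map.mp hθ
      exact h i (List.mem_of_mem_drop hi)
    · rw [← List.length_pos_iff, List.length_map, List.length_take]; omega
    · rw [← List.length_pos_iff, List.length_map, List.length_drop]; omega

/-- The homotopy between two families of connections. -/
theorem d_prism_cwL {ι : Type*} (hP : P ∈ invariantPolynomials K r) (l : List ι)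
    (f g : ι → Matrix (Fin r) (Fin r) (Cochain O M)) (hf : ∀ i ∈ l, IsConn (f i))
    (hg : ∀ i ∈ l, IsConn (g i)) :
    d (∑ k ∈ Finset.range l.length,
        (-1) ^ k * cwL P ((l.take (k + 1)).map f ++ (l.drop k).map g)) +
      ∑ m ∈ Finset.range l.length, (-1) ^ m * ∑ k ∈ Finset.range (l.eraseIdx m).length,
        (-1) ^ k * cwL P (((l.eraseIdx m).take (k + 1)).map f ++ ((l.eraseIdx m).drop k).map g) =
    cwL P (l.map g) - cwL P (l.map f) := by
  -- The mixed sequence spans one simplex, so no product term occurs. Its faces are those of the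
  -- left block followed by those of the right block, the latter with the sign shifted by the `k +
  -- 1` entries on the left.
  have key := prism_formula (⟨⟨d, d_zero⟩, d_add⟩ : Cochain O M →+ Cochain O M)
    (fun a b => cwL P (a.map f ++ b.map g)) (fun _ _ => 0) l ?_
  · refine key.trans ?_
    rw [Finset.sum_const_zero, zero_add, List.map_nil, List.map_nil, List.nil_append,
      List.append_nil]
  · intro k hk
    have h1 := d_cwL hP (l := (l.take (k + 1)).map f ++ (l.drop k).map g) ?_
    · refine h1.trans ?_
      have hlen : (l.take (k + 1)).length = k + 1 := by rw [List.length_take]; omega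
      rw [List.length_append, List.length_map, List.length_map, Finset.sum_range_add, hlen,
        add_comm, zero_sub, mul_neg, Finset.mul_sum, ← Finset.sum_neg_distrib]
      refine congrArg₂ _ (Finset.sum_congr rfl fun j _ => ?_) (Finset.sum_congr rfl fun i hi => ?_)
      · rw [List.eraseIdx_append_of_length_le (by rw [List.length_map]; omega), List.length_map,
          hlen, Nat.add_sub_cancel_left, List.eraseIdx_map, ← mul_assoc, ← pow_add, ← neg_mul,
          ← neg_one_mul ((-1 : Cochain O M) ^ _), ← pow_succ', show k + 1 + j = k + j + 1 by ring]
      · rw [Finset.mem_range] at hi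
        rw [List.eraseIdx_append_of_lt_length (by rw [List.length_map]; omega), List.eraseIdx_map]
    · intro θ hθ
      rcases List.mem_append.mp hθ with hθ | hθ
      · obtain ⟨i, hi, rfl⟩ := List.mem_map.mp hθ
        exact hf i (List.mem_of_mem_take hi)
      · obtain ⟨i, hi, rfl⟩ := List.mem_map.mp hθ
        exact hg i (List.mem_of_mem_drop hi)
end Lists
end Cochain

/-! ### Change of arguments, and values on pairs. -/

namespace Cochain
section Comap
variable {A G G' : Type*} [CommRing A]

/-- Precomposition with a map of the arguments. -/
def comapHom (A : Type*) [CommRing A] {G G' : Type*} (ψ : G → G') :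
    Cochain A G' →+* Cochain A G where
  toFun a := fun l => a (l.map ψ)
  map_one' := ext' fun l => by cases l <;> rfl
  map_mul' a b := ext' fun l =>
    ((Compat.mul (φ := RingHom.id A) (ψ := ψ) (a := fun l => a (l.map ψ)) (a' := a)
      (b := fun l => b (l.map ψ)) (b' := b) (fun _ => rfl) (fun _ => rfl)) l).symm
  map_zero' := rfl
  map_add' _ _ := rfl

theorem comapHom_const (ψ : G → G') (f : A) : comapHom A ψ (const f) = const f :=
  ext' fun l => by cases l <;> rfl

theorem comapHom_polyEval {K : Type*} [Field K] [Algebra K A] {r : ℕ} (ψ : G → G')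
    (P : MvPolynomial (Fin r × Fin r) K) (R : Fin r → Fin r → Cochain A G') :
    comapHom A ψ (polyEval P R) = polyEval P fun a b => comapHom A ψ (R a b) := by
  simp only [polyEval, map_sum, map_mul, comapHom_const, map_list_prod, List.map_map,
    Function.comp_def, map_pow]

theorem sum_app {ι : Type*} (s : Finset ι) (F : ι → Cochain A G) (l : List G) :
    (∑ i ∈ s, F i) l = ∑ i ∈ s, F i l := by
  classical
  induction s using Finset.induction_on with
  | empty => rfl
  | insert i s hi ih => rw [Finset.sum_insert hi, Finset.sum_insert hi, add_app, ih]

theorem mul_apply_pair {a b : Cochain A G} (ha : Deg 1 a) (hb : Deg 1 b) (Y Z : G) :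
    (a * b) [Y, Z] = a [Y] * b [Z] - a [Z] * b [Y] := by
  have h1 : a [Y, Z] = 0 := ha _ (by simp)
  have h2 : b [Y, Z] = 0 := hb _ (by simp)
  simp only [mul_cons, mul_nil, ins_sgn, sgn_nil, ins_app, sgn_sgn, neg_app, h1, h2]
  simp
  ring

theorem d_apply_pair [LieRing G] [LieRingModule G A] (a : Cochain A G) (Y Z : G) :
    d a [Y, Z] = ⁅Y, a [Z]⁆ - a [⁅Y, Z⁆] - ⁅Z, a [Y]⁆ := by
  simp only [d_cons, lieDer_cons, lieDer_nil, d_nil, ins_app, sub_zero]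
end Comap
end Cochain

/-! ### Connection matrices in a frame, and comparison with covariant derivatives. -/

section Local
open Cochain
variable {K : Type v} [Field K] {S : RingedSpaceOver.{u} K} {L : LieAlgebroid S} {E : OModule S}
  {V : S.Open} {r n : ℕ}

instance : DerAct K (S.Sec V) (L.Sec V) where
  lie_mul' X f g := by
    rw [LieRinehartRing.leibniz_mul_right, smul_eq_mul]; ring
  lie_smul' X c f := lie_smul c X f

/-- The matrix of a connection in a basis. -/
def connMat (A : L.Sec V →ₗ[S.Sec V] (E.Sec V →ₗ[K] E.Sec V))
    (e : Module.Basis (Fin r) (S.Sec V) (E.Sec V)) :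
    Matrix (Fin r) (Fin r) (Cochain (S.Sec V) (L.Sec V)) :=
  fun a b l => match l with
    | [X] => e.coord a (A X (e b))
    | _ => 0

theorem connMat_apply (A : L.Sec V →ₗ[S.Sec V] (E.Sec V →ₗ[K] E.Sec V))
    (e : Module.Basis (Fin r) (S.Sec V) (E.Sec V)) (a b : Fin r) (X : L.Sec V) :
    connMat A e a b [X] = e.coord a (A X (e b)) := rfl

theorem connMat_isConn (A : L.Sec V →ₗ[S.Sec V] (E.Sec V →ₗ[K] E.Sec V))
    (e : Module.Basis (Fin r) (S.Sec V) (E.Sec V)) : IsConn (connMat A e) := fun a b => by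
  have h : Deg 1 (connMat A e a b) := fun l hl => by
    match l, hl with
    | [], _ => rfl
    | [X], hl => exact absurd rfl hl
    | _ :: _ :: _, _ => rfl
  refine ⟨h, IsAlt.of_deg_one h fun X Y => ?_⟩
  simp only [connMat_apply, map_add, LinearMap.add_apply]

theorem connMat_lin (A : L.Sec V →ₗ[S.Sec V] (E.Sec V →ₗ[K] E.Sec V))
    (e : Module.Basis (Fin r) (S.Sec V) (E.Sec V)) (f : S.Sec V) (X : L.Sec V) (a b : Fin r) :
    Lin f X (f • X) (connMat A e a b) := by
  refine ⟨?_, fun Y => ?_⟩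
  · simp only [connMat_apply, map_smul, LinearMap.smul_apply, smul_eq_mul]
  · simp only [connMat_apply, LieRinehartRing.leibniz_smul_right, map_add, map_smul,
      LinearMap.smul_apply, LinearMap.add_apply, smul_eq_mul]

/-- The Leibniz rule for a covariant derivative. -/
def IsLeibniz (A : L.Sec V →ₗ[S.Sec V] (E.Sec V →ₗ[K] E.Sec V)) : Prop :=
  ∀ (X : L.Sec V) (f : S.Sec V) (m : E.Sec V), A X (f • m) = f • A X m + ⁅X, f⁆ • m

/-- Writing `e'_b = ∑ g_{cb} e_c`, applying the Leibniz rule and taking coordinates in `e` gives `g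
θ' = θ g + dg`. -/
theorem connMat_gauge {A : L.Sec V →ₗ[S.Sec V] (E.Sec V →ₗ[K] E.Sec V)} (hA : IsLeibniz A)
    (e e' : Module.Basis (Fin r) (S.Sec V) (E.Sec V)) :
    Gauge (e.toMatrix e') (connMat A e) (connMat A e') := by
  rw [Gauge.apply]
  intro a b
  have h₁ : Deg 1 (∑ c, const (e.toMatrix e' a c) * connMat A e' c b) := Deg.sum _ fun c _ => by
    simpa using (Deg.const (e.toMatrix e' a c)).mul (connMat_isConn A e' c b).1
  have h₂ : Deg 1 (∑ c, connMat A e a c * const (e.toMatrix e' c b) +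
      d (const (e.toMatrix e' a b))) :=
    (Deg.sum _ fun c _ => by
      simpa using (connMat_isConn A e a c).1.mul (Deg.const (e.toMatrix e' c b))).add
      (by simpa using (Deg.const (e.toMatrix e' a b)).d)
  refine ext' fun l => ?_
  by_cases hl : l.length = 1
  · obtain ⟨X, rfl⟩ := List.length_eq_one_iff.mp hl
    have hd : d (const (e.toMatrix e' a b) : Cochain (S.Sec V) (L.Sec V)) [X] =
        ⁅X, e.toMatrix e' a b⁆ := by
      rw [d_cons, lieDer_const, ins_const, d_zero, zero_app, sub_zero]; rfl
    rw [add_app, sum_app, sum_app, hd]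
    simp only [const_mul_app, mul_const_app, connMat_apply]
    have e₁ : e' b = ∑ c, e.toMatrix e' c b • e c := (e.sum_toMatrix_smul_self e' b).symm
    have e₂ : A X (e' b) = ∑ c, e'.coord c (A X (e' b)) • e' c := (e'.sum_repr _).symm
    have e₃ : e.coord a (A X (e' b)) = ∑ c, e.toMatrix e' a c * e'.coord c (A X (e' b)) := by
      conv_lhs => rw [e₂]
      rw [map_sum]
      refine Finset.sum_congr rfl fun c _ => ?_
      rw [map_smul, smul_eq_mul, mul_comm]; rfl
    rw [← e₃]
    conv_lhs => rw [e₁]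
    rw [map_sum, map_sum]
    simp only [hA X, map_add, map_smul, smul_eq_mul, Finset.sum_add_distrib]
    refine congrArg₂ _ (Finset.sum_congr rfl fun c _ => mul_comm _ _) ?_
    rw [Finset.sum_eq_single a]
    · simp
    · intro c _ hc
      simp [hc]
    · simp
  · rw [h₁ l hl, h₂ l hl]

/-! Comparison with the definition through covariant derivatives. -/

/-- Multiples of a basis vector. -/
def smulBasis (n : ℕ) (e : Module.Basis (Fin r) (S.Sec V) (E.Sec V)) (b : Fin r) :
    SimplexRing K n ⊗[K] S.Sec V →ₗ[K] SimplexRing K n ⊗[K] E.Sec V :=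
  LinearMap.lTensor _ ((LinearMap.toSpanSingleton (S.Sec V) (E.Sec V) (e b)).restrictScalars K)

theorem smulBasis_tmul (e : Module.Basis (Fin r) (S.Sec V) (E.Sec V)) (b : Fin r)
    (f : SimplexRing K n) (g : S.Sec V) : smulBasis n e b (f ⊗ₜ g) = f ⊗ₜ (g • e b) := rfl

/-- The coordinates in the basis. -/
def coordTensor (n : ℕ) (e : Module.Basis (Fin r) (S.Sec V) (E.Sec V)) (a : Fin r) :
    SimplexRing K n ⊗[K] E.Sec V →ₗ[K] SimplexRing K n ⊗[K] S.Sec V :=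
  LinearMap.lTensor (SimplexRing K n) ((e.coord a).restrictScalars K)

theorem coordTensor_smulBasis (e : Module.Basis (Fin r) (S.Sec V) (E.Sec V)) (a b : Fin r)
    (F : SimplexRing K n ⊗[K] S.Sec V) :
    coordTensor n e a (smulBasis n e b F) = if a = b then F else 0 := by
  induction F with
  | zero => simp
  | add F G hF hG => rw [map_add, map_add, hF, hG]; split_ifs <;> simp
  | tmul f g =>
    rw [smulBasis_tmul]
    change f ⊗ₜ[K] (e.coord a (g • e b)) = _
    rw [map_smul, Module.Basis.coord_apply, Module.Basis.repr_self, smul_eq_mul]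
    by_cases h : a = b
    · subst h; simp
    · rw [Finsupp.single_eq_of_ne h, mul_zero, TensorProduct.tmul_zero, if_neg h]

variable (A : Fin (n + 1) → L.Sec V →ₗ[S.Sec V] (E.Sec V →ₗ[K] E.Sec V))
  (e : Module.Basis (Fin r) (S.Sec V) (E.Sec V))

/-- The embedding of the constant vector fields in all. -/
def toTotal (Y : Prism K (L.Sec V) n) : TotalSec L V n := (Y.1, coordDer K Y.2)

theorem tot_apply (Θ : Fin (n + 1) → Matrix (Fin r) (Fin r) (Cochain (S.Sec V) (L.Sec V)))
    (a b : Fin r) (l : List (Prism K (L.Sec V) n)) :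
    tot K Θ a b l = ∑ j, SimplexRing.t K j ⊗ₜ Θ j a b (l.map fun Y => Y.1) := by
  refine (sum_app _ _ _).trans (Finset.sum_congr rfl fun j _ => ?_)
  refine (const_mul_app _ _ _).trans ?_
  change _ * (1 ⊗ₜ Θ j a b (l.map fun Y => Y.1)) = _
  rw [Algebra.TensorProduct.tmul_mul_tmul, one_mul, mul_one]

variable {A} in
-- The Leibniz rule for the total connection in coordinates. Each `∇_j` contributes the derivative
-- of the coefficient with weight `t_j`, and the weights add up to `1`.
theorem nablaTot_smulBasis (hA : ∀ j, IsLeibniz (A j)) (Y : Prism K (L.Sec V) n) (b : Fin r)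
    (F : SimplexRing K n ⊗[K] S.Sec V) :
    nablaTot A (toTotal Y) (smulBasis n e b F) = smulBasis n e b ⁅Y, F⁆ +
      ∑ a, smulBasis n e a (F * tot K (fun j => connMat (A j) e) a b [Y]) := by
  induction F with
  | zero => simp
  | add F G hF hG =>
    simp only [map_add, hF, hG, lie_add, add_mul, Finset.sum_add_distrib]; abel
  | tmul f g =>
    have h1 : ∀ a, (f ⊗ₜ[K] g) * tot K (fun j => connMat (A j) e) a b [Y] =
        ∑ j, (SimplexRing.t K j * f) ⊗ₜ[K] (g * e.coord a (A j Y.1 (e b))) := fun a => by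
      rw [tot_apply, Finset.mul_sum]
      refine Finset.sum_congr rfl fun j _ => ?_
      rw [Algebra.TensorProduct.tmul_mul_tmul, mul_comm f]; rfl
    have h2 : ∑ a, smulBasis n e a ((f ⊗ₜ[K] g) * tot K (fun j => connMat (A j) e) a b [Y]) =
        ∑ j, (SimplexRing.t K j * f) ⊗ₜ[K] (g • A j Y.1 (e b)) := by
      simp only [h1, map_sum, smulBasis_tmul]
      rw [Finset.sum_comm]
      refine Finset.sum_congr rfl fun j _ => ?_
      rw [← TensorProduct.tmul_sum]
      simp only [mul_smul]
      rw [← Finset.smul_sum]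
      exact congrArg (fun m => _ ⊗ₜ[K] (g • m)) (e.sum_repr _)
    have h3 : ∑ j, (SimplexRing.t K j * f) ⊗ₜ[K] (⁅Y.1, g⁆ • e b) = f ⊗ₜ (⁅Y.1, g⁆ • e b) := by
      rw [← TensorProduct.sum_tmul, ← Finset.sum_mul, SimplexRing.sum_t, one_mul]
    have h4 : nablaTot A (toTotal Y) (f ⊗ₜ (g • e b)) = coordDer K Y.2 f ⊗ₜ (g • e b) +
        ∑ j, (SimplexRing.t K j * f) ⊗ₜ[K] (A j Y.1 (g • e b)) := by
      rw [nablaTot, LinearMap.add_apply, LinearMap.sum_apply]; rfl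
    rw [h2, smulBasis_tmul, h4, prism_lie_tmul, map_add, smulBasis_tmul, smulBasis_tmul, ← h3]
    simp only [hA _ Y.1, TensorProduct.tmul_add, Finset.sum_add_distrib]
    abel

variable {A} in
-- Applying `[∇_Y, ∇_Z] - ∇_{⁅Y,Z⁆}` to a basis vector and reading off coordinates gives `dT + TT`
-- for the connection matrix `T`. The comparison is made on constant vector fields, which commute,
-- so that the embedding `toTotal` respects brackets.
theorem curvatureMatrix_comap (hA : ∀ j, IsLeibniz (A j)) (a b : Fin r) :
    comapHom _ toTotal (curvatureMatrix A e a b) =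
      curv (tot K fun j => connMat (A j) e) a b := by
  have hT := IsConn.tot K fun j => connMat_isConn (A j) e
  refine ext' fun l => ?_
  by_cases hl : l.length = 2
  · obtain ⟨Y, Z, rfl⟩ := List.length_eq_two.mp hl
    set T := tot K fun j => connMat (A j) e with hTdef
    have hone : (1 : SimplexRing K n) ⊗ₜ[K] e b = smulBasis n e b 1 := by
      change _ = (1 : SimplexRing K n) ⊗ₜ[K] ((1 : S.Sec V) • e b)
      rw [one_smul]
    have h1 : ∀ W, nablaTot A (toTotal W) (smulBasis n e b 1) = ∑ c, smulBasis n e c (T c b [W]) := by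
      intro W
      rw [nablaTot_smulBasis e hA, lie_one_of_derAct K, map_zero, zero_add]
      simp only [one_mul]; rfl
    have hc : ∀ F : Fin r → SimplexRing K n ⊗[K] S.Sec V,
        coordTensor n e a (∑ c, smulBasis n e c (F c)) = F a := fun F => by
      rw [map_sum]
      simp only [coordTensor_smulBasis]
      simp
    have h2 : ∀ W W', coordTensor n e a (nablaTot A (toTotal W)
        (nablaTot A (toTotal W') (smulBasis n e b 1))) =
        ⁅W, T a b [W']⁆ + ∑ c, T c b [W'] * T a c [W] := fun W W' => by
      rw [h1, map_sum, map_sum]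
      simp only [nablaTot_smulBasis e hA, map_add, hc, coordTensor_smulBasis]
      rw [Finset.sum_add_distrib]
      simp
      rfl
    have h3 : ⁅toTotal Y, toTotal Z⁆ = toTotal (L := L) (V := V) ⁅Y, Z⁆ :=
      Prod.ext rfl ((coordDer_lie K Y.2 Z.2).trans (coordDer_zero K).symm)
    have h4 : curvatureMatrix A e a b [toTotal Y, toTotal Z] =
        coordTensor n e a (nablaTot A (toTotal Y) (nablaTot A (toTotal Z) (smulBasis n e b 1))) -
        coordTensor n e a (nablaTot A (toTotal Z) (nablaTot A (toTotal Y) (smulBasis n e b 1))) -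
        coordTensor n e a (nablaTot A (toTotal ⁅Y, Z⁆) (smulBasis n e b 1)) := by
      rw [← map_sub, ← map_sub, ← h3, ← hone]; rfl
    refine h4.trans ?_
    rw [h2, h2, h1, hc]
    have h5 : (T * T) a b [Y, Z] = ∑ c, (T a c [Y] * T c b [Z] - T a c [Z] * T c b [Y]) := by
      rw [Matrix.mul_apply]
      refine (sum_app _ _ _).trans (Finset.sum_congr rfl fun c _ => ?_)
      exact mul_apply_pair (hT a c).1 (hT c b).1 Y Z
    have h6 : curv T a b [Y, Z] = d (T a b) [Y, Z] + (T * T) a b [Y, Z] := rfl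
    rw [h6, h5, d_apply_pair, Finset.sum_sub_distrib]
    simp only [mul_comm (T _ b _)]
    ring
  · rw [hT.curv_deg a b l hl]
    match l, hl with
    | [], _ => rfl
    | [_], _ => rfl
    | [_, _], hl => exact absurd rfl hl
    | _ :: _ :: _ :: _, _ => rfl

variable {A} in
-- All arguments at which the integral evaluates its form, the `∂_j` and the sections of the Lie
-- algebroid, lie in the image of `toTotal`.
theorem chernWeil_eq_cw (hA : ∀ j, IsLeibniz (A j)) (P : MvPolynomial (Fin r × Fin r) K)
    (X : List (L.Sec V)) :
    chernWeil A e P X = cw P (fun j => connMat (A j) e) X := by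
  have hl : ((List.ofFn fun j : Fin n => ((0, MvPolynomial.pderiv j) : TotalSec L V n)).reverse ++
      X.map fun Y => ((Y, 0) : TotalSec L V n)) =
      (Prism.frame K (L.Sec V) n ++ X.map (Prism.incl K n)).map toTotal := by
    rw [List.map_append, List.map_map, Prism.frame, List.map_reverse, List.map_ofFn]
    refine congrArg₂ (fun f g => (List.ofFn f).reverse ++ X.map g) ?_ ?_
    · funext j
      exact Prod.ext rfl (coordDer_single K j).symm
    · funext Y
      exact Prod.ext rfl (coordDer_zero K).symm
  have hp : polyEval P (curvatureMatrix A e)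
      ((Prism.frame K (L.Sec V) n ++ X.map (Prism.incl K n)).map toTotal) =
      polyEval P (curv (tot K fun j => connMat (A j) e))
        (Prism.frame K (L.Sec V) n ++ X.map (Prism.incl K n)) := by
    have h := comapHom_polyEval (toTotal (L := L) (V := V) (n := n)) P (curvatureMatrix A e)
    simp only [curvatureMatrix_comap e hA] at h
    exact congrFun h _
  rw [chernWeil, hl, hp]
  rfl

/-! Restriction to smaller open sets. -/

/-- Restriction of sections as a morphism. -/
def resMorph (L : LieAlgebroid S) {W V : S.Open} (h : W ≤ V) :
    Morph K (S.Sec V) (L.Sec V) (S.Sec W) (L.Sec W) (L.Sec V) where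
  φ := S.res h
  α := id
  β := L.res h
  α_lie _ _ := rfl
  β_lie := L.res_lie h
  φ_lie := L.res_lie_fun h

theorem resMorph_rel_iff {W V : S.Open} (h : W ≤ V) (a : Cochain (S.Sec V) (L.Sec V))
    (a' : Cochain (S.Sec W) (L.Sec W)) : (resMorph L h).Rel a a' ↔
      Compat (S.res h : S.Sec V →+* S.Sec W) (L.res h) a a' := by
  refine forall_congr' fun l => ?_
  change S.res h (a (l.map id)) = _ ↔ _
  rw [List.map_id]; rfl

theorem OModule.res_sum (E : OModule S) {W V : S.Open} (h : W ≤ V) {ι : Type*} (s : Finset ι)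
    (m : ι → E.Sec V) : E.res h (∑ i ∈ s, m i) = ∑ i ∈ s, E.res h (m i) := map_sum _ _ _

theorem Frame.res_coord (e : Frame E r V) {W : S.Open} (h : W ≤ V) (a : Fin r) (m : E.Sec V) :
    S.res h ((e.basis V le_rfl).coord a m) = (e.basis W h).coord a (E.res h m) := by
  conv_rhs => rw [← (e.basis V le_rfl).sum_repr m]
  rw [OModule.res_sum, map_sum]
  simp only [OModule.res_smul, e.res_basis, map_smul, smul_eq_mul]
  rw [Finset.sum_eq_single a]
  · simp
  · intro c _ hc
    simp [hc.symm]
  · simp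

/-- Restriction of frames. -/
def Frame.restrict (e : Frame E r V) {W : S.Open} (h : W ≤ V) : Frame E r W where
  basis W' h' := e.basis W' (h'.trans h)
  res_basis W' h' i := by
    rw [← e.res_basis W h, ← e.res_basis W' (h'.trans h), OModule.res_trans]

theorem connMat_rel {U : S.Open} (c : Connection L E U) (hV : V ≤ U) (e : Frame E r V)
    {W : S.Open} (h : W ≤ V) (a b : Fin r) :
    (resMorph L h).Rel (connMat (c.nabla V hV) (e.basis V le_rfl) a b)
      (connMat (c.nabla W (h.trans hV)) (e.basis W h) a b) := by
  rw [resMorph_rel_iff]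
  intro l
  match l with
  | [] => exact map_zero (S.res h)
  | [X] =>
    refine (e.res_coord h a _).trans ?_
    rw [c.res_nabla V W hV h, e.res_basis]; rfl
  | _ :: _ :: _ => exact map_zero (S.res h)
end Local

/-! ### Gluing of forms given in local frames. -/

section Gluing
variable {K : Type v} [Field K] {S : RingedSpaceOver.{u} K} {L : LieAlgebroid S} {E : OModule S}
  {r : ℕ}

theorem RingedSpaceOver.sec_ext {V : S.Open} {J : Type u} (W : J → S.Open) (hW : ∀ j, W j ≤ V)
    (hV : ∀ x ∈ V, ∃ j, x ∈ W j) {f g : S.Sec V} (h : ∀ j, S.res (hW j) f = S.res (hW j) g) :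
    f = g :=
  S.space.sheaf.eq_of_locally_eq' W V (fun j => homOfLE (hW j))
    (fun x hx => Opens.mem_iSup.mpr (hV x hx)) f g h

theorem RingedSpaceOver.exists_sec {V : S.Open} {J : Type u} (W : J → S.Open)
    (hW : ∀ j, W j ≤ V) (hV : ∀ x ∈ V, ∃ j, x ∈ W j) (s : ∀ j, S.Sec (W j))
    (hs : ∀ i j, S.res (inf_le_left : W i ⊓ W j ≤ W i) (s i) =
      S.res (inf_le_right : W i ⊓ W j ≤ W j) (s j)) :
    ∃ f : S.Sec V, ∀ j, S.res (hW j) f = s j :=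
  (S.space.sheaf.existsUnique_gluing' W V (fun j => homOfLE (hW j))
    (fun x hx => Opens.mem_iSup.mpr (hV x hx)) s fun i j => hs i j).exists

/-- The open subsets of `V` with a frame. -/
abbrev FrameOpen (E : OModule S) (r : ℕ) (V : S.Open) : Type u :=
  {W : S.Open // W ≤ V ∧ Nonempty (Frame E r W)}

theorem FrameOpen.cover (hE : IsLocallyFree E r) (V : S.Open) (x : S.space) (hx : x ∈ V) :
    ∃ j : FrameOpen E r V, x ∈ j.1 := by
  obtain ⟨W, hxW, ⟨e⟩⟩ := hE x
  exact ⟨⟨W ⊓ V, inf_le_right, ⟨e.restrict inf_le_left⟩⟩, hxW, hx⟩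

theorem IsLocallyFree.sec_ext (hE : IsLocallyFree E r) {V : S.Open} {f g : S.Sec V}
    (h : ∀ (W : S.Open) (hW : W ≤ V), Frame E r W → S.res hW f = S.res hW g) : f = g :=
  S.sec_ext (fun j : FrameOpen E r V => j.1) (fun j => j.2.1) (FrameOpen.cover hE V)
    fun j => j.2.2.elim (h j.1 j.2.1)

namespace LieAlgebroid.Form

/-- The cochain of a form on the sections over the whole open set. -/
def coch {V : S.Open} : L.Form V →+* Cochain (S.Sec V) (L.Sec V) where
  toFun ω := ω.1 ⟨V, le_rfl⟩
  map_one' := rfl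
  map_mul' _ _ := rfl
  map_zero' := rfl
  map_add' _ _ := rfl

theorem coch_d {V : S.Open} (ω : L.Form V) : coch (d ω) = Cochain.d (coch ω) := rfl
theorem coch_sgn {V : S.Open} (ω : L.Form V) : coch (sgn ω) = Cochain.sgn (coch ω) := rfl

theorem ext_frames (hE : IsLocallyFree E r) {U : S.Open} {ω η : L.Form U}
    (h : ∀ (V : S.Open) (hV : V ≤ U), Frame E r V → coch (res hV ω) = coch (res hV η)) :
    ω = η := by
  refine ext fun V hV X => hE.sec_ext fun W hW e => ?_
  refine (ω.2.2 ⟨V, hV⟩ ⟨W, hW.trans hV⟩ hW X).trans ?_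
  refine (congrFun (h W (hW.trans hV) e) (X.map (L.res hW))).trans ?_
  exact (η.2.2 ⟨V, hV⟩ ⟨W, hW.trans hV⟩ hW X).symm

end LieAlgebroid.Form

/-- A function of local frames with values in forms that is compatible with restriction and does
not depend on the frame. -/
structure IsNatural (U : S.Open)
    (F : ∀ V : S.Open, Frame E r V → Cochain (S.Sec V) (L.Sec V)) : Prop where
  form : ∀ V, V ≤ U → ∀ e, (F V e).IsForm
  frame : ∀ V, V ≤ U → ∀ e e', F V e = F V e'
  compat : ∀ V, V ≤ U → ∀ (e : Frame E r V) (W : S.Open) (hW : W ≤ V),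
    Cochain.Compat (S.res hW : S.Sec V →+* S.Sec W) (L.res hW) (F V e) (F W (e.restrict hW))

namespace IsNatural
variable {U : S.Open} {F G : ∀ V : S.Open, Frame E r V → Cochain (S.Sec V) (L.Sec V)}

theorem zero : IsNatural (E := E) (r := r) (L := L) U fun _ _ => 0 :=
  ⟨fun _ _ _ => Cochain.IsForm.zero, fun _ _ _ _ => rfl, fun _ _ _ _ _ => Cochain.Compat.zero⟩

theorem add (hF : IsNatural U F) (hG : IsNatural U G) : IsNatural U fun V e => F V e + G V e :=
  ⟨fun V h e => (hF.form V h e).add (hG.form V h e),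
    fun V h e e' => congrArg₂ _ (hF.frame V h e e') (hG.frame V h e e'),
    fun V h e W hW => (hF.compat V h e W hW).add (hG.compat V h e W hW)⟩

theorem neg (hF : IsNatural U F) : IsNatural U fun V e => -F V e :=
  ⟨fun V h e => (hF.form V h e).neg, fun V h e e' => congrArg _ (hF.frame V h e e'),
    fun V h e W hW => (hF.compat V h e W hW).neg⟩

theorem sign_mul (k : ℕ) (hF : IsNatural U F) : IsNatural U fun V e => (-1) ^ k * F V e := by
  rcases Nat.even_or_odd k with h | h
  · simpa only [h.neg_one_pow, one_mul] using hF
  · simpa only [h.neg_one_pow, neg_one_mul] using hF.neg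

theorem sum {ι : Type*} (s : Finset ι)
    {F : ι → ∀ V : S.Open, Frame E r V → Cochain (S.Sec V) (L.Sec V)}
    (hF : ∀ i ∈ s, IsNatural U (F i)) : IsNatural U fun V e => ∑ i ∈ s, F i V e := by
  classical
  induction s using Finset.induction_on with
  | empty => simpa only [Finset.sum_empty] using zero
  | insert i s hi ih =>
    simp only [Finset.sum_insert hi]
    exact (hF i (Finset.mem_insert_self i s)).add
      (ih fun j hj => hF j (Finset.mem_insert_of_mem hj))

/-- The values on framed open sets agree on overlaps, by compatibility with restriction and
independence of the frame, so the sheaf axiom yields a section; the frames chosen on the way drop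
out. -/
theorem exists_eval (hE : IsLocallyFree E r) (hF : IsNatural U F) {V : S.Open} (hV : V ≤ U)
    (X : List (L.Sec V)) : ∃ f : S.Sec V, ∀ (W : S.Open) (hW : W ≤ V) (e : Frame E r W),
      S.res hW f = F W e (X.map (L.res hW)) := by
  have hmap : ∀ {W W' : S.Open} (hW : W ≤ V) (h : W' ≤ W),
      (X.map (L.res hW)).map (L.res h) = X.map (L.res (h.trans hW)) := fun hW h => by
    rw [List.map_map]
    exact List.map_congr_left fun Y _ => L.res_trans h hW Y
  obtain ⟨f, hf⟩ := S.exists_sec (fun j : FrameOpen E r V => j.1) (fun j => j.2.1)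
    (FrameOpen.cover hE V) (fun j => F j.1 j.2.2.some (X.map (L.res j.2.1))) fun i j => by
      have hi := hF.compat i.1 (i.2.1.trans hV) i.2.2.some (i.1 ⊓ j.1) inf_le_left
        (X.map (L.res i.2.1))
      have hj := hF.compat j.1 (j.2.1.trans hV) j.2.2.some (i.1 ⊓ j.1) inf_le_right
        (X.map (L.res j.2.1))
      rw [hmap] at hi hj
      refine hi.trans (Eq.trans ?_ hj.symm)
      exact congrFun (hF.frame _ ((inf_le_left.trans i.2.1).trans hV) _ _) _
  refine ⟨f, fun W hW e => (hf ⟨W, hW, ⟨e⟩⟩).trans ?_⟩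
  exact congrFun (hF.frame W (hW.trans hV) _ _) _

/-- The glued values are characterized by their restrictions to framed open sets. Multilinearity,
alternation and compatibility are equalities of sections, hence may be checked there, where they
hold for the local expressions. -/
theorem exists_form (hE : IsLocallyFree E r) (hF : IsNatural U F) :
    ∃ ω : L.Form U, ∀ (V : S.Open) (hV : V ≤ U) (e : Frame E r V),
      LieAlgebroid.Form.coch (LieAlgebroid.Form.res hV ω) = F V e := by
  choose G hG using fun (V : {V : S.Open // V ≤ U}) (X : List (L.Sec V.1)) =>
    exists_eval hE hF V.2 X
  have hmap : ∀ {V W W' : S.Open} (hW : W ≤ V) (h : W' ≤ W) (X : List (L.Sec V)),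
      (X.map (L.res hW)).map (L.res h) = X.map (L.res (h.trans hW)) := fun hW h X => by
    rw [List.map_map]
    exact List.map_congr_left fun Y _ => L.res_trans h hW Y
  refine ⟨⟨G, fun V => ⟨fun l₁ X Y l₂ => ?_, fun l₁ f X l₂ => ?_, fun l₁ X l₂ => ?_⟩,
    fun V W h X => ?_⟩, fun V hV e => Cochain.ext' fun X => ?_⟩
  · refine hE.sec_ext fun W hW e => ?_
    rw [map_add, hG V _ W hW e, hG V _ W hW e, hG V _ W hW e]
    simp only [List.map_append, List.map_cons, map_add]
    exact (hF.form W (hW.trans V.2) e).map_add _ _ _ _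
  · refine hE.sec_ext fun W hW e => ?_
    rw [map_mul, hG V _ W hW e, hG V _ W hW e]
    have hX : L.res hW (f • X) = S.res hW f • L.res hW X := L.mod.res_smul hW f X
    simp only [List.map_append, List.map_cons, hX]
    exact (hF.form W (hW.trans V.2) e).map_smul _ _ _ _
  · refine hE.sec_ext fun W hW e => ?_
    rw [map_zero, hG V _ W hW e]
    simp only [List.map_append, List.map_cons]
    exact (hF.form W (hW.trans V.2) e).alternating _ _ _
  · refine hE.sec_ext fun W' hW' e => ?_
    rw [hG W _ W' hW' e, hmap]
    exact (S.res_trans hW' h _).trans (hG V X W' (hW'.trans h) e)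
  · refine (S.res_refl _).symm.trans ((hG ⟨V, hV⟩ X V le_rfl e).trans (congrArg (F V e) ?_))
    exact (List.map_congr_left fun Y _ => L.res_refl Y).trans (List.map_id X)

end IsNatural

namespace Tot
open LieAlgebroid.Form
variable {N : OpenSystem S}

theorem ext_frames (hE : IsLocallyFree E r) {a b : Tot L N}
    (h : ∀ (l : List N.Idx) (V : S.Open) (hV : V ≤ N.opens l), Frame E r V →
      coch (a.val l hV) = coch (b.val l hV)) : a = b :=
  ext fun l => LieAlgebroid.Form.ext_frames hE fun V hV e => h l V hV e

theorem eval_eq_zero (hE : IsLocallyFree E r) {U V : S.Open} (ω : L.Form U) (hV : V ≤ U)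
    (X : List (L.Sec V)) (h : ∀ (W : S.Open) (hW : W ≤ V), Frame E r W →
      coch (res (hW.trans hV) ω) (X.map (L.res hW)) = 0) : ω.eval V hV X = 0 :=
  hE.sec_ext fun W hW e => by
    rw [map_zero]
    exact (ω.2.2 ⟨V, hV⟩ ⟨W, hW.trans hV⟩ hW X).trans (h W hW e)

theorem exists_tot (hE : IsLocallyFree E r)
    {F : List N.Idx → ∀ V : S.Open, Frame E r V → Cochain (S.Sec V) (L.Sec V)}
    (hF : ∀ l, IsNatural (N.opens l) (F l)) (h0 : ∀ V e, F [] V e = 0) (m : ℕ)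
    (hm : ∀ (l : List N.Idx) (V : S.Open), V ≤ N.opens l → ∀ (e : Frame E r V)
      (X : List (L.Sec V)), m < l.length + X.length → F l V e X = 0) :
    ∃ x : Tot L N, ∀ (l : List N.Idx) (V : S.Open) (hV : V ≤ N.opens l) (e : Frame E r V),
      coch (x.val l hV) = F l V e := by
  choose G hG using fun l => (hF l).exists_form hE
  refine ⟨⟨G, ?_, m, fun l V hV X hX => ?_⟩, hG⟩
  · refine LieAlgebroid.Form.ext_frames hE fun V hV e => ?_
    rw [hG [] V hV e, h0]; rfl
  · refine eval_eq_zero hE (G l) hV X fun W hW e => ?_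
    rw [hG l W _ e]
    exact hm l W (hW.trans hV) e _ (by rwa [List.length_map])

end Tot
end Gluing

/-! ### Additivity in the polynomial, and the unit. -/

namespace Cochain
section Algebra
variable {K O M : Type*} [Field K] [CommRing O] [Algebra K O] [LieRing M] [LieRingModule M O]
  [DerAct K O M] {r : ℕ} {l : List (Matrix (Fin r) (Fin r) (Cochain O M))}

theorem cwL_zero (h : ∀ θ ∈ l, IsConn θ) :
    cwL (0 : MvPolynomial (Fin r × Fin r) K) l = 0 :=
  ext' fun X => cwL_vanish _ h X fun s hs => by simp at hs

theorem cwL_add (P Q : MvPolynomial (Fin r × Fin r) K) (h : ∀ θ ∈ l, IsConn θ) :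
    cwL (P + Q) l = cwL P l + cwL Q l := by
  cases l with
  | nil => exact (add_zero _).symm
  | cons θ t =>
    rw [cwL, cw, polyEval_add P Q (IsConn.tot K fun j => h _ (List.get_mem (θ :: t) j)).curv_even,
      fiberInt_add]
    rfl

theorem lift_one (n : ℕ) : lift K n (1 : Cochain O M) = 1 :=
  lift_eq Morph.Rel.one

theorem d_sign_mul (k : ℕ) (a : Cochain O M) : d ((-1) ^ k * a) = (-1) ^ k * d a :=
  map_neg_one_pow_mul (⟨⟨d, d_zero⟩, d_add⟩ : Cochain O M →+ Cochain O M) k a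

/-- A constant polynomial gives a form of degree zero, which cannot be integrated over a simplex of
positive dimension; over a point the integral is the value. -/
theorem cwL_one [CharZero K] (h : ∀ θ ∈ l, IsConn θ) :
    cwL (1 : MvPolynomial (Fin r × Fin r) K) l = if l.length = 1 then 1 else 0 := by
  match l with
  | [] => rfl
  | [θ] =>
    refine Eq.trans ?_ (if_pos rfl).symm
    rw [cwL, cw, polyEval_one (IsConn.tot K fun j => h _ (List.get_mem [θ] j)).curv_even]
    have := fiberInt_zero_lift (K := K) (1 : Cochain O M)
    rw [lift_one] at this
    exact this
  | θ :: θ' :: t =>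
    rw [if_neg (by simp)]
    refine ext' fun X => cwL_vanish _ h X fun s hs => ?_
    rw [MvPolynomial.mem_support_iff, MvPolynomial.coeff_one] at hs
    obtain rfl : 0 = s := by by_contra hne; simp [hne] at hs
    simp
    omega
end Algebra
end Cochain

/-! ### Forms of families of connections in local frames. -/

section Families
open Cochain LieAlgebroid.Form
variable {K : Type v} [Field K] {S : RingedSpaceOver.{u} K} {L : LieAlgebroid S} {E : OModule S}
  {r : ℕ} {I : Type*} {U : I → S.Open}

open Classical in
/-- The matrices of a family of connections in a frame (zero where a connection is not defined). -/
def frameMat (c : ∀ i, Connection L E (U i)) {V : S.Open} (e : Frame E r V) (i : I) :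
    Matrix (Fin r) (Fin r) (Cochain (S.Sec V) (L.Sec V)) :=
  if h : V ≤ U i then connMat ((c i).nabla V h) (e.basis V le_rfl) else 0

variable (c : ∀ i, Connection L E (U i)) {V : S.Open}

theorem frameMat_of_le (e : Frame E r V) {i : I} (h : V ≤ U i) :
    frameMat c e i = connMat ((c i).nabla V h) (e.basis V le_rfl) := dif_pos h

theorem frameMat_isConn (e : Frame E r V) (i : I) : IsConn (frameMat c e i) := by
  by_cases h : V ≤ U i
  · rw [frameMat_of_le c e h]
    exact connMat_isConn _ _
  · rw [frameMat, dif_neg h]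
    exact fun a b => ⟨fun _ _ => rfl, IsAlt.zero⟩

theorem isConn_of_mem_map (e : Frame E r V) {l : List I} :
    ∀ θ ∈ l.map (frameMat c e), IsConn θ := fun θ hθ => by
  obtain ⟨i, -, rfl⟩ := List.mem_map.mp hθ
  exact frameMat_isConn c e i

theorem frameMat_lin (e : Frame E r V) (i : I) (f : S.Sec V) (X : L.Sec V) (a b : Fin r) :
    Lin f X (f • X) (frameMat c e i a b) := by
  by_cases h : V ≤ U i
  · rw [frameMat_of_le c e h]
    exact connMat_lin _ _ f X a b
  · rw [frameMat, dif_neg h]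
    refine ⟨(mul_zero f).symm, fun Y => ?_⟩
    change (0 : S.Sec V) = f * 0 + _ * 0
    rw [mul_zero, mul_zero, add_zero]

theorem lin_of_mem_map (e : Frame E r V) {l : List I} (f : S.Sec V) (X : L.Sec V) :
    ∀ θ ∈ l.map (frameMat c e), ∀ a b, Lin f X (f • X) (θ a b) := fun θ hθ => by
  obtain ⟨i, -, rfl⟩ := List.mem_map.mp hθ
  exact frameMat_lin c e i f X

theorem frameMat_gauge (e e' : Frame E r V) {i : I} (h : V ≤ U i) :
    Gauge ((e.basis V le_rfl).toMatrix (e'.basis V le_rfl)) (frameMat c e i) (frameMat c e' i) := by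
  rw [frameMat_of_le c e h, frameMat_of_le c e' h]
  exact connMat_gauge ((c i).leibniz V h) _ _

theorem frameMat_rel (e : Frame E r V) {W : S.Open} (hW : W ≤ V) {i : I} (h : V ≤ U i)
    (a b : Fin r) : (resMorph L hW).Rel (frameMat c e i a b) (frameMat c (e.restrict hW) i a b) := by
  rw [frameMat_of_le c e h, frameMat_of_le c _ (hW.trans h)]
  exact connMat_rel (c i) h e hW a b

/-- Taking `Z = f X` for all `f` and `X` turns the relation `Scal`, which was followed through
products with simplices, back into linearity over the structure sheaf. -/
theorem IsNatural.of_scal {U : S.Open}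
    {F : ∀ V : S.Open, Frame E r V → Cochain (S.Sec V) (L.Sec V)}
    (h₁ : ∀ V e, IsAlt (F V e)) (h₂ : ∀ V e f X, Scal f X (f • X) (F V e))
    (h₃ : ∀ V, V ≤ U → ∀ e e', F V e = F V e')
    (h₄ : ∀ V, V ≤ U → ∀ (e : Frame E r V) (W : S.Open) (hW : W ≤ V),
      (resMorph L hW).Rel (F V e) (F W (e.restrict hW))) : IsNatural U F :=
  ⟨fun V _ e => ⟨(h₁ V e).map_add, fun l₁ f X l₂ => h₂ V e f X l₁ l₂, (h₁ V e).alternating⟩, h₃,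
    fun V h e W hW => (resMorph_rel_iff hW _ _).mp (h₄ V h e W hW)⟩

variable [CharZero K] {P Q : MvPolynomial (Fin r × Fin r) K} {U₀ : S.Open} {l s : List I}

theorem IsNatural.cwL (hP : P ∈ invariantPolynomials K r) (hl : ∀ i ∈ l, U₀ ≤ U i) :
    IsNatural U₀ fun V (e : Frame E r V) => cwL P (l.map (frameMat c e)) :=
  .of_scal (fun _ e => cwL_isAlt P (isConn_of_mem_map c e))
    (fun _ e f X => cwL_scal P (fun g => LieRinehartRing.lie_smul_eq_mul f g X)
      (isConn_of_mem_map c e) (lin_of_mem_map c e f X))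
    (fun V hV e e' => cwL_gauge hP
      (Module.Basis.toMatrix_mul_toMatrix_flip (e.basis V le_rfl) (e'.basis V le_rfl))
      (fun i _ => frameMat_isConn c e i) (fun i _ => frameMat_isConn c e' i)
      fun i hi => frameMat_gauge c e e' (hV.trans (hl i hi)))
    fun _ hV e _ hW => cwL_rel P rfl (map_zero (L.res hW)) fun i hi a b =>
      frameMat_rel c e hW (hV.trans (hl i hi)) a b

theorem IsNatural.hcwL (hP : P ∈ invariantPolynomials K r) (hQ : Q ∈ invariantPolynomials K r)
    (hl : ∀ i ∈ l, U₀ ≤ U i) (hs : ∀ i ∈ s, U₀ ≤ U i) :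
    IsNatural U₀ fun V (e : Frame E r V) =>
      hcwL P Q (l.map (frameMat c e)) (s.map (frameMat c e)) :=
  .of_scal (fun _ e => hcwL_isAlt P Q (isConn_of_mem_map c e) (isConn_of_mem_map c e))
    (fun _ e f X => hcwL_scal P Q (fun g => LieRinehartRing.lie_smul_eq_mul f g X)
      (isConn_of_mem_map c e) (lin_of_mem_map c e f X) (isConn_of_mem_map c e)
      (lin_of_mem_map c e f X))
    (fun V hV e e' => hcwL_gauge hP hQ
      (Module.Basis.toMatrix_mul_toMatrix_flip (e.basis V le_rfl) (e'.basis V le_rfl))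
      (fun i _ => frameMat_isConn c e i) (fun i _ => frameMat_isConn c e' i)
      (fun i hi => frameMat_gauge c e e' (hV.trans (hl i hi)))
      (fun i _ => frameMat_isConn c e i) (fun i _ => frameMat_isConn c e' i)
      fun i hi => frameMat_gauge c e e' (hV.trans (hs i hi)))
    fun _ hV e _ hW => hcwL_rel P Q rfl (map_zero (L.res hW))
      (fun i hi a b => frameMat_rel c e hW (hV.trans (hl i hi)) a b)
      fun i hi a b => frameMat_rel c e hW (hV.trans (hs i hi)) a b

theorem hcwL_eq_zero (e : Frame E r V) (X : List (L.Sec V))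
    (h : 2 * P.totalDegree + 2 * Q.totalDegree + 1 < l.length + s.length + X.length) :
    Cochain.hcwL P Q (l.map (frameMat c e)) (s.map (frameMat c e)) X = 0 :=
  hcwL_vanish P Q (isConn_of_mem_map c e) (isConn_of_mem_map c e) X (by simpa using h)

theorem cwL_eq_zero (e : Frame E r V) (X : List (L.Sec V))
    (h : 2 * P.totalDegree + 1 < l.length + X.length) :
    Cochain.cwL P (l.map (frameMat c e)) X = 0 :=
  cwL_vanish_of_lt P (isConn_of_mem_map c e) X (by simpa using h)
end Families

/-! ### Characteristic elements of the total complex. -/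

namespace Tot
open Cochain LieAlgebroid.Form
variable {K : Type v} [Field K] {S : RingedSpaceOver.{u} K} {L : LieAlgebroid S} {E : OModule S}
  {r : ℕ} {N N' : OpenSystem S} {U U' : N.Idx → S.Open} {c : ∀ i, Connection L E (U i)}
  {c' : ∀ i, Connection L E (U' i)} {P Q : MvPolynomial (Fin r × Fin r) K} {p q : Tot L N}

/-- The family of characteristic forms of a family of connections. -/
def IsCharacteristic (c : ∀ i, Connection L E (U i)) (P : MvPolynomial (Fin r × Fin r) K)
    (p : Tot L N) : Prop :=
  ∀ (l : List N.Idx) (V : S.Open) (h : V ≤ N.opens l) (e : Frame E r V),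
    coch (p.val l h) = cwL P (l.map (frameMat c e))

namespace IsCharacteristic

theorem exists_of_le [CharZero K] (hE : IsLocallyFree E r) (hP : P ∈ invariantPolynomials K r)
    (c : ∀ i, Connection L E (U i)) (hc : ∀ l, ∀ i ∈ l, N.opens l ≤ U i) :
    ∃ p : Tot L N, IsCharacteristic c P p :=
  exists_tot hE (fun l => .cwL c hP fun i hi => hc l i hi) (fun _ _ => rfl)
    (2 * P.totalDegree + 1) fun _ _ _ e X hX => cwL_eq_zero c e X hX

theorem unique (hE : IsLocallyFree E r) (hp : IsCharacteristic c P p)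
    (hq : IsCharacteristic c P q) : p = q :=
  ext_frames hE fun l V hV e => (hp l V hV e).trans (hq l V hV e).symm

theorem isHomogeneous (hE : IsLocallyFree E r) (h : IsCharacteristic c P p) {k : ℕ}
    (hP : P.IsHomogeneous k) : p.IsHomogeneous (2 * k) := fun l V hV X hX => by
  refine eval_eq_zero hE _ hV X fun W hW e => ?_
  refine (congrFun (h l W (hW.trans hV) e) _).trans ?_
  refine cwL_vanish P (isConn_of_mem_map _ e) _ fun s hs => ?_
  have hs' : s.degree = k := by
    rw [Finsupp.degree_eq_weight_one]
    exact hP (MvPolynomial.mem_support_iff.mp hs)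
  rwa [List.length_map, List.length_map, hs']

theorem d_val [CharZero K] (hE : IsLocallyFree E r) (hP : P ∈ invariantPolynomials K r)
    (h : IsCharacteristic c P p) (l : List N.Idx) {U : S.Open} (hU : U ≤ N.opens l) :
    LieAlgebroid.Form.d (p.val l hU) = ∑ j ∈ Finset.range l.length,
      (-1) ^ j * p.val (l.eraseIdx j) (hU.trans (erase_le l j)) := by
  refine LieAlgebroid.Form.ext_frames hE fun V hV e => ?_
  rw [LieAlgebroid.Form.res_d, coch_d, res_val, h _ _ _ e, d_cwL hP (isConn_of_mem_map _ e),
    List.length_map, map_sum, map_sum]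
  refine Finset.sum_congr rfl fun j _ => ?_
  rw [map_mul, map_mul, map_pow, map_neg, map_one, map_pow, map_neg, map_one, res_val, h _ _ _ e,
    List.eraseIdx_map]

theorem add (hp : IsCharacteristic c P p) (hq : IsCharacteristic c Q q) :
    IsCharacteristic c (P + Q) (p + q) := fun l V h e => by
  rw [val_add, map_add, hp, hq, cwL_add P Q (isConn_of_mem_map c e)]

theorem zero : IsCharacteristic c (0 : MvPolynomial (Fin r × Fin r) K) 0 := fun l V h e => by
  rw [val_zero, map_zero, cwL_zero (isConn_of_mem_map c e)]

theorem one [CharZero K] : IsCharacteristic c (1 : MvPolynomial (Fin r × Fin r) K) 1 :=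
  fun l V h e => by
    rw [val_one, cwL_one (isConn_of_mem_map c e), List.length_map]
    split_ifs
    · exact map_one coch
    · exact map_zero coch

theorem pullback {φ : N'.Idx → N.Idx} {hφ : ∀ l, N'.opens l ≤ N.opens (l.map φ)}
    (hp : IsCharacteristic c P p) :
    IsCharacteristic (fun j => c (φ j)) P (Tot.pullback φ hφ p) := fun l V h e => by
  rw [val_pullback, hp _ _ _ e, List.map_map]
  rfl

end IsCharacteristic

/-- With `m = n - 1` the Čech degree of a list of length `n`, the exponent is `m(m-1)/2`, and
passing to `m + 1` adds `m`. Truncated subtraction keeps this true for `n = 0`. -/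
theorem sign_exponent_succ (n : ℕ) :
    (n + 1 - 1) * (n + 1 - 2) / 2 = (n - 1) * (n - 2) / 2 + (n - 1) := by
  rcases n with _ | _ | n
  · rfl
  · rfl
  · rw [show (n + 1 + 1 + 1 - 1) * (n + 1 + 1 + 1 - 2) =
      (n + 1 + 1 - 1) * (n + 1 + 1 - 2) + (n + 1) * 2 by
        simp only [Nat.add_sub_cancel, Nat.reduceSubDiff]; ring,
      Nat.add_mul_div_right _ _ two_pos]
    rfl

theorem signed_pullback {φ : N'.Idx → N.Idx} {hφ : ∀ l, N'.opens l ≤ N.opens (l.map φ)}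
    (p : Tot L N) : signed (Tot.pullback φ hφ p) = Tot.pullback φ hφ (signed p) :=
  ext fun l => by
    rw [val_signed, val_pullback, val_pullback, val_signed, List.length_map]

theorem coch_signed (p : Tot L N) (l : List N.Idx) {V : S.Open} (h : V ≤ N.opens l) :
    coch ((signed p).val l h) = (-1) ^ ((l.length - 1) * (l.length - 2) / 2) * coch (p.val l h) := by
  rw [val_signed, map_mul, map_pow, map_neg, map_one]

theorem coch_D (p : Tot L N) (l : List N.Idx) {V : S.Open} (h : V ≤ N.opens l) :
    coch ((D p).val l h) = ∑ j ∈ Finset.range l.length,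
      (-1) ^ j * coch (p.val (l.eraseIdx j) (h.trans (erase_le l j))) +
      (-1) ^ (l.length - 1) * Cochain.d (coch (p.val l h)) := by
  rw [val_D, map_add, map_sum, map_mul, map_pow, map_neg, map_one, coch_d]
  refine congrArg (· + _) (Finset.sum_congr rfl fun j _ => ?_)
  rw [map_mul, map_pow, map_neg, map_one]

/-- Primitives in the total complex from local homotopies. -/
theorem exists_primitive (hE : IsLocallyFree E r)
    {F B : List N.Idx → ∀ V : S.Open, Frame E r V → Cochain (S.Sec V) (L.Sec V)}
    (hF : ∀ l, IsNatural (N.opens l) (F l)) (h0 : ∀ V e, F [] V e = 0) (m : ℕ)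
    (hm : ∀ (l : List N.Idx) (V : S.Open), V ≤ N.opens l → ∀ (e : Frame E r V)
      (X : List (L.Sec V)), m < l.length + X.length → F l V e X = 0)
    (hB : ∀ (l : List N.Idx) (V : S.Open), V ≤ N.opens l → ∀ e : Frame E r V,
      Cochain.d (F l V e) + ∑ j ∈ Finset.range l.length, (-1) ^ j * F (l.eraseIdx j) V e =
        B l V e) :
    ∃ x : Tot L N, ∀ (l : List N.Idx) (V : S.Open) (hV : V ≤ N.opens l) (e : Frame E r V),
      coch ((D x).val l hV) = (-1) ^ ((l.length - 1) * (l.length - 2) / 2) * -B l V e := by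
  -- Let `ε(n)` be the sign attached to length `n`. The primitive gets `ε(n+1)`: deleting an index
  -- turns it into `ε(n)`, and the factor `(-1)^(n-1)` of the term with `d` also turns it into
  -- `ε(n)`. Hence both parts of `D` acquire the same sign.
  obtain ⟨x, hx⟩ := exists_tot hE
    (F := fun l V e => (-1) ^ ((l.length + 1 - 1) * (l.length + 1 - 2) / 2) * -F l V e)
    (fun l => (hF l).neg.sign_mul _) (fun V e => by rw [h0, neg_zero, mul_zero]) m
    fun l V hV e X hX => by
      rcases Nat.even_or_odd ((l.length + 1 - 1) * (l.length + 1 - 2) / 2) with h | h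
      · rw [h.neg_one_pow, one_mul, neg_app, hm l V hV e X hX, neg_zero]
      · rw [h.neg_one_pow, neg_one_mul, neg_neg, hm l V hV e X hX]
  refine ⟨x, fun l V hV e => ?_⟩
  rw [coch_D, hx _ _ _ e, ← hB l V hV e]
  have h1 : ∀ j ∈ Finset.range l.length,
      (-1) ^ j * coch (x.val (l.eraseIdx j) (hV.trans (erase_le l j))) =
      (-1) ^ ((l.length - 1) * (l.length - 2) / 2) * -((-1) ^ j * F (l.eraseIdx j) V e) := by
    intro j hj
    rw [Finset.mem_range] at hj
    rw [hx _ _ _ e, List.length_eraseIdx_of_lt hj, Nat.sub_add_cancel (by omega), ← mul_assoc,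
      ← mul_neg, ← mul_assoc, ← pow_add, ← pow_add, add_comm]
  rw [Finset.sum_congr rfl h1, ← Finset.mul_sum, Finset.sum_neg_distrib, sign_exponent_succ,
    d_sign_mul, d_neg, ← mul_assoc, ← pow_add, add_comm _ (_ + _), add_assoc, ← two_mul, pow_add,
    pow_mul, neg_one_sq, one_pow, mul_one, ← mul_add, neg_add, add_comm (-_)]

end Tot

/-! ### Comparison with the local formula for coverings. -/

namespace ConnectionCover
open Cochain LieAlgebroid.Form
variable {K : Type v} [Field K] {S : RingedSpaceOver.{u} K} {L : LieAlgebroid S} {E : OModule S}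
  {r : ℕ} (𝒰 : ConnectionCover L E) (P : MvPolynomial (Fin r × Fin r) K) {p : Tot L 𝒰.system}

theorem chernWeil_eq_cwL (i : 𝒰.Idx) (t : List 𝒰.Idx) {V : S.Open}
    (h : V ≤ 𝒰.system.opens (i :: t)) (e : Frame E r V) (X : List (L.Sec V)) :
    chernWeil (𝒰.nabla i t h) (e.basis V le_rfl) P X =
      cwL P ((i :: t).map (frameMat 𝒰.conn e)) X := by
  rw [cwL_map_cons]
  refine (chernWeil_eq_cw _ (fun j => (𝒰.conn _).leibniz V _) P X).trans ?_
  refine congrFun (congrArg (cw P) (funext fun j => ?_)) X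
  exact (frameMat_of_le 𝒰.conn e _).symm

theorem isChernWeil_iff : 𝒰.IsChernWeil P p ↔
    Tot.IsCharacteristic (N := 𝒰.system) (U := 𝒰.opens) 𝒰.conn P p := by
  refine ⟨fun H l V h e => ?_, fun H i t V h e X => ?_⟩
  · cases l with
    | nil => exact (congrArg coch (p.val_nil h)).trans (map_zero coch)
    | cons i t => exact ext' fun X => (H i t V h e X).trans (𝒰.chernWeil_eq_cwL P i t h e X)
  · exact (congrFun (H (i :: t) V h e) X).trans (𝒰.chernWeil_eq_cwL P i t h e X).symm

end ConnectionCover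

/-! ### The cocycle property, independence of the connections, and multiplicativity. -/

namespace Tot
open Cochain LieAlgebroid.Form
variable {K : Type v} [Field K] [CharZero K] {S : RingedSpaceOver.{u} K} {L : LieAlgebroid S}
  {E : OModule S} {r : ℕ} {N : OpenSystem S} {U U' : N.Idx → S.Open}
  {c : ∀ i, Connection L E (U i)} {c' : ∀ i, Connection L E (U' i)}
  {P Q : MvPolynomial (Fin r × Fin r) K} {p q s : Tot L N}

namespace IsCharacteristic

/-- In Čech degree `n` the sign `ε_n` satisfies `(-1)^n ε_n = -ε_{n-1}`, so the term `(-1)^n ε_n d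
p` cancels `ε_{n-1} δ p` by the relation between `d` and `δ`. -/
theorem D_signed (hE : IsLocallyFree E r) (hP : P ∈ invariantPolynomials K r)
    (h : IsCharacteristic c P p) : D (signed p) = 0 := by
  refine ext_frames hE fun l V hV e => ?_
  have h1 : ∀ j ∈ Finset.range l.length,
      (-1) ^ j * coch ((signed p).val (l.eraseIdx j) (hV.trans (erase_le l j))) =
      (-1) ^ ((l.length - 1 - 1) * (l.length - 1 - 2) / 2) *
        ((-1) ^ j * cwL P ((l.eraseIdx j).map (frameMat c e))) := by
    intro j hj
    rw [Finset.mem_range] at hj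
    rw [coch_signed, h _ _ _ e, List.length_eraseIdx_of_lt hj, ← mul_assoc, ← mul_assoc, ← pow_add,
      ← pow_add, add_comm]
  rw [coch_D, Finset.sum_congr rfl h1, coch_signed, h _ _ _ e, d_sign_mul,
    d_cwL hP (isConn_of_mem_map c e), List.length_map, val_zero, map_zero, ← Finset.mul_sum]
  simp only [List.eraseIdx_map]
  -- Lengths zero and one are separated because the subtractions in the exponents truncate there;
  -- the sums vanish anyway, the form of the empty list being zero.
  match l with
  | [] => simp
  | [i] =>
    have h0 : cwL P ([] : List (Matrix (Fin r) (Fin r) (Cochain (S.Sec V) (L.Sec V)))) = 0 := rfl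
    simp [h0]
  | i :: i' :: t =>
    generalize ∑ j ∈ Finset.range (i :: i' :: t).length,
      (-1) ^ j * cwL P (((i :: i' :: t).eraseIdx j).map (frameMat c e)) = y
    simp only [List.length_cons]
    rw [sign_exponent_succ (t.length + 1), ← mul_assoc, ← pow_add]
    simp only [Nat.add_sub_cancel]
    rw [show t.length + 1 + (t.length * (t.length + 1 - 2) / 2 + t.length) =
      t.length * (t.length + 1 - 2) / 2 + 2 * t.length + 1 by ring, pow_succ, pow_add _ _ (2 * _),
      pow_mul, neg_one_sq, one_pow]
    simp

/-- The primitive is assembled from the simplices spanned by a beginning of the first family and the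
rest of the second, with the transition index used twice; `d_prism_cwL` computes its boundary. -/
theorem cohomologous (hE : IsLocallyFree E r) (hP : P ∈ invariantPolynomials K r)
    (hc : ∀ l, ∀ i ∈ l, N.opens l ≤ U i) (hc' : ∀ l, ∀ i ∈ l, N.opens l ≤ U' i)
    (hp : IsCharacteristic c P p) (hq : IsCharacteristic c' P q) :
    ∃ x : Tot L N, D x = signed p - signed q := by
  -- The two families become one family over the disjoint union of the index sets, so the mixed
  -- sequences fall under the gluing results for a single family.
  let C : ∀ i : N.Idx ⊕ N.Idx, Connection L E (Sum.elim U U' i) :=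
    fun i => match i with
    | .inl i => c i
    | .inr i => c' i
  have hl : ∀ (l : List N.Idx) (k : ℕ),
      ∀ i ∈ (l.take (k + 1)).map Sum.inl ++ (l.drop k).map Sum.inr,
        N.opens l ≤ Sum.elim U U' i := by
    intro l k i hi
    rcases List.mem_append.mp hi with hi | hi
    · obtain ⟨j, hj, rfl⟩ := List.mem_map.mp hi
      exact hc l j (List.mem_of_mem_take hj)
    · obtain ⟨j, hj, rfl⟩ := List.mem_map.mp hi
      exact hc' l j (List.mem_of_mem_drop hj)
  have hmap : ∀ {V : S.Open} (e : Frame E r V) (l : List N.Idx) (k : ℕ),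
      ((l.take (k + 1)).map Sum.inl ++ (l.drop k).map Sum.inr).map (frameMat C e) =
      (l.take (k + 1)).map (frameMat c e) ++ (l.drop k).map (frameMat c' e) := fun e l k => by
    rw [List.map_append, List.map_map, List.map_map]; rfl
  have key := exists_primitive hE (N := N)
    (F := fun l V e => ∑ k ∈ Finset.range l.length, (-1) ^ k * cwL P
      (((l.take (k + 1)).map Sum.inl ++ (l.drop k).map Sum.inr).map (frameMat C e)))
    (B := fun l V e => cwL P (l.map (frameMat c' e)) - cwL P (l.map (frameMat c e)))
    (fun l => .sum _ fun k _ => .sign_mul _ (.cwL C hP (hl l k)))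
    (fun _ _ => rfl) (2 * P.totalDegree + 1) (fun l V hV e X hX => ?_) fun l V hV e => ?_
  · obtain ⟨x, hx⟩ := key
    refine ⟨x, ext_frames hE fun l V hV e => (hx l V hV e).trans ?_⟩
    have hs : (signed p - signed q).val l hV = (signed p).val l hV - (signed q).val l hV := rfl
    rw [hs, map_sub, coch_signed, coch_signed, hp _ _ _ e, hq _ _ _ e, neg_sub, mul_sub]
  · rw [sum_app]
    refine Finset.sum_eq_zero fun k hk => ?_
    rw [Finset.mem_range] at hk
    have h0 := cwL_eq_zero (P := P) C e X
      (l := (l.take (k + 1)).map Sum.inl ++ (l.drop k).map Sum.inr) (by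
        rw [List.length_append, List.length_map, List.length_map, List.length_take,
          List.length_drop]
        omega)
    rcases Nat.even_or_odd k with h | h
    · rw [h.neg_one_pow, one_mul, h0]
    · rw [h.neg_one_pow, neg_one_mul, neg_app, h0, neg_zero]
  · simp only [hmap]
    exact d_prism_cwL hP l _ _ (fun i _ => frameMat_isConn c e i) fun i _ => frameMat_isConn c' e i

theorem _root_.ChernWeil.LieAlgebroid.Form.coch_sgnPow {V : S.Open} {ω : L.Form V} {j : ℕ}
    (h : Cochain.sgn (coch ω) = (-1) ^ j * coch ω) (k : ℕ) :
    coch (sgnPow k ω) = (-1) ^ (k * j) * coch ω := by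
  induction k with
  | zero => rw [sgnPow_zero, zero_mul, pow_zero, one_mul]
  | succ k ih =>
    have hs : Cochain.sgn ((-1) ^ (k * j) * coch ω) = (-1) ^ (k * j) * Cochain.sgn (coch ω) :=
      map_neg_one_pow_mul (⟨⟨Cochain.sgn, sgn_zero⟩, sgn_add⟩ :
        Cochain (S.Sec V) (L.Sec V) →+ Cochain (S.Sec V) (L.Sec V)) (k * j) (coch ω)
    rw [sgnPow_succ, coch_sgn, ih, hs, h, ← mul_assoc, ← pow_add, add_mul, one_mul]

theorem sign_mul_mul_sign_mul {R : Type*} [Ring R] (i j k : ℕ) (x y : R) :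
    (-1) ^ i * ((-1) ^ j * x) * ((-1) ^ k * y) = (-1) ^ (j + i + k) * (x * y) := by
  rw [pow_add, add_comm, pow_add]
  rcases Nat.even_or_odd k with h | h <;> simp [h.neg_one_pow, mul_assoc]

/-- This is `k(n-k) + k(k-1)/2 + (n-k)(n-k-1)/2 = n(n-1)/2`. The first term comes from the sign of
the Alexander-Whitney product, the others from the signs of the two factors. -/
theorem sign_exponent_add (n k : ℕ) (h : k ≤ n) : (n - k) * k +
    (k + 1 - 1) * (k + 1 - 2) / 2 + (n + 1 - k - 1) * (n + 1 - k - 2) / 2 =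
    (n + 1 - 1) * (n + 1 - 2) / 2 := by
  obtain ⟨m, rfl⟩ := Nat.exists_eq_add_of_le h
  clear h
  induction m with
  | zero => simp
  | succ m ih =>
    have h1 := sign_exponent_succ (k + m + 1)
    have h2 := sign_exponent_succ (m + 1)
    have e1 : k + (m + 1) + 1 - k = m + 1 + 1 := by omega
    have e2 : k + m + 1 - k = m + 1 := by omega
    have e3 : k + (m + 1) - k = m + 1 := by omega
    have e4 : k + m - k = m := by omega
    rw [e2, e4] at ih
    rw [e1, e3, show k + (m + 1) + 1 = k + m + 1 + 1 by ring, h1, h2, ← ih, add_mul]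
    simp only [Nat.add_sub_cancel]
    ring

/-- The left factor is an integral of an even form over a `k`-simplex, so it has the parity of `k`
and the Alexander-Whitney sign is `(-1)^(k(n-k))`. All signs then combine into one that does not
depend on `k`. -/
theorem coch_mul (hp : IsCharacteristic c P p) (hq : IsCharacteristic c Q q) (l : List N.Idx)
    {V : S.Open} (hV : V ≤ N.opens l) (e : Frame E r V) :
    coch ((signed p * signed q).val l hV) = (-1) ^ ((l.length - 1) * (l.length - 2) / 2) *
      ∑ k ∈ Finset.range l.length, cwL P ((l.take (k + 1)).map (frameMat c e)) *
        cwL Q ((l.drop k).map (frameMat c e)) := by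
  rw [val_mul, map_sum, Finset.mul_sum]
  refine Finset.sum_congr rfl fun k hk => ?_
  rw [Finset.mem_range] at hk
  obtain ⟨n, hn⟩ : ∃ n, l.length = n + 1 := ⟨l.length - 1, by omega⟩
  have h1 : (l.take (k + 1)).length = k + 1 := by rw [List.length_take]; omega
  have h2 : (l.drop k).length = n + 1 - k := by rw [List.length_drop]; omega
  have h3 := cwL_sgn P (isConn_of_mem_map c e (l := l.take (k + 1)))
  rw [List.length_map, h1, Nat.add_sub_cancel] at h3
  rw [val_signed, map_mul (sgnPow _), map_pow, map_neg, map_one, map_mul, map_mul, map_pow, map_neg,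
    map_one, coch_sgnPow (j := k) (by rw [hp _ _ _ e, h3]), coch_signed, hp _ _ _ e, hq _ _ _ e, h1,
    h2, hn, ← sign_exponent_add n k (by omega), Nat.add_sub_cancel n 1]
  exact sign_mul_mul_sign_mul _ _ _ _ _

/-- The primitive is the alternating sum of the homotopy forms over all splittings of the list into
two blocks that share one index; `d_prism_hcwL` computes its boundary. -/
theorem mul (hE : IsLocallyFree E r) (hP : P ∈ invariantPolynomials K r)
    (hQ : Q ∈ invariantPolynomials K r) (hc : ∀ l, ∀ i ∈ l, N.opens l ≤ U i)
    (hp : IsCharacteristic c P p) (hq : IsCharacteristic c Q q)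
    (hs : IsCharacteristic c (P * Q) s) :
    ∃ x : Tot L N, D x = signed s - signed p * signed q := by
  have key := exists_primitive hE (N := N)
    (F := fun l V e => ∑ k ∈ Finset.range l.length, (-1) ^ k * hcwL P Q
      ((l.take (k + 1)).map (frameMat c e)) ((l.drop k).map (frameMat c e)))
    (B := fun l V e => ∑ k ∈ Finset.range l.length, cwL P ((l.take (k + 1)).map (frameMat c e)) *
        cwL Q ((l.drop k).map (frameMat c e)) - cwL (P * Q) (l.map (frameMat c e)))
    (fun l => .sum _ fun k _ => .sign_mul _ (.hcwL c hP hQ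
      (fun i hi => hc l i (List.mem_of_mem_take hi))
      fun i hi => hc l i (List.mem_of_mem_drop hi)))
    (fun _ _ => rfl) (2 * P.totalDegree + 2 * Q.totalDegree + 1) (fun l V hV e X hX => ?_)
    fun l V hV e => d_prism_hcwL hP hQ l _ fun i _ => frameMat_isConn c e i
  · obtain ⟨x, hx⟩ := key
    refine ⟨x, ext_frames hE fun l V hV e => (hx l V hV e).trans ?_⟩
    have h1 : (signed s - signed p * signed q).val l hV =
      (signed s).val l hV - (signed p * signed q).val l hV := rfl
    rw [h1, map_sub, coch_signed, hs _ _ _ e, coch_mul hp hq l hV e, neg_sub, mul_sub]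
  · rw [sum_app]
    refine Finset.sum_eq_zero fun k hk => ?_
    rw [Finset.mem_range] at hk
    have h0 := hcwL_eq_zero (P := P) (Q := Q) c e X (l := l.take (k + 1)) (s := l.drop k) (by
      rw [List.length_take, List.length_drop]
      omega)
    rcases Nat.even_or_odd k with h | h
    · rw [h.neg_one_pow, one_mul, h0]
    · rw [h.neg_one_pow, neg_one_mul, neg_app, h0, neg_zero]

end IsCharacteristic
end Tot

/-! ### Passage to hypercohomology. -/

namespace Hypercohomology
variable {K : Type v} [Field K] {S : RingedSpaceOver.{u} K} (L : LieAlgebroid S)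

theorem of_transition {W W' : NbhdSystem S} (h : W ≤ W') (z : Cohomology L W.system) :
    of L W' (transition L W W' h z) = of L W z :=
  (DirectLimit.eq_of_le (f := transition L) (⟨W, z⟩ : Σ W : NbhdSystem S, Cohomology L W.system)
    W' h).symm

end Hypercohomology

section Refinement
variable {K : Type v} [Field K] {S : RingedSpaceOver.{u} K} (L : LieAlgebroid S)

/-- The canonical map to hypercohomology factors through a refinement indexed by the points. -/
theorem cechToHyper_refine {I : Type u} (U : I → S.Open) (ι : S.space → I)
    (hι : ∀ x, x ∈ U (ι x)) (V : S.space → S.Open) (hV : ∀ x, x ∈ V x) (h : ∀ x, V x ≤ U (ι x))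
    (z : Cohomology L (cech U)) :
    cechToHyper L U ι hι z =
      cechToHyper L V id hV (Cohomology.pullback (N := cech U) (N' := cech V) ι (cech_le h) z) := by
  have hW : NbhdSystem.ofCover U ι hι ≤ NbhdSystem.ofCover V id hV := fun _ x => h x
  obtain ⟨z, rfl⟩ := Ideal.Quotient.mk_surjective z
  refine (Hypercohomology.of_transition L hW _).symm.trans ?_
  refine congrArg (Hypercohomology.of L _) (congrArg Cohomology.mk (Subtype.ext (Tot.ext fun l => rfl)))

theorem cechToHyper_mem_degree {I : Type u} (U : I → S.Open) (ι : S.space → I)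
    (hι : ∀ x, x ∈ U (ι x)) {z : Tot.cocycles L (cech U)} {m : ℕ}
    (hz : (z : Tot L (cech U)).IsHomogeneous m) :
    cechToHyper L U ι hι (Cohomology.mk z) ∈ Hypercohomology.degree L m := by
  refine AddSubgroup.mem_iSup_of_mem (NbhdSystem.ofCover U ι hι) ?_
  refine ⟨_, ⟨Cohomology.cocycleMap (N := cech U) (N' := (NbhdSystem.ofCover U ι hι).system) ι
    (NbhdSystem.ofCover_le U ι hι) z, fun l V h X hX => ?_, rfl⟩, rfl⟩
  exact hz (l.map ι) V (h.trans (NbhdSystem.ofCover_le U ι hι l)) X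
    fun e => hX ((congrArg (· + X.length) (List.length_map (as := l) ι)).symm.trans e)

end Refinement

/-! ### Existence of local connections. -/

section Flat
variable {K : Type v} [Field K] {S : RingedSpaceOver.{u} K} (L : LieAlgebroid S) {E : OModule S}
  {r : ℕ} {V : S.Open}

/-- The connection for which the members of a frame are flat. -/
def Frame.flatConnection (e : Frame E r V) : Connection L E V where
  nabla W h :=
    { toFun := fun X =>
        { toFun := fun m => ∑ i, ⁅X, (e.basis W h).coord i m⁆ • e.basis W h i
          map_add' := fun m m' => by
            simp only [map_add, lie_add, add_smul, Finset.sum_add_distrib]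
          map_smul' := fun a m => by
            rw [RingHom.id_apply, Finset.smul_sum]
            refine Finset.sum_congr rfl fun i _ => ?_
            rw [LinearMap.map_smul_of_tower, DerAct.lie_smul', smul_assoc] }
      map_add' := fun X Y => by
        ext m
        simp only [LinearMap.coe_mk, AddHom.coe_mk, LinearMap.add_apply, add_lie, add_smul,
          Finset.sum_add_distrib]
      map_smul' := fun f X => by
        ext m
        simp only [LinearMap.coe_mk, AddHom.coe_mk, LinearMap.smul_apply, RingHom.id_apply,
          Finset.smul_sum, LieRinehartRing.lie_smul_eq_mul, mul_smul] }
  leibniz W h X f m := by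
    change ∑ i, ⁅X, (e.basis W h).coord i (f • m)⁆ • e.basis W h i =
      f • ∑ i, ⁅X, (e.basis W h).coord i m⁆ • e.basis W h i + ⁅X, f⁆ • m
    have hm : ⁅X, f⁆ • m = ∑ i, (⁅X, f⁆ * (e.basis W h).coord i m) • e.basis W h i := by
      simp only [mul_smul]
      rw [← Finset.smul_sum]
      exact congrArg _ ((e.basis W h).sum_repr m).symm
    rw [hm, Finset.smul_sum, ← Finset.sum_add_distrib]
    refine Finset.sum_congr rfl fun i _ => ?_
    rw [map_smul, smul_eq_mul, LieRinehartRing.leibniz_mul_right, add_smul, smul_assoc]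
  res_nabla W W' h h' X m := by
    change E.res h' (∑ i, ⁅X, (e.basis W h).coord i m⁆ • e.basis W h i) =
      ∑ i, ⁅L.res h' X, (e.basis W' (h'.trans h)).coord i (E.res h' m)⁆ • e.basis W' (h'.trans h) i
    rw [OModule.res_sum]
    refine Finset.sum_congr rfl fun i _ => ?_
    have h₁ := (e.restrict h).res_basis W' h' i
    have h₂ := (e.restrict h).res_coord h' i m
    rw [OModule.res_smul, L.res_lie_fun]
    exact congrArg₂ (fun f v => ⁅L.res h' X, f⁆ • v) h₂ h₁

/-- Each point has a framed neighbourhood, and the flat connection of the frame is available there;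
no connection over the whole space is required. This covering both defines the characteristic
homomorphism and forces its uniqueness. -/
theorem exists_connectionCover (hE : IsLocallyFree E r) : Nonempty (ConnectionCover L E) := by
  choose V hV e using hE
  exact ⟨⟨S.space, V, fun x => ⟨x, hV x⟩, fun x => (e x).some.flatConnection L⟩⟩
end Flat

/-! ### The characteristic homomorphism of a covering with connections. -/

namespace Tot
variable {K : Type v} [Field K] [CharZero K] {S : RingedSpaceOver.{u} K} {L : LieAlgebroid S}
  {E : OModule S} {r : ℕ} {N : OpenSystem S} {U : N.Idx → S.Open}
  {c : ∀ i, Connection L E (U i)} {P : invariantPolynomials K r} {p : Tot L N}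

/-- Characteristic elements are unique, so the class depends on the polynomial alone. This removes
the choices made in `characteristicHom`. -/
theorem IsCharacteristic.mk_congr (hE : IsLocallyFree E r) {P Q : invariantPolynomials K r}
    {p q : Tot L N} (hp : IsCharacteristic c P.1 p) (hq : IsCharacteristic c Q.1 q) (h : P = Q) :
    Cohomology.mk ⟨signed p, hp.D_signed hE P.2⟩ =
      Cohomology.mk ⟨signed q, hq.D_signed hE Q.2⟩ := by
  subst h
  obtain rfl := hp.unique hE hq
  rfl

/-- The characteristic classes of a family of connections as a ring homomorphism. -/
def characteristicHom (hE : IsLocallyFree E r) (c : ∀ i, Connection L E (U i))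
    (hc : ∀ l, ∀ i ∈ l, N.opens l ≤ U i) : invariantPolynomials K r →+* Cohomology L N where
  toFun P := Cohomology.mk ⟨signed (IsCharacteristic.exists_of_le hE P.2 c hc).choose,
    (IsCharacteristic.exists_of_le hE P.2 c hc).choose_spec.D_signed hE P.2⟩
  map_zero' := by
    refine (IsCharacteristic.mk_congr hE
      (IsCharacteristic.exists_of_le hE (0 : invariantPolynomials K r).2 c hc).choose_spec (Q := 0) .zero
      rfl).trans ?_
    rw [← map_zero Cohomology.mk]
    exact congrArg _ (Subtype.ext (map_zero signed))
  map_one' := by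
    refine (IsCharacteristic.mk_congr hE
      (IsCharacteristic.exists_of_le hE (1 : invariantPolynomials K r).2 c hc).choose_spec (Q := 1) .one
      rfl).trans ?_
    rw [← map_one Cohomology.mk]
    refine congrArg _ (Subtype.ext (ext fun l => ?_))
    change (signed (1 : Tot L N)).val l le_rfl = (1 : Tot L N).val l le_rfl
    rw [val_signed, val_one]
    split_ifs with h
    · rw [h, mul_one]; simp
    · rw [mul_zero]
  map_add' P Q := by
    refine (IsCharacteristic.mk_congr hE
      (IsCharacteristic.exists_of_le hE (P + Q).2 c hc).choose_spec (Q := P + Q)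
      ((IsCharacteristic.exists_of_le hE P.2 c hc).choose_spec.add
        (IsCharacteristic.exists_of_le hE Q.2 c hc).choose_spec) rfl).trans ?_
    rw [← map_add Cohomology.mk]
    exact congrArg _ (Subtype.ext (map_add signed _ _))
  map_mul' P Q := by
    rw [← map_mul Cohomology.mk]
    exact Cohomology.mk_eq_mk.mpr (IsCharacteristic.mul hE P.2 Q.2 hc
      (IsCharacteristic.exists_of_le hE P.2 c hc).choose_spec
      (IsCharacteristic.exists_of_le hE Q.2 c hc).choose_spec
      (IsCharacteristic.exists_of_le hE (P * Q).2 c hc).choose_spec)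

theorem characteristicHom_apply (hE : IsLocallyFree E r) (hc : ∀ l, ∀ i ∈ l, N.opens l ≤ U i)
    (hp : IsCharacteristic c P.1 p) :
    characteristicHom hE c hc P = Cohomology.mk ⟨signed p, hp.D_signed hE P.2⟩ :=
  IsCharacteristic.mk_congr hE (IsCharacteristic.exists_of_le hE P.2 c hc).choose_spec hp rfl
end Tot

/-! ### Independence of the covering. -/

namespace ConnectionCover
variable {K : Type v} [Field K] [CharZero K] {S : RingedSpaceOver.{u} K} {L : LieAlgebroid S}
  {E : OModule S} {r : ℕ} (𝒰 𝒰' : ConnectionCover L E)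

theorem exists_isChernWeil (hE : IsLocallyFree E r) (P : invariantPolynomials K r) :
    ∃ p : Tot L 𝒰.system, 𝒰.IsChernWeil P.1 p := by
  obtain ⟨p, hp⟩ := Tot.IsCharacteristic.exists_of_le (N := 𝒰.system) (U := 𝒰.opens) hE P.2 𝒰.conn
    fun l i hi => cech_le_of_mem 𝒰.opens hi
  exact ⟨p, (𝒰.isChernWeil_iff P.1).mpr hp⟩

variable {𝒰 𝒰'} {P : invariantPolynomials K r} {p : Tot L 𝒰.system} {p' : Tot L 𝒰'.system}

theorem IsChernWeil.signed_mem (hE : IsLocallyFree E r) (hp : 𝒰.IsChernWeil P.1 p) :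
    Tot.signed p ∈ Tot.cocycles L 𝒰.system :=
  ((𝒰.isChernWeil_iff P.1).mp hp).D_signed hE P.2

theorem IsChernWeil.cohomologous (hE : IsLocallyFree E r) (hp : 𝒰.IsChernWeil P.1 p) (hp' : 𝒰'.IsChernWeil P.1 p')
    {J : Type u} {V : J → S.Open} {φ : J → 𝒰.Idx} {φ' : J → 𝒰'.Idx}
    (h : ∀ j, V j ≤ 𝒰.opens (φ j)) (h' : ∀ j, V j ≤ 𝒰'.opens (φ' j)) :
    ∃ x : Tot L (cech V), Tot.D x =
      Tot.pullback (N := 𝒰.system) (N' := cech V) φ (cech_le h) (Tot.signed p) -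
      Tot.pullback (N := 𝒰'.system) (N' := cech V) φ' (cech_le h') (Tot.signed p') := by
  obtain ⟨x, hx⟩ := Tot.IsCharacteristic.cohomologous (N := cech V) hE P.2
    (fun l j hj => (cech_le_of_mem V hj).trans (h j))
    (fun l j hj => (cech_le_of_mem V hj).trans (h' j))
    ((𝒰.isChernWeil_iff P.1).mp hp).pullback ((𝒰'.isChernWeil_iff P.1).mp hp').pullback
  exact ⟨x, hx.trans (congrArg₂ _ (Tot.signed_pullback _) (Tot.signed_pullback _))⟩

/-- Both maps to hypercohomology factor through the covering by `U_{ι(x)} ∩ U'_{ι'(x)}`, indexed by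
the points, where the two pullbacks are cohomologous. With equal coverings this also shows that the
choice of `ι` is irrelevant. -/
theorem IsChernWeil.cechToHyper_eq (hE : IsLocallyFree E r) (hp : 𝒰.IsChernWeil P.1 p) (hp' : 𝒰'.IsChernWeil P.1 p')
    (ι : S.space → 𝒰.Idx) (hι : ∀ x, x ∈ 𝒰.opens (ι x)) (ι' : S.space → 𝒰'.Idx)
    (hι' : ∀ x, x ∈ 𝒰'.opens (ι' x)) :
    cechToHyper L 𝒰.opens ι hι (Cohomology.mk ⟨Tot.signed p, IsChernWeil.signed_mem hE hp⟩) =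
      cechToHyper L 𝒰'.opens ι' hι' (Cohomology.mk ⟨Tot.signed p', IsChernWeil.signed_mem hE hp'⟩) := by
  rw [cechToHyper_refine L 𝒰.opens ι hι (fun x => 𝒰.opens (ι x) ⊓ 𝒰'.opens (ι' x))
      (fun x => ⟨hι x, hι' x⟩) (fun _ => inf_le_left),
    cechToHyper_refine L 𝒰'.opens ι' hι' (fun x => 𝒰.opens (ι x) ⊓ 𝒰'.opens (ι' x))
      (fun x => ⟨hι x, hι' x⟩) fun _ => inf_le_right]
  exact congrArg _ (Cohomology.mk_eq_mk.mpr (IsChernWeil.cohomologous hE hp hp' (fun _ => inf_le_left)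
    fun _ => inf_le_right))

theorem IsChernWeil.characteristicHom_eq (hE : IsLocallyFree E r) (hp : 𝒰.IsChernWeil P.1 p) :
    Tot.characteristicHom (N := 𝒰.system) hE 𝒰.conn (fun _ _ hi => cech_le_of_mem 𝒰.opens hi) P =
      Cohomology.mk ⟨Tot.signed p, IsChernWeil.signed_mem hE hp⟩ :=
  Tot.characteristicHom_apply hE _ ((𝒰.isChernWeil_iff P.1).mp hp)

end ConnectionCover

end ChernWeil
end

/-! ### The theorem. -/

theorem mainTheorem10 {K : Type v} [Field K] [CharZero K] (S : RingedSpaceOver.{u} K)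
    (L : LieAlgebroid S) (d : ℕ) (hL : IsLocallyFree L.mod d)
    (E : OModule S) (r : ℕ) (hE : IsLocallyFree E r) :
    (∀ (𝒰 : ConnectionCover L E) (P : invariantPolynomials K r),
      (∃! p : Tot L 𝒰.system, 𝒰.IsChernWeil P.1 p) ∧
      ∀ p : Tot L 𝒰.system, 𝒰.IsChernWeil P.1 p →
        (∀ k : ℕ, P.1.IsHomogeneous k → p.IsHomogeneous (2 * k)) ∧
        (∀ l : List 𝒰.Idx, LieAlgebroid.Form.d (p.val l le_rfl) =
          ∑ j ∈ Finset.range l.length,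
            (-1) ^ j * p.val (l.eraseIdx j) (Tot.erase_le (N := 𝒰.system) l j)) ∧
        Tot.signed p ∈ Tot.cocycles L 𝒰.system) ∧
    (∀ (𝒰 𝒰' : ConnectionCover L E) (P : invariantPolynomials K r)
      (p : Tot L 𝒰.system) (p' : Tot L 𝒰'.system),
      𝒰.IsChernWeil P.1 p → 𝒰'.IsChernWeil P.1 p' →
      ∀ (J : Type u) (V : J → S.Open) (φ : J → 𝒰.Idx) (φ' : J → 𝒰'.Idx)
        (h : ∀ j, V j ≤ 𝒰.opens (φ j)) (h' : ∀ j, V j ≤ 𝒰'.opens (φ' j)),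
        ∃ x : Tot L (cech V), Tot.D x =
          Tot.pullback (N := 𝒰.system) (N' := cech V) φ (cech_le h) (Tot.signed p) -
          Tot.pullback (N := 𝒰'.system) (N' := cech V) φ' (cech_le h') (Tot.signed p')) ∧
    (∃! Φ : invariantPolynomials K r →+* Hypercohomology L,
      (∀ (k : ℕ) (P : invariantPolynomials K r), P.1.IsHomogeneous k →
        Φ P ∈ Hypercohomology.degree L (2 * k)) ∧
      ∀ (𝒰 : ConnectionCover L E) (P : invariantPolynomials K r) (p : Tot L 𝒰.system)
        (ι : S.space → 𝒰.Idx) (hι : ∀ x, x ∈ 𝒰.opens (ι x)),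
        𝒰.IsChernWeil P.1 p → ∃ hp : Tot.signed p ∈ Tot.cocycles L 𝒰.system,
        Φ P = cechToHyper L 𝒰.opens ι hι (Cohomology.mk ⟨Tot.signed p, hp⟩)) := by
  refine ⟨fun 𝒰 P => ⟨?_, fun p hp => ?_⟩, fun 𝒰 𝒰' P p p' hp hp' J V φ φ' h h' =>
    ConnectionCover.IsChernWeil.cohomologous hE hp hp' h h', ?_⟩
  · obtain ⟨p, hp⟩ := 𝒰.exists_isChernWeil hE P
    exact ⟨p, hp, fun q hq =>
      ((𝒰.isChernWeil_iff P.1).mp hq).unique hE ((𝒰.isChernWeil_iff P.1).mp hp)⟩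
  · have hp' := (𝒰.isChernWeil_iff P.1).mp hp
    exact ⟨fun k hk => hp'.isHomogeneous hE hk, fun l => hp'.d_val hE P.2 l le_rfl,
      hp'.D_signed hE P.2⟩
  -- One fixed covering with connections, together with a choice of a member around each point,
  -- defines `Φ`; for uniqueness the prescribed value on this same covering is used.
  · obtain ⟨𝒱⟩ := exists_connectionCover L hE
    choose κ hκ using 𝒱.cover
    refine ⟨(cechToHyper L 𝒱.opens κ hκ).comp (Tot.characteristicHom (N := 𝒱.system) hE 𝒱.conn
      fun _ _ hi => cech_le_of_mem 𝒱.opens hi), ⟨fun k P hk => ?_, fun 𝒰 P p ι hι hp => ?_⟩,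
      fun Φ hΦ => RingHom.ext fun P => ?_⟩
    · obtain ⟨q, hq⟩ := 𝒱.exists_isChernWeil hE P
      rw [RingHom.comp_apply, ConnectionCover.IsChernWeil.characteristicHom_eq hE hq]
      refine cechToHyper_mem_degree L 𝒱.opens κ hκ fun l V h X hX => ?_
      -- The signs only rescale components, so the signed cocycle stays homogeneous.
      rw [Tot.val_signed, LieAlgebroid.Form.eval_sign_mul,
        ((𝒱.isChernWeil_iff P.1).mp hq).isHomogeneous hE hk l V h X hX, mul_zero]
    · obtain ⟨q, hq⟩ := 𝒱.exists_isChernWeil hE P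
      refine ⟨ConnectionCover.IsChernWeil.signed_mem hE hp, ?_⟩
      rw [RingHom.comp_apply, ConnectionCover.IsChernWeil.characteristicHom_eq hE hq]
      exact ConnectionCover.IsChernWeil.cechToHyper_eq hE hq hp κ hκ ι hι
    · obtain ⟨q, hq⟩ := 𝒱.exists_isChernWeil hE P
      obtain ⟨_, e⟩ := hΦ.2 𝒱 P q κ hκ hq
      rw [e, RingHom.comp_apply, ConnectionCover.IsChernWeil.characteristicHom_eq hE hq]
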